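/- **Notation.** For $x,z,\lambda\in\mathbb C^n$ and $y,\mu\in\mathbb C$ put $A(x)=\prod_{i<j}(x_i-x_j)$, $A(x,y)=\prod_{i=1}^n(x_i-y)$, $A^*(z,x)=\prod_{i\le j}(z_i-x_j)\prod_{i>j}(x_j-z_i)$, $(\lambda,x)=\sum_i\lambda_ix_i$, $\bar x=\sum_i x_i$. A polynomial in space variables ($x$, or $x,y$) and spectral variables ($\lambda$, or $\lambda,\mu$) has *leading term* $T$ if its part of highest degree in the space variables is $T$ and its part of highest degree in the spectral variables is also $T$. Let $n\ge 0$. For an integer $k\ge0$ the *$n$-particle rational Baker–Akhiezer (BA) function* of multiplicity $k$ is $$\Psi^{(n)}_k(x,\lambda)=\frac{P(x,\lambda)}{A(x)^kA(\lambda)^k}e^{(\lambda,x)},$$ with $P$ a polynomial with leading term $A(x)^kA(\lambda)^k$, satisfying $\bigl(-\Delta+\sum_{i<j}\frac{2k(k+1)}{(x_i-x_j)^2}\bigr)\Psi=-(\lambda,\lambda)\Psi$ for $x$ with distinct coordinates and $\lambda$ with distinct coordinates. For a nonzero integer $m$ put $m^*=\max(m,-m-1)$. The *rational deformed $A_{n,1}$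 BA function* is $$\Psi^{(n,1)}_m(x,y,\lambda,\mu)=\frac{Q(x,y,\lambda,\mu)}{A(x)^{m^*}A(x,y)A(\lambda)^{m^*}A(\lambda,\mu)}e^{(\lambda,x)+\mu y/m},$$ with $Q$ a polynomial with leading term $A(x)^{m^*}A(x,y)A(\lambda)^{m^*}A(\lambda,\mu)$, satisfying, wherever the denominator does not vanish and the $x_i$ are distinct, the $\lambda_i$ are distinct, $x_i\ne y$ and $\lambda_i\neq\mu$, $$\Bigl(-\sum_i\partial_{x_i}^2-m\,\partial_y^2+\sum_{i<j}\frac{2m(m+1)}{(x_i-x_j)^2}+\sum_i\frac{2(m+1)}{(x_i-y)^2}\Bigr)\Psi=-\Bigl((\lambda,\lambda)+\frac{\mu^2}{m}\Bigr)\Psi .$$ **Theorem.** For every integer $k\ge0$ the polynomial $P$ exists and is unique, and for every nonzero integer $m$ the polynomial $Q$ exists and is unique. Moreover: (1) Let $m\geq 1$. Suppose that the $x_i$ have pairwise distinct imaginary parts, $x_i\neq y$, the $\lambda_i$ are distinct, and $\operatorname{Re}(\lambda_i-\mu)<0$ for all $i$. Let $\gamma$ be the contour $z_i=x_i+\tau_i$,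 $\tau_i\in(0,\infty)$. Then the following integral converges absolutely and $$\Psi^{(n,1)}_m(x,y,\lambda,\mu)=\frac{C_5}{A(x)^mA(x,y)}\int_\gamma\frac{A^*(z,x)^mA(z,y)}{A(z)^m}e^{\mu(\bar x-\bar z+y/m)}\,\Psi^{(n)}_m(z,\lambda)\,dz,\qquad C_5=\frac{\prod_{i=1}^n(\mu-\lambda_i)^{m+1}}{(m!)^n}.$$ (2) Let $m=-m^*-1$ with $m^*\ge0$. Suppose that the $x_i$ are distinct, $x_i\ne y$, the $\lambda_i$ are distinct and $\lambda_i\ne\mu$. Let $\sigma$ be the product of the positively oriented circles $|z_i-x_i|=\epsilon$, where $0<\epsilon<|x_i-x_j|$ for all $i\ne j$. Then $$\Psi^{(n,1)}_m(x,y,\lambda,\mu)=C_6\frac{A(x)^{m^*+1}}{A(x,y)}\oint_\sigma\frac{A(z)^{m^*+1}A(z,y)}{A^*(z,x)^{m^*+1}}e^{\mu(\bar x-\bar z+y/m)}\,\Psi^{(n)}_{m^*}(z,\lambda)\,dz,\qquad C_6=\Bigl(\frac{m^*!}{2\pi i}\Bigr)^n\prod_{i=1}^n(\lambda_i-\mu)^{-m^*}.$$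 -/

import Mathlib

open MeasureTheory

noncomputable section

namespace CalogeroBA

/-- `A(x) = ∏_{i<j} (x_i - x_j)`, over any commutative ring. -/
def vdm {R : Type*} [CommRing R] {n : ℕ} (x : Fin n → R) : R :=
  ∏ i, ∏ j ∈ Finset.Ioi i, (x i - x j)

/-- `A(x, y) = ∏_i (x_i - y)` for a single element `y`. -/
def cross {R : Type*} [CommRing R] {n : ℕ} (x : Fin n → R) (y : R) : R :=
  ∏ i, (x i - y)

/-- `A*(z, x) = ∏_{i ≤ j} (z_i - x_j) ∏_{i > j} (x_j - z_i)`. -/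
def starProd {n : ℕ} (z x : Fin n → ℂ) : ℂ :=
  ∏ i, ∏ j, if i ≤ j then z i - x j else x j - z i

/-- The second partial derivative `∂² f / ∂ x_i²` at `x`. -/
def partial2 {n : ℕ} (f : (Fin n → ℂ) → ℂ) (i : Fin n) (x : Fin n → ℂ) : ℂ :=
  iteratedDeriv 2 (fun t : ℂ => f (Function.update x i t)) (x i)

/-- The part of `P` of highest degree, where the variable `s` is given the degree `w s`. -/
def leadingForm {σ : Type*} (w : σ → ℕ) (P : MvPolynomial σ ℂ) : MvPolynomial σ ℂ :=
  MvPolynomial.weightedHomogeneousComponent w (MvPolynomial.weightedTotalDegree w P) P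

/-- A polynomial `P` in two groups of variables, indexed by `ι` (space variables) and by `κ`
(spectral variables), has leading term `T`: the part of `P` of highest degree in the space
variables is `T`, and so is the part of `P` of highest degree in the spectral variables. -/
def HasLeadingTerm {ι κ : Type*} (P T : MvPolynomial (ι ⊕ κ) ℂ) : Prop :=
  leadingForm (Sum.elim (fun _ => 1) (fun _ => 0)) P = T ∧
    leadingForm (Sum.elim (fun _ => 0) (fun _ => 1)) P = T

/-- The Calogero--Moser operator
`L = -Δ + ∑_{i<j} 2 k (k+1) / (x_i - x_j)²`, applied to `f` at `x`. -/
def calogeroMoser {n : ℕ} (k : ℕ) (f : (Fin n → ℂ) → ℂ) (x : Fin n → ℂ) : ℂ :=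
  -(∑ i, partial2 f i x) +
    (∑ i, ∑ j ∈ Finset.Ioi i, 2 * (k : ℂ) * ((k : ℂ) + 1) / (x i - x j) ^ 2) * f x

/-- The function `P(x, λ) / (A(x)^k A(λ)^k) · exp (λ, x)`. -/
def baFun {n : ℕ} (k : ℕ) (P : MvPolynomial (Fin n ⊕ Fin n) ℂ) (x lam : Fin n → ℂ) : ℂ :=
  MvPolynomial.eval (Sum.elim x lam) P / (vdm x ^ k * vdm lam ^ k) *
    Complex.exp (∑ i, lam i * x i)

/-- `P` is the polynomial of a rational Baker--Akhiezer function of `n` particles with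
multiplicity `k`; the function itself is `baFun k P`. -/
structure IsBA (n k : ℕ) (P : MvPolynomial (Fin n ⊕ Fin n) ℂ) : Prop where
  leading : HasLeadingTerm P
    (vdm (fun i => MvPolynomial.X (Sum.inl i)) ^ k *
      vdm (fun i => MvPolynomial.X (Sum.inr i)) ^ k)
  schrodinger : ∀ x lam : Fin n → ℂ, Function.Injective x → Function.Injective lam →
    calogeroMoser k (fun x' => baFun k P x' lam) x = -(∑ i, lam i ^ 2) * baFun k P x lam

/-- The deformed Calogero--Moser operator
`-∑ ∂²/∂x_i² - m ∂²/∂y² + ∑_{i<j} 2m(m+1)/(x_i-x_j)² + ∑_i 2(m+1)/(x_i-y)²`. -/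
def deformedCM {n : ℕ} (m : ℤ) (f : (Fin n → ℂ) → ℂ → ℂ) (x : Fin n → ℂ) (y : ℂ) : ℂ :=
  -(∑ i, partial2 (fun x' => f x' y) i x) - (m : ℂ) * iteratedDeriv 2 (fun y' => f x y') y +
    ((∑ i, ∑ j ∈ Finset.Ioi i, 2 * (m : ℂ) * ((m : ℂ) + 1) / (x i - x j) ^ 2) +
      ∑ i, 2 * ((m : ℂ) + 1) / (x i - y) ^ 2) * f x y

/-- `m* = max (m, -m-1)`, which is nonnegative for every integer `m`. -/
def mStar (m : ℤ) : ℕ := (max m (-m - 1)).toNat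

/-- The function `P(x, y, λ, μ) / (A(x)^{m*} A(x,y) A(λ)^{m*} A(λ,μ)) · exp ((λ, x) + μ y / m)`.
The variables `some i` stand for `x_i` and `λ_i`, the variables `none` for `y` and `μ`. -/
def deformedFun {n : ℕ} (m : ℤ) (P : MvPolynomial (Option (Fin n) ⊕ Option (Fin n)) ℂ)
    (x : Fin n → ℂ) (y : ℂ) (lam : Fin n → ℂ) (mu : ℂ) : ℂ :=
  MvPolynomial.eval (Sum.elim (fun o => o.elim y x) (fun o => o.elim mu lam)) P /
      (vdm x ^ mStar m * cross x y * vdm lam ^ mStar m * cross lam mu) *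
    Complex.exp ((∑ i, lam i * x i) + mu * y / (m : ℂ))

/-- `P` is the polynomial of a rational deformed Baker--Akhiezer function of type `A_{n,1}` with
parameter `m`; the function itself is `deformedFun m P`. -/
structure IsDeformedBA (n : ℕ) (m : ℤ)
    (P : MvPolynomial (Option (Fin n) ⊕ Option (Fin n)) ℂ) : Prop where
  leading : HasLeadingTerm P
    (vdm (fun i => MvPolynomial.X (Sum.inl (some i))) ^ mStar m *
      cross (fun i => MvPolynomial.X (Sum.inl (some i))) (MvPolynomial.X (Sum.inl none)) *
      vdm (fun i => MvPolynomial.X (Sum.inr (some i))) ^ mStar m *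
      cross (fun i => MvPolynomial.X (Sum.inr (some i))) (MvPolynomial.X (Sum.inr none)))
  schrodinger : ∀ (x : Fin n → ℂ) (y : ℂ) (lam : Fin n → ℂ) (mu : ℂ),
    Function.Injective x → (∀ i, x i ≠ y) → Function.Injective lam → (∀ i, lam i ≠ mu) →
    deformedCM m (fun x' y' => deformedFun m P x' y' lam mu) x y =
      -((∑ i, lam i ^ 2) + mu ^ 2 / (m : ℂ)) * deformedFun m P x y lam mu

/-- The integrand of the Selberg-type integral for `m = k`. -/
def selbergIntegrand {n : ℕ} (k : ℕ) (P : MvPolynomial (Fin n ⊕ Fin n) ℂ)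
    (x : Fin n → ℂ) (y : ℂ) (lam : Fin n → ℂ) (mu : ℂ) (z : Fin n → ℂ) : ℂ :=
  starProd z x ^ k * cross z y / vdm z ^ k *
    Complex.exp (mu * ((∑ i, x i) - (∑ i, z i) + y / (k : ℂ))) * baFun k P z lam

/-- The integrand of the iterated residue for `m = -k-1`. -/
def residueIntegrand {n : ℕ} (k : ℕ) (P : MvPolynomial (Fin n ⊕ Fin n) ℂ)
    (x : Fin n → ℂ) (y : ℂ) (lam : Fin n → ℂ) (mu : ℂ) (z : Fin n → ℂ) : ℂ :=
  vdm z ^ (k + 1) * cross z y / starProd z x ^ (k + 1) *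
    Complex.exp (mu * ((∑ i, x i) - (∑ i, z i) + y / (-(k : ℂ) - 1))) * baFun k P z lam

/-- The constant `C₅ = ∏_i (μ - λ_i)^{k+1} / (k!)^n`. -/
def selbergConst {n : ℕ} (k : ℕ) (lam : Fin n → ℂ) (mu : ℂ) : ℂ :=
  (∏ i, (mu - lam i) ^ (k + 1)) / (k.factorial : ℂ) ^ n

/-- The constant `C₆ = (k! / 2πi)^n ∏_i (λ_i - μ)^{-k}`. -/
def residueConst {n : ℕ} (k : ℕ) (lam : Fin n → ℂ) (mu : ℂ) : ℂ :=
  ((k.factorial : ℂ) / (2 * (Real.pi : ℂ) * Complex.I)) ^ n * ∏ i, ((lam i - mu) ^ k)⁻¹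

end CalogeroBA

end

open MeasureTheory

noncomputable section

set_option linter.unusedSectionVars false

namespace CalogeroBA

open MvPolynomial

/-! ### Extension of derivations to localizations -/

section LocalizedDerivation

variable {R : Type*} (S : Type*) [CommRing R] [Algebra ℂ R] [CommRing S] [Algebra R S]
  [Algebra ℂ S] [IsScalarTower ℂ R S] (M : Submonoid R) [IsLocalization M S]

/-! All systems are treated together by giving particle `o` a charge `q o`: the coupling is `m (q_a
+ q_b)(1 + m q_a q_b)`, which is `2m(m+1)` for two charges 1 and `2(m+1)` for charges 1 and `1/m`. A
wave function is a rational function `f` times `exp (∑ q_o λ_o x_o)`, and the Schrödinger equation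
becomes `Δf + 2∇f - Uf = 0`, with `∇` the derivative in the direction of the spectral variables
(`satisfiesSchr_iff`). Splitting `f` into homogeneous pieces gives a series `φ_0 = 1, φ_1, …`, with
`φ_l` of degree `-l` in the space and in the spectral variables and `2∇φ_{l+1} = -(Δ - U)φ_l`
(`IsSeries`). A homogeneous function of negative degree that is constant along the lines `x + tλ` is
zero (`eq_zero_of_gradRat_eq_zero`); this gives uniqueness.

Existence and the integral formulas rest on one formal integral transform. With `X = x + τ`, the
kernel is `∏_{i<j} ((x_i-x_j)(X_i-X_j) / ((X_i-x_j)(x_i-X_j)))^{-m} ∏_i ((X_i-y)/(x_i-y))^c`,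
expanded in powers of `τ`. Integration against `τ_i^m exp (-(μ-λ_i)τ_i)` is replaced by the
functional `bracket`, which sends `τ^α` to `∏ (m+1)_{α_i} / (μ-λ_i)^{α_i}` and obeys integration by
parts. The operator in `(x, y)` and the operator in `X` differ on the kernel by a total
`τ`-derivative (`kernel_identity`), because the three-body terms cancel (`sum_sq_sum_inv_sub`).
Hence series go to series (`IsSeries.kernelSeries`). Two exponents are possible: `c = 1`, where the
new particle has charge `1/m`, and `c = m`, where it has charge 1.

A series gives a wave function as soon as its denominators are controlled. On a wall `x_i = x_j` the
exponents of the equation bound the order of the pole by `k` (`regularAt_of_schrRat`). On a wall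
`λ_i = μ`, for `c = 1`, the recursion leaves only a simple pole, since the coefficient of a higher
one would be constant along `λ` with too small a degree (`IsSeries.isPolyMul_of_pole`); for `c = m =
-k-1` the symbol `(-k)_α` vanishes for `α > k`. Bounded spectral denominators force the series to
stop. The transform with `c = m = -k-1` adds one particle at a time, so induction on `n` gives the
ordinary wave function (`exists_isGenBA`); with `c = 1` it gives the deformed one.

Thus the deformed function is a terminating formal expansion of the integrals in the theorem. For `m
= -k-1` a torus integral only sees finitely many Taylor coefficients, so it equals its expansion
(`torusIntegral_poleWeight_div_eq`). For `m = k` the difference of integral and expansion, as a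
function of `μ`, is `O(ν^{-N})` for every `N` under `μ ↦ μ + ν`. It is also the Laplace transform
(up to a factor `ν`) of the integral over the simplex `∑ τ_i ≤ u`. This is analytic in `u` near the
real axis because the imaginary parts of the `x_i` are distinct. By a converse of Watson's lemma it
vanishes identically (`integral_gammaWeight_div_eq`). -/

/-- The ring homomorphism `r ↦ r + ε d r` into the dual numbers. -/
def dualHom (d : Derivation ℂ R R) : R →+* TrivSqZeroExt S S where
  toFun r := (algebraMap R S r, algebraMap R S (d r))
  map_one' := TrivSqZeroExt.ext (map_one _)
    (by change algebraMap R S (d 1) = 0; rw [Derivation.map_one_eq_zero, map_zero])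
  map_zero' := TrivSqZeroExt.ext (map_zero _)
    (by change algebraMap R S (d 0) = 0; rw [map_zero, map_zero])
  map_add' a b := TrivSqZeroExt.ext (map_add _ _ _)
    (by
      change algebraMap R S (d (a + b)) = algebraMap R S (d a) + algebraMap R S (d b)
      rw [map_add, map_add])
  map_mul' a b := TrivSqZeroExt.ext (map_mul _ _ _)
    (by
      change algebraMap R S (d (a * b)) = algebraMap R S a • algebraMap R S (d b) +
        MulOpposite.op (algebraMap R S b) • algebraMap R S (d a)
      simp only [Derivation.leibniz, map_add, smul_eq_mul, map_mul, op_smul_eq_smul])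

theorem isUnit_dualHom (d : Derivation ℂ R R) (y : M) : IsUnit (dualHom S d y) := by
  rw [TrivSqZeroExt.isUnit_iff_isUnit_fst]
  exact IsLocalization.map_units S y

/-- The extension of `dualHom` to the localization. -/
def dualLift (d : Derivation ℂ R R) : S →+* TrivSqZeroExt S S :=
  IsLocalization.lift (M := M) (g := dualHom S d) (isUnit_dualHom S M d)

theorem dualLift_algebraMap (d : Derivation ℂ R R) (r : R) :
    dualLift S M d (algebraMap R S r) = dualHom S d r :=
  IsLocalization.lift_eq _ _

/-- The first component is a ring endomorphism fixing `R`, so it is the identity by the universal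
property. Multiplicativity in the dual numbers is then the Leibniz rule for the second component. -/
theorem fst_dualLift (d : Derivation ℂ R R) (s : S) : (dualLift S M d s).fst = s := by
  have h : ((TrivSqZeroExt.fstHom S S S).toRingHom.comp (dualLift S M d)) = RingHom.id S := by
    apply IsLocalization.ringHom_ext M
    ext r
    change (dualLift S M d (algebraMap R S r)).fst = algebraMap R S r
    rw [dualLift_algebraMap]
    rfl
  exact congrArg (fun f : S →+* S => f s) h

/-- The extension of a derivation to a localization. -/
def locDer (d : Derivation ℂ R R) : Derivation ℂ S S :=
  Derivation.mk'
    { toFun := fun s => (dualLift S M d s).snd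
      map_add' := fun a b => by simp
      map_smul' := fun c a => by
        have h : dualLift S M d (algebraMap ℂ S c) = TrivSqZeroExt.inl (algebraMap ℂ S c) := by
          rw [IsScalarTower.algebraMap_apply ℂ R S, dualLift_algebraMap]
          exact TrivSqZeroExt.ext rfl (by
            change algebraMap R S (d (algebraMap ℂ R c)) = 0
            rw [Derivation.map_algebraMap, map_zero])
        rw [Algebra.smul_def, map_mul, h]
        simp [Algebra.smul_def] }
    (fun a b => by
      simp [fst_dualLift, mul_comm])

theorem locDer_algebraMap (d : Derivation ℂ R R) (r : R) :
    locDer S M d (algebraMap R S r) = algebraMap R S (d r) := by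
  change (dualLift S M d _).snd = _
  rw [dualLift_algebraMap]
  rfl

variable {S}


/-- Two twisted derivations that agree on a ring agree on its localizations. -/
theorem twisted_derivation_eq (M : Submonoid R) [IsLocalization M S] {G : Type*} [CommRing G] [Algebra ℂ G] (T : S →+* G) (g : G)
    (d : Derivation ℂ S S) (D : Derivation ℂ G G)
    (h : ∀ r : R, D (T (algebraMap R S r)) = g * T (d (algebraMap R S r))) (s : S) :
    D (T s) = g * T (d s) := by
  obtain ⟨r, m, rfl⟩ := IsLocalization.exists_mk'_eq M s
  have hu : IsUnit (T (algebraMap R S m)) := (IsLocalization.map_units S m).map T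
  have e : IsLocalization.mk' S r m * algebraMap R S m = algebraMap R S r :=
    IsLocalization.mk'_spec S r m
  set s := IsLocalization.mk' S r m
  have h1 := h r
  rw [← e, map_mul, Derivation.leibniz, Derivation.leibniz, h m] at h1
  simp only [smul_eq_mul, map_add, map_mul] at h1
  -- Both sides of the Leibniz rule for `s * m = r` are compared; `T m` is a unit, so the claim for
  -- `s` follows from those for `r` and `m`.
  apply hu.mul_left_cancel
  linear_combination h1

end LocalizedDerivation

/-! ### Rational functions with poles where coordinates coincide -/

section RationalFunctions

variable (ι : Type*) [Fintype ι] [DecidableEq ι]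

/-- Polynomials in space variables `inl o` and spectral variables `inr o`. -/
abbrev PolyRing := MvPolynomial (ι ⊕ ι) ℂ

/-- The product of all differences of space variables and of spectral variables. -/
def disc : PolyRing ι :=
  ∏ p ∈ (Finset.univ : Finset ι).offDiag,
    ((X (Sum.inl p.1) - X (Sum.inl p.2)) * (X (Sum.inr p.1) - X (Sum.inr p.2)))

/-- Rational functions with denominator a power of `disc`. -/
abbrev RatRing := Localization.Away (disc ι)

theorem X_sub_X_ne_zero {σ : Type*} {a b : σ} (h : a ≠ b) :
    (X a - X b : MvPolynomial σ ℂ) ≠ 0 :=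
  sub_ne_zero.mpr fun e => h (MvPolynomial.X_injective e)

theorem disc_ne_zero : disc ι ≠ 0 := by
  refine Finset.prod_ne_zero_iff.mpr fun p hp => mul_ne_zero ?_ ?_ <;>
    exact X_sub_X_ne_zero (by simpa using hp)

theorem powers_disc_le : Submonoid.powers (disc ι) ≤ nonZeroDivisors (PolyRing ι) :=
  powers_le_nonZeroDivisors_of_noZeroDivisors (disc_ne_zero ι)

instance : IsDomain (RatRing ι) :=
  IsLocalization.isDomain_localization (powers_disc_le ι)

variable {ι}

/-- The rational function defined by a polynomial. -/
abbrev toRat : PolyRing ι →+* RatRing ι := algebraMap _ _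

theorem toRat_injective : Function.Injective (toRat : PolyRing ι →+* RatRing ι) :=
  IsLocalization.injective _ (powers_disc_le ι)

/-- A space variable as a rational function. -/
def sp (o : ι) : RatRing ι := toRat (X (Sum.inl o))

/-- A spectral variable as a rational function. -/
def sc (o : ι) : RatRing ι := toRat (X (Sum.inr o))

theorem isUnit_toRat_of_dvd {P : PolyRing ι} {N : ℕ} (h : P ∣ disc ι ^ N) : IsUnit (toRat P) := by
  have h1 : toRat P ∣ toRat (disc ι ^ N) := map_dvd _ h
  refine isUnit_of_dvd_unit h1 ?_
  rw [map_pow]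
  exact (IsLocalization.Away.algebraMap_isUnit (disc ι)).pow N

theorem inl_sub_inl_dvd {a b : ι} (h : a ≠ b) :
    (X (Sum.inl a) - X (Sum.inl b) : PolyRing ι) ∣ disc ι :=
  (Dvd.intro _ rfl).trans (Finset.dvd_prod_of_mem _ (a := (a, b)) (by simpa using h))

theorem inr_sub_inr_dvd {a b : ι} (h : a ≠ b) :
    (X (Sum.inr a) - X (Sum.inr b) : PolyRing ι) ∣ disc ι :=
  (Dvd.intro_left _ rfl).trans (Finset.dvd_prod_of_mem _ (a := (a, b)) (by simpa using h))

theorem isUnit_sp_sub {a b : ι} (h : a ≠ b) : IsUnit (sp a - sp b : RatRing ι) := by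
  have := isUnit_toRat_of_dvd (N := 1) (by simpa using inl_sub_inl_dvd h)
  simpa [sp] using this

theorem isUnit_sc_sub {a b : ι} (h : a ≠ b) : IsUnit (sc a - sc b : RatRing ι) := by
  have := isUnit_toRat_of_dvd (N := 1) (by simpa using inr_sub_inr_dvd h)
  simpa [sc] using this

theorem exists_toRat_eq (f : RatRing ι) : ∃ (N : ℕ) (P : PolyRing ι),
    toRat (disc ι) ^ N * f = toRat P := by
  obtain ⟨N, P, h⟩ := IsLocalization.Away.surj (disc ι) f
  exact ⟨N, P, by rw [mul_comm]; exact h⟩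

/-- The derivation of the ring of rational functions extending one of polynomials. -/
def extDer (d : Derivation ℂ (PolyRing ι) (PolyRing ι)) : Derivation ℂ (RatRing ι) (RatRing ι) :=
  locDer _ (Submonoid.powers (disc ι)) d

theorem extDer_toRat (d : Derivation ℂ (PolyRing ι) (PolyRing ι)) (P : PolyRing ι) :
    extDer d (toRat P) = toRat (d P) :=
  locDer_algebraMap _ _ _ _

/-- The partial derivative with respect to any variable. -/
def dv (v : ι ⊕ ι) : Derivation ℂ (RatRing ι) (RatRing ι) := extDer (pderiv v)

/-- The partial derivative with respect to a space variable. -/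
abbrev dx (o : ι) : Derivation ℂ (RatRing ι) (RatRing ι) := dv (Sum.inl o)

theorem dv_toRat (v : ι ⊕ ι) (P : PolyRing ι) : dv v (toRat P) = toRat (pderiv v P) :=
  extDer_toRat _ _

@[simp] theorem dx_sp (o o' : ι) : dx o (sp o') = if o' = o then 1 else 0 := by
  rw [sp, dv_toRat, pderiv_X]
  by_cases h : o' = o
  · subst h; simp
  · rw [if_neg h, Pi.single_apply, if_neg (fun e => h (Sum.inl_injective e)), map_zero]

@[simp] theorem dx_sc (o o' : ι) : dx o (sc o') = 0 := by
  rw [sc, dv_toRat, pderiv_X]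
  simp

/-- The Euler derivation with respect to the space variables. -/
def eulerX : Derivation ℂ (RatRing ι) (RatRing ι) := ∑ o, (sp o) • dv (Sum.inl o)

/-- The Euler derivation with respect to the spectral variables. -/
def eulerL : Derivation ℂ (RatRing ι) (RatRing ι) := ∑ o, (sc o) • dv (Sum.inr o)

theorem der_sum_apply {α G : Type*} [CommRing G] [Algebra ℂ G] (s : Finset α)
    (d : α → Derivation ℂ G G) (f : G) : (∑ o ∈ s, d o) f = ∑ o ∈ s, d o f := by
  classical
  induction s using Finset.induction_on with
  | empty => simp
  | insert a s ha ih => simp [Finset.sum_insert ha, ih]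

theorem eulerX_apply (f : RatRing ι) : eulerX f = ∑ o, sp o * dv (Sum.inl o) f := by
  simp [eulerX, der_sum_apply]

theorem eulerL_apply (f : RatRing ι) : eulerL f = ∑ o, sc o * dv (Sum.inr o) f := by
  simp [eulerL, der_sum_apply]

/-- Weight that counts the degree in the space variables. -/
abbrev wX : ι ⊕ ι → ℕ := Sum.elim (fun _ => 1) (fun _ => 0)

/-- Weight that counts the degree in the spectral variables. -/
abbrev wL : ι ⊕ ι → ℕ := Sum.elim (fun _ => 0) (fun _ => 1)

theorem eulerX_toRat {P : PolyRing ι} {d : ℕ} (h : IsWeightedHomogeneous wX P d) :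
    eulerX (toRat P) = (d : ℂ) • toRat P := by
  have := congrArg toRat h.sum_weight_X_mul_pderiv
  rw [eulerX_apply]
  simp only [dv_toRat, sp, ← map_mul, ← map_sum]
  rw [Fintype.sum_sum_type] at this
  simp only [Sum.elim_inl, Sum.elim_inr, one_smul, zero_smul, Finset.sum_const_zero,
    add_zero] at this
  rw [this, map_nsmul, Nat.cast_smul_eq_nsmul]

theorem eulerL_toRat {P : PolyRing ι} {d : ℕ} (h : IsWeightedHomogeneous wL P d) :
    eulerL (toRat P) = (d : ℂ) • toRat P := by
  have := congrArg toRat h.sum_weight_X_mul_pderiv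
  rw [eulerL_apply]
  simp only [dv_toRat, sc, ← map_mul, ← map_sum]
  rw [Fintype.sum_sum_type] at this
  simp only [Sum.elim_inl, Sum.elim_inr, one_smul, zero_smul, Finset.sum_const_zero,
    zero_add] at this
  rw [this, map_nsmul, Nat.cast_smul_eq_nsmul]

/-- Two derivations of the ring of rational functions agree if they agree on variables. -/
theorem ratDer_ext {d d' : Derivation ℂ (RatRing ι) (RatRing ι)}
    (h : ∀ v, d (toRat (X v)) = d' (toRat (X v))) : d = d' := by
  ext f
  have := twisted_derivation_eq (R := PolyRing ι) (S := RatRing ι) (Submonoid.powers (disc ι))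
    (RingHom.id _) (1 : RatRing ι) d d' ?_ f
  · simpa using this.symm
  · intro P
    simp only [RingHom.id_apply, one_mul]
    induction P using MvPolynomial.induction_on with
    | C a =>
      have : toRat (C a : PolyRing ι) = algebraMap ℂ (RatRing ι) a := by
        rw [IsScalarTower.algebraMap_apply ℂ (PolyRing ι) (RatRing ι)]; rfl
      rw [this]; simp
    | add p q hp hq => rw [map_add, map_add, map_add, hp, hq]
    | mul_X p v hp => rw [map_mul, Derivation.leibniz, Derivation.leibniz, hp, h v]

/-- The commutator of derivations. -/
theorem dv_comm (v v' : ι ⊕ ι) (f : RatRing ι) : dv v (dv v' f) = dv v' (dv v f) := by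
  have h : ⁅dv v, dv v'⁆ = (0 : Derivation ℂ (RatRing ι) (RatRing ι)) := by
    apply ratDer_ext
    intro u
    rw [Derivation.commutator_apply]
    simp only [dv_toRat, pderiv_X, Derivation.zero_apply]
    simp only [Pi.single_apply]
    split_ifs <;> simp
  have := congrArg (fun d : Derivation ℂ (RatRing ι) (RatRing ι) => d f) h
  rw [Derivation.commutator_apply] at this
  simpa [sub_eq_zero] using this

@[simp] theorem eulerX_sp (o : ι) : eulerX (sp o) = sp o := by
  have := eulerX_toRat (isWeightedHomogeneous_X ℂ (wX (ι := ι)) (Sum.inl o))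
  simpa [sp] using this

@[simp] theorem eulerX_sc (o : ι) : eulerX (sc o) = 0 := by
  have := eulerX_toRat (isWeightedHomogeneous_X ℂ (wX (ι := ι)) (Sum.inr o))
  simpa [sc] using this

@[simp] theorem eulerL_sp (o : ι) : eulerL (sp o) = 0 := by
  have := eulerL_toRat (isWeightedHomogeneous_X ℂ (wL (ι := ι)) (Sum.inl o))
  simpa [sp] using this

@[simp] theorem eulerL_sc (o : ι) : eulerL (sc o) = sc o := by
  have := eulerL_toRat (isWeightedHomogeneous_X ℂ (wL (ι := ι)) (Sum.inr o))
  simpa [sc] using this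

/-- Differentiation lowers the degree by one: the commutator with the Euler field is `-∂`. -/
theorem eulerX_dx (o : ι) (f : RatRing ι) : eulerX (dx o f) = dx o (eulerX f) - dx o f := by
  rw [eulerX_apply, eulerX_apply, map_sum]
  simp only [Derivation.leibniz, smul_eq_mul, dx_sp, Finset.sum_add_distrib]
  rw [Finset.sum_congr rfl fun o' _ => by rw [dv_comm]]
  simp

/-- Eigenvectors of an operator for distinct eigenvalues `c - l` that sum to zero vanish. -/
theorem eigen_sum_zero {V : Type*} [AddCommGroup V] [Module ℂ V] (E : V →ₗ[ℂ] V) (c : ℂ)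
    (s : Finset ℕ) (v : ℕ → V) (h : ∀ l ∈ s, E (v l) = (c - l) • v l) (h0 : ∑ l ∈ s, v l = 0) :
    ∀ l ∈ s, v l = 0 := by
  classical
  have hi : iSupIndep fun l : ℕ => Module.End.eigenspace E (c - l) :=
    (Module.End.eigenspaces_iSupIndep E).comp (f := fun l : ℕ => c - (l : ℂ))
      (fun a b hab => by simpa using hab)
  exact (iSupIndep_iff_finsetSum_eq_zero_imp_eq_zero _).mp hi s v
    (fun l hl => Module.End.mem_eigenspace_iff.mpr (h l hl)) h0

/-! ### Evaluation -/

theorem eval_disc_ne_zero {x lam : ι → ℂ} (hx : Function.Injective x)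
    (hl : Function.Injective lam) : eval (Sum.elim x lam) (disc ι) ≠ 0 := by
  rw [disc, map_prod]
  refine Finset.prod_ne_zero_iff.mpr fun p hp => ?_
  have hne : p.1 ≠ p.2 := by simpa using hp
  simp only [map_mul, map_sub, eval_X, Sum.elim_inl, Sum.elim_inr]
  exact mul_ne_zero (sub_ne_zero.mpr (hx.ne hne)) (sub_ne_zero.mpr (hl.ne hne))

/-- Evaluation of rational functions away from the poles. -/
def evalRat (x lam : ι → ℂ) (hx : Function.Injective x) (hl : Function.Injective lam) :
    RatRing ι →+* ℂ :=
  IsLocalization.Away.lift (disc ι) (g := eval (Sum.elim x lam))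
    (isUnit_iff_ne_zero.mpr (eval_disc_ne_zero hx hl))

@[simp] theorem evalRat_toRat (x lam : ι → ℂ) (hx : Function.Injective x)
    (hl : Function.Injective lam) (P : PolyRing ι) :
    evalRat x lam hx hl (toRat P) = eval (Sum.elim x lam) P :=
  IsLocalization.Away.lift_eq _ _ _

@[simp] theorem evalRat_sp (x lam : ι → ℂ) (hx : Function.Injective x)
    (hl : Function.Injective lam) (o : ι) : evalRat x lam hx hl (sp o) = x o := by simp [sp]

@[simp] theorem evalRat_sc (x lam : ι → ℂ) (hx : Function.Injective x)
    (hl : Function.Injective lam) (o : ι) : evalRat x lam hx hl (sc o) = lam o := by simp [sc]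

/-- A polynomial that vanishes where another nonzero one does not vanish is zero. -/
theorem poly_eq_zero_of_eval {σ : Type*} {P D : MvPolynomial σ ℂ} (hD : D ≠ 0)
    (h : ∀ z, eval z D ≠ 0 → eval z P = 0) : P = 0 := by
  have : P * D = 0 := by
    apply MvPolynomial.funext
    intro z
    by_cases hz : eval z D = 0
    · simp [hz]
    · simp [h z hz]
  exact (mul_eq_zero.mp this).resolve_right hD

theorem injective_of_eval_disc {z : ι ⊕ ι → ℂ} (h : eval z (disc ι) ≠ 0) :
    Function.Injective (z ∘ Sum.inl) ∧ Function.Injective (z ∘ Sum.inr) := by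
  rw [disc, map_prod, Finset.prod_ne_zero_iff] at h
  constructor <;> intro a b hab <;> by_contra hne <;>
    exact h (a, b) (by simpa using hne) (by simp_all)

theorem poly_eq_zero_of_eval_injective {P : PolyRing ι}
    (h : ∀ x lam : ι → ℂ, Function.Injective x → Function.Injective lam →
      eval (Sum.elim x lam) P = 0) : P = 0 := by
  refine poly_eq_zero_of_eval (disc_ne_zero ι) fun z hz => ?_
  obtain ⟨h1, h2⟩ := injective_of_eval_disc hz
  have := h _ _ h1 h2
  rwa [Sum.elim_comp_inl_inr] at this

theorem rat_eq_zero_of_evalRat {f : RatRing ι}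
    (h : ∀ (x lam : ι → ℂ) (hx : Function.Injective x) (hl : Function.Injective lam),
      evalRat x lam hx hl f = 0) : f = 0 := by
  obtain ⟨N, P, hP⟩ := exists_toRat_eq f
  have : P = 0 := poly_eq_zero_of_eval_injective fun x lam hx hl => by
    have := congrArg (evalRat x lam hx hl) hP
    rw [map_mul, h x lam hx hl, mul_zero, evalRat_toRat] at this
    exact this.symm
  rw [this, map_zero] at hP
  exact ((IsLocalization.Away.algebraMap_isUnit (disc ι)).pow N).mul_right_eq_zero.mp hP

theorem hasDerivAt_eval_update (P : PolyRing ι) (z : ι ⊕ ι → ℂ) (v : ι ⊕ ι) (t : ℂ) :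
    HasDerivAt (fun t => eval (Function.update z v t) P)
      (eval (Function.update z v t) (pderiv v P)) t := by
  induction P using MvPolynomial.induction_on with
  | C a => simpa using hasDerivAt_const t a
  | add p q hp hq => simpa [Function.comp_def, Pi.add_def] using hp.add hq
  | mul_X p u hp =>
    have hu : HasDerivAt (fun t : ℂ => Function.update z v t u)
        (if u = v then 1 else 0 : ℂ) t := by
      by_cases h : u = v
      · subst h; simpa using hasDerivAt_id' t
      · simpa [h] using hasDerivAt_const t (z u)
    have := hp.mul hu
    simp only [map_mul, eval_X, Derivation.leibniz, smul_eq_mul, map_add, pderiv_X]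
    refine this.congr_deriv ?_
    by_cases h : u = v
    · subst h; simp; ring
    · simp [h]; ring

theorem elim_update (x lam : ι → ℂ) (o : ι) (t : ℂ) :
    (Sum.elim (Function.update x o t) lam : ι ⊕ ι → ℂ) =
      Function.update (Sum.elim x lam) (Sum.inl o) t := by
  ext (a | a)
  · by_cases h : a = o
    · subst h; simp
    · simp [h]
  · simp

/-- Distinctness of coordinates is an open condition. Formulas valid only off the poles may
therefore be differentiated, whatever default values the functions take on them. -/
theorem eventually_injective_update {x : ι → ℂ} (hx : Function.Injective x) (o : ι) :
    ∀ᶠ t in nhds (x o), Function.Injective (Function.update x o t) := by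
  have h : ∀ᶠ t in nhds (x o), ∀ o' : ι, o' ≠ o → t ≠ x o' := by
    rw [Filter.eventually_all]
    intro o'
    by_cases h : o' = o
    · simp [h]
    · filter_upwards [isOpen_ne.mem_nhds (hx.ne (Ne.symm h))] with t ht _ using ht
  filter_upwards [h] with t ht a b hab
  by_cases ha : a = o <;> by_cases hb : b = o
  · rw [ha, hb]
  · subst ha; simp [hb] at hab; exact absurd hab (ht b hb)
  · subst hb; simp [ha] at hab; exact absurd hab.symm (ht a ha)
  · simp [ha, hb] at hab; exact hx hab

/-- The value of a rational function, set to zero at the poles. -/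
def ratFun (f : RatRing ι) (x lam : ι → ℂ) : ℂ :=
  open Classical in
  if h : Function.Injective x ∧ Function.Injective lam then evalRat x lam h.1 h.2 f else 0

theorem ratFun_eq (f : RatRing ι) {x lam : ι → ℂ} (hx : Function.Injective x)
    (hl : Function.Injective lam) : ratFun f x lam = evalRat x lam hx hl f := by
  rw [ratFun, dif_pos ⟨hx, hl⟩]

/-- Near the point the function is a quotient `P / D` of polynomials. The derivation applied to `D f
= P` reproduces the quotient rule. -/
theorem hasDerivAt_ratFun (f : RatRing ι) {x lam : ι → ℂ} (hx : Function.Injective x)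
    (hl : Function.Injective lam) (o : ι) :
    HasDerivAt (fun t => ratFun f (Function.update x o t) lam) (ratFun (dx o f) x lam) (x o) := by
  obtain ⟨N, P, hP⟩ := exists_toRat_eq f
  set D := disc ι ^ N with hD
  have hDP : toRat D * f = toRat P := by rw [hD, map_pow]; exact hP
  have hne : eval (Sum.elim x lam) D ≠ 0 := by
    rw [hD, map_pow]; exact pow_ne_zero _ (eval_disc_ne_zero hx hl)
  have hev : (fun t => ratFun f (Function.update x o t) lam) =ᶠ[nhds (x o)]
      fun t => eval (Function.update (Sum.elim x lam) (Sum.inl o) t) P /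
        eval (Function.update (Sum.elim x lam) (Sum.inl o) t) D := by
    filter_upwards [eventually_injective_update hx o] with t ht
    rw [ratFun_eq f ht hl, ← elim_update, eq_div_iff, mul_comm]
    · have := congrArg (evalRat _ lam ht hl) hDP
      rwa [map_mul, evalRat_toRat, evalRat_toRat] at this
    · rw [hD, map_pow]; exact pow_ne_zero _ (eval_disc_ne_zero ht hl)
  have h1 := (hasDerivAt_eval_update P (Sum.elim x lam) (Sum.inl o) (x o)).div
    (hasDerivAt_eval_update D (Sum.elim x lam) (Sum.inl o) (x o))
    (by rw [show x o = (Sum.elim x lam : ι ⊕ ι → ℂ) (Sum.inl o) from rfl,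
      Function.update_eq_self]; exact hne)
  refine (h1.congr_of_eventuallyEq hev).congr_deriv ?_
  rw [show x o = (Sum.elim x lam : ι ⊕ ι → ℂ) (Sum.inl o) from rfl, Function.update_eq_self,
    ratFun_eq _ hx hl]
  have h2 := congrArg (fun g => evalRat x lam hx hl (dx o g)) hDP
  have h3 := congrArg (evalRat x lam hx hl) hDP
  simp only [Derivation.leibniz, dv_toRat, smul_eq_mul, map_add, map_mul, evalRat_toRat] at h2 h3
  rw [div_eq_iff (pow_ne_zero _ hne), ← h2, ← h3]
  ring

end RationalFunctions

/-! ### Leading terms -/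

section LeadingTerm

variable {σ : Type*} {w : σ → ℕ} {P T : MvPolynomial σ ℂ} {d : ℕ}

theorem component_weightedTotalDegree_ne_zero (hP : P ≠ 0) :
    weightedHomogeneousComponent w (weightedTotalDegree w P) P ≠ 0 := by
  classical
  obtain ⟨s, hs, he⟩ := Finset.exists_mem_eq_sup P.support
    (by simpa [Finset.nonempty_iff_ne_empty] using hP) (fun s => Finsupp.weight w s)
  intro h
  have := congrArg (coeff s) h
  rw [coeff_weightedHomogeneousComponent, if_pos (show _ = weightedTotalDegree w P from he.symm),
    coeff_zero] at this
  exact mem_support_iff.mp hs this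

theorem component_eq_zero_of_weightedTotalDegree_lt {e : ℕ} (h : weightedTotalDegree w P < e) :
    weightedHomogeneousComponent w e P = 0 :=
  weightedHomogeneousComponent_eq_zero _ _ h

/-- Characterization of the leading form when it is nonzero. -/
theorem leadingForm_eq_iff (hT : T ≠ 0) (hTd : IsWeightedHomogeneous w T d) :
    leadingForm w P = T ↔ (∀ e, d < e → weightedHomogeneousComponent w e P = 0) ∧
      weightedHomogeneousComponent w d P = T := by
  constructor
  · intro h
    have hd : weightedTotalDegree w P = d :=
      IsWeightedHomogeneous.inj_right (w := w) hT
        (h ▸ weightedHomogeneousComponent_isWeightedHomogeneous _ _) hTd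
    refine ⟨fun e he => component_eq_zero_of_weightedTotalDegree_lt (hd ▸ he), ?_⟩
    rw [← hd]; exact h
  · rintro ⟨h1, h2⟩
    have hP : P ≠ 0 := by rintro rfl; rw [map_zero] at h2; exact hT h2.symm
    have hd : weightedTotalDegree w P = d := by
      rcases lt_trichotomy (weightedTotalDegree w P) d with h | h | h
      · exact absurd (h2.symm.trans (component_eq_zero_of_weightedTotalDegree_lt h)) hT
      · exact h
      · exact absurd (h1 _ h) (component_weightedTotalDegree_ne_zero hP)
    rw [leadingForm, hd, h2]

theorem sum_component_of_lt {L : ℕ} (h : ∀ e, L ≤ e → weightedHomogeneousComponent w e P = 0) :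
    ∑ e ∈ Finset.range L, weightedHomogeneousComponent w e P = P := by
  conv_rhs => rw [← sum_weightedHomogeneousComponent w P]
  rw [finsum_eq_sum_of_support_subset]
  intro e he
  by_contra hc
  exact he (h e (by simpa using hc))

theorem component_sum_of_homogeneous {L : ℕ} {v : ℕ → MvPolynomial σ ℂ}
    (h : ∀ l, l < L → IsWeightedHomogeneous w (v l) l) (e : ℕ) :
    weightedHomogeneousComponent w e (∑ l ∈ Finset.range L, v l) = if e < L then v e else 0 := by
  rw [map_sum]
  split_ifs with he
  · rw [Finset.sum_eq_single_of_mem e (by simpa using he)]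
    · exact (h e he).weightedHomogeneousComponent_same
    · intro l hl hne
      exact (h l (by simpa using hl)).weightedHomogeneousComponent_ne _ hne.symm
  · refine Finset.sum_eq_zero fun l hl => ?_
    refine (h l (by simpa using hl)).weightedHomogeneousComponent_ne _ ?_
    rintro rfl
    exact he (by simpa using hl)

end LeadingTerm

/-! ### Restriction of polynomials to lines in the direction of the spectral variables -/

section Lines

variable {ι : Type*} [Fintype ι] [DecidableEq ι]

/-- Restriction of a polynomial to the line `x + t λ`. -/
def line (x lam : ι → ℂ) : PolyRing ι →ₐ[ℂ] Polynomial ℂ :=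
  aeval (Sum.elim (fun o => Polynomial.C (x o) + Polynomial.C (lam o) * Polynomial.X)
    (fun o => Polynomial.C (lam o)))

theorem eval_line (x lam : ι → ℂ) (t : ℂ) (P : PolyRing ι) :
    (line x lam P).eval t = eval (Sum.elim (fun o => x o + lam o * t) lam) P := by
  have : (Polynomial.evalRingHom t).comp (line x lam).toRingHom =
      eval (Sum.elim (fun o => x o + lam o * t) lam) := by
    apply MvPolynomial.ringHom_ext
    · intro r; simp
    · rintro (o | o) <;> simp [line]
  exact congrArg (fun f : PolyRing ι →+* ℂ => f P) this

theorem eval_line_zero (x lam : ι → ℂ) (P : PolyRing ι) :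
    (line x lam P).eval 0 = eval (Sum.elim x lam) P := by
  simp [eval_line]

/-- The derivative in the direction of the spectral variables. -/
def gradPoly (P : PolyRing ι) : PolyRing ι := ∑ o, X (Sum.inr o) * pderiv (Sum.inl o) P

theorem derivative_line (x lam : ι → ℂ) (P : PolyRing ι) :
    Polynomial.derivative (line x lam P) = line x lam (gradPoly P) := by
  induction P using MvPolynomial.induction_on with
  | C a => simp [gradPoly, line]
  | add p q hp hq =>
    rw [map_add, map_add, hp, hq, ← map_add]
    simp [gradPoly, mul_add, Finset.sum_add_distrib]
  | mul_X p u hp =>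
    have h : gradPoly (p * X u) = gradPoly p * X u + p * gradPoly (X u) := by
      simp only [gradPoly, Derivation.leibniz, smul_eq_mul, mul_add, Finset.sum_add_distrib,
        Finset.mul_sum, Finset.sum_mul]
      rw [add_comm]
      congr 1 <;> exact Finset.sum_congr rfl fun _ _ => by ring
    have h2 : Polynomial.derivative (line x lam (X u)) = line x lam (gradPoly (X u)) := by
      rcases u with o | o
      · simp [gradPoly, line, pderiv_X, Pi.single_apply]
      · simp [gradPoly, line]
    rw [h, map_mul, Polynomial.derivative_mul, hp, h2, map_add, map_mul, map_mul]

/-- For large `t` the point `x + tλ` is dominated by `tλ`, so the top coefficient in `t` is the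
value at `x = λ`. -/
theorem line_monomial (x lam : ι → ℂ) (s : ι ⊕ ι →₀ ℕ) :
    (line x lam (monomial s 1)).natDegree ≤ Finsupp.weight wX s ∧
      (line x lam (monomial s 1)).coeff (Finsupp.weight wX s) =
        eval (Sum.elim lam lam) (monomial s 1) := by
  induction s using Finsupp.induction with
  | zero => simp
  | single_add v k s _ _ ih =>
    have h1 : (line x lam (monomial (Finsupp.single v k) 1)).natDegree ≤ k * wX v ∧
        (line x lam (monomial (Finsupp.single v k) 1)).coeff (k * wX v) =
          eval (Sum.elim lam lam) (monomial (Finsupp.single v k) 1) := by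
      rw [← X_pow_eq_monomial, map_pow, map_pow]
      rcases v with o | o
      · have hl : (line x lam (X (Sum.inl o))).natDegree ≤ 1 := by
          simp only [line, aeval_X, Sum.elim_inl]
          compute_degree
        have := Polynomial.coeff_pow_of_natDegree_le (m := k) hl
        refine ⟨Polynomial.natDegree_pow_le_of_le k hl, ?_⟩
        simp only [Sum.elim_inl]
        rw [this]
        simp [line]
      · refine ⟨?_, by
          simp only [line, aeval_X, Sum.elim_inr, eval_X, mul_zero]
          rw [← Polynomial.C_pow, Polynomial.coeff_C_zero]⟩
        simp only [line, aeval_X, Sum.elim_inr, ← Polynomial.C_pow]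
        simp
    rw [show (monomial (Finsupp.single v k + s) (1 : ℂ)) =
      monomial (Finsupp.single v k) 1 * monomial s 1 by simp [monomial_mul], map_mul, map_mul,
      map_add, Finsupp.weight_single, smul_eq_mul]
    exact ⟨Polynomial.natDegree_mul_le_of_le h1.1 ih.1, by
      rw [Polynomial.coeff_mul_add_eq_of_natDegree_le h1.1 ih.1, h1.2, ih.2]⟩

theorem line_homogeneous (x lam : ι → ℂ) {P : PolyRing ι} {d : ℕ}
    (h : IsWeightedHomogeneous wX P d) :
    (line x lam P).natDegree ≤ d ∧ (line x lam P).coeff d = eval (Sum.elim lam lam) P := by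
  have e : P = ∑ s ∈ P.support, C (coeff s P) * monomial s 1 := by
    conv_lhs => rw [P.as_sum]
    exact Finset.sum_congr rfl fun s _ => by simp [C_mul_monomial]
  have hw : ∀ s ∈ P.support, Finsupp.weight wX s = d := fun s hs => h (mem_support_iff.mp hs)
  constructor
  · rw [e, map_sum]
    refine Polynomial.natDegree_sum_le_of_forall_le _ _ fun s hs => ?_
    rw [map_mul, ← hw s hs]
    simp only [algHom_C, Polynomial.algebraMap_eq]
    exact (Polynomial.natDegree_C_mul_le _ _).trans (line_monomial x lam s).1
  · rw [e, map_sum, map_sum, Polynomial.finsetSum_coeff]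
    refine Finset.sum_congr rfl fun s hs => ?_
    rw [map_mul, map_mul, ← (line_monomial x lam s).2, ← hw s hs]
    simp

/-- The quotient `p / q` has derivative zero, hence is constant, and the degrees make the constant
zero. In the proof, the coefficients of degree `deg p + deg q - 1` on the two sides are the product
of the leading coefficients times `deg p` and `deg q` respectively. -/
theorem polynomial_wronskian {p q : Polynomial ℂ} (h : p.natDegree < q.natDegree)
    (hw : Polynomial.derivative p * q = p * Polynomial.derivative q) : p = 0 := by
  by_contra hp
  have hq : q ≠ 0 := by rintro rfl; simp at h
  obtain ⟨b, hb⟩ : ∃ b, q.natDegree = b + 1 := ⟨q.natDegree - 1, by omega⟩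
  have hq' : (Polynomial.derivative q).natDegree ≤ b := by
    have := Polynomial.natDegree_derivative_le q; omega
  have hr : (p * Polynomial.derivative q).coeff (p.natDegree + b) =
      p.leadingCoeff * (q.leadingCoeff * (b + 1)) := by
    rw [Polynomial.coeff_mul_add_eq_of_natDegree_le le_rfl hq', Polynomial.coeff_derivative, ← hb]
    rfl
  have hl : (Polynomial.derivative p * q).coeff (p.natDegree + b) =
      p.leadingCoeff * (q.leadingCoeff * p.natDegree) := by
    rcases Nat.eq_zero_or_pos p.natDegree with h0 | h0
    · rw [Polynomial.derivative_of_natDegree_zero h0, h0]; simp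
    · obtain ⟨a, ha⟩ : ∃ a, p.natDegree = a + 1 := ⟨p.natDegree - 1, by omega⟩
      have hp' : (Polynomial.derivative p).natDegree ≤ a := by
        have := Polynomial.natDegree_derivative_le p; omega
      rw [show p.natDegree + b = a + q.natDegree by omega,
        Polynomial.coeff_mul_add_eq_of_natDegree_le hp' le_rfl, Polynomial.coeff_derivative, ← ha, ha]
      simp only [Polynomial.leadingCoeff, ha]
      push_cast
      ring
  rw [hw, hr] at hl
  have h3 := mul_left_cancel₀ (Polynomial.leadingCoeff_ne_zero.mpr hq)
    (mul_left_cancel₀ (Polynomial.leadingCoeff_ne_zero.mpr hp) hl)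
  norm_cast at h3
  omega

/-- A homogeneous numerator of a function that is constant in the direction of `λ` vanishes if
the denominator has larger degree in that direction. -/
theorem eval_eq_zero_of_wronskian {N H K : PolyRing ι} {e : ℕ} {x lam : ι → ℂ}
    (hN : IsWeightedHomogeneous wX N e)
    (hW : ∀ x, eval (Sum.elim x lam) (K * (H * gradPoly N - N * gradPoly H)) = 0)
    (hK : line x lam K ≠ 0) (hH : e < (line x lam H).natDegree) :
    eval (Sum.elim x lam) N = 0 := by
  -- The Wronskian identity holds on the whole line, and `K` is a nonzero polynomial there, so it
  -- cancels.
  have h0 : line x lam (K * (H * gradPoly N - N * gradPoly H)) = 0 := by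
    apply Polynomial.funext
    intro t
    rw [eval_line, hW, Polynomial.eval_zero]
  rw [map_mul, map_sub, map_mul, map_mul, ← derivative_line, ← derivative_line] at h0
  have h1 := (mul_eq_zero.mp h0).resolve_left hK
  have := polynomial_wronskian ((line_homogeneous x lam hN).1.trans_lt hH)
    (by rw [mul_comm]; exact sub_eq_zero.mp h1)
  rw [← eval_line_zero, this, Polynomial.eval_zero]

end Lines

/-! ### The Schrödinger equation -/

section Schrodinger

variable {ι : Type*} [Fintype ι] [DecidableEq ι]

/-- The coupling constant of two particles of charges `q a` and `q b`. -/
def coup (m : ℂ) (q : ι → ℂ) (a b : ι) : ℂ := m * (q a + q b) * (1 + m * q a * q b)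

/-- The potential as a rational function. -/
def potRat (m : ℂ) (q : ι → ℂ) : RatRing ι :=
  -- The sum runs over ordered pairs, hence the factor 1/2. Diagonal terms vanish because
  -- `Ring.inverse 0 = 0`.
  ∑ a, ∑ b, (coup m q a b / 2) • Ring.inverse (sp a - sp b) ^ 2

/-- The potential as a function. -/
def potNum (m : ℂ) (q : ι → ℂ) (x : ι → ℂ) : ℂ :=
  ∑ a, ∑ b, coup m q a b / 2 * ((x a - x b)⁻¹) ^ 2

/-- The Laplace operator of particles with charges `q`. -/
def lapRat (q : ι → ℂ) : RatRing ι →ₗ[ℂ] RatRing ι :=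
  ∑ o, (q o)⁻¹ • ((dx o).toLinearMap ∘ₗ (dx o).toLinearMap)

/-- The derivative in the direction of the spectral variables. -/
def gradRat : Derivation ℂ (RatRing ι) (RatRing ι) := ∑ o, (sc o) • dx o

theorem lapRat_apply (q : ι → ℂ) (f : RatRing ι) :
    lapRat q f = ∑ o, (q o)⁻¹ • dx o (dx o f) := by
  simp [lapRat]

theorem gradRat_apply (f : RatRing ι) : gradRat f = ∑ o, sc o * dx o f := by
  simp [gradRat, der_sum_apply]

theorem gradRat_toRat (P : PolyRing ι) : gradRat (toRat P) = toRat (gradPoly P) := by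
  simp [gradRat_apply, gradPoly, dv_toRat, sc]

/-- The Schrödinger operator acting on the rational factor. -/
def schrRat (m : ℂ) (q : ι → ℂ) (f : RatRing ι) : RatRing ι :=
  lapRat q f + 2 * gradRat f - potRat m q * f

theorem map_ringInverse {A F : Type*} [CommRing A] [Field F] (g : A →+* F) {u : A}
    (hu : IsUnit u) : g (Ring.inverse u) = (g u)⁻¹ := by
  obtain ⟨u, rfl⟩ := hu
  rw [Ring.inverse_unit]
  exact eq_inv_of_mul_eq_one_left (by rw [← map_mul, Units.inv_mul, map_one])

theorem evalRat_inverse_sub {x lam : ι → ℂ} (hx : Function.Injective x)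
    (hl : Function.Injective lam) (a b : ι) :
    evalRat x lam hx hl (Ring.inverse (sp a - sp b)) = (x a - x b)⁻¹ := by
  by_cases h : a = b
  · subst h; simp
  · rw [map_ringInverse _ (isUnit_sp_sub h)]; simp

theorem evalRat_smul {x lam : ι → ℂ} (hx : Function.Injective x)
    (hl : Function.Injective lam) (c : ℂ) (f : RatRing ι) :
    evalRat x lam hx hl (c • f) = c * evalRat x lam hx hl f := by
  have : algebraMap ℂ (RatRing ι) c = toRat (C c) := by
    rw [IsScalarTower.algebraMap_apply ℂ (PolyRing ι) (RatRing ι)]; rfl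
  rw [Algebra.smul_def, map_mul, this, evalRat_toRat, eval_C]

theorem evalRat_potRat {x lam : ι → ℂ} (hx : Function.Injective x)
    (hl : Function.Injective lam) (m : ℂ) (q : ι → ℂ) :
    evalRat x lam hx hl (potRat m q) = potNum m q x := by
  simp only [potRat, potNum, map_sum, evalRat_smul, map_pow, evalRat_inverse_sub]

/-- A rational function times the exponential. -/
def expFun (q : ι → ℂ) (f : RatRing ι) (x lam : ι → ℂ) : ℂ :=
  ratFun f x lam * Complex.exp (∑ o, q o * lam o * x o)

/-- Conjugation by the exponential turns `∂_o` into `∂_o + q_o λ_o`. -/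
theorem hasDerivAt_expFun (q : ι → ℂ) (f : RatRing ι) {x lam : ι → ℂ}
    (hx : Function.Injective x) (hl : Function.Injective lam) (o : ι) :
    HasDerivAt (fun t => expFun q f (Function.update x o t) lam)
      (expFun q (dx o f + q o • (sc o * f)) x lam) (x o) := by
  have h1 := hasDerivAt_ratFun f hx hl o
  have h2 : HasDerivAt (fun t => ∑ o', q o' * lam o' * Function.update x o t o')
      (q o * lam o) (x o) := by
    have : ∀ o' ∈ Finset.univ, HasDerivAt (fun t => q o' * lam o' * Function.update x o t o')
        (if o' = o then q o * lam o else 0) (x o) := by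
      intro o' _
      by_cases h : o' = o
      · subst h; simpa using (hasDerivAt_id' (x o')).const_mul (q o' * lam o')
      · simpa [h] using hasDerivAt_const (x o) (q o' * lam o' * x o')
    have := HasDerivAt.fun_sum this
    simpa using this
  have h3 := h1.mul h2.cexp
  refine h3.congr_deriv ?_
  simp only [expFun, ratFun_eq _ hx hl, map_add, evalRat_smul, map_mul, evalRat_sc,
    Function.update_eq_self]
  ring

theorem iteratedDeriv_expFun (q : ι → ℂ) (f : RatRing ι) {x lam : ι → ℂ}
    (hx : Function.Injective x) (hl : Function.Injective lam) (o : ι) :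
    iteratedDeriv 2 (fun t => expFun q f (Function.update x o t) lam) (x o) =
      expFun q (dx o (dx o f) + (2 * q o) • (sc o * dx o f) + (q o ^ 2) • (sc o ^ 2 * f))
        x lam := by
  rw [iteratedDeriv_succ, iteratedDeriv_one]
  have h : deriv (fun t => expFun q f (Function.update x o t) lam) =ᶠ[nhds (x o)]
      fun t => expFun q (dx o f + q o • (sc o * f)) (Function.update x o t) lam := by
    filter_upwards [eventually_injective_update hx o] with t ht
    have := (hasDerivAt_expFun q f ht hl o).deriv
    simpa using this
  rw [h.deriv_eq, (hasDerivAt_expFun q _ hx hl o).deriv]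
  congr 1
  simp only [map_add, Derivation.map_smul, Derivation.leibniz, dx_sc, smul_eq_mul]
  simp only [Algebra.smul_def, map_mul, map_pow, map_ofNat]
  ring

/-- The wave function with polynomial numerator `Q` and denominator `T`. -/
def genFun (q : ι → ℂ) (T Q : PolyRing ι) (x lam : ι → ℂ) : ℂ :=
  eval (Sum.elim x lam) Q / eval (Sum.elim x lam) T * Complex.exp (∑ o, q o * lam o * x o)

/-- The Schrödinger equation for `genFun`. -/
def SatisfiesSchr (m : ℂ) (q : ι → ℂ) (T Q : PolyRing ι) : Prop :=
  ∀ x lam : ι → ℂ, Function.Injective x → Function.Injective lam →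
    -(∑ o, (q o)⁻¹ * iteratedDeriv 2 (fun t => genFun q T Q (Function.update x o t) lam) (x o)) +
      potNum m q x * genFun q T Q x lam = -(∑ o, q o * lam o ^ 2) * genFun q T Q x lam

theorem genFun_eq_expFun {q : ι → ℂ} {T Q : PolyRing ι} {f : RatRing ι} (hT : IsUnit (toRat T))
    (hf : toRat T * f = toRat Q) {x lam : ι → ℂ}
    (hx : Function.Injective x) (hl : Function.Injective lam) :
    genFun q T Q x lam = expFun q f x lam := by
  have h1 : eval (Sum.elim x lam) T ≠ 0 := by
    rw [← evalRat_toRat x lam hx hl]; exact (hT.map _).ne_zero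
  have h2 := congrArg (evalRat x lam hx hl) hf
  rw [map_mul, evalRat_toRat, evalRat_toRat] at h2
  rw [genFun, expFun, ratFun_eq _ hx hl, ← h2, mul_div_cancel_left₀ _ h1]

/-- After conjugation by the exponential the terms `q_o λ_o² f` cancel against the eigenvalue and
the exponential factors out. A rational function that vanishes at all points with distinct
coordinates is zero, so the equation becomes an identity in `RatRing`. -/
theorem satisfiesSchr_iff {m : ℂ} {q : ι → ℂ} (hq : ∀ o, q o ≠ 0) {T Q : PolyRing ι}
    {f : RatRing ι} (hT : IsUnit (toRat T)) (hf : toRat T * f = toRat Q) :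
    SatisfiesSchr m q T Q ↔ schrRat m q f = 0 := by
  have key : ∀ (x lam : ι → ℂ) (hx : Function.Injective x) (hl : Function.Injective lam),
      -(∑ o, (q o)⁻¹ *
        iteratedDeriv 2 (fun t => genFun q T Q (Function.update x o t) lam) (x o)) +
      potNum m q x * genFun q T Q x lam + (∑ o, q o * lam o ^ 2) * genFun q T Q x lam =
      -evalRat x lam hx hl (schrRat m q f) * Complex.exp (∑ o, q o * lam o * x o) := by
    intro x lam hx hl
    have h1 : ∀ o, iteratedDeriv 2 (fun t => genFun q T Q (Function.update x o t) lam) (x o) =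
        iteratedDeriv 2 (fun t => expFun q f (Function.update x o t) lam) (x o) := by
      intro o
      apply Filter.EventuallyEq.iteratedDeriv_eq
      filter_upwards [eventually_injective_update hx o] with t ht
      exact genFun_eq_expFun hT hf ht hl
    simp only [h1, iteratedDeriv_expFun q f hx hl]
    simp only [genFun_eq_expFun hT hf hx hl, expFun,
      ratFun_eq _ hx hl, schrRat, lapRat_apply, gradRat_apply, map_sub, map_add, map_sum, map_mul,
      evalRat_smul, evalRat_sc, evalRat_potRat, map_pow, map_ofNat]
    have h2 : ∀ o, (q o)⁻¹ * ((evalRat x lam hx hl (dx o (dx o f)) +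
        2 * q o * (lam o * evalRat x lam hx hl (dx o f)) +
        q o ^ 2 * (lam o ^ 2 * evalRat x lam hx hl f)) *
          Complex.exp (∑ o, q o * lam o * x o)) =
        ((q o)⁻¹ * evalRat x lam hx hl (dx o (dx o f)) +
          2 * (lam o * evalRat x lam hx hl (dx o f)) +
          q o * lam o ^ 2 * evalRat x lam hx hl f) * Complex.exp (∑ o, q o * lam o * x o) := by
      intro o
      field_simp [hq o]
    rw [Finset.sum_congr rfl fun o _ => h2 o, ← Finset.sum_mul, Finset.sum_add_distrib,
      Finset.sum_add_distrib, ← Finset.mul_sum, ← Finset.sum_mul]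
    ring
  constructor
  · intro h
    apply rat_eq_zero_of_evalRat
    intro x lam hx hl
    have := key x lam hx hl
    rw [h x lam hx hl] at this
    have h3 := mul_eq_zero.mp (this.symm.trans (by ring))
    simpa using h3.resolve_right (Complex.exp_ne_zero _)
  · intro h x lam hx hl
    have := key x lam hx hl
    rw [h, map_zero, neg_zero, zero_mul] at this
    linear_combination this

end Schrodinger

/-! ### Homogeneous expansions of wave functions -/

section Series

variable {ι : Type*} [Fintype ι] [DecidableEq ι]

theorem der_ringInverse {G : Type*} [CommRing G] [Algebra ℂ G] (D : Derivation ℂ G G) {u : G}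
    (hu : IsUnit u) : D (Ring.inverse u) = -Ring.inverse u ^ 2 * D u := by
  have := D.leibniz_of_mul_eq_one (Ring.inverse_mul_cancel u hu)
  simpa using this

theorem der_inverse_sp_sub (D : Derivation ℂ (RatRing ι) (RatRing ι)) (a b : ι) :
    D (Ring.inverse (sp a - sp b)) = -Ring.inverse (sp a - sp b) ^ 2 * D (sp a - sp b) := by
  by_cases h : a = b
  · subst h; simp
  · exact der_ringInverse D (isUnit_sp_sub h)

theorem eulerX_inverse_sub (a b : ι) :
    eulerX (Ring.inverse (sp a - sp b) : RatRing ι) = -Ring.inverse (sp a - sp b) := by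
  by_cases h : a = b
  · subst h; simp
  · rw [der_inverse_sp_sub, map_sub, eulerX_sp, eulerX_sp]
    linear_combination (-Ring.inverse (sp a - sp b)) *
      Ring.inverse_mul_cancel _ (isUnit_sp_sub h)

theorem eulerX_potRat (m : ℂ) (q : ι → ℂ) :
    eulerX (potRat m q) = (-2 : ℂ) • potRat m q := by
  simp only [potRat, map_sum, Derivation.map_smul, Finset.smul_sum, Derivation.leibniz_pow,
    eulerX_inverse_sub]
  refine Finset.sum_congr rfl fun a _ => Finset.sum_congr rfl fun b _ => ?_
  rw [smul_comm (-2 : ℂ)]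
  refine congrArg _ ?_
  rw [Algebra.smul_def (-2 : ℂ), map_neg, map_ofNat, smul_eq_mul, nsmul_eq_mul]
  push_cast
  ring

theorem eulerX_lapRat {c : ℂ} {q : ι → ℂ} {f : RatRing ι} (h : eulerX f = c • f) :
    eulerX (lapRat q f) = (c - 2) • lapRat q f := by
  simp only [lapRat_apply, map_sum, Derivation.map_smul, Finset.smul_sum]
  refine Finset.sum_congr rfl fun o _ => ?_
  rw [eulerX_dx, eulerX_dx, h, smul_comm]
  congr 1
  simp only [map_sub, Derivation.map_smul]
  module

theorem eulerX_gradRat {c : ℂ} {f : RatRing ι} (h : eulerX f = c • f) :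
    eulerX (gradRat f) = (c - 1) • gradRat f := by
  simp only [gradRat_apply, map_sum, Finset.smul_sum]
  refine Finset.sum_congr rfl fun o _ => ?_
  rw [Derivation.leibniz, eulerX_dx, h, eulerX_sc]
  rw [Derivation.map_smul, smul_zero, add_zero, smul_eq_mul, mul_sub, mul_smul_comm, sub_smul,
    one_smul]

theorem eulerX_potRat_mul {c : ℂ} {m : ℂ} {q : ι → ℂ} {f : RatRing ι} (h : eulerX f = c • f) :
    eulerX (potRat m q * f) = (c - 2) • (potRat m q * f) := by
  rw [Derivation.leibniz, eulerX_potRat, h, smul_eq_mul, smul_eq_mul, mul_smul_comm, mul_smul_comm,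
    mul_comm f]
  module

theorem eulerX_two_mul {c : ℂ} {f : RatRing ι} (h : eulerX f = c • f) :
    eulerX (2 * f) = c • (2 * f) := by
  rw [two_mul, map_add, h, smul_add]

/-- The homogeneous expansion of a Baker--Akhiezer function. -/
structure IsSeries (m : ℂ) (q : ι → ℂ) (φ : ℕ → RatRing ι) : Prop where
  zero : φ 0 = 1
  eulerX : ∀ l : ℕ, eulerX (φ l) = (-(l : ℂ)) • φ l
  eulerL : ∀ l : ℕ, eulerL (φ l) = (-(l : ℂ)) • φ l
  recursion : ∀ l, 2 * gradRat (φ (l + 1)) + (lapRat q (φ l) - potRat m q * φ l) = 0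

theorem schrRat_sum (m : ℂ) (q : ι → ℂ) (v : ℕ → RatRing ι) (L : ℕ) :
    schrRat m q (∑ l ∈ Finset.range L, v l) =
      (∑ l ∈ Finset.range L, (lapRat q (v l) - potRat m q * v l)) +
        ∑ l ∈ Finset.range L, 2 * gradRat (v l) := by
  simp only [schrRat, map_sum, Finset.mul_sum, Finset.sum_sub_distrib]
  ring

/-- The gradient lowers the degree by one, the Laplacian and the potential by two. Each degree of
the equation therefore couples two consecutive terms, and the Euler operator separates the degrees.
-/
theorem schr_components {c m : ℂ} {q : ι → ℂ} {v : ℕ → RatRing ι} {L : ℕ}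
    (hv : ∀ l : ℕ, eulerX (v l) = (c - l) • v l) (h0 : ∀ l, L ≤ l → v l = 0)
    (h : schrRat m q (∑ l ∈ Finset.range L, v l) = 0) :
    2 * gradRat (v 0) = 0 ∧
      ∀ l, 2 * gradRat (v (l + 1)) + (lapRat q (v l) - potRat m q * v l) = 0 := by
  -- `w j` collects the terms of degree `c - 1 - j`.
  set w : ℕ → RatRing ι := fun j => Nat.casesOn j (2 * gradRat (v 0))
    (fun l => 2 * gradRat (v (l + 1)) + (lapRat q (v l) - potRat m q * v l)) with hw
  have hE : ∀ j : ℕ, eulerX (w j) = ((c - 1) - j) • w j := by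
    intro j
    cases j with
    | zero =>
      have := eulerX_two_mul (eulerX_gradRat (hv 0))
      simpa [hw] using this
    | succ l =>
      have h1 := eulerX_two_mul (eulerX_gradRat (hv (l + 1)))
      have h2 := eulerX_lapRat (q := q) (hv l)
      have h3 := eulerX_potRat_mul (m := m) (q := q) (hv l)
      simp only [hw, map_add, map_sub, h1, h2, h3]
      push_cast
      module
  have hsum : ∑ j ∈ Finset.range (L + 1), w j = 0 := by
    rw [← h, schrRat_sum, Finset.sum_range_succ']
    have hw0 : w 0 = 2 * gradRat (v 0) := rfl
    have hw1 : ∀ l, w (l + 1) =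
        2 * gradRat (v (l + 1)) + (lapRat q (v l) - potRat m q * v l) := fun _ => rfl
    simp only [hw0, hw1, Finset.sum_add_distrib]
    have : ∑ l ∈ Finset.range L, 2 * gradRat (v (l + 1)) + 2 * gradRat (v 0) =
        ∑ l ∈ Finset.range L, 2 * gradRat (v l) := by
      rw [← Finset.sum_range_succ' (fun l => 2 * gradRat (v l)), Finset.sum_range_succ, h0 L le_rfl]
      simp
    rw [← this]; ring
  have key := eigen_sum_zero eulerX.toLinearMap (c - 1) (Finset.range (L + 1)) w
    (fun l _ => hE l) hsum
  refine ⟨key 0 (by simp), fun l => ?_⟩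
  by_cases hl : l < L
  · exact key (l + 1) (by simpa using hl)
  · rw [h0 l (by omega), h0 (l + 1) (by omega)]; simp

/-- A homogeneous rational function of negative degree that is constant in the direction of the
spectral variables vanishes. -/
theorem eq_zero_of_gradRat_eq_zero {g : RatRing ι} {T N : PolyRing ι} {d e : ℕ}
    (hT : IsUnit (toRat T)) (hTd : IsWeightedHomogeneous wX T d)
    (hN : IsWeightedHomogeneous wX N e) (he : e < d) (hg : toRat T * g = toRat N)
    (h : gradRat g = 0) : g = 0 := by
  have h1 := congrArg gradRat hg
  rw [Derivation.leibniz, h, smul_zero, zero_add, gradRat_toRat, gradRat_toRat, smul_eq_mul] at h1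
  have h2 : T * gradPoly N - N * gradPoly T = 0 := by
    apply toRat_injective
    rw [map_sub, map_mul, map_mul, map_zero, ← h1, ← hg]; ring
  have hN0 : N = 0 := by
    apply poly_eq_zero_of_eval_injective
    intro x lam hx hl
    refine eval_eq_zero_of_wronskian (H := T) (K := 1) hN (by simp [h2]) (by simp) ?_
    -- The value of `T` at `x = λ` is not zero because `T` is invertible off the walls. So `T` keeps
    -- its full degree `d > e` on the line.
    refine he.trans_le (Polynomial.le_natDegree_of_ne_zero ?_)
    rw [(line_homogeneous x lam hTd).2, ← evalRat_toRat lam lam hl hl]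
    exact (hT.map _).ne_zero
  rw [hN0, map_zero] at hg
  exact hT.mul_right_eq_zero.mp hg

theorem two_mul_eq_zero_rat {g : RatRing ι} (h : 2 * g = 0) : g = 0 := by
  have h2 : (2 : ℂ) • g = 0 := by rw [← h, Algebra.smul_def, map_ofNat]
  simpa using h2

/-- If `N_l` are the components of `N`, the eigenvalue equation says `∑ (l - c) N_l = 0`, and the
summands have distinct eigenvalues. -/
theorem component_eq_zero_of_euler {w : ι ⊕ ι → ℕ} {E : Derivation ℂ (RatRing ι) (RatRing ι)}
    (hE : ∀ (P : PolyRing ι) (d : ℕ), IsWeightedHomogeneous w P d →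
      E (toRat P) = (d : ℂ) • toRat P) {N : PolyRing ι} {c : ℂ}
    (h : E (toRat N) = c • toRat N) (n : ℕ) (hn : (n : ℂ) ≠ c) :
    weightedHomogeneousComponent w n N = 0 := by
  set L := max (weightedTotalDegree w N) n + 1
  have hL : ∀ e, L ≤ e → weightedHomogeneousComponent w e N = 0 := fun e he =>
    component_eq_zero_of_weightedTotalDegree_lt (by omega)
  have hs := sum_component_of_lt hL
  have key := eigen_sum_zero (-E.toLinearMap) 0 (Finset.range L)
    (fun l => ((l : ℂ) - c) • toRat (weightedHomogeneousComponent w l N))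
    (fun l _ => by
      have := hE _ _ (weightedHomogeneousComponent_isWeightedHomogeneous (w := w) l N)
      rw [LinearMap.neg_apply, map_smul, Derivation.coeFn_coe, this]
      module)
    (by
      simp only [sub_smul, Finset.sum_sub_distrib]
      rw [← Finset.smul_sum, ← map_sum, hs, ← h]
      conv_rhs => rw [← sub_self (E (toRat N))]
      congr 1
      conv_rhs => rw [← hs, map_sum, map_sum]
      refine Finset.sum_congr rfl fun l _ => ?_
      exact (hE _ _ (weightedHomogeneousComponent_isWeightedHomogeneous (w := w) l N)).symm)
  have := key n (by simp [L])
  have h3 := (smul_eq_zero.mp this).resolve_left (sub_ne_zero.mpr hn)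
  exact toRat_injective (by rw [h3, map_zero])

theorem isWeightedHomogeneous_of_euler {w : ι ⊕ ι → ℕ}
    {E : Derivation ℂ (RatRing ι) (RatRing ι)}
    (hE : ∀ (P : PolyRing ι) (d : ℕ), IsWeightedHomogeneous w P d →
      E (toRat P) = (d : ℂ) • toRat P) {N : PolyRing ι} {d : ℕ}
    (h : E (toRat N) = (d : ℂ) • toRat N) : IsWeightedHomogeneous w N d := by
  intro s hs
  by_contra hne
  classical
  have := component_eq_zero_of_euler hE h (Finsupp.weight w s) (by exact_mod_cast hne)
  have h2 := congrArg (coeff s) this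
  rw [coeff_weightedHomogeneousComponent, if_pos rfl] at h2
  exact hs h2

/-- Polynomials have only natural numbers as degrees. This is what ends the series: a numerator of
negative degree must vanish. -/
theorem eq_zero_of_euler {w : ι ⊕ ι → ℕ} {E : Derivation ℂ (RatRing ι) (RatRing ι)}
    (hE : ∀ (P : PolyRing ι) (d : ℕ), IsWeightedHomogeneous w P d →
      E (toRat P) = (d : ℂ) • toRat P) {N : PolyRing ι} {c : ℂ} (hc : ∀ n : ℕ, (n : ℂ) ≠ c)
    (h : E (toRat N) = c • toRat N) : N = 0 := by
  rw [← sum_component_of_lt (w := w) (P := N) (L := weightedTotalDegree w N + 1)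
    fun e he => component_eq_zero_of_weightedTotalDegree_lt (by omega)]
  exact Finset.sum_eq_zero fun n _ => component_eq_zero_of_euler hE h n (hc n)

/-- `Q` is the numerator of a wave function with denominator and leading term `T`. -/
structure IsGenBA (m : ℂ) (q : ι → ℂ) (T Q : PolyRing ι) : Prop where
  leading : HasLeadingTerm Q T
  schr : SatisfiesSchr m q T Q

/-- A denominator of wave functions. -/
structure IsDenominator (T : PolyRing ι) (d : ℕ) : Prop where
  isUnit : IsUnit (toRat T)
  homX : IsWeightedHomogeneous wX T d
  homL : IsWeightedHomogeneous wL T d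

theorem IsDenominator.ne_zero {T : PolyRing ι} {d : ℕ} (hT : IsDenominator T d) : T ≠ 0 := by
  rintro rfl
  have := hT.isUnit
  simp at this

theorem IsDenominator.exists_quotient {T : PolyRing ι} {d : ℕ} (hT : IsDenominator T d)
    (Q : RatRing ι) : ∃ f, toRat T * f = Q := by
  obtain ⟨u, hu⟩ := hT.isUnit
  exact ⟨↑u⁻¹ * Q, by rw [← hu, ← mul_assoc, Units.mul_inv, one_mul]⟩

theorem euler_quotient {E : Derivation ℂ (RatRing ι) (RatRing ι)} {T : RatRing ι} {c d : ℂ}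
    {f g : RatRing ι} (hT : IsUnit T) (hd : E T = d • T) (hf : T * f = g) (hg : E g = c • g) :
    E f = (c - d) • f := by
  have h := congrArg E hf
  rw [Derivation.leibniz, hd, hg, ← hf, smul_eq_mul, smul_eq_mul] at h
  apply hT.mul_left_cancel
  rw [mul_smul_comm, sub_smul, ← h, mul_smul_comm, mul_comm f T]
  abel

/-- The component of `R` of degree `d - l`, divided by `T`, is the part of degree `-l` of the
rational factor. Truncation at `l = d` costs nothing since `R` is a polynomial. -/
theorem quotient_components {m : ℂ} {q : ι → ℂ} (hq : ∀ o, q o ≠ 0) {T R : PolyRing ι} {d : ℕ}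
    (hT : IsDenominator T d) (hR : ∀ e, d < e → weightedHomogeneousComponent wX e R = 0)
    (hS : SatisfiesSchr m q T R) : ∃ v : ℕ → RatRing ι,
      (∀ l, l ≤ d → toRat T * v l = toRat (weightedHomogeneousComponent wX (d - l) R)) ∧
      (∀ l, d < l → v l = 0) ∧ (∀ l : ℕ, eulerX (v l) = (-(l : ℂ)) • v l) ∧
      toRat T * ∑ l ∈ Finset.range (d + 1), v l = toRat R ∧
      2 * gradRat (v 0) = 0 ∧
      ∀ l, 2 * gradRat (v (l + 1)) + (lapRat q (v l) - potRat m q * v l) = 0 := by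
  choose v hv using fun l : ℕ => hT.exists_quotient
    (if l ≤ d then toRat (weightedHomogeneousComponent wX (d - l) R) else 0)
  have h1 : ∀ l, l ≤ d → toRat T * v l = toRat (weightedHomogeneousComponent wX (d - l) R) :=
    fun l hl => by rw [hv, if_pos hl]
  have h2 : ∀ l, d < l → v l = 0 := fun l hl => by
    have := hv l
    rw [if_neg (by omega)] at this
    exact hT.isUnit.mul_right_eq_zero.mp this
  have h3 : ∀ l : ℕ, eulerX (v l) = (-(l : ℂ)) • v l := by
    intro l
    by_cases hl : l ≤ d
    · have := euler_quotient hT.isUnit (eulerX_toRat hT.homX) (h1 l hl)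
        (eulerX_toRat (weightedHomogeneousComponent_isWeightedHomogeneous (w := wX) (d - l) R))
      rw [this]
      congr 1
      push_cast [hl]
      ring
    · rw [h2 l (by omega)]; simp
  have h4 : toRat T * ∑ l ∈ Finset.range (d + 1), v l = toRat R := by
    rw [Finset.mul_sum]
    conv_rhs => rw [← sum_component_of_lt (w := wX) (P := R) (L := d + 1) fun e he => hR e he,
      ← Finset.sum_range_reflect, map_sum]
    refine Finset.sum_congr rfl fun l hl => ?_
    rw [h1 l (by simp at hl; omega)]
    congr 2
  have h5 := (satisfiesSchr_iff hq hT.isUnit h4).mp hS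
  obtain ⟨h6, h7⟩ := schr_components (c := 0) (fun l => by rw [h3, zero_sub])
    (fun l hl => h2 l hl) h5
  exact ⟨v, h1, h2, h3, h4, h6, h7⟩

theorem SatisfiesSchr.sub {m : ℂ} {q : ι → ℂ} (hq : ∀ o, q o ≠ 0) {T Q Q' : PolyRing ι} {d : ℕ}
    (hT : IsDenominator T d) (h : SatisfiesSchr m q T Q) (h' : SatisfiesSchr m q T Q') :
    SatisfiesSchr m q T (Q - Q') := by
  obtain ⟨f, hf⟩ := hT.exists_quotient (toRat Q)
  obtain ⟨f', hf'⟩ := hT.exists_quotient (toRat Q')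
  rw [satisfiesSchr_iff hq hT.isUnit hf] at h
  rw [satisfiesSchr_iff hq hT.isUnit hf'] at h'
  rw [satisfiesSchr_iff hq hT.isUnit (f := f - f') (by rw [mul_sub, hf, hf', map_sub])]
  simp only [schrRat, map_sub] at h h' ⊢
  linear_combination h - h'

/-- Uniqueness of the numerator. -/
theorem IsGenBA.unique {m : ℂ} {q : ι → ℂ} (hq : ∀ o, q o ≠ 0) {T Q Q' : PolyRing ι} {d : ℕ}
    (hT : IsDenominator T d) (h : IsGenBA m q T Q) (h' : IsGenBA m q T Q') : Q = Q' := by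
  have l1 := (leadingForm_eq_iff hT.ne_zero hT.homX).mp h.leading.1
  have l2 := (leadingForm_eq_iff hT.ne_zero hT.homX).mp h'.leading.1
  have hR : ∀ e, d < e → weightedHomogeneousComponent wX e (Q - Q') = 0 := fun e he => by
    rw [map_sub, l1.1 e he, l2.1 e he, sub_zero]
  obtain ⟨v, h1, h2, -, h4, -, h7⟩ := quotient_components hq hT hR (h.schr.sub hq hT h'.schr)
  -- Equal leading terms give `v 0 = 0`. If `v l = 0`, the recursion says that `v (l + 1)` is
  -- constant along `λ`, and its degree is negative.
  have hv : ∀ l, v l = 0 := by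
    intro l
    induction l with
    | zero =>
      have := h1 0 (Nat.zero_le _)
      rw [Nat.sub_zero, map_sub, l1.2, l2.2, sub_self, map_zero] at this
      exact hT.isUnit.mul_right_eq_zero.mp this
    | succ l ih =>
      by_cases hl : l + 1 ≤ d
      · have h8 := h7 l
        rw [ih] at h8
        simp only [map_zero, mul_zero, sub_zero, add_zero] at h8
        exact eq_zero_of_gradRat_eq_zero hT.isUnit hT.homX
          (weightedHomogeneousComponent_isWeightedHomogeneous _ _) (by omega) (h1 _ hl)
          (two_mul_eq_zero_rat h8)
      · exact h2 _ (by omega)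
  have : toRat (Q - Q') = 0 := by
    rw [← h4, Finset.sum_eq_zero fun l _ => hv l, mul_zero]
  exact sub_eq_zero.mp (toRat_injective (by rw [this, map_zero]))

/-- Every monomial has the same degree in the space variables as in the spectral variables. -/
def IsBalanced (Q : PolyRing ι) : Prop :=
  ∀ e, IsWeightedHomogeneous wL (weightedHomogeneousComponent wX e Q) e

/-- The homogeneous expansion of a wave function with balanced numerator. -/
theorem IsGenBA.exists_series {m : ℂ} {q : ι → ℂ} (hq : ∀ o, q o ≠ 0) {T Q : PolyRing ι} {d : ℕ}
    (hT : IsDenominator T d) (h : IsGenBA m q T Q) (hb : IsBalanced Q) :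
    ∃ φ : ℕ → RatRing ι, IsSeries m q φ ∧
      (∀ l, l ≤ d → toRat T * φ l = toRat (weightedHomogeneousComponent wX (d - l) Q)) ∧
      (∀ l, d < l → φ l = 0) := by
  have l1 := (leadingForm_eq_iff hT.ne_zero hT.homX).mp h.leading.1
  obtain ⟨v, h1, h2, h3, -, -, h7⟩ := quotient_components hq hT l1.1 h.schr
  refine ⟨v, ⟨?_, h3, ?_, h7⟩, h1, h2⟩
  · have := h1 0 (Nat.zero_le _)
    rw [Nat.sub_zero, l1.2] at this
    exact hT.isUnit.mul_left_cancel (by rw [this, mul_one])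
  · intro l
    by_cases hl : l ≤ d
    · rw [euler_quotient hT.isUnit (eulerL_toRat hT.homL) (h1 l hl) (eulerL_toRat (hb (d - l)))]
      congr 1
      push_cast [hl]
      ring
    · rw [h2 l (by omega)]; simp

/-- Two decompositions of the same vector into eigenvectors agree term by term; one is indexed by
the eigenvalue, the other by its distance from `d`. -/
theorem eigen_sum_eq {V : Type*} [AddCommGroup V] [Module ℂ V] (E : V →ₗ[ℂ] V) {u v : ℕ → V}
    {A L d : ℕ} (hu : ∀ e : ℕ, E (u e) = (e : ℂ) • u e) (hu0 : ∀ e, A ≤ e → u e = 0)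
    (hv : ∀ l : ℕ, E (v l) = ((d : ℂ) - l) • v l) (hv0 : ∀ l, L ≤ l → v l = 0)
    (h : ∑ e ∈ Finset.range A, u e = ∑ l ∈ Finset.range L, v l) (e : ℕ) :
    u e = if e ≤ d then v (d - e) else 0 := by
  -- With `C` this large both families fit into one index `j` with eigenvalue `C - j`, and every
  -- subtraction of naturals that occurs is a true one.
  set C := A + d + e with hC
  set w : ℕ → V := fun j => (if j ≤ C then u (C - j) else 0) -
    (if C - d ≤ j then v (j - (C - d)) else 0) with hw
  have hE : ∀ j : ℕ, E (w j) = ((C : ℂ) - j) • w j := by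
    intro j
    simp only [hw, map_sub, smul_sub]
    congr 1
    · split_ifs with hj
      · rw [hu]; push_cast [hj]; rfl
      · simp
    · split_ifs with hj
      · rw [hv]; congr 1; push_cast [hj, show d ≤ C by omega]; ring
      · simp
  have hsum : ∑ j ∈ Finset.range (C + 1 + L), w j = 0 := by
    simp only [hw, Finset.sum_sub_distrib]
    rw [sub_eq_zero]
    have e1 : ∑ j ∈ Finset.range (C + 1 + L), (if j ≤ C then u (C - j) else 0) =
        ∑ e ∈ Finset.range A, u e := by
      rw [Finset.sum_range_add, Finset.sum_eq_zero (s := Finset.range L)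
        (fun i _ => if_neg (by omega)), add_zero]
      rw [← Finset.sum_range_reflect u A, ]
      have : ∑ j ∈ Finset.range (C + 1), (if j ≤ C then u (C - j) else 0) =
          ∑ j ∈ Finset.range (C + 1), u (C + 1 - 1 - j) :=
        Finset.sum_congr rfl fun j hj => if_pos (by simp at hj; omega)
      rw [this, Finset.sum_range_reflect, Finset.sum_range_reflect,
        show C + 1 = A + (d + e + 1) by omega, Finset.sum_range_add,
        Finset.sum_eq_zero (s := Finset.range (d + e + 1)) (fun i _ => hu0 _ (by omega)), add_zero]
    have e2 : ∑ j ∈ Finset.range (C + 1 + L), (if C - d ≤ j then v (j - (C - d)) else 0) =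
        ∑ l ∈ Finset.range L, v l := by
      rw [show C + 1 + L = (C - d) + (L + (d + 1)) by omega, Finset.sum_range_add,
        Finset.sum_eq_zero (s := Finset.range (C - d)) (fun i hi => if_neg
          (by simp at hi; omega)), zero_add, Finset.sum_range_add,
        Finset.sum_eq_zero (s := Finset.range (d + 1)) (fun i hi => by
          rw [if_pos (by omega)]; exact hv0 _ (by omega)), add_zero]
      exact Finset.sum_congr rfl fun l _ => by rw [if_pos (by omega)]; congr 1; omega
    rw [e1, e2, h]
  have := eigen_sum_zero E C (Finset.range (C + 1 + L)) w (fun l _ => hE l) hsum (C - e)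
    (by simp; omega)
  simp only [hw] at this
  rw [if_pos (by omega), show C - (C - e) = e by omega, sub_eq_zero] at this
  rw [this]
  by_cases he : e ≤ d
  · rw [if_pos (by omega), if_pos he]; congr 1; omega
  · rw [if_neg (by omega), if_neg he]

/-- A finite series whose sum has denominator `T` comes from a balanced numerator. -/
theorem IsSeries.isGenBA {m : ℂ} {q : ι → ℂ} (hq : ∀ o, q o ≠ 0) {T Q : PolyRing ι} {d : ℕ}
    (hT : IsDenominator T d) {φ : ℕ → RatRing ι} (hφ : IsSeries m q φ) {L : ℕ}
    (hL : ∀ l, L ≤ l → φ l = 0) (hQ : toRat T * ∑ l ∈ Finset.range L, φ l = toRat Q) :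
    IsGenBA m q T Q ∧ IsBalanced Q := by
  -- The argument is the same for the space and for the spectral grading: the component of degree
  -- `e` of `Q` is `T φ_{d-e}`. Equality of the two answers is what makes `Q` balanced.
  have key : ∀ (w : ι ⊕ ι → ℕ) (E : Derivation ℂ (RatRing ι) (RatRing ι))
      (hE : ∀ (P : PolyRing ι) (d : ℕ), IsWeightedHomogeneous w P d →
      E (toRat P) = (d : ℂ) • toRat P) (hTw : IsWeightedHomogeneous w T d)
      (hφE : ∀ l : ℕ, E (φ l) = (-(l : ℂ)) • φ l) (e : ℕ),
      toRat (weightedHomogeneousComponent w e Q) = if e ≤ d then toRat T * φ (d - e) else 0 := by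
    intro w E hE hTw hφE e
    refine eigen_sum_eq (A := weightedTotalDegree w Q + 1) (L := L) E.toLinearMap
      (u := fun e => toRat (weightedHomogeneousComponent w e Q)) (v := fun l => toRat T * φ l)
      ?_ ?_ ?_ ?_ ?_ e
    · exact fun e => hE _ _ (weightedHomogeneousComponent_isWeightedHomogeneous _ _)
    · intro e he
      rw [component_eq_zero_of_weightedTotalDegree_lt (by omega), map_zero]
    · intro l
      rw [Derivation.coeFn_coe, Derivation.leibniz, hφE, hE _ _ hTw, smul_eq_mul, smul_eq_mul,
        mul_smul_comm, mul_smul_comm, mul_comm (φ l)]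
      module
    · intro l hl
      simp only [hL l hl, mul_zero]
    · rw [← Finset.mul_sum, hQ, ← map_sum, sum_component_of_lt]
      exact fun e he => component_eq_zero_of_weightedTotalDegree_lt (by omega)
  have kX := key wX CalogeroBA.eulerX (fun _ _ => eulerX_toRat) hT.homX hφ.eulerX
  have kL := key wL CalogeroBA.eulerL (fun _ _ => eulerL_toRat) hT.homL hφ.eulerL
  have lead : ∀ (w : ι ⊕ ι → ℕ) (hTw : IsWeightedHomogeneous w T d) (k : ∀ e : ℕ,
      toRat (weightedHomogeneousComponent w e Q) = if e ≤ d then toRat T * φ (d - e) else 0),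
      leadingForm w Q = T := by
    intro w hTw k
    rw [leadingForm_eq_iff hT.ne_zero hTw]
    refine ⟨fun e he => toRat_injective ?_, toRat_injective ?_⟩
    · rw [k, if_neg (by omega), map_zero]
    · rw [k, if_pos le_rfl, Nat.sub_self, hφ.zero, mul_one]
  refine ⟨⟨⟨lead _ hT.homX kX, lead _ hT.homL kL⟩, ?_⟩, ?_⟩
  · rw [satisfiesSchr_iff hq hT.isUnit hQ, schrRat_sum]
    cases L with
    | zero => simp
    | succ L =>
      -- Shifting the gradient sum by one pairs it with the other terms as in the recursion; the
      -- ends drop out because `φ 0` is constant and `φ (L + 1)` is zero.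
      rw [Finset.sum_range_succ' (fun l => 2 * gradRat (φ l)), hφ.zero, Finset.sum_range_succ,
        Derivation.map_one_eq_zero, mul_zero, add_zero]
      have h1 := hφ.recursion L
      rw [hL (L + 1) le_rfl, map_zero, mul_zero, zero_add] at h1
      rw [h1, add_zero, ← Finset.sum_add_distrib]
      exact Finset.sum_eq_zero fun l _ => by rw [add_comm]; exact hφ.recursion l
  · intro e
    have : weightedHomogeneousComponent wX e Q = weightedHomogeneousComponent wL e Q :=
      toRat_injective (by rw [kX, kL])
    rw [this]
    exact weightedHomogeneousComponent_isWeightedHomogeneous _ _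

end Series

/-! ### Derivations of power series rings -/

section PowerSeriesDerivations

variable {σ S : Type*} [CommRing S] [Algebra ℂ S]

theorem powerSeries_coeff_csmul (c : ℂ) (α : σ →₀ ℕ) (g : MvPowerSeries σ S) :
    MvPowerSeries.coeff α (c • g) = c • MvPowerSeries.coeff α g := rfl

/-- The derivation acting on the coefficients of power series. -/
def coeffDer (D : Derivation ℂ S S) : Derivation ℂ (MvPowerSeries σ S) (MvPowerSeries σ S) :=
  Derivation.mk'
    { toFun := fun g α => D (g α)
      map_add' := fun f g => funext fun α => map_add D (f α) (g α)
      map_smul' := fun c g => funext fun α => D.map_smul c (g α) }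
    (fun f g => by
      classical
      ext α
      change D (MvPowerSeries.coeff α (f * g)) = MvPowerSeries.coeff α (f * _ + g * _)
      rw [map_add, MvPowerSeries.coeff_mul, MvPowerSeries.coeff_mul, mul_comm g,
        MvPowerSeries.coeff_mul, map_sum, ← Finset.sum_add_distrib]
      refine Finset.sum_congr rfl fun p _ => ?_
      rw [Derivation.leibniz, smul_eq_mul, smul_eq_mul,
        mul_comm (MvPowerSeries.coeff p.2 g)]
      rfl)

@[simp] theorem coeff_coeffDer (D : Derivation ℂ S S) (α : σ →₀ ℕ) (g : MvPowerSeries σ S) :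
    MvPowerSeries.coeff α (coeffDer D g) = D (MvPowerSeries.coeff α g) := rfl

/-- The Euler derivation with respect to one variable of a power series ring. -/
def thetaDer (i : σ) : Derivation ℂ (MvPowerSeries σ S) (MvPowerSeries σ S) :=
  Derivation.mk'
    { toFun := fun g α => (α i : ℂ) • g α
      map_add' := fun f g => funext fun α => smul_add _ (f α) (g α)
      map_smul' := fun c g => funext fun α => smul_comm (α i : ℂ) c (g α) }
    (fun f g => by
      classical
      ext α
      change (α i : ℂ) • (MvPowerSeries.coeff α (f * g)) = MvPowerSeries.coeff α (f * _ + g * _)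
      rw [map_add, MvPowerSeries.coeff_mul, MvPowerSeries.coeff_mul, mul_comm g,
        MvPowerSeries.coeff_mul, Finset.smul_sum, ← Finset.sum_add_distrib]
      refine Finset.sum_congr rfl fun p hp => ?_
      have : α i = p.1 i + p.2 i := by
        rw [← Finset.HasAntidiagonal.mem_antidiagonal.mp hp]; rfl
      rw [this]
      change _ = MvPowerSeries.coeff p.1 f * ((p.2 i : ℂ) • MvPowerSeries.coeff p.2 g) +
        ((p.1 i : ℂ) • MvPowerSeries.coeff p.1 f) * MvPowerSeries.coeff p.2 g
      rw [mul_smul_comm, smul_mul_assoc, ← add_smul]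
      push_cast
      rw [add_comm])

@[simp] theorem coeff_thetaDer (i : σ) (α : σ →₀ ℕ) (g : MvPowerSeries σ S) :
    MvPowerSeries.coeff α (thetaDer i g) = (α i : ℂ) • MvPowerSeries.coeff α g := rfl

@[simp] theorem coeffDer_C (D : Derivation ℂ S S) (s : S) :
    coeffDer (σ := σ) D (MvPowerSeries.C s) = MvPowerSeries.C (D s) := by
  classical
  ext α
  rw [coeff_coeffDer, MvPowerSeries.coeff_C, MvPowerSeries.coeff_C]
  split_ifs <;> simp

@[simp] theorem coeffDer_X (D : Derivation ℂ S S) (i : σ) :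
    coeffDer D (MvPowerSeries.X i : MvPowerSeries σ S) = 0 := by
  classical
  ext α
  rw [coeff_coeffDer, MvPowerSeries.coeff_X]
  split_ifs <;> simp

@[simp] theorem thetaDer_C (i : σ) (s : S) :
    thetaDer i (MvPowerSeries.C s : MvPowerSeries σ S) = 0 := by
  classical
  ext α
  rw [coeff_thetaDer, MvPowerSeries.coeff_C]
  split_ifs with h <;> simp [h]

theorem thetaDer_X [DecidableEq σ] (i j : σ) :
    thetaDer i (MvPowerSeries.X j : MvPowerSeries σ S) =
      if j = i then MvPowerSeries.X i else 0 := by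
  ext α
  rw [coeff_thetaDer, MvPowerSeries.coeff_X]
  by_cases h : j = i
  · subst h
    rw [if_pos rfl, MvPowerSeries.coeff_X]
    split_ifs with h <;> simp [h]
  · rw [if_neg h]
    split_ifs with h' <;> simp [h', h]

theorem coeff_single_add_X_mul [DecidableEq σ] (i : σ) (β : σ →₀ ℕ) (g : MvPowerSeries σ S) :
    MvPowerSeries.coeff (Finsupp.single i 1 + β) (MvPowerSeries.X i * g) =
      MvPowerSeries.coeff β g := by
  rw [MvPowerSeries.X, MvPowerSeries.coeff_add_monomial_mul, one_mul]

theorem coeff_X_mul_eq_zero (i : σ) {α : σ →₀ ℕ} (h : α i = 0) (g : MvPowerSeries σ S) :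
    MvPowerSeries.coeff α (MvPowerSeries.X i * g) = 0 :=
  MvPowerSeries.X_dvd_iff.mp (Dvd.intro _ rfl) α h

variable [Fintype σ] [DecidableEq σ]

/-- The moment of the monomial with exponent `α`. -/
def moment (p : ℂ) (a : σ → S) (α : σ →₀ ℕ) : S :=
  -- This is the integral of `τ^α ∏ τ_i^{p-1} exp (-a_i τ_i)` over the orthant divided by its value
  -- at `α = 0`. The formula makes sense for every complex `p`.
  (∏ i, (ascPochhammer ℂ (α i)).eval p) • ∏ i, Ring.inverse (a i) ^ α i

/-- The part of degree `N` of a formal Gamma type integral of a power series. -/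
def bracket (p : ℂ) (a : σ → S) (N : ℕ) : MvPowerSeries σ S →ₗ[S] S :=
  ∑ α ∈ Finset.finsuppAntidiag (Finset.univ : Finset σ) N,
    moment p a α • MvPowerSeries.coeff α

theorem bracket_apply (p : ℂ) (a : σ → S) (N : ℕ) (g : MvPowerSeries σ S) :
    bracket p a N g = ∑ α ∈ Finset.finsuppAntidiag (Finset.univ : Finset σ) N,
      moment p a α * MvPowerSeries.coeff α g := by
  simp [bracket]

/-- This is the functional equation `Γ(s + 1) = s Γ(s)`. -/
theorem moment_single_add (p : ℂ) {a : σ → S} (i : σ) (ha : IsUnit (a i)) (β : σ →₀ ℕ) :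
    a i * moment p a (Finsupp.single i 1 + β) = (p + β i) • moment p a β := by
  have h1 : ∏ j, (ascPochhammer ℂ ((Finsupp.single i 1 + β : σ →₀ ℕ) j)).eval p =
      (p + β i) * ∏ j, (ascPochhammer ℂ (β j)).eval p := by
    rw [← Finset.mul_prod_erase _ _ (Finset.mem_univ i),
      ← Finset.mul_prod_erase (f := fun j => (ascPochhammer ℂ (β j)).eval p) _
        (Finset.mem_univ i), ← mul_assoc]
    congr 1
    · simp only [Finsupp.add_apply, Finsupp.single_eq_same]
      rw [add_comm 1, ascPochhammer_succ_eval, mul_comm]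
    · refine Finset.prod_congr rfl fun j hj => ?_
      rw [Finsupp.add_apply, Finsupp.single_eq_of_ne (Finset.ne_of_mem_erase hj), zero_add]
  have h2 : a i * ∏ j, Ring.inverse (a j) ^ ((Finsupp.single i 1 + β : σ →₀ ℕ) j) =
      ∏ j, Ring.inverse (a j) ^ β j := by
    rw [← Finset.mul_prod_erase _ _ (Finset.mem_univ i),
      ← Finset.mul_prod_erase (f := fun j => Ring.inverse (a j) ^ β j) _
        (Finset.mem_univ i), ← mul_assoc]
    congr 1
    · simp only [Finsupp.add_apply, Finsupp.single_eq_same]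
      rw [add_comm 1, pow_succ', ← mul_assoc, Ring.mul_inverse_cancel _ ha, one_mul]
    · refine Finset.prod_congr rfl fun j hj => ?_
      rw [Finsupp.add_apply, Finsupp.single_eq_of_ne (Finset.ne_of_mem_erase hj), zero_add]
  rw [moment, moment, h1, mul_smul_comm, h2, mul_smul]

/-- Integration by parts for the bracket. -/
theorem bracket_X_mul (p : ℂ) {a : σ → S} (i : σ) (ha : IsUnit (a i)) (N : ℕ)
    (g : MvPowerSeries σ S) :
    a i * bracket p a (N + 1) (MvPowerSeries.X i * g) =
      bracket p a N (thetaDer i g + p • g) := by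
  rw [bracket_apply, bracket_apply, Finset.mul_sum]
  symm
  -- Exponents with `α i ≥ 1` are those of the form `e_i + β`; the others do not occur in a multiple
  -- of `X i`.
  refine Finset.sum_of_injOn (fun β => Finsupp.single i 1 + β) ?_ ?_ ?_ ?_
  · intro β _ γ _ h
    exact add_left_cancel h
  · intro β hβ
    simp only [Finset.mem_coe,
      Finset.mem_finsuppAntidiag, Finset.subset_univ, and_true] at hβ ⊢
    rw [← hβ]
    simp [Finset.sum_add_distrib, add_comm]
  · intro α hα hn
    rw [coeff_X_mul_eq_zero, mul_zero, mul_zero]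
    by_contra h
    apply hn
    refine ⟨α - Finsupp.single i 1, ?_, ?_⟩
    · simp only [Finset.mem_coe,
        Finset.mem_finsuppAntidiag, Finset.subset_univ, and_true] at hα ⊢
      have h2 : Finset.univ.sum (⇑(Finsupp.single i 1 + (α - Finsupp.single i 1) : σ →₀ ℕ)) = N + 1 := by
        rw [add_tsub_cancel_of_le (Finsupp.single_le_iff.mpr (Nat.one_le_iff_ne_zero.mpr h)), hα]
      simp only [Finsupp.coe_add, Pi.add_apply, Finset.sum_add_distrib,
        Finsupp.univ_sum_single_apply] at h2
      change ∑ x, (α - Finsupp.single i 1 : σ →₀ ℕ) x = N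
      omega
    · exact add_tsub_cancel_of_le (Finsupp.single_le_iff.mpr (Nat.one_le_iff_ne_zero.mpr h))
  · intro β _
    rw [coeff_single_add_X_mul, ← mul_assoc, moment_single_add p i ha, map_add, coeff_thetaDer,
      powerSeries_coeff_csmul, ← add_smul, mul_smul_comm, smul_mul_assoc, add_comm]

theorem bracket_zero (p : ℂ) (a : σ → S) (g : MvPowerSeries σ S) :
    bracket p a 0 g = MvPowerSeries.coeff 0 g := by
  rw [bracket_apply, Finset.finsuppAntidiag_zero, Finset.sum_singleton]
  simp [moment]

theorem bracket_zero_X_mul (p : ℂ) (a : σ → S) (i : σ) (g : MvPowerSeries σ S) :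
    bracket p a 0 (MvPowerSeries.X i * g) = 0 := by
  rw [bracket_zero, coeff_X_mul_eq_zero i (by simp)]

/-- The moment is homogeneous of degree `|α|` in the inverses of the `a i`, each of which is an
eigenvector of `D` with eigenvalue `c`. -/
theorem der_moment (D : Derivation ℂ S S) (p : ℂ) {a : σ → S} {c : ℂ}
    (h : ∀ i, D (Ring.inverse (a i)) = c • Ring.inverse (a i)) (α : σ →₀ ℕ) :
    D (moment p a α) = (c * ∑ i, (α i : ℂ)) • moment p a α := by
  have key : ∀ s : Finset σ, D (∏ i ∈ s, Ring.inverse (a i) ^ α i) =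
      (c * ∑ i ∈ s, (α i : ℂ)) • ∏ i ∈ s, Ring.inverse (a i) ^ α i := by
    intro s
    induction s using Finset.induction_on with
    | empty => simp
    | insert i s hi ih =>
      rw [Finset.prod_insert hi, Finset.sum_insert hi, Derivation.leibniz, ih,
        Derivation.leibniz_pow, h]
      by_cases h0 : α i = 0
      · simp [h0]
      · obtain ⟨k, hk⟩ := Nat.exists_eq_succ_of_ne_zero h0
        rw [hk]
        rw [← Nat.cast_smul_eq_nsmul ℂ]
        simp only [smul_eq_mul, Nat.succ_sub_one, Algebra.smul_def, map_mul, map_add, map_natCast,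
          Nat.succ_eq_add_one]
        push_cast
        ring
  rw [moment, Derivation.map_smul, key, smul_comm]

theorem der_bracket (D : Derivation ℂ S S) (p : ℂ) {a : σ → S} {c : ℂ}
    (h : ∀ i, D (Ring.inverse (a i)) = c • Ring.inverse (a i)) (N : ℕ) (g : MvPowerSeries σ S) :
    D (bracket p a N g) = bracket p a N (coeffDer D g) + (c * N) • bracket p a N g := by
  simp only [bracket_apply, map_sum, Finset.smul_sum, ← Finset.sum_add_distrib]
  refine Finset.sum_congr rfl fun α hα => ?_
  simp only [Finset.mem_finsuppAntidiag, Finset.subset_univ, and_true] at hα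
  rw [Derivation.leibniz, der_moment D p h, coeff_coeffDer, smul_eq_mul, smul_eq_mul, ← hα,
    mul_smul_comm, mul_comm (MvPowerSeries.coeff α g)]
  push_cast
  rfl

theorem bracket_sum_thetaDer (p : ℂ) (a : σ → S) (N : ℕ) (g : MvPowerSeries σ S) :
    bracket p a N (∑ i, thetaDer i g) = (N : ℂ) • bracket p a N g := by
  simp only [bracket_apply, Finset.smul_sum]
  refine Finset.sum_congr rfl fun α hα => ?_
  simp only [Finset.mem_finsuppAntidiag, Finset.subset_univ, and_true] at hα
  rw [map_sum]
  simp only [coeff_thetaDer]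
  rw [← Finset.sum_smul, mul_smul_comm, ← hα]
  push_cast
  rfl

theorem bracket_csmul (p : ℂ) (a : σ → S) (N : ℕ) (c : ℂ) (g : MvPowerSeries σ S) :
    bracket p a N (c • g) = c • bracket p a N g := by
  simp only [bracket_apply, Finset.smul_sum, powerSeries_coeff_csmul, mul_smul_comm]

end PowerSeriesDerivations

/-! ### Logarithmic derivatives -/

section DLog

variable {G : Type*} [CommRing G] [Algebra ℂ G]

/-- The logarithmic derivative. -/
def dlog (D : Derivation ℂ G G) : Gˣ →* Multiplicative G where
  toFun u := Multiplicative.ofAdd (↑u⁻¹ * D u)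
  map_one' := by simp
  map_mul' u v := by
    rw [← ofAdd_add]
    congr 1
    simp only [Units.val_mul, Derivation.leibniz, smul_eq_mul, mul_inv]
    linear_combination (↑v⁻¹ * D v : G) * u.inv_mul + (↑u⁻¹ * D u : G) * v.inv_mul

theorem der_eq_mul_dlog (D : Derivation ℂ G G) (u : Gˣ) :
    D u = u * (dlog D u).toAdd := by
  simp [dlog]

theorem dlog_unit (D : Derivation ℂ G G) {u : G} (hu : IsUnit u) :
    (dlog D hu.unit).toAdd = Ring.inverse u * D u := by
  change ↑hu.unit⁻¹ * D u = _
  rw [← Ring.inverse_unit, IsUnit.unit_spec]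

end DLog

/-! ### The identity behind the kernel functions -/

section ThreeBody

variable {K : Type*} [Field K] [CharZero K]

/-- The three-body interactions cancel. -/
theorem sum_sq_sum_inv_sub {α : Type*} [Fintype α] [DecidableEq α] (q : α → K) {p : α → K}
    (hp : Function.Injective p) :
    ∑ a, q a * (∑ b, q b * (p a - p b)⁻¹) ^ 2 =
      ∑ a, ∑ b, q a * q b ^ 2 * ((p a - p b)⁻¹) ^ 2 := by
  -- These are the cross terms `b ≠ c` of the squares. Terms with `b = c` are the right-hand side,
  -- and the convention `0⁻¹ = 0` removes `a = b` and `a = c`.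
  set F : α → α → α → K := fun a b c =>
    if b = c then 0 else q a * q b * q c * (p a - p b)⁻¹ * (p a - p c)⁻¹ with hF
  -- For distinct points, `1/((a-b)(a-c))` summed over cyclic permutations is zero.
  have hcyc : ∀ a b c, F a b c + F b c a + F c a b = 0 := by
    intro a b c
    by_cases hab : a = b
    · subst hab; simp [hF]
    by_cases hbc : b = c
    · subst hbc; simp [hF]
    by_cases hca : c = a
    · subst hca; simp [hF]
    have h1 := sub_ne_zero.mpr (hp.ne hab)
    have h2 := sub_ne_zero.mpr (hp.ne hbc)
    have h3 := sub_ne_zero.mpr (hp.ne hca)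
    have h4 : (p b - p a) = -(p a - p b) := by ring
    have h5 : (p c - p b) = -(p b - p c) := by ring
    have h6 : (p a - p c) = -(p c - p a) := by ring
    simp only [hF, if_neg hab, if_neg hbc, if_neg hca]
    rw [h4, h5, h6]
    field_simp
    ring
  have hS : ∑ a, ∑ b, ∑ c, F a b c = 0 := by
    have e1 : ∑ a, ∑ b, ∑ c, F b c a = ∑ a, ∑ b, ∑ c, F a b c := by
      rw [Finset.sum_comm]
      exact Finset.sum_congr rfl fun a _ => Finset.sum_comm
    have e2 : ∑ a, ∑ b, ∑ c, F c a b = ∑ a, ∑ b, ∑ c, F a b c := by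
      rw [← e1]
      rw [Finset.sum_comm]
      exact Finset.sum_congr rfl fun a _ => Finset.sum_comm
    have : ∑ a, ∑ b, ∑ c, (F a b c + F b c a + F c a b) = 0 :=
      Finset.sum_eq_zero fun a _ => Finset.sum_eq_zero fun b _ => Finset.sum_eq_zero fun c _ =>
        hcyc a b c
    simp only [Finset.sum_add_distrib] at this
    rw [e1, e2] at this
    have h3 : (3 : K) * ∑ a, ∑ b, ∑ c, F a b c = 0 := by linear_combination this
    simpa using h3
  rw [← sub_eq_zero, ← hS, ← Finset.sum_sub_distrib]
  refine Finset.sum_congr rfl fun a _ => ?_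
  rw [pow_two, Finset.sum_mul_sum, Finset.mul_sum, ← Finset.sum_sub_distrib]
  refine Finset.sum_congr rfl fun b _ => ?_
  have : ∀ c, F a b c = q a * (q b * (p a - p b)⁻¹ * (q c * (p a - p c)⁻¹)) -
      if b = c then q a * q b ^ 2 * ((p a - p b)⁻¹) ^ 2 else 0 := by
    intro c
    by_cases h : b = c
    · subst h; simp only [hF, if_true]; ring
    · simp only [hF, if_neg h]; ring
  simp only [this, Finset.sum_sub_distrib, Finset.sum_ite_eq, Finset.mem_univ, if_true,
    Finset.mul_sum]

/-- The identity for the logarithmic derivatives of the kernel function. -/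
theorem kernel_field_identity {n : ℕ} {x X : Fin n → K} {y : K}
    (hp : Function.Injective (fun o : Option (Fin n ⊕ Fin n) => o.elim y (Sum.elim x X)))
    {m c s M : K} (hs : s * m = c) (hM : M * c = m) (hc : (c - 1) * (c - m) = 0)
    (a b z : Fin n → Fin n → K) (u v W : Fin n → K)
    (ha : ∀ i j, a i j = (x i - x j)⁻¹) (hb : ∀ i j, b i j = (X i - X j)⁻¹)
    (hz : ∀ i j, i ≠ j → z i j = (X i - x j)⁻¹) (hz0 : ∀ i, z i i = 0)
    (hW : ∀ i, W i = (X i - x i)⁻¹)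
    (hu : ∀ i, u i = (x i - y)⁻¹) (hv : ∀ i, v i = (X i - y)⁻¹) :
    ∑ i, ((-m * ∑ j, (-a i j ^ 2 - b i j ^ 2 + z i j ^ 2 + z j i ^ 2) + c * (u i ^ 2 - v i ^ 2)) +
        (-m * ∑ j, (a i j + b i j - z i j + z j i) + c * (v i - u i)) ^ 2) +
      M * (c * ∑ i, (u i ^ 2 - v i ^ 2) + (c * ∑ i, (u i - v i)) ^ 2) +
      ((∑ i, ∑ j, m * (m + 1) * b i j ^ 2) - ((∑ i, ∑ j, m * (m + 1) * a i j ^ 2) +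
        ∑ i, m * (1 + s) * (1 + m * s) * u i ^ 2)) -
      2 * ∑ i, ((m * ∑ j, (b i j ^ 2 - z i j ^ 2) - c * v i ^ 2) +
        (-m * ∑ j, (a i j + b i j - z i j + z j i) + c * (v i - u i)) *
          (-m * ∑ j, (b i j - z i j) + c * v i + m * W i)) = 0 := by
  -- `f` includes the diagonal `1/(X_i - x_i)`, which `z` replaces by zero. The three-body identity
  -- needs the full sums, so all terms are first rewritten through `f`.
  set f : Fin n → Fin n → K := fun i j => (X i - x j)⁻¹ with hf
  have hfz : ∀ i j, f i j = z i j + if i = j then W i else 0 := by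
    intro i j
    by_cases h : i = j
    · subst h; simp [hf, hz0, hW]
    · simp [hf, h, hz]
  have hfz' : ∀ i j, f j i = z j i + if i = j then W i else 0 := by
    intro i j
    rw [hfz]; congr 1
    by_cases h : i = j
    · subst h; rfl
    · rw [if_neg h, if_neg (Ne.symm h)]
  have hf2 : ∀ i j, f i j ^ 2 = z i j ^ 2 + if i = j then W i ^ 2 else 0 := by
    intro i j
    rw [hfz]
    by_cases h : i = j
    · subst h; simp [hz0]
    · simp [h]
  have hf2' : ∀ i j, f j i ^ 2 = z j i ^ 2 + if i = j then W i ^ 2 else 0 := by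
    intro i j
    rw [hfz']
    by_cases h : i = j
    · subst h; simp [hz0]
    · simp [h]
  have r1 : ∀ i, ∑ j, f i j = ∑ j, z i j + W i := fun i => by
    simp only [hfz, Finset.sum_add_distrib, Finset.sum_ite_eq, Finset.mem_univ, if_true]
  have r2 : ∀ i, ∑ j, f j i = ∑ j, z j i + W i := fun i => by
    simp only [hfz' i, Finset.sum_add_distrib, Finset.sum_ite_eq, Finset.mem_univ, if_true]
  have r3 : ∀ i, ∑ j, f i j ^ 2 = ∑ j, z i j ^ 2 + W i ^ 2 := fun i => by
    simp only [hf2, Finset.sum_add_distrib, Finset.sum_ite_eq, Finset.mem_univ, if_true]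
  have r4 : ∀ i, ∑ j, f j i ^ 2 = ∑ j, z j i ^ 2 + W i ^ 2 := fun i => by
    simp only [hf2' i, Finset.sum_add_distrib, Finset.sum_ite_eq, Finset.mem_univ, if_true]
  -- The charges are 1 at the `x_i`, -1 at the `X_i` and `s` at `y`.
  have h3 := sum_sq_sum_inv_sub (fun o : Option (Fin n ⊕ Fin n) =>
    o.elim s (Sum.elim (fun _ => 1) (fun _ => -1))) hp
  have n1 : ∀ i j, (x i - X j)⁻¹ = -f j i := fun i j => by
    rw [hf]; simp only; rw [← inv_neg]; congr 1; ring
  have n2 : ∀ i, (y - x i)⁻¹ = -u i := fun i => by rw [hu, ← inv_neg]; congr 1; ring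
  have n3 : ∀ i, (y - X i)⁻¹ = -v i := fun i => by rw [hv, ← inv_neg]; congr 1; ring
  have n4 : ∀ i j, (X i - x j)⁻¹ = f i j := fun _ _ => rfl
  simp only [Fintype.sum_option, Fintype.sum_sum_type, Option.elim_none, Option.elim_some,
    Sum.elim_inl, Sum.elim_inr, n1, n2, n3, n4, ← ha, ← hb, ← hu, ← hv, sub_self, inv_zero,
    one_mul, neg_mul, neg_neg, one_pow, mul_zero, zero_add, zero_pow, ne_eq,
    OfNat.ofNat_ne_zero, not_false_eq_true, even_two, Even.neg_pow, mul_one,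
    Finset.sum_neg_distrib, Finset.sum_add_distrib] at h3
  -- Completing the square: `ℓ² - 2ℓρ = (ℓ - ρ)² - ρ²`, where `ℓ - ρ` and `ρ` are, up to the factor
  -- `∓m`, the sums that the three-body identity attaches to `x_i` and `X_i`.
  have key : ∀ i, (-m * ∑ j, (a i j + b i j - z i j + z j i) + c * (v i - u i)) ^ 2 -
      2 * ((-m * ∑ j, (a i j + b i j - z i j + z j i) + c * (v i - u i)) *
          (-m * ∑ j, (b i j - z i j) + c * v i + m * W i)) =
      m ^ 2 * ((s * u i + (∑ j, a i j + ∑ j, f j i)) ^ 2 -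
        (s * v i + (∑ j, f i j - ∑ j, b i j)) ^ 2) := by
    intro i
    rw [r1, r2, ← hs]
    simp only [Finset.sum_add_distrib, Finset.sum_sub_distrib]
    ring
  have tr : ∑ i, ∑ j, f j i ^ 2 = ∑ i, ∑ j, f i j ^ 2 := Finset.sum_comm
  have per : ∀ i, ((-m * ∑ j, (-a i j ^ 2 - b i j ^ 2 + z i j ^ 2 + z j i ^ 2) +
        c * (u i ^ 2 - v i ^ 2)) +
        (-m * ∑ j, (a i j + b i j - z i j + z j i) + c * (v i - u i)) ^ 2) -
      2 * ((m * ∑ j, (b i j ^ 2 - z i j ^ 2) - c * v i ^ 2) +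
        (-m * ∑ j, (a i j + b i j - z i j + z j i) + c * (v i - u i)) *
          (-m * ∑ j, (b i j - z i j) + c * v i + m * W i)) =
      m * (∑ j, a i j ^ 2 - ∑ j, b i j ^ 2 + ∑ j, f i j ^ 2 - ∑ j, f j i ^ 2) +
        c * (u i ^ 2 + v i ^ 2) +
      m ^ 2 * ((s * u i + (∑ j, a i j + ∑ j, f j i)) ^ 2 -
        (s * v i + (∑ j, f i j - ∑ j, b i j)) ^ 2) := by
    intro i
    rw [← key i, r3, r4]
    generalize (-m * ∑ j, (a i j + b i j - z i j + z j i) + c * (v i - u i)) = ℓ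
    simp only [Finset.sum_add_distrib, Finset.sum_sub_distrib, Finset.sum_neg_distrib]
    ring
  have tot := Finset.sum_congr (rfl : (Finset.univ : Finset (Fin n)) = _) fun i _ => per i
  rw [Finset.sum_sub_distrib, ← Finset.mul_sum] at tot
  rw [show ∀ p q r t : K, p + q + r - t = (p - t) + (q + r) by intros; ring, tot]
  simp only [Finset.sum_add_distrib, Finset.sum_sub_distrib, ← Finset.mul_sum, tr]
  simp only [← sub_eq_add_neg, ← Finset.mul_sum, tr] at h3
  generalize (∑ i, (s * u i + (∑ j, a i j + ∑ j, f j i)) ^ 2) = t1 at *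
  generalize (∑ i, (s * v i + (∑ j, f i j - ∑ j, b i j)) ^ 2) = t2 at *
  generalize (∑ i, u i) = t3 at *
  generalize (∑ i, v i) = t4 at *
  generalize (∑ i, u i ^ 2) = t5 at *
  generalize (∑ i, v i ^ 2) = t6 at *
  generalize (∑ i, ∑ j, a i j ^ 2) = t7 at *
  generalize (∑ i, ∑ j, b i j ^ 2) = t8 at *
  generalize (∑ i, ∑ j, f i j ^ 2) = t9 at *
  subst hs
  linear_combination m ^ 2 * h3 + (s * m * (t3 - t4) ^ 2 + (t5 - t6)) * hM - t6 * hc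

end ThreeBody

/-! ### The kernel function -/

section Kernel

variable {n : ℕ}

/-- Power series in the increments of the positions of the particles. -/
abbrev KerRing (n : ℕ) := MvPowerSeries (Fin n) (RatRing (Option (Fin n)))

/-- The positions of the particles (`inl o`) and their shifts by the increments (`inr i`). -/
def kerPt : Option (Fin n) ⊕ Fin n → KerRing n :=
  Sum.elim (fun o => MvPowerSeries.C (sp o))
    (fun i => MvPowerSeries.C (sp (some i)) + MvPowerSeries.X i)

/-- The position that is shifted. -/
def kerBase : Option (Fin n) ⊕ Fin n → Option (Fin n) := Sum.elim id some

theorem constantCoeff_kerPt (a : Option (Fin n) ⊕ Fin n) :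
    MvPowerSeries.constantCoeff (kerPt a) = sp (kerBase a) := by
  cases a <;> simp [kerPt, kerBase]

theorem isUnit_kerPt_sub {a b : Option (Fin n) ⊕ Fin n} (h : kerBase a ≠ kerBase b) :
    IsUnit (kerPt a - kerPt b) := by
  rw [MvPowerSeries.isUnit_iff_constantCoeff, map_sub, constantCoeff_kerPt, constantCoeff_kerPt]
  exact isUnit_sp_sub h

/-- The inverse of the difference of two positions, or zero if this difference has no constant
term. -/
def kerInv (a b : Option (Fin n) ⊕ Fin n) : KerRing n := Ring.inverse (kerPt a - kerPt b)

theorem kerInv_eq_zero {a b : Option (Fin n) ⊕ Fin n} (h : kerBase a = kerBase b) :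
    kerInv a b = 0 := by
  refine Ring.inverse_non_unit _ fun hu => ?_
  rw [MvPowerSeries.isUnit_iff_constantCoeff, map_sub, constantCoeff_kerPt, constantCoeff_kerPt,
    h, sub_self] at hu
  exact not_isUnit_zero hu

theorem mul_kerInv {a b : Option (Fin n) ⊕ Fin n} (h : kerBase a ≠ kerBase b) :
    (kerPt a - kerPt b) * kerInv a b = 1 :=
  Ring.mul_inverse_cancel _ (isUnit_kerPt_sub h)

theorem kerInv_swap (a b : Option (Fin n) ⊕ Fin n) : kerInv b a = -kerInv a b := by
  by_cases h : kerBase a = kerBase b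
  · rw [kerInv_eq_zero h, kerInv_eq_zero h.symm, neg_zero]
  · apply (isUnit_kerPt_sub h).mul_left_cancel
    have h1 := mul_kerInv h
    have h2 := mul_kerInv (Ne.symm h)
    linear_combination h1 - h2

theorem der_kerInv (D : Derivation ℂ (KerRing n) (KerRing n)) (a b : Option (Fin n) ⊕ Fin n) :
    D (kerInv a b) = -kerInv a b ^ 2 * D (kerPt a - kerPt b) := by
  by_cases h : kerBase a = kerBase b
  · rw [kerInv_eq_zero h]; simp
  · exact der_ringInverse D (isUnit_kerPt_sub h)

theorem coeffDer_kerPt (o : Option (Fin n)) (a : Option (Fin n) ⊕ Fin n) :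
    coeffDer (dx o) (kerPt a) = if kerBase a = o then 1 else 0 := by
  have key : ∀ o' : Option (Fin n), MvPowerSeries.C (σ := Fin n) (dx o (sp o')) =
      if o' = o then 1 else 0 := fun o' => by
    rw [dx_sp]; split_ifs <;> simp
  rcases a with o' | i
  · exact (coeffDer_C _ _).trans (key o')
  · refine Eq.trans ?_ (key (some i))
    simp [kerPt]

theorem thetaDer_kerPt (i : Fin n) (a : Option (Fin n) ⊕ Fin n) :
    thetaDer i (kerPt a) = if a = Sum.inr i then MvPowerSeries.X i else 0 := by
  cases a <;> simp [kerPt, thetaDer_X]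

theorem algebraMap_rat (ι : Type*) [Fintype ι] [DecidableEq ι] (c : ℂ) :
    algebraMap ℂ (RatRing ι) c = toRat (C c) := by
  rw [IsScalarTower.algebraMap_apply ℂ (PolyRing ι) (RatRing ι)]; rfl

theorem algebraMap_powerSeries {σ S : Type*} [CommRing S] [Algebra ℂ S] (c : ℂ) :
    algebraMap ℂ (MvPowerSeries σ S) c = MvPowerSeries.C (algebraMap ℂ S c) :=
  MvPowerSeries.algebraMap_apply

/-- The substitution of the shifted positions, for polynomials. -/
def shiftPoly (n : ℕ) : PolyRing (Fin n) →+* KerRing n :=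
  eval₂Hom (algebraMap ℂ (KerRing n))
    (Sum.elim (fun i => kerPt (Sum.inr i)) (fun i => MvPowerSeries.C (sc (some i))))

theorem isUnit_shiftPoly_disc : IsUnit (shiftPoly n (disc (Fin n))) := by
  simp only [MvPowerSeries.isUnit_iff_constantCoeff, disc, map_prod, IsUnit.prod_iff]
  intro p hp
  have hne : p.1 ≠ p.2 := by simpa using hp
  have hne' : some p.1 ≠ some p.2 := by simpa using hne
  simp only [map_mul, map_sub, shiftPoly, coe_eval₂Hom, eval₂_X, Sum.elim_inl, Sum.elim_inr,
    constantCoeff_kerPt, MvPowerSeries.constantCoeff_C]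
  exact (isUnit_sp_sub hne').mul (isUnit_sc_sub hne')

/-- The substitution of the shifted positions. -/
def shiftHom (n : ℕ) : RatRing (Fin n) →+* KerRing n :=
  IsLocalization.Away.lift (disc (Fin n)) isUnit_shiftPoly_disc

theorem shiftHom_toRat (P : PolyRing (Fin n)) : shiftHom n (toRat P) = shiftPoly n P :=
  IsLocalization.Away.lift_eq _ _ _

theorem shiftHom_sp (i : Fin n) : shiftHom n (sp i) = kerPt (Sum.inr i) := by
  rw [sp, shiftHom_toRat]; simp [shiftPoly]

theorem shiftHom_sc (i : Fin n) : shiftHom n (sc i) = MvPowerSeries.C (sc (some i)) := by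
  rw [sc, shiftHom_toRat]; simp [shiftPoly]

theorem shiftHom_algebraMap (c : ℂ) : shiftHom n (algebraMap ℂ _ c) = algebraMap ℂ _ c := by
  rw [algebraMap_rat, shiftHom_toRat]; simp [shiftPoly]

theorem shiftHom_smul (c : ℂ) (f : RatRing (Fin n)) : shiftHom n (c • f) = c • shiftHom n f := by
  rw [Algebra.smul_def, map_mul, shiftHom_algebraMap, Algebra.smul_def]

theorem der_shiftHom (D : Derivation ℂ (KerRing n) (KerRing n))
    (d : Derivation ℂ (RatRing (Fin n)) (RatRing (Fin n))) (g : KerRing n)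
    (hx : ∀ i, D (kerPt (Sum.inr i)) = g * shiftHom n (d (sp i)))
    (hl : ∀ i, D (MvPowerSeries.C (sc (some i))) = g * shiftHom n (d (sc i)))
    (f : RatRing (Fin n)) : D (shiftHom n f) = g * shiftHom n (d f) := by
  refine twisted_derivation_eq (R := PolyRing (Fin n)) (S := RatRing (Fin n))
    (Submonoid.powers (disc (Fin n))) (shiftHom n) g d D ?_ f
  intro P
  induction P using MvPolynomial.induction_on with
  | C a => rw [← algebraMap_rat, shiftHom_algebraMap]; simp
  | add p q hp hq => simp only [map_add, hp, hq, mul_add]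
  | mul_X p v hp =>
    have h : D (shiftHom n (toRat (X v))) = g * shiftHom n (d (toRat (X v))) := by
      cases v with
      | inl i => rw [← sp, shiftHom_sp]; exact hx i
      | inr i => rw [← sc, shiftHom_sc]; exact hl i
    simp only [map_mul, Derivation.leibniz, smul_eq_mul, map_add, hp, h]
    ring

theorem coeffDer_some_shiftHom (i : Fin n) (f : RatRing (Fin n)) :
    coeffDer (dx (some i)) (shiftHom n f) = shiftHom n (dx i f) := by
  rw [der_shiftHom (coeffDer (dx (some i))) (dx i) 1, one_mul]
  · intro j
    rw [coeffDer_kerPt, dx_sp, one_mul]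
    by_cases h : j = i
    · subst h; simp [kerBase]
    · simp [kerBase, h]
  · intro j; simp

theorem coeffDer_none_shiftHom (f : RatRing (Fin n)) :
    coeffDer (dx none) (shiftHom n f) = 0 := by
  rw [der_shiftHom (coeffDer (dx none)) 0 0, zero_mul]
  · intro j
    rw [coeffDer_kerPt]
    simp [kerBase]
  · intro j; simp

/-- A function of `x_i + τ_i` has the same derivative in `x_i` and in `τ_i`. -/
theorem thetaDer_shiftHom (i : Fin n) (f : RatRing (Fin n)) :
    thetaDer i (shiftHom n f) = MvPowerSeries.X i * shiftHom n (dx i f) := by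
  rw [der_shiftHom (thetaDer i) (dx i) (MvPowerSeries.X i)]
  · intro j
    rw [thetaDer_kerPt, dx_sp]
    by_cases h : j = i
    · subst h; simp
    · simp [h]
  · intro j; simp

theorem coeffDer_eulerX_shiftHom (f : RatRing (Fin n)) :
    coeffDer eulerX (shiftHom n f) + ∑ i, thetaDer i (shiftHom n f) =
      shiftHom n (eulerX f) := by
  have := der_shiftHom (coeffDer eulerX + ∑ i, thetaDer i) eulerX 1 ?_ ?_ f
  · simpa [der_sum_apply] using this
  · intro j
    rw [eulerX_sp, shiftHom_sp, one_mul, Derivation.add_apply, der_sum_apply]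
    simp only [thetaDer_kerPt, Sum.inr.injEq, Finset.sum_ite_eq, Finset.mem_univ, if_true]
    simp [kerPt]
  · intro j
    simp [der_sum_apply]

theorem coeffDer_eulerL_shiftHom (f : RatRing (Fin n)) :
    coeffDer eulerL (shiftHom n f) = shiftHom n (eulerL f) := by
  rw [der_shiftHom (coeffDer eulerL) eulerL 1, one_mul]
  · intro j
    rw [eulerL_sp]
    simp [kerPt]
  · intro j
    simp [shiftHom_sc]

/-- The difference of two positions as a unit. -/
def unitDiff (a b : Option (Fin n) ⊕ Fin n) : (KerRing n)ˣ :=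
  if h : kerBase a ≠ kerBase b then (isUnit_kerPt_sub h).unit else 1

theorem val_unitDiff {a b : Option (Fin n) ⊕ Fin n} (h : kerBase a ≠ kerBase b) :
    (unitDiff a b : KerRing n) = kerPt a - kerPt b := by
  rw [unitDiff, dif_pos h, IsUnit.unit_spec]

theorem dlog_unitDiff (D : Derivation ℂ (KerRing n) (KerRing n)) (a b : Option (Fin n) ⊕ Fin n) :
    (dlog D (unitDiff a b)).toAdd = kerInv a b * D (kerPt a - kerPt b) := by
  by_cases h : kerBase a = kerBase b
  · rw [unitDiff, dif_neg (by simpa using h), kerInv_eq_zero h]; simp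
  · rw [unitDiff, dif_pos h, dlog_unit, kerInv]

/-- The position of a particle. -/
abbrev ptx (i : Fin n) : Option (Fin n) ⊕ Fin n := Sum.inl (some i)

/-- The shifted position of a particle. -/
abbrev ptX (i : Fin n) : Option (Fin n) ⊕ Fin n := Sum.inr i

/-- The position of the last particle. -/
abbrev pty : Option (Fin n) ⊕ Fin n := Sum.inl none

/-- The kernel function, up to monomial and exponential factors. -/
def kerUnit (n : ℕ) (m c : ℤ) : (KerRing n)ˣ :=
  (∏ i, ∏ j ∈ Finset.Ioi i, unitDiff (ptx i) (ptx j) * unitDiff (ptX i) (ptX j) *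
      (unitDiff (ptX i) (ptx j))⁻¹ * (unitDiff (ptx i) (ptX j))⁻¹) ^ (-m) *
    (∏ i, unitDiff (ptX i) pty * (unitDiff (ptx i) pty)⁻¹) ^ c

theorem dlog_kerUnit (m c : ℤ) (D : Derivation ℂ (KerRing n) (KerRing n)) :
    (dlog D (kerUnit n m c)).toAdd =
      -(m : KerRing n) * (∑ i, ∑ j ∈ Finset.Ioi i,
        (kerInv (ptx i) (ptx j) * D (kerPt (ptx i) - kerPt (ptx j)) +
          kerInv (ptX i) (ptX j) * D (kerPt (ptX i) - kerPt (ptX j)) -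
          kerInv (ptX i) (ptx j) * D (kerPt (ptX i) - kerPt (ptx j)) +
          kerInv (ptX j) (ptx i) * D (kerPt (ptx i) - kerPt (ptX j)))) +
      (c : KerRing n) * ∑ i, (kerInv (ptX i) pty * D (kerPt (ptX i) - kerPt pty) -
        kerInv (ptx i) pty * D (kerPt (ptx i) - kerPt pty)) := by
  simp only [kerUnit, map_mul, map_zpow, map_prod, map_inv, toAdd_mul, toAdd_zpow, toAdd_prod,
    toAdd_inv, dlog_unitDiff, zsmul_eq_mul, Int.cast_neg, ← sub_eq_add_neg]
  simp only [kerInv_swap (ptX _) (ptx _), neg_mul, sub_eq_add_neg]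
  simp only [neg_neg]

/-- Among the pairs `i < j`, those containing `k` have it either first or second; together their
partners exhaust all indices different from `k`. -/
theorem sum_pairs {G : Type*} [AddCommMonoid G] (k : Fin n) (F : Fin n → Fin n → G)
    (hF : F k k = 0) :
    ∑ i, ∑ j ∈ Finset.Ioi i, ((if i = k then F i j else 0) + if j = k then F j i else 0) =
      ∑ j, F k j := by
  have h1 : ∀ i, ∑ j ∈ Finset.Ioi i,
      ((if i = k then F i j else 0) + if j = k then F j i else 0) =
      (if i = k then ∑ j ∈ Finset.Ioi k, F k j else 0) + if i < k then F k i else 0 := by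
    intro i
    rw [Finset.sum_add_distrib, Finset.sum_ite_eq' (Finset.Ioi i) k]
    simp only [Finset.mem_Ioi]
    congr 1
    by_cases h : i = k
    · subst h; simp
    · simp [h]
  simp only [h1, Finset.sum_add_distrib, Finset.sum_ite_eq', Finset.mem_univ, if_true]
  rw [← Finset.sum_filter, ← Finset.sum_filter_add_sum_filter_not Finset.univ (fun j => k < j)]
  congr 1
  · exact Finset.sum_congr (by ext; simp) fun _ _ => rfl
  · refine Finset.sum_subset (fun j => by simp; exact fun h => h.le) fun j hj hj' => ?_
    have : j = k := by
      simp at hj hj'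
      exact le_antisymm hj hj'
    rw [this, hF]

end Kernel

/-! ### Logarithmic derivatives of the kernel function. -/

section Kernel

variable {n : ℕ}

theorem der_intCast_mul {G : Type*} [CommRing G] [Algebra ℂ G] (D : Derivation ℂ G G) (m : ℤ)
    (f : G) : D (m * f) = m * D f := by
  simp [Derivation.leibniz]

/-- The logarithmic derivative of the kernel function with respect to a position. -/
def kerEll (m c : ℤ) (i : Fin n) : KerRing n :=
  -(m : KerRing n) * ∑ j, (kerInv (ptx i) (ptx j) + kerInv (ptX i) (ptX j) -
    kerInv (ptX i) (ptx j) + kerInv (ptX j) (ptx i)) +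
    (c : KerRing n) * (kerInv (ptX i) pty - kerInv (ptx i) pty)

/-- The logarithmic derivative of the kernel function with respect to the last position. -/
def kerEllY (n : ℕ) (c : ℤ) : KerRing n :=
  (c : KerRing n) * ∑ i, (kerInv (ptx i) pty - kerInv (ptX i) pty)

/-- The logarithmic derivative of the kernel function with respect to an increment. -/
def kerR (m c : ℤ) (i : Fin n) : KerRing n :=
  -(m : KerRing n) * ∑ j, (kerInv (ptX i) (ptX j) - kerInv (ptX i) (ptx j)) +
    (c : KerRing n) * kerInv (ptX i) pty

/-- The quotient of `kerEll` by the increment. -/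
def kerEta (m c : ℤ) (i : Fin n) : KerRing n :=
  -(m : KerRing n) * ∑ j, (kerInv (ptx i) (ptx j) * kerInv (ptX i) (ptx j) +
    kerInv (ptX i) (ptX j) * kerInv (ptX j) (ptx i)) -
    (c : KerRing n) * (kerInv (ptX i) pty * kerInv (ptx i) pty)

/-- The derivative of `kerEll` with respect to the increment. -/
def kerKappa (m c : ℤ) (i : Fin n) : KerRing n :=
  (m : KerRing n) * ∑ j, (kerInv (ptX i) (ptX j) ^ 2 - kerInv (ptX i) (ptx j) ^ 2) -
    (c : KerRing n) * kerInv (ptX i) pty ^ 2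

theorem kerPt_ptX_sub (i : Fin n) : kerPt (ptX i) - kerPt (ptx i) = MvPowerSeries.X i := by
  simp [kerPt]

/-- At `τ_i = 0` the points `X_i` and `x_i` coincide and the four terms cancel, so the logarithmic
derivative is divisible by `τ_i`. This divisibility is what makes integration by parts applicable.
-/
theorem kerEll_eq (m c : ℤ) (i : Fin n) : kerEll m c i = MvPowerSeries.X i * kerEta m c i := by
  have h1 : ∀ j, kerInv (ptx i) (ptx j) + kerInv (ptX i) (ptX j) -
      kerInv (ptX i) (ptx j) + kerInv (ptX j) (ptx i) =
      MvPowerSeries.X i * (kerInv (ptx i) (ptx j) * kerInv (ptX i) (ptx j) +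
        kerInv (ptX i) (ptX j) * kerInv (ptX j) (ptx i)) := by
    intro j
    by_cases h : i = j
    · subst h
      rw [kerInv_eq_zero (a := ptx i) (b := ptx i) rfl, kerInv_eq_zero (a := ptX i) (b := ptX i) rfl,
        kerInv_eq_zero (a := ptX i) (b := ptx i) rfl]
      simp
    · have hij : some i ≠ some j := by simpa using h
      have e1 := mul_kerInv (a := ptx i) (b := ptx j) hij
      have e2 := mul_kerInv (a := ptX i) (b := ptX j) hij
      have e3 := mul_kerInv (a := ptX i) (b := ptx j) hij
      have e4 := mul_kerInv (a := ptX j) (b := ptx i) hij.symm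
      have e5 := kerPt_ptX_sub i
      rw [← e5]
      linear_combination kerInv (ptX i) (ptx j) * e1 - kerInv (ptx i) (ptx j) * e3
        - kerInv (ptX i) (ptX j) * e4 - kerInv (ptX j) (ptx i) * e2
  have e1 := mul_kerInv (a := ptx i) (b := pty) (by simp [kerBase])
  have e2 := mul_kerInv (a := ptX i) (b := pty) (by simp [kerBase])
  have e5 := kerPt_ptX_sub i
  simp only [kerEll, kerEta, h1, ← Finset.mul_sum]
  rw [← e5]
  linear_combination (c : KerRing n) * (kerInv (ptx i) pty * e2 - kerInv (ptX i) pty * e1)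

theorem dlog_kerUnit_some (m c : ℤ) (k : Fin n) :
    (dlog (coeffDer (dx (some k))) (kerUnit n m c)).toAdd = kerEll m c k := by
  rw [dlog_kerUnit, kerEll, ← sum_pairs k (fun k j => kerInv (ptx k) (ptx j) +
    kerInv (ptX k) (ptX j) - kerInv (ptX k) (ptx j) + kerInv (ptX j) (ptx k))]
  · congr 2
    · refine Finset.sum_congr rfl fun i _ => Finset.sum_congr rfl fun j _ => ?_
      simp only [map_sub, coeffDer_kerPt, kerBase, Sum.elim_inl, Sum.elim_inr, id, Option.some_inj]
      rw [kerInv_swap (ptx i) (ptx j), kerInv_swap (ptX i) (ptX j)]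
      split_ifs <;> ring
    · simp only [map_sub, coeffDer_kerPt, kerBase, Sum.elim_inl, Sum.elim_inr, id, Option.some_inj,
        reduceCtorEq, if_false, sub_zero, mul_ite, mul_one, mul_zero, Finset.sum_sub_distrib,
        Finset.sum_ite_eq', Finset.mem_univ, if_true]
  · rw [kerInv_eq_zero (a := ptx k) (b := ptx k) rfl, kerInv_eq_zero (a := ptX k) (b := ptX k) rfl]
    ring

theorem dlog_kerUnit_none (m c : ℤ) :
    (dlog (coeffDer (dx none)) (kerUnit n m c)).toAdd = kerEllY n c := by
  rw [dlog_kerUnit, kerEllY]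
  simp only [map_sub, coeffDer_kerPt, kerBase, Sum.elim_inl, Sum.elim_inr, id, reduceCtorEq,
    if_false, if_true, sub_zero, mul_zero, add_zero, Finset.sum_const_zero, zero_sub, mul_neg,
    mul_one, zero_add]
  congr 1
  exact Finset.sum_congr rfl fun i _ => by ring

theorem dlog_kerUnit_theta (m c : ℤ) (k : Fin n) :
    (dlog (thetaDer k) (kerUnit n m c)).toAdd = MvPowerSeries.X k * kerR m c k := by
  rw [dlog_kerUnit, kerR, ← sum_pairs k
    (fun k j => kerInv (ptX k) (ptX j) - kerInv (ptX k) (ptx j))]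
  · rw [mul_add, mul_left_comm, mul_left_comm _ (c : KerRing n)]
    congr 2
    · rw [Finset.mul_sum]
      refine Finset.sum_congr rfl fun i _ => ?_
      rw [Finset.mul_sum]
      refine Finset.sum_congr rfl fun j _ => ?_
      simp only [map_sub, thetaDer_kerPt, Sum.inr.injEq, reduceCtorEq, if_false]
      rw [kerInv_swap (ptX i) (ptX j)]
      split_ifs <;> ring
    · simp only [map_sub, thetaDer_kerPt, Sum.inr.injEq, reduceCtorEq, if_false, sub_zero, mul_ite,
        mul_zero, Finset.sum_ite_eq', Finset.mem_univ, if_true]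
      ring
  · rw [kerInv_eq_zero (a := ptX k) (b := ptX k) rfl, kerInv_eq_zero (a := ptX k) (b := ptx k) rfl,
      sub_zero]

theorem coeffDer_some_kerUnit (m c : ℤ) (k : Fin n) :
    coeffDer (dx (some k)) (kerUnit n m c : KerRing n) = (kerUnit n m c : KerRing n) * kerEll m c k := by
  rw [der_eq_mul_dlog, dlog_kerUnit_some]

theorem coeffDer_none_kerUnit (m c : ℤ) :
    coeffDer (dx none) (kerUnit n m c : KerRing n) = (kerUnit n m c : KerRing n) * kerEllY n c := by
  rw [der_eq_mul_dlog, dlog_kerUnit_none]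

theorem thetaDer_kerUnit (m c : ℤ) (k : Fin n) :
    thetaDer k (kerUnit n m c : KerRing n) =
      (kerUnit n m c : KerRing n) * (MvPowerSeries.X k * kerR m c k) := by
  rw [der_eq_mul_dlog, dlog_kerUnit_theta]

/-- The kernel function is translation invariant. -/
theorem sum_coeffDer_kerUnit (m c : ℤ) :
    ∑ o, coeffDer (dx o) (kerUnit n m c : KerRing n) = 0 := by
  rw [← der_sum_apply, der_eq_mul_dlog, dlog_kerUnit]
  have : ∀ a, (∑ o, coeffDer (dx o)) (kerPt a : KerRing n) = 1 := fun a => by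
    simp only [der_sum_apply, coeffDer_kerPt, Finset.sum_ite_eq, Finset.mem_univ, if_true]
  generalize (∑ o, coeffDer (dx o) : Derivation ℂ (KerRing n) (KerRing n)) = D at *
  simp [map_sub, this]

theorem coeffDer_eulerL_kerUnit (m c : ℤ) :
    coeffDer eulerL (kerUnit n m c : KerRing n) = 0 := by
  rw [der_eq_mul_dlog, dlog_kerUnit]
  have : ∀ a, coeffDer eulerL (kerPt a : KerRing n) = 0 := fun a => by
    cases a <;> simp [kerPt]
  simp [map_sub, this]

/-- The kernel has as many differences in the numerator as in the denominator, so it is invariant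
under a common scaling of positions and increments. -/
theorem coeffDer_eulerX_kerUnit (m c : ℤ) :
    coeffDer eulerX (kerUnit n m c : KerRing n) + ∑ i, thetaDer i (kerUnit n m c : KerRing n)
      = 0 := by
  rw [← der_sum_apply, ← Derivation.add_apply, der_eq_mul_dlog, dlog_kerUnit]
  have h1 : ∀ a : Option (Fin n) ⊕ Fin n, (coeffDer eulerX + ∑ i, thetaDer i :
      Derivation ℂ (KerRing n) (KerRing n)) (kerPt a) = kerPt a := fun a => by
    simp only [Derivation.add_apply, der_sum_apply, thetaDer_kerPt]
    cases a <;> simp [kerPt]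
  have h2 : ∀ i : Fin n, ∀ j ∈ Finset.Ioi i, some i ≠ some j := fun i j hj => by
    simp at hj ⊢; exact hj.ne
  have h3 : ∀ a b : Option (Fin n) ⊕ Fin n, kerBase a ≠ kerBase b →
      kerInv a b * (kerPt a - kerPt b) = 1 := fun a b h => by rw [mul_comm, mul_kerInv h]
  simp only [map_sub, h1]
  have h4 : ∀ i : Fin n, kerInv (ptX i) pty * (kerPt (ptX i) - kerPt pty) -
      kerInv (ptx i) pty * (kerPt (ptx i) - kerPt pty) = 0 := fun i => by
    rw [h3 _ _ (by simp [kerBase]), h3 _ _ (by simp [kerBase]), sub_self]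
  have h5 : ∀ i : Fin n, ∀ j ∈ Finset.Ioi i,
      (kerInv (ptx i) (ptx j) * (kerPt (ptx i) - kerPt (ptx j)) +
        kerInv (ptX i) (ptX j) * (kerPt (ptX i) - kerPt (ptX j)) -
        kerInv (ptX i) (ptx j) * (kerPt (ptX i) - kerPt (ptx j)) +
        kerInv (ptX j) (ptx i) * (kerPt (ptx i) - kerPt (ptX j))) = 0 := fun i j hj => by
    have := h3 (ptX j) (ptx i) (h2 i j hj).symm
    rw [h3 (ptx i) (ptx j) (h2 i j hj), h3 (ptX i) (ptX j) (h2 i j hj), h3 (ptX i) (ptx j) (h2 i j hj)]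
    linear_combination -this
  rw [Finset.sum_eq_zero fun i _ => h4 i,
    Finset.sum_eq_zero fun i _ => Finset.sum_eq_zero fun j hj => h5 i j hj]
  simp

theorem thetaDer_kerEll (m c : ℤ) (k : Fin n) :
    thetaDer k (kerEll m c k) = MvPowerSeries.X k * kerKappa m c k := by
  simp only [kerEll, kerKappa, map_add, map_sub, neg_mul, map_neg, der_intCast_mul, map_sum,
    der_kerInv, thetaDer_kerPt, Sum.inr.injEq, reduceCtorEq, if_false, if_true, sub_zero]
  have h1 : ∀ j, -(kerInv (ptX k) (ptX j) ^ 2 * (MvPowerSeries.X k -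
      if j = k then MvPowerSeries.X k else 0)) =
      -(MvPowerSeries.X k * kerInv (ptX k) (ptX j) ^ 2) := by
    intro j
    by_cases hj : j = k
    · subst hj
      rw [kerInv_eq_zero (a := ptX j) (b := ptX j) rfl]
      simp
    · rw [if_neg hj]; ring
  have h2 : ∀ j, -(kerInv (ptX j) (ptx k) ^ 2 * if j = k then MvPowerSeries.X k else 0) = 0 := by
    intro j
    by_cases hj : j = k
    · subst hj
      rw [kerInv_eq_zero (a := ptX j) (b := ptx j) rfl]
      simp
    · simp [hj]
  simp only [h1, h2, mul_zero, neg_zero, zero_add, add_zero, sub_zero]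
  have h3 : ∀ j, -(MvPowerSeries.X k * kerInv (ptX k) (ptX j) ^ 2) -
      -(kerInv (ptX k) (ptx j) ^ 2 * MvPowerSeries.X k) =
      -MvPowerSeries.X k * (kerInv (ptX k) (ptX j) ^ 2 - kerInv (ptX k) (ptx j) ^ 2) :=
    fun j => by ring
  simp only [h3, ← Finset.mul_sum]
  ring

theorem coeffDer_kerEll (m c : ℤ) (k : Fin n) :
    coeffDer (dx (some k)) (kerEll m c k) =
      -(m : KerRing n) * ∑ j, (-kerInv (ptx k) (ptx j) ^ 2 - kerInv (ptX k) (ptX j) ^ 2 +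
        kerInv (ptX k) (ptx j) ^ 2 + kerInv (ptX j) (ptx k) ^ 2) +
      (c : KerRing n) * (kerInv (ptx k) pty ^ 2 - kerInv (ptX k) pty ^ 2) := by
  simp only [kerEll, map_add, map_sub, neg_mul, map_neg, der_intCast_mul, map_sum,
    der_kerInv, coeffDer_kerPt, kerBase, Sum.elim_inl, Sum.elim_inr, id, Option.some_inj,
    reduceCtorEq, if_false, if_true, sub_zero]
  congr 2
  · congr 1
    refine Finset.sum_congr rfl fun j _ => ?_
    by_cases hj : j = k
    · subst hj
      rw [kerInv_eq_zero (a := ptX j) (b := ptX j) rfl, kerInv_eq_zero (a := ptX j) (b := ptx j) rfl,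
        kerInv_eq_zero (a := ptx j) (b := ptx j) rfl]
      simp
    · simp only [if_neg hj]; ring
  · ring

theorem coeffDer_kerEllY (c : ℤ) :
    coeffDer (dx none) (kerEllY n c) =
      (c : KerRing n) * ∑ i, (kerInv (ptx i) pty ^ 2 - kerInv (ptX i) pty ^ 2) := by
  simp only [kerEllY, map_sub, der_intCast_mul, map_sum,
    der_kerInv, coeffDer_kerPt, kerBase, Sum.elim_inl, Sum.elim_inr, id,
    reduceCtorEq, if_false, if_true]
  congr 1
  exact Finset.sum_congr rfl fun i _ => by ring

theorem X_mul_cancel {i : Fin n} {f g : KerRing n}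
    (h : MvPowerSeries.X i * f = MvPowerSeries.X i * g) : f = g := by
  ext α
  rw [← coeff_single_add_X_mul i, h, coeff_single_add_X_mul]

/-- With `ℓ = τ_i η`, the derivative of `ℓU` is computed once from this factorization and once from
the logarithmic derivatives of `U`; then one factor `τ_i` cancels. -/
theorem thetaDer_kerEta_mul (m c : ℤ) (i : Fin n) :
    thetaDer i (kerEta m c i * (kerUnit n m c : KerRing n)) + kerEta m c i * (kerUnit n m c : KerRing n) =
      (kerKappa m c i + kerEll m c i * kerR m c i) * (kerUnit n m c : KerRing n) := by
  apply X_mul_cancel (i := i)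
  have h1 : thetaDer i (kerEll m c i * (kerUnit n m c : KerRing n)) =
      MvPowerSeries.X i * (thetaDer i (kerEta m c i * (kerUnit n m c : KerRing n)) +
        kerEta m c i * (kerUnit n m c : KerRing n)) := by
    rw [kerEll_eq, mul_assoc, Derivation.leibniz, thetaDer_X, if_pos rfl, smul_eq_mul, smul_eq_mul]
    ring
  rw [← h1, Derivation.leibniz, thetaDer_kerEll, thetaDer_kerUnit, smul_eq_mul, smul_eq_mul]
  ring

end Kernel

/-! ### The differential equation of the kernel and the integral transform. -/

section Kernel

variable {n : ℕ}

theorem shiftHom_inverse_sub (i j : Fin n) :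
    shiftHom n (Ring.inverse (sp i - sp j)) = kerInv (ptX i) (ptX j) := by
  by_cases h : i = j
  · subst h
    rw [kerInv_eq_zero rfl]
    simp
  · have hij : some i ≠ some j := by simpa using h
    apply (isUnit_kerPt_sub (a := ptX i) (b := ptX j) hij).mul_left_cancel
    rw [mul_kerInv (a := ptX i) (b := ptX j) hij, ← shiftHom_sp, ← shiftHom_sp, ← map_sub, ← map_mul,
      Ring.mul_inverse_cancel _ (isUnit_sp_sub h), map_one]

theorem C_inverse_sub (a b : Option (Fin n)) :
    (MvPowerSeries.C (Ring.inverse (sp a - sp b)) : KerRing n) =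
      kerInv (Sum.inl a) (Sum.inl b) := by
  by_cases h : a = b
  · subst h
    rw [kerInv_eq_zero rfl]
    simp
  · apply (isUnit_kerPt_sub (a := Sum.inl a) (b := Sum.inl b) h).mul_left_cancel
    rw [mul_kerInv (a := Sum.inl a) (b := Sum.inl b) h]
    simp only [kerPt, Sum.elim_inl]
    rw [← map_sub, ← map_mul, Ring.mul_inverse_cancel _ (isUnit_sp_sub h), map_one]

theorem C_csmul (c : ℂ) (s : RatRing (Option (Fin n))) :
    (MvPowerSeries.C (c • s) : KerRing n) = c • MvPowerSeries.C s := by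
  rw [Algebra.smul_def, map_mul, ← algebraMap_powerSeries, Algebra.smul_def]

theorem shiftHom_potRat (m : ℂ) :
    shiftHom n (potRat m fun _ => 1) =
      ∑ i, ∑ j, (m * (m + 1)) • kerInv (ptX i) (ptX j) ^ 2 := by
  simp only [potRat, map_sum, shiftHom_smul, map_pow, shiftHom_inverse_sub, coup]
  refine Finset.sum_congr rfl fun i _ => Finset.sum_congr rfl fun j _ => ?_
  congr 1
  ring

theorem C_potRat {m s : ℂ} {q : Option (Fin n) → ℂ} (hq1 : ∀ i, q (some i) = 1)
    (hs : q none = s) :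
    (MvPowerSeries.C (potRat m q) : KerRing n) =
      ∑ i, ∑ j, (m * (m + 1)) • kerInv (ptx i) (ptx j) ^ 2 +
        ∑ i, (m * (1 + s) * (1 + m * s)) • kerInv (ptx i) pty ^ 2 := by
  simp only [potRat, map_sum, map_add, C_csmul, map_pow, C_inverse_sub, coup, Fintype.sum_option,
    hq1, hs]
  rw [kerInv_eq_zero (a := pty) (b := pty) rfl, Finset.sum_add_distrib]
  have h1 : ∀ i : Fin n, (m * (s + 1) * (1 + m * s * 1) / 2) • kerInv pty (ptx i) ^ 2 +
      (m * (1 + s) * (1 + m * 1 * s) / 2) • kerInv (ptx i) pty ^ 2 =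
      (m * (1 + s) * (1 + m * s)) • kerInv (ptx i) pty ^ 2 := by
    intro i
    rw [kerInv_swap (ptx i) pty, neg_sq, ← add_smul]
    congr 1
    ring
  have h2 : m * (1 + 1) * (1 + m * 1 * 1) / 2 = m * (m + 1) := by ring
  simp only [← h1, h2, Finset.sum_add_distrib]
  simp
  abel

/-- Points over different positions differ by a unit, while `X_i` and `x_i` differ by the nonzero,
non-invertible series `τ_i`. So all points are distinct in the fraction field, as the three-body
identity requires. -/
theorem kerPt_injective :
    Function.Injective (kerPt : Option (Fin n) ⊕ Fin n → KerRing n) := by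
  intro a b h
  have hb : kerBase a = kerBase b := by
    by_contra hne
    have := isUnit_kerPt_sub hne
    rw [h, sub_self] at this
    exact not_isUnit_zero this
  have hX : ∀ i : Fin n, (MvPowerSeries.X i : KerRing n) ≠ 0 := fun i h0 => by
    have := congrArg (MvPowerSeries.coeff (Finsupp.single i 1)) h0
    rw [MvPowerSeries.coeff_index_single_self_X] at this
    exact one_ne_zero this
  rcases a with o | i <;> rcases b with o' | j <;> simp only [kerBase, Sum.elim_inl, Sum.elim_inr, id]
    at hb
  · rw [hb]
  · subst hb
    exact absurd (by rw [← kerPt_ptX_sub j, h]; simp) (hX j)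
  · subst hb
    exact absurd (by rw [← kerPt_ptX_sub i, h]; simp) (hX i)
  · rw [Option.some_inj.mp hb]

/-- The identity for the logarithmic derivatives of the kernel function. -/
theorem kernel_log_identity {m c : ℤ} {q : Option (Fin n) → ℂ} (hq1 : ∀ i, q (some i) = 1)
    (hq : q none * m = c) (hM : (q none)⁻¹ * c = m) (hc : (c - 1) * (c - m) = 0) :
    ∑ i, (coeffDer (dx (some i)) (kerEll m c i) + kerEll m c i ^ 2) +
      algebraMap ℂ _ (q none)⁻¹ * (coeffDer (dx none) (kerEllY n c) + kerEllY n c ^ 2) +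
      (shiftHom n (potRat m fun _ => 1) - MvPowerSeries.C (potRat m q)) -
      2 * ∑ i, (kerKappa m c i + kerEll m c i * kerR m c i + (m : KerRing n) * kerEta m c i)
      = 0 := by
  -- In the fraction field `X_i - x_i = τ_i` has an inverse, so the identity for points of a field
  -- applies.
  set K := FractionRing (KerRing n)
  have inj : Function.Injective (algebraMap (KerRing n) K) := IsFractionRing.injective _ _
  have : CharZero K := by
    refine ⟨fun a b h => ?_⟩
    have h1 : (algebraMap (KerRing n) K) (algebraMap ℂ _ (a : ℂ)) =
        (algebraMap (KerRing n) K) (algebraMap ℂ _ (b : ℂ)) := by simpa using h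
    exact_mod_cast (algebraMap ℂ (KerRing n)).injective (inj h1)
  set ψ := algebraMap (KerRing n) K
  set p : Option (Fin n) ⊕ Fin n → K := fun a => ψ (kerPt a) with hp
  have pinj : Function.Injective p := inj.comp kerPt_injective
  have hinv : ∀ {a b : Option (Fin n) ⊕ Fin n}, kerBase a ≠ kerBase b →
      ψ (kerInv a b) = (p a - p b)⁻¹ := fun {a b} h => by
    rw [kerInv, map_ringInverse _ (isUnit_kerPt_sub h), map_sub]
  have hcast : ∀ k : ℤ, ψ (algebraMap ℂ _ (k : ℂ)) = (k : K) := fun k => by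
    rw [map_intCast, map_intCast]
  have key := kernel_field_identity (K := K) (n := n) (x := fun i => p (ptx i))
    (X := fun i => p (ptX i)) (y := p pty) (m := (m : K)) (c := (c : K))
    (s := ψ (algebraMap ℂ _ (q none))) (M := ψ (algebraMap ℂ _ (q none)⁻¹))
    ?_ ?_ ?_ ?_ (fun i j => ψ (kerInv (ptx i) (ptx j))) (fun i j => ψ (kerInv (ptX i) (ptX j)))
    (fun i j => ψ (kerInv (ptX i) (ptx j))) (fun i => ψ (kerInv (ptx i) pty))
    (fun i => ψ (kerInv (ptX i) pty)) (fun i => (p (ptX i) - p (ptx i))⁻¹)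
    ?_ ?_ ?_ ?_ ?_ ?_ ?_
  · apply inj
    rw [map_zero, ← key]
    -- The term `m η` of the claim is `m ℓ / τ_i`, which is the contribution of the weight `τ_i^m`.
    have hη : ∀ i, ψ (kerEta m c i) = ψ (kerEll m c i) * (p (ptX i) - p (ptx i))⁻¹ := by
      intro i
      rw [kerEll_eq, map_mul, ← kerPt_ptX_sub, map_sub, mul_comm (ψ _ - ψ _), mul_assoc,
        mul_inv_cancel₀ (sub_ne_zero.mpr (pinj.ne (by simp))), mul_one]
    simp only [coeffDer_kerEll, coeffDer_kerEllY, map_add, map_sub, map_mul, map_sum, hη,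
      shiftHom_potRat, C_potRat hq1 rfl, Algebra.smul_def, map_intCast, map_one, map_ofNat]
    simp only [kerEll, kerEllY, kerKappa, kerR, map_neg, map_add, map_sub, map_mul, map_sum,
      map_pow, map_intCast]
    congr 1
    congr 1
    refine Finset.sum_congr rfl fun i _ => ?_
    ring
  · intro a b h
    rcases a with _ | a | a <;> rcases b with _ | b | b <;>
      simpa using pinj h
  · rw [← hcast m, ← map_mul, ← map_mul, hq, hcast]
  · rw [← hcast c, ← map_mul, ← map_mul, hM, hcast]
  · rcases mul_eq_zero.mp hc with h | h
    · rw [sub_eq_zero.mp h, Int.cast_one, sub_self, zero_mul]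
    · rw [sub_eq_zero.mp h, sub_self, mul_zero]
  · exact fun i j => by
      by_cases h : i = j
      · subst h; rw [kerInv_eq_zero rfl]; simp
      · exact hinv (by simpa [kerBase] using h)
  · exact fun i j => by
      by_cases h : i = j
      · subst h; rw [kerInv_eq_zero rfl]; simp
      · exact hinv (by simpa [kerBase] using h)
  · exact fun i j h => hinv (by simpa [kerBase] using h)
  · exact fun i => by rw [kerInv_eq_zero (a := ptX i) (b := ptx i) rfl, map_zero]
  · exact fun i => rfl
  · exact fun i => hinv (by simp [kerBase])
  · exact fun i => hinv (by simp [kerBase])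

/-- The differential equation of the kernel function. -/
theorem kernel_identity {m c : ℤ} {q : Option (Fin n) → ℂ} (hq1 : ∀ i, q (some i) = 1)
    (hq : q none * m = c) (hM : (q none)⁻¹ * c = m) (hc : (c - 1) * (c - m) = 0) {U : KerRing n}
    (hU : U = kerUnit n m c) :
    ∑ i, coeffDer (dx (some i)) (coeffDer (dx (some i)) U) +
      (q none)⁻¹ • coeffDer (dx none) (coeffDer (dx none) U) +
      (shiftHom n (potRat m fun _ => 1) - MvPowerSeries.C (potRat m q)) * U -
      2 * ∑ i, (thetaDer i (kerEta m c i * U) + ((m : ℂ) + 1) • (kerEta m c i * U)) = 0 := by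
  have h := kernel_log_identity hq1 hq hM hc
  have h1 : ∀ i, coeffDer (dx (some i)) (coeffDer (dx (some i)) U) =
      (coeffDer (dx (some i)) (kerEll m c i) + kerEll m c i ^ 2) * U := fun i => by
    rw [hU, coeffDer_some_kerUnit, Derivation.leibniz, coeffDer_some_kerUnit, smul_eq_mul,
      smul_eq_mul]
    ring
  have h2 : coeffDer (dx none) (coeffDer (dx none) U) =
      (coeffDer (dx none) (kerEllY n c) + kerEllY n c ^ 2) * U := by
    rw [hU, coeffDer_none_kerUnit, Derivation.leibniz, coeffDer_none_kerUnit, smul_eq_mul,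
      smul_eq_mul]
    ring
  have h3 : ∀ i, thetaDer i (kerEta m c i * U) + ((m : ℂ) + 1) • (kerEta m c i * U) =
      (kerKappa m c i + kerEll m c i * kerR m c i + (m : KerRing n) * kerEta m c i) * U := by
    intro i
    have := thetaDer_kerEta_mul m c i
    rw [← hU] at this
    rw [Algebra.smul_def, map_add, map_one, map_intCast]
    linear_combination this
  simp only [h1, h2, h3, ← Finset.sum_mul]
  rw [Algebra.smul_def]
  linear_combination U * h

theorem C_mul_eq_smul {σ S : Type*} [CommRing S] (s : S) (g : MvPowerSeries σ S) :
    MvPowerSeries.C s * g = s • g := (MvPowerSeries.smul_eq_C_mul g s).symm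

/-- The differences of the last spectral variable and the others. -/
def specDiff (n : ℕ) (i : Fin n) : RatRing (Option (Fin n)) := sc none - sc (some i)

theorem isUnit_specDiff (i : Fin n) : IsUnit (specDiff n i) := isUnit_sc_sub (by simp)

theorem dx_inverse_specDiff (o : Option (Fin n)) (i : Fin n) :
    dx o (Ring.inverse (specDiff n i)) = (0 : ℂ) • Ring.inverse (specDiff n i) := by
  rw [der_ringInverse _ (isUnit_specDiff i), specDiff, map_sub, dx_sc, dx_sc]; simp

theorem eulerX_inverse_specDiff (i : Fin n) :
    eulerX (Ring.inverse (specDiff n i)) = (0 : ℂ) • Ring.inverse (specDiff n i) := by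
  rw [der_ringInverse _ (isUnit_specDiff i), specDiff, map_sub, eulerX_sc, eulerX_sc]; simp

theorem eulerL_inverse_specDiff (i : Fin n) :
    eulerL (Ring.inverse (specDiff n i)) = (-1 : ℂ) • Ring.inverse (specDiff n i) := by
  rw [der_ringInverse _ (isUnit_specDiff i)]
  have h : eulerL (specDiff n i) = specDiff n i := by simp [specDiff]
  rw [h, neg_one_smul]
  linear_combination (-Ring.inverse (specDiff n i)) *
    Ring.inverse_mul_cancel _ (isUnit_specDiff i)

/-- The series obtained by integrating a series against the kernel function. -/
def kernelSeries (m c : ℤ) (φ : ℕ → RatRing (Fin n)) (j : ℕ) : RatRing (Option (Fin n)) :=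
  -- The parameter `m + 1` belongs to the weight `τ_i^m`. The bracket has degree `-(j - l)` in the
  -- spectral variables and `φ l` has degree `-l`, so the total is `-j`.
  ∑ l ∈ Finset.range (j + 1), bracket ((m : ℂ) + 1) (specDiff n) (j - l)
    (kerUnit n m c * shiftHom n (φ l))

variable {m c : ℤ}

theorem dx_bracket (p : ℂ) (N : ℕ) (o : Option (Fin n)) (g : KerRing n) :
    dx o (bracket p (specDiff n) N g) = bracket p (specDiff n) N (coeffDer (dx o) g) := by
  rw [der_bracket (dx o) p (dx_inverse_specDiff o)]; simp

/-- By translation invariance `∂_y U = -∑ ∂_i U`, so the gradient of `U` in the direction of the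
spectral variables is `-∑ (μ - λ_i) ∂_i U`, and each `∂_i U` contains a factor `τ_i`. The factor `μ
- λ_i` is the one that integration by parts consumes. -/
theorem gradRat_bracket (p : ℂ) (N : ℕ) (f : RatRing (Fin n)) :
    gradRat (bracket p (specDiff n) N (kerUnit n m c * shiftHom n f)) =
      bracket p (specDiff n) N (kerUnit n m c * shiftHom n (gradRat f)) -
        ∑ i, specDiff n i * bracket p (specDiff n) N
          (MvPowerSeries.X i * (kerEta m c i * (kerUnit n m c : KerRing n) * shiftHom n f)) := by
  simp only [gradRat_apply, dx_bracket, ← smul_eq_mul (a := sc _), ← map_smul, ← map_sum]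
  simp only [← smul_eq_mul (a := specDiff n _), ← map_smul, ← map_sum, ← map_sub]
  congr 1
  have h0 := sum_coeffDer_kerUnit (n := n) m c
  have h1 : ∀ i, coeffDer (dx (some i)) (kerUnit n m c : KerRing n) =
      MvPowerSeries.X i * (kerEta m c i * (kerUnit n m c : KerRing n)) := fun i => by
    rw [coeffDer_some_kerUnit, kerEll_eq]; ring
  rw [Fintype.sum_option] at h0
  simp only [h1] at h0
  have h2 := eq_neg_of_add_eq_zero_left h0
  rw [Fintype.sum_option]
  simp only [Derivation.leibniz, smul_eq_mul, coeffDer_none_shiftHom, coeffDer_some_shiftHom, h1,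
    h2, map_sum, map_mul, shiftHom_sc, specDiff, ← C_mul_eq_smul, map_sub, mul_zero, zero_add,
    mul_neg, Finset.mul_sum]
  rw [← Finset.sum_neg_distrib, ← Finset.sum_add_distrib, ← Finset.sum_sub_distrib]
  refine Finset.sum_congr rfl fun i _ => ?_
  ring

theorem lapRat_bracket (p : ℂ) (N : ℕ) {q : Option (Fin n) → ℂ} (hq1 : ∀ i, q (some i) = 1)
    (g : KerRing n) :
    lapRat q (bracket p (specDiff n) N g) = bracket p (specDiff n) N
      (∑ i, coeffDer (dx (some i)) (coeffDer (dx (some i)) g) +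
      (q none)⁻¹ • coeffDer (dx none) (coeffDer (dx none) g)) := by
  rw [lapRat_apply, Fintype.sum_option, map_add, map_sum, bracket_csmul, add_comm]
  simp only [dx_bracket, hq1, inv_one, one_smul]

/-- By Leibniz the only new terms are the cross terms `2 ∂_i U ∂_i f = 2 τ_i η U ∂_i f`. They are
exactly what `2 θ_i` produces when it falls on the shifted `f`. -/
theorem kernel_equation {q : Option (Fin n) → ℂ} (hq1 : ∀ i, q (some i) = 1)
    (hq : q none * m = c) (hM : (q none)⁻¹ * c = m) (hc : (c - 1) * (c - m) = 0)
    {U : KerRing n} (hU : U = kerUnit n m c) (f : RatRing (Fin n)) :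
    ∑ i, coeffDer (dx (some i)) (coeffDer (dx (some i)) (U * shiftHom n f)) +
      (q none)⁻¹ • coeffDer (dx none) (coeffDer (dx none) (U * shiftHom n f)) -
      MvPowerSeries.C (potRat m q) * (U * shiftHom n f) =
    2 * ∑ i, (thetaDer i (kerEta m c i * U * shiftHom n f) +
      ((m : ℂ) + 1) • (kerEta m c i * U * shiftHom n f)) +
      U * shiftHom n (lapRat (fun _ => 1) f - (potRat m fun _ => 1) * f) := by
  have h := kernel_identity hq1 hq hM hc hU
  have h1 : ∀ i, coeffDer (dx (some i)) U = MvPowerSeries.X i * (kerEta m c i * U) := fun i => by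
    rw [hU, coeffDer_some_kerUnit, kerEll_eq]; ring
  have e1 : ∀ i, coeffDer (dx (some i)) (coeffDer (dx (some i)) (U * shiftHom n f)) =
      coeffDer (dx (some i)) (coeffDer (dx (some i)) U) * shiftHom n f +
      2 * (MvPowerSeries.X i * (kerEta m c i * U) * shiftHom n (dx i f)) +
      U * shiftHom n (dx i (dx i f)) := fun i => by
    simp only [Derivation.leibniz, smul_eq_mul, coeffDer_some_shiftHom, map_add]
    rw [h1]
    ring
  have e2 : ∀ i, thetaDer i (kerEta m c i * U * shiftHom n f) =
      thetaDer i (kerEta m c i * U) * shiftHom n f +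
      MvPowerSeries.X i * (kerEta m c i * U) * shiftHom n (dx i f) := fun i => by
    rw [Derivation.leibniz, thetaDer_shiftHom, smul_eq_mul, smul_eq_mul]
    ring
  have e3 : coeffDer (dx none) (coeffDer (dx none) (U * shiftHom n f)) =
      coeffDer (dx none) (coeffDer (dx none) U) * shiftHom n f := by
    simp only [Derivation.leibniz, smul_eq_mul, coeffDer_none_shiftHom, mul_zero, zero_add]
    ring
  simp only [e1, e2, e3, lapRat_apply, inv_one, one_smul, map_sub, map_sum, map_mul]
  simp only [Finset.sum_add_distrib, Algebra.smul_def, ← Finset.mul_sum, ← Finset.sum_mul] at h ⊢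
  simp only [← mul_assoc] at h ⊢
  linear_combination shiftHom n f * h

theorem bracket_kernel_equation (p : ℂ) (N : ℕ) {q : Option (Fin n) → ℂ}
    (hq1 : ∀ i, q (some i) = 1)
    (hq : q none * m = c) (hM : (q none)⁻¹ * c = m) (hc : (c - 1) * (c - m) = 0)
    {U : KerRing n} (hU : U = kerUnit n m c) (f : RatRing (Fin n)) :
    lapRat q (bracket p (specDiff n) N (U * shiftHom n f)) -
      potRat m q * bracket p (specDiff n) N (U * shiftHom n f) =
    2 * bracket p (specDiff n) N (∑ i, (thetaDer i (kerEta m c i * U * shiftHom n f) +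
      ((m : ℂ) + 1) • (kerEta m c i * U * shiftHom n f))) +
      bracket p (specDiff n) N
        (U * shiftHom n (lapRat (fun _ => 1) f - (potRat m fun _ => 1) * f)) := by
  have h := congrArg (bracket p (specDiff n) N) (kernel_equation hq1 hq hM hc hU f)
  rw [map_sub, C_mul_eq_smul, map_smul, smul_eq_mul, map_add _ (2 * _), two_mul (∑ i, _),
    map_add _ (∑ i, (_ + _)), ← two_mul] at h
  rw [lapRat_bracket _ _ hq1]
  exact h

theorem constantCoeff_unitDiff {a b a' b' : Option (Fin n) ⊕ Fin n} (ha : kerBase a = kerBase a')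
    (hb : kerBase b = kerBase b') :
    Units.map (MvPowerSeries.constantCoeff (σ := Fin n)
      (R := RatRing (Option (Fin n)))).toMonoidHom (unitDiff a b) =
    Units.map (MvPowerSeries.constantCoeff (σ := Fin n)
      (R := RatRing (Option (Fin n)))).toMonoidHom (unitDiff a' b') := by
  by_cases h : kerBase a = kerBase b
  · rw [unitDiff, dif_neg (by simpa using h), unitDiff, dif_neg (by rw [← ha, ← hb]; simpa using h)]
  · ext
    change MvPowerSeries.constantCoeff (unitDiff a b : KerRing n) =
      MvPowerSeries.constantCoeff (unitDiff a' b' : KerRing n)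
    rw [val_unitDiff h, val_unitDiff (by rw [← ha, ← hb]; exact h), map_sub, map_sub,
      constantCoeff_kerPt, constantCoeff_kerPt, constantCoeff_kerPt, constantCoeff_kerPt, ha, hb]

/-- At `τ = 0` every `X_i` becomes `x_i` and the factors cancel. Hence the transform of a series
again starts with 1. -/
theorem constantCoeff_kerUnit (m c : ℤ) :
    MvPowerSeries.constantCoeff (kerUnit n m c : KerRing n) = 1 := by
  have : Units.map (MvPowerSeries.constantCoeff (σ := Fin n)
      (R := RatRing (Option (Fin n)))).toMonoidHom (kerUnit n m c) = 1 := by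
    simp only [kerUnit, map_mul, map_zpow, map_prod, map_inv]
    have h1 : ∀ i : Fin n, _ := fun i => constantCoeff_unitDiff (a := ptX i) (a' := ptx i)
      (b := pty) (b' := pty) rfl rfl
    have h2 : ∀ i j : Fin n, _ := fun i j => constantCoeff_unitDiff (a := ptX i) (a' := ptx i)
      (b := ptX j) (b' := ptx j) rfl rfl
    have h3 : ∀ i j : Fin n, _ := fun i j => constantCoeff_unitDiff (a := ptX i) (a' := ptx i)
      (b := ptx j) (b' := ptx j) rfl rfl
    have h4 : ∀ i j : Fin n, _ := fun i j => constantCoeff_unitDiff (a := ptx i) (a' := ptx i)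
      (b := ptX j) (b' := ptx j) rfl rfl
    simp only [h1, h2, h3, h4]
    simp
  exact congrArg Units.val this

/-- Integration by parts lowers the degree of the bracket from `j + 1 - l` to `j - l`. At the ends,
`φ 0 = 1` has zero gradient, and the bracket of degree zero kills multiples of `τ_i`. -/
theorem gradRat_kernelSeries {φ : ℕ → RatRing (Fin n)} (h0 : φ 0 = 1) (j : ℕ) :
    gradRat (kernelSeries m c φ (j + 1)) =
      ∑ l ∈ Finset.range (j + 1), (bracket ((m : ℂ) + 1) (specDiff n) (j - l)
        ((kerUnit n m c : KerRing n) * shiftHom n (gradRat (φ (l + 1)))) -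
        bracket ((m : ℂ) + 1) (specDiff n) (j - l)
          (∑ i, (thetaDer i (kerEta m c i * (kerUnit n m c : KerRing n) * shiftHom n (φ l)) +
            ((m : ℂ) + 1) • (kerEta m c i * (kerUnit n m c : KerRing n) * shiftHom n (φ l))))) := by
  rw [kernelSeries, map_sum]
  simp only [gradRat_bracket, Finset.sum_sub_distrib]
  congr 1
  · rw [Finset.sum_range_succ', h0, Derivation.map_one_eq_zero, map_zero, mul_zero,
      map_zero, add_zero]
    exact Finset.sum_congr rfl fun l _ => by rw [Nat.add_sub_add_right]
  · rw [Finset.sum_range_succ, Nat.sub_self]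
    simp only [bracket_zero_X_mul, mul_zero, Finset.sum_const_zero, add_zero]
    refine Finset.sum_congr rfl fun l hl => ?_
    rw [Nat.succ_sub (Nat.lt_succ_iff.mp (Finset.mem_range.mp hl)), map_sum]
    refine Finset.sum_congr rfl fun i _ => ?_
    have h := bracket_X_mul ((m : ℂ) + 1) i (isUnit_specDiff i) (j - l)
      (kerEta m c i * (kerUnit n m c : KerRing n) * shiftHom n (φ l))
    exact h

/-- Integration against the kernel function maps series to series. -/
theorem IsSeries.kernelSeries {φ : ℕ → RatRing (Fin n)} (hφ : IsSeries m (fun _ => 1) φ)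
    {q : Option (Fin n) → ℂ} (hq1 : ∀ i, q (some i) = 1)
    (hq : q none * m = c) (hM : (q none)⁻¹ * c = m) (hc : (c - 1) * (c - m) = 0) :
    IsSeries m q (kernelSeries m c φ) where
  zero := by
    rw [CalogeroBA.kernelSeries, Finset.sum_range_one, Nat.sub_zero, bracket_zero, hφ.zero, map_one,
      mul_one]
    exact constantCoeff_kerUnit m c
  eulerX j := by
    rw [CalogeroBA.kernelSeries, map_sum, Finset.smul_sum]
    refine Finset.sum_congr rfl fun l hl => ?_
    rw [der_bracket _ _ eulerX_inverse_specDiff, zero_mul, zero_smul, add_zero]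
    have h1 := coeffDer_eulerX_shiftHom (φ l)
    have h2 := coeffDer_eulerX_kerUnit (n := n) m c
    rw [hφ.eulerX, shiftHom_smul] at h1
    have h3 : coeffDer CalogeroBA.eulerX ((kerUnit n m c : KerRing n) * shiftHom n (φ l)) =
        (-(l : ℂ)) • ((kerUnit n m c : KerRing n) * shiftHom n (φ l)) -
          ∑ i, thetaDer i ((kerUnit n m c : KerRing n) * shiftHom n (φ l)) := by
      simp only [Derivation.leibniz, smul_eq_mul, Finset.sum_add_distrib, ← Finset.mul_sum]
      rw [eq_sub_of_add_eq h1, eq_neg_of_add_eq_zero_left h2, mul_sub, mul_smul_comm]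
      ring
    rw [h3, map_sub, bracket_csmul, bracket_sum_thetaDer, ← sub_smul]
    congr 1
    push_cast [Nat.lt_succ_iff.mp (Finset.mem_range.mp hl)]
    ring
  eulerL j := by
    rw [CalogeroBA.kernelSeries, map_sum, Finset.smul_sum]
    refine Finset.sum_congr rfl fun l hl => ?_
    rw [der_bracket _ _ eulerL_inverse_specDiff, Derivation.leibniz, coeffDer_eulerL_kerUnit,
      coeffDer_eulerL_shiftHom, hφ.eulerL, shiftHom_smul, smul_zero, add_zero, smul_eq_mul,
      mul_smul_comm, bracket_csmul, ← add_smul]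
    congr 1
    push_cast [Nat.lt_succ_iff.mp (Finset.mem_range.mp hl)]
    ring
  recursion j := by
    set U : KerRing n := (kerUnit n m c : KerRing n) with hU
    set p : ℂ := (m : ℂ) + 1 with hp
    have hgrad := gradRat_kernelSeries (m := m) (c := c) hφ.zero j
    rw [← hU, ← hp] at hgrad
    rw [hgrad, CalogeroBA.kernelSeries, map_sum, Finset.mul_sum, Finset.mul_sum,
      ← Finset.sum_sub_distrib, ← Finset.sum_add_distrib]
    refine Finset.sum_eq_zero fun l _ => ?_
    rw [bracket_kernel_equation _ _ hq1 hq hM hc hU]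
    -- The total derivatives from the gradient and from the kernel equation cancel. What remains is
    -- the transform of the recursion for `φ`.
    have h : bracket p (specDiff n) (j - l) (2 * (U * shiftHom n (gradRat (φ (l + 1)))) +
        U * shiftHom n (lapRat (fun _ => 1) (φ l) - (potRat m fun _ => 1) * φ l)) = 0 := by
      have h := congrArg (fun f => U * shiftHom n f) (hφ.recursion l)
      simp only [map_add, map_mul, map_ofNat, map_zero, mul_zero] at h
      rw [← map_zero (bracket p (specDiff n) (j - l)), ← h]
      congr 1
      ring
    rw [map_add, two_mul (U * _), map_add] at h
    linear_combination h

end Kernel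

/-! ### Rational functions regular along a wall -/

section Regular

/-- The substitution of one variable for another. -/
def identify {σ : Type*} [DecidableEq σ] (v u : σ) : MvPolynomial σ ℂ →ₐ[ℂ] MvPolynomial σ ℂ :=
  aeval (Function.update X v (X u))

theorem identify_X {σ : Type*} [DecidableEq σ] (v u w : σ) :
    identify v u (X w) = if w = v then X u else X w := by
  rw [identify, aeval_X, Function.update_apply]

theorem sub_dvd_sub_identify {σ : Type*} [DecidableEq σ] (v u : σ) (P : MvPolynomial σ ℂ) :
    X v - X u ∣ P - identify v u P := by
  induction P using MvPolynomial.induction_on with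
  | C a => simp [identify]
  | add p q hp hq =>
    rw [map_add, add_sub_add_comm]
    exact dvd_add hp hq
  | mul_X p w hp =>
    have h : X v - X u ∣ X w - identify v u (X w) := by
      rw [identify_X]
      split_ifs with h
      · rw [h]
      · simp
    have e : p * X w - identify v u (p * X w) =
        (p - identify v u p) * X w + identify v u p * (X w - identify v u (X w)) := by
      rw [map_mul]; ring
    rw [e]
    exact dvd_add (hp.mul_right _) (h.mul_left _)

theorem sub_dvd_of_identify_eq_zero {σ : Type*} [DecidableEq σ] {v u : σ} {P : MvPolynomial σ ℂ}
    (h : identify v u P = 0) : X v - X u ∣ P := by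
  simpa [h] using sub_dvd_sub_identify v u P

theorem eval_identify {σ : Type*} [DecidableEq σ] (v u : σ) (P : MvPolynomial σ ℂ) (z : σ → ℂ) :
    eval z (identify v u P) = eval (Function.update z v (z u)) P := by
  induction P using MvPolynomial.induction_on with
  | C a => simp [identify]
  | add p q hp hq => simp only [map_add, hp, hq]
  | mul_X p w hp =>
    rw [map_mul, map_mul, map_mul, hp, identify_X, eval_X, Function.update_apply]
    split_ifs <;> simp

variable {ι : Type*} [Fintype ι] [DecidableEq ι]

/-- The rational function `f` is regular at a generic point where the variables `v` and `u`
coincide. -/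
def RegularAt (v u : ι ⊕ ι) (f : RatRing ι) : Prop :=
  ∃ G N : PolyRing ι, identify v u G ≠ 0 ∧ toRat G * f = toRat N

variable {v u : ι ⊕ ι} {f g : RatRing ι}

theorem regularAt_toRat (P : PolyRing ι) : RegularAt v u (toRat P) :=
  ⟨1, P, by simp, by simp⟩

theorem RegularAt.add (hf : RegularAt v u f) (hg : RegularAt v u g) : RegularAt v u (f + g) := by
  obtain ⟨G, N, h0, h⟩ := hf
  obtain ⟨G', N', h0', h'⟩ := hg
  refine ⟨G * G', N * G' + N' * G, by rw [map_mul]; exact mul_ne_zero h0 h0', ?_⟩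
  rw [map_add, map_mul, map_mul, map_mul, ← h, ← h']
  ring

theorem RegularAt.mul (hf : RegularAt v u f) (hg : RegularAt v u g) : RegularAt v u (f * g) := by
  obtain ⟨G, N, h0, h⟩ := hf
  obtain ⟨G', N', h0', h'⟩ := hg
  refine ⟨G * G', N * N', by rw [map_mul]; exact mul_ne_zero h0 h0', ?_⟩
  rw [map_mul, map_mul, ← h, ← h']
  ring

theorem RegularAt.smul (c : ℂ) (hf : RegularAt v u f) : RegularAt v u (c • f) := by
  rw [Algebra.smul_def, algebraMap_rat]
  exact (regularAt_toRat _).mul hf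

theorem RegularAt.neg (hf : RegularAt v u f) : RegularAt v u (-f) := by
  simpa using hf.smul (-1)

theorem RegularAt.sub (hf : RegularAt v u f) (hg : RegularAt v u g) : RegularAt v u (f - g) := by
  rw [sub_eq_add_neg]
  exact hf.add hg.neg

theorem RegularAt.sum {β : Type*} {s : Finset β} {F : β → RatRing ι}
    (h : ∀ i ∈ s, RegularAt v u (F i)) : RegularAt v u (∑ i ∈ s, F i) :=
  Finset.sum_induction F (RegularAt v u) (fun _ _ => RegularAt.add)
    (by simpa using regularAt_toRat (v := v) (u := u) (0 : PolyRing ι)) h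

theorem RegularAt.dv (w : ι ⊕ ι) (hf : RegularAt v u f) : RegularAt v u (dv w f) := by
  obtain ⟨G, N, h0, h⟩ := hf
  refine ⟨G * G, G * pderiv w N - pderiv w G * N, by rw [map_mul]; exact mul_ne_zero h0 h0, ?_⟩
  have h1 := congrArg (CalogeroBA.dv w) h
  rw [Derivation.leibniz, dv_toRat, dv_toRat, smul_eq_mul, smul_eq_mul] at h1
  rw [map_sub, map_mul, map_mul, map_mul, ← h, ← h1]
  ring

theorem regularAt_sp (a : ι) : RegularAt v u (sp a) := regularAt_toRat _

theorem regularAt_sc (a : ι) : RegularAt v u (sc a) := regularAt_toRat _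

theorem RegularAt.lapRat (q : ι → ℂ) (hf : RegularAt v u f) : RegularAt v u (lapRat q f) := by
  rw [lapRat_apply]
  exact RegularAt.sum fun o _ => ((hf.dv _).dv _).smul _

theorem RegularAt.gradRat (hf : RegularAt v u f) : RegularAt v u (gradRat f) := by
  rw [gradRat_apply]
  exact RegularAt.sum fun o _ => (regularAt_sc o).mul (hf.dv _)

theorem regularAt_inverse_sub {a b c d : ι} (h : c ≠ d → (if c = a then b else c) ≠
    if d = a then b else d) :
    RegularAt (Sum.inl a) (Sum.inl b) (Ring.inverse (sp c - sp d)) := by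
  by_cases hcd : c = d
  · subst hcd
    simpa using regularAt_toRat (0 : PolyRing ι)
  · refine ⟨X (Sum.inl c) - X (Sum.inl d), 1, ?_, ?_⟩
    · rw [map_sub, identify_X, identify_X]
      simp only [Sum.inl.injEq, ← apply_ite X, ← apply_ite Sum.inl]
      exact X_sub_X_ne_zero fun e => h hcd (Sum.inl_injective e)
    · rw [map_sub, map_one]
      exact Ring.mul_inverse_cancel _ (isUnit_sp_sub hcd)

/-- A pole that is not there. -/
theorem eq_toRat_of_regularAt (hvu : v ≠ u) {N : PolyRing ι} (h : toRat (X v - X u) * f = toRat N)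
    (hf : RegularAt v u f) : ∃ N', f = toRat N' := by
  obtain ⟨G, N₁, h0, h1⟩ := hf
  have h2 : G * N = (X v - X u) * N₁ := by
    apply toRat_injective
    rw [map_mul, map_mul, ← h, ← h1]; ring
  have h3 := congrArg (identify v u) h2
  rw [map_mul, map_mul, map_sub, identify_X, identify_X, if_pos rfl] at h3
  -- Putting `v = u` annihilates the right-hand side while `G` stays nonzero, so `N` vanishes on the
  -- wall and is divisible by `v - u`.
  have h4 : identify v u N = 0 := by
    have : (X u : PolyRing ι) - (if u = v then X u else X u) = 0 := by split_ifs <;> simp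
    rw [this, zero_mul] at h3
    exact (mul_eq_zero.mp h3).resolve_left h0
  obtain ⟨N', rfl⟩ := sub_dvd_of_identify_eq_zero h4
  refine ⟨N', ?_⟩
  rw [map_mul] at h
  exact mul_left_cancel₀ ((map_ne_zero_iff _ toRat_injective).mpr (X_sub_X_ne_zero hvu)) h

/-- Only the ordered pairs `(a, b)` and `(b, a)` have a pole on this wall. For charges 1 they add up
to the subtracted term. -/
theorem potRat_regular {m : ℂ} {q : ι → ℂ} {a b : ι} (hab : a ≠ b) (ha : q a = 1) (hb : q b = 1) :
    RegularAt (Sum.inl a) (Sum.inl b)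
      (potRat m q - (2 * (m * (m + 1))) • Ring.inverse (sp a - sp b) ^ 2) := by
  set t : ι → ι → RatRing ι := fun c d =>
    (coup m q c d / 2) • Ring.inverse (sp c - sp d) ^ 2 with ht
  have e1 : ∀ c d : ι, (Ring.inverse (sp c - sp d) : RatRing ι) ^ 2 =
      Ring.inverse (sp d - sp c) ^ 2 := by
    intro c d
    by_cases h : c = d
    · rw [h]
    have h1 := Ring.mul_inverse_cancel _ (isUnit_sp_sub h)
    have h2 := Ring.mul_inverse_cancel _ (isUnit_sp_sub (Ne.symm h))
    have : (Ring.inverse (sp d - sp c) : RatRing ι) = -Ring.inverse (sp c - sp d) := by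
      apply (isUnit_sp_sub h).mul_left_cancel
      linear_combination h1 - h2
    rw [this, neg_sq]
  have e2 : potRat m q - (2 * (m * (m + 1))) • Ring.inverse (sp a - sp b) ^ 2 =
      ∑ p : ι × ι, if p = (a, b) ∨ p = (b, a) then 0 else t p.1 p.2 := by
    have h1 : potRat m q = ∑ p : ι × ι, t p.1 p.2 := by
      rw [Fintype.sum_prod_type]; rfl
    have h2 : ∑ p : ι × ι, (if p = (a, b) ∨ p = (b, a) then t p.1 p.2 else 0) =
        (2 * (m * (m + 1))) • Ring.inverse (sp a - sp b) ^ 2 := by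
      rw [← Finset.sum_filter]
      have : Finset.univ.filter (fun p : ι × ι => p = (a, b) ∨ p = (b, a)) =
          {(a, b), (b, a)} := by ext; simp
      rw [this, Finset.sum_pair (by simp [hab])]
      simp only [ht, e1 b a, coup, ha, hb, ← add_smul]
      congr 1
      ring
    rw [h1, ← h2, ← Finset.sum_sub_distrib]
    refine Finset.sum_congr rfl fun p _ => ?_
    split_ifs <;> simp
  rw [e2]
  refine RegularAt.sum fun p _ => ?_
  split_ifs with h
  · simpa using regularAt_toRat (0 : PolyRing ι)
  · refine RegularAt.smul _ ?_
    rw [pow_two]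
    have := regularAt_inverse_sub (a := a) (b := b) (c := p.1) (d := p.2) (by
      intro hne
      push Not at h
      by_cases h1 : p.1 = a <;> by_cases h2 : p.2 = a <;> simp only [h1, h2, if_true, if_false]
      · exact absurd (h1.trans h2.symm) hne
      · intro h3; exact h.1 (Prod.ext h1 h3.symm)
      · intro h3; exact h.2 (Prod.ext h3 h2)
      · exact hne)
    exact this.mul this

/-- The possible orders of the pole of a wave function. -/
theorem regularAt_of_schrRat {m : ℂ} {q : ι → ℂ} {a b : ι} (hab : a ≠ b) (ha : q a = 1)
    (hb : q b = 1) {k : ℕ} (hm : m * (m + 1) = k * (k + 1)) (hf : schrRat m q f = 0) {r : ℕ}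
    (hr : k ≤ r) (h : RegularAt (Sum.inl a) (Sum.inl b) ((sp a - sp b) ^ (r + 1) * f)) :
    RegularAt (Sum.inl a) (Sum.inl b) ((sp a - sp b) ^ r * f) := by
  have hlu : IsUnit (sp a - sp b : RatRing ι) := isUnit_sp_sub hab
  have hpreg' := potRat_regular (m := m) hab ha hb
  have hlreg : RegularAt (Sum.inl a) (Sum.inl b) (sp a - sp b : RatRing ι) :=
    (regularAt_sp a).sub (regularAt_sp b)
  obtain ⟨l, hl⟩ : ∃ l : RatRing ι, l = sp a - sp b := ⟨_, rfl⟩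
  rw [← hl] at h hlu hpreg' hlreg ⊢
  -- With `l = x_a - x_b`, the function `w` is regular and `s = r + 1` bounds the order of the pole;
  -- the bound is to be lowered by one.
  obtain ⟨w, hw⟩ : ∃ w, w = l ^ (r + 1) * f := ⟨_, rfl⟩
  rw [← hw] at h
  obtain ⟨s, hs⟩ : ∃ s : RatRing ι, s = (r : RatRing ι) + 1 := ⟨_, rfl⟩
  have d1 : ∀ o, l ^ (r + 2) * dx o f = l * dx o w - s * dx o l * w := by
    intro o
    rw [hw, Derivation.leibniz, Derivation.leibniz_pow, smul_eq_mul, smul_eq_mul, smul_eq_mul,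
      nsmul_eq_mul, Nat.add_sub_cancel, hs]
    push_cast
    ring
  have d2 : ∀ o, dx o (dx o l) = 0 := by
    intro o
    rw [hl, map_sub, dx_sp, dx_sp]
    split_ifs <;> simp
  have d3 : ∀ o, l ^ (r + 3) * dx o (dx o f) =
      l ^ 2 * dx o (dx o w) - 2 * s * l * (dx o l * dx o w) + s * (s + 1) * (dx o l ^ 2 * w) := by
    intro o
    have h1 := congrArg (dx o) (d1 o)
    have hs0 : dx o s = 0 := by simp [hs]
    rw [map_sub, Derivation.leibniz, Derivation.leibniz, Derivation.leibniz, Derivation.leibniz,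
      Derivation.leibniz_pow, d2, hs0] at h1
    simp only [smul_eq_mul, nsmul_eq_mul, mul_zero, add_zero] at h1
    push_cast at h1
    linear_combination l * h1 - (s + 1) * dx o l * d1 o + l ^ (r + 2) * dx o l * dx o f * hs
  have hda : dx a l = 1 := by rw [hl, map_sub, dx_sp, dx_sp, if_pos rfl, if_neg hab.symm, sub_zero]
  have hdb : dx b l = -1 := by rw [hl, map_sub, dx_sp, dx_sp, if_pos rfl, if_neg hab, zero_sub]
  have hdo : ∀ o, o ≠ a → o ≠ b → dx o l = 0 := fun o h1 h2 => by
    rw [hl, map_sub, dx_sp, dx_sp, if_neg (Ne.symm h1), if_neg (Ne.symm h2), sub_zero]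
  have sum_two : ∀ F : ι → RatRing ι, (∀ o, o ≠ a → o ≠ b → F o = 0) →
      ∑ o, F o = F a + F b := by
    intro F hF
    rw [← Finset.sum_pair hab]
    symm
    refine Finset.sum_subset (Finset.subset_univ _) fun o _ ho => hF o ?_ ?_ <;>
      (rintro rfl; simp at ho)
  have e1 : l ^ (r + 3) * lapRat q f = l ^ 2 * lapRat q w - 2 * s * l * (dx a w - dx b w) +
      2 * (s * (s + 1)) * w := by
    rw [lapRat_apply, lapRat_apply, Finset.mul_sum, Finset.mul_sum]
    simp only [mul_smul_comm, d3, smul_add, smul_sub, Finset.sum_add_distrib,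
      Finset.sum_sub_distrib]
    rw [sum_two (fun o => (q o)⁻¹ • (2 * s * l * (dx o l * dx o w)))
      (fun o h1 h2 => by simp [hdo o h1 h2]),
      sum_two (fun o => (q o)⁻¹ • (s * (s + 1) * (dx o l ^ 2 * w)))
      (fun o h1 h2 => by simp [hdo o h1 h2]), ha, hb, hda, hdb]
    simp only [inv_one, one_smul]
    ring
  have e2 : l ^ (r + 2) * gradRat f = l * gradRat w - s * (sc a - sc b) * w := by
    rw [gradRat_apply, gradRat_apply, Finset.mul_sum, Finset.mul_sum]
    have : ∀ o, l ^ (r + 2) * (sc o * dx o f) =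
        l * (sc o * dx o w) - s * (sc o * dx o l) * w := fun o => by
      linear_combination sc o * d1 o
    simp only [this, Finset.sum_sub_distrib]
    rw [sum_two (fun o => s * (sc o * dx o l) * w)
      (fun o h1 h2 => by simp [hdo o h1 h2]), hda, hdb]
    ring
  obtain ⟨p, hp⟩ : ∃ p, p = potRat m q - (2 * (m * (m + 1))) • Ring.inverse l ^ 2 := ⟨_, rfl⟩
  have hpreg : RegularAt (Sum.inl a) (Sum.inl b) p := hp ▸ hpreg'
  have e3 : l ^ 2 * potRat m q = l ^ 2 * p + 2 * ((k : RatRing ι) * (k + 1)) := by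
    have h1 := Ring.mul_inverse_cancel l hlu
    rw [hp, hm, Algebra.smul_def]
    simp only [map_mul, map_add, map_ofNat, map_natCast, map_one]
    linear_combination (2 * ((k : RatRing ι) * (k + 1)) * (l * Ring.inverse l + 1)) * h1
  -- The most singular part of the equation carries the indicial factor `2s(s+1) - 2k(k+1)`; the
  -- remaining terms are regular after one factor `l` is cancelled.
  have key : (2 * (s * (s + 1)) - 2 * ((k : RatRing ι) * (k + 1))) * (l ^ r * f) =
      -(l * lapRat q w - 2 * s * (dx a w - dx b w) + 2 * (l * gradRat w)
        - 2 * (s * (sc a - sc b) * w) - l * (p * w)) := by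
    apply hlu.mul_left_cancel
    rw [schrRat] at hf
    have hw' : l * (l ^ r * f) = w := by rw [hw]; ring
    linear_combination l ^ (r + 3) * hf - e1 - 2 * l * e2 + w * e3 + l ^ 2 * potRat m q * hw' +
      (2 * (s * (s + 1)) - 2 * ((k : RatRing ι) * (k + 1))) * hw'
  have h2reg : RegularAt (Sum.inl a) (Sum.inl b) (2 : RatRing ι) := by
    have := regularAt_toRat (v := Sum.inl a) (u := Sum.inl b) (2 : PolyRing ι)
    rwa [map_ofNat] at this
  have hsreg : RegularAt (Sum.inl a) (Sum.inl b) s := by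
    have := regularAt_toRat (v := Sum.inl a) (u := Sum.inl b) ((r : PolyRing ι) + 1)
    rwa [map_add, map_natCast, map_one, ← hs] at this
  have hreg := ((((((hlreg.mul (h.lapRat q)).sub ((h2reg.mul hsreg).mul
    ((h.dv (Sum.inl a)).sub (h.dv (Sum.inl b))))).add (h2reg.mul (hlreg.mul h.gradRat))).sub
    (h2reg.mul ((hsreg.mul ((regularAt_sc a).sub (regularAt_sc b))).mul h))).sub
    (hlreg.mul (hpreg.mul h)))).neg
  rw [← key] at hreg
  set c : ℂ := 2 * ((r + 1) * (r + 1 + 1)) - 2 * (k * (k + 1)) with hc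
  -- The exponents at the wall are `-k` and `k + 1`, and `s = r + 1 > k` excludes the exponent `-s`.
  have hc0 : c ≠ 0 := by
    have h1 : k * (k + 1) < (r + 1) * (r + 1 + 1) := Nat.mul_lt_mul'' (by omega) (by omega)
    have h2 : ((k * (k + 1) : ℕ) : ℂ) ≠ (((r + 1) * (r + 1 + 1) : ℕ) : ℂ) := by
      exact_mod_cast h1.ne
    push_cast at h2
    rw [hc, ← mul_sub]
    exact mul_ne_zero two_ne_zero (sub_ne_zero.mpr h2.symm)
  have := hreg.smul c⁻¹
  have hcc : (2 * (s * (s + 1)) - 2 * ((k : RatRing ι) * (k + 1))) * (l ^ r * f) =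
      c • (l ^ r * f) := by
    rw [Algebra.smul_def, hc]
    simp only [map_mul, map_add, map_sub, map_ofNat, map_natCast, map_one, hs]
  rwa [hcc, smul_smul, inv_mul_cancel₀ hc0, one_smul] at this

theorem regularAt_pow_mul_of_schrRat {m : ℂ} {q : ι → ℂ} {a b : ι} (hab : a ≠ b) (ha : q a = 1)
    (hb : q b = 1) {k : ℕ} (hm : m * (m + 1) = k * (k + 1)) (hf : schrRat m q f = 0) (r : ℕ)
    (h : RegularAt (Sum.inl a) (Sum.inl b) ((sp a - sp b) ^ (k + r) * f)) :
    RegularAt (Sum.inl a) (Sum.inl b) ((sp a - sp b) ^ k * f) := by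
  induction r with
  | zero => exact h
  | succ r ih => exact ih (regularAt_of_schrRat hab ha hb hm hf (by omega) h)

/-- The product of `T` and `f` is a polynomial. -/
def IsPolyMul (T : PolyRing ι) (f : RatRing ι) : Prop := ∃ N, toRat T * f = toRat N

theorem IsPolyMul.of_dvd {T T' : PolyRing ι} (h : IsPolyMul T f) (hd : T ∣ T') :
    IsPolyMul T' f := by
  obtain ⟨N, hN⟩ := h
  obtain ⟨G, rfl⟩ := hd
  exact ⟨N * G, by rw [map_mul, map_mul, ← hN]; ring⟩

/-- Superfluous factors are cancelled one by one. The hypothesis covers every subset `t` because the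
other factors are still present at each stage. -/
theorem IsPolyMul.remove_factors {β : Type*} [DecidableEq β] {s : Finset β} {g : β → PolyRing ι}
    {T : PolyRing ι} (hstep : ∀ p ∈ s, ∀ t ⊆ s, IsPolyMul (g p * ((∏ i ∈ t, g i) * T)) f →
      IsPolyMul ((∏ i ∈ t, g i) * T) f) (h : IsPolyMul ((∏ i ∈ s, g i) * T) f) :
    IsPolyMul T f := by
  have : ∀ t, t ⊆ s → IsPolyMul ((∏ i ∈ t, g i) * T) f → IsPolyMul T f := by
    intro t
    induction t using Finset.induction_on with
    | empty => intro _ h; simpa using h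
    | insert p t hp ih =>
      intro hts h
      rw [Finset.prod_insert hp, mul_assoc] at h
      have hts' := (Finset.subset_insert p t).trans hts
      exact ih hts' (hstep p (hts (Finset.mem_insert_self _ _)) t hts' h)
  exact this s subset_rfl h

theorem IsPolyMul.of_regularAt {T : PolyRing ι} (hvu : v ≠ u)
    (h : IsPolyMul ((X v - X u) * T) f)
    (hr : RegularAt v u (toRat T * f)) : IsPolyMul T f := by
  obtain ⟨N, hN⟩ := h
  rw [map_mul, mul_assoc] at hN
  exact eq_toRat_of_regularAt hvu hN hr

end Regular

/-! ### Denominators of the coefficients of the kernel function -/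

section Denominators

/-- Rational functions whose denominator is a power of `d`. -/
def locSub {ι : Type*} [Fintype ι] [DecidableEq ι] (d : PolyRing ι) : Subring (RatRing ι) where
  carrier := {b | ∃ (M : ℕ) (N : PolyRing ι), toRat d ^ M * b = toRat N}
  mul_mem' := by
    rintro a b ⟨M, N, h⟩ ⟨M', N', h'⟩
    exact ⟨M + M', N * N', by rw [map_mul, ← h, ← h']; ring⟩
  one_mem' := ⟨0, 1, by simp⟩
  add_mem' := by
    rintro a b ⟨M, N, h⟩ ⟨M', N', h'⟩
    exact ⟨M + M', d ^ M' * N + d ^ M * N', by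
      rw [map_add, map_mul, map_mul, ← h, ← h', map_pow, map_pow]; ring⟩
  zero_mem' := ⟨0, 0, by simp⟩
  neg_mem' := by
    rintro a ⟨M, N, h⟩
    exact ⟨M, -N, by rw [map_neg, ← h]; ring⟩

section

variable {ι : Type*} [Fintype ι] [DecidableEq ι] {d : PolyRing ι}

theorem toRat_mem_locSub (P : PolyRing ι) : toRat P ∈ locSub d := ⟨0, P, by simp⟩

theorem inverse_mem_locSub {P : PolyRing ι} (hP : P ∣ d) :
    Ring.inverse (toRat P) ∈ locSub d := by
  by_cases hu : IsUnit (toRat P)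
  · obtain ⟨G, hG⟩ := hP
    refine ⟨1, G, ?_⟩
    rw [hG, map_mul, pow_one, mul_right_comm, Ring.mul_inverse_cancel _ hu, one_mul]
  · rw [Ring.inverse_non_unit _ hu]
    exact zero_mem _

theorem inverse_sub_mem_locSub {a b : ι}
    (h : a ≠ b → (X (Sum.inl a) - X (Sum.inl b) : PolyRing ι) ∣ d) :
    Ring.inverse (sp a - sp b) ∈ locSub d := by
  by_cases hab : a = b
  · subst hab; simp
  · rw [sp, sp, ← map_sub]
    exact inverse_mem_locSub (h hab)

end

variable {n : ℕ}

/-- Power series with coefficients in a subring. -/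
def psSub (S : Subring (RatRing (Option (Fin n)))) : Subring (KerRing n) :=
  (MvPowerSeries.map S.subtype).range

variable {S : Subring (RatRing (Option (Fin n)))}

theorem mem_psSub {g : KerRing n} :
    g ∈ psSub S ↔ ∀ α, MvPowerSeries.coeff α g ∈ S := by
  constructor
  · rintro ⟨g', rfl⟩ α
    rw [MvPowerSeries.coeff_map]
    exact (MvPowerSeries.coeff α g').2
  · intro h
    refine ⟨show MvPowerSeries (Fin n) S from fun α => ⟨MvPowerSeries.coeff α g, h α⟩, ?_⟩
    ext α
    exact MvPowerSeries.coeff_map _ _ _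

theorem C_mem_psSub {s : RatRing (Option (Fin n))} (h : s ∈ S) :
    (MvPowerSeries.C s : KerRing n) ∈ psSub S :=
  ⟨MvPowerSeries.C ⟨s, h⟩, by rw [MvPowerSeries.map_C]; rfl⟩

theorem X_mem_psSub (i : Fin n) : (MvPowerSeries.X i : KerRing n) ∈ psSub S :=
  ⟨MvPowerSeries.X i, MvPowerSeries.map_X _ _⟩

/-- A power series over `S` with constant term invertible in `S` has its inverse over `S`, so
inverting differences introduces no new denominators. -/
theorem mem_units_psSub {u : (KerRing n)ˣ} (h : (u : KerRing n) ∈ psSub S)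
    (hc : Ring.inverse (MvPowerSeries.constantCoeff (u : KerRing n)) ∈ S) :
    u ∈ (psSub S).toSubmonoid.units := by
  rw [Submonoid.mem_units_iff]
  refine ⟨h, ?_⟩
  obtain ⟨g, hg⟩ := h
  have h0 : IsUnit (MvPowerSeries.constantCoeff (u : KerRing n)) := u.isUnit.map _
  have h1 : S.subtype (MvPowerSeries.constantCoeff g) = MvPowerSeries.constantCoeff (u : KerRing n) := by
    rw [← hg, MvPowerSeries.constantCoeff_map]
  have hu : IsUnit g := by
    rw [MvPowerSeries.isUnit_iff_constantCoeff]
    refine IsUnit.of_mul_eq_one ⟨_, hc⟩ (Subtype.ext ?_)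
    change S.subtype (MvPowerSeries.constantCoeff g) * _ = 1
    rw [h1]
    exact Ring.mul_inverse_cancel _ h0
  obtain ⟨g, rfl⟩ := hu
  refine ⟨(↑g⁻¹ : MvPowerSeries (Fin n) S), ?_⟩
  apply u.isUnit.mul_left_cancel
  change (u : KerRing n) * MvPowerSeries.map S.subtype _ = (u : KerRing n) * (↑u⁻¹ : KerRing n)
  rw [Units.mul_inv, ← hg]
  change MvPowerSeries.map S.subtype _ * MvPowerSeries.map S.subtype _ = 1
  rw [← map_mul, Units.mul_inv, map_one]

theorem kerPt_mem_psSub (hS : ∀ P, toRat P ∈ S) (a : Option (Fin n) ⊕ Fin n) :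
    (kerPt a : KerRing n) ∈ psSub S := by
  cases a with
  | inl o => exact C_mem_psSub (hS _)
  | inr i => exact add_mem (C_mem_psSub (hS _)) (X_mem_psSub i)

theorem unitDiff_mem (hS : ∀ P, toRat P ∈ S) {a b : Option (Fin n) ⊕ Fin n}
    (h : Ring.inverse (sp (kerBase a) - sp (kerBase b)) ∈ S) :
    unitDiff a b ∈ (psSub S).toSubmonoid.units := by
  by_cases hab : kerBase a = kerBase b
  · rw [unitDiff, dif_neg (by simpa using hab)]
    exact one_mem _
  · refine mem_units_psSub ?_ ?_
    · rw [val_unitDiff hab]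
      exact sub_mem (kerPt_mem_psSub hS a) (kerPt_mem_psSub hS b)
    · rw [val_unitDiff hab, map_sub, constantCoeff_kerPt, constantCoeff_kerPt]
      exact h

theorem shiftHom_toRat_mem (hS : ∀ P, toRat P ∈ S) (P : PolyRing (Fin n)) :
    shiftHom n (toRat P) ∈ psSub S := by
  induction P using MvPolynomial.induction_on with
  | C a =>
    rw [← algebraMap_rat, shiftHom_algebraMap, algebraMap_powerSeries]
    exact C_mem_psSub (by rw [algebraMap_rat]; exact hS _)
  | add p q hp hq => rw [map_add, map_add]; exact add_mem hp hq
  | mul_X p v hp =>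
    rw [map_mul, map_mul]
    refine mul_mem hp ?_
    cases v with
    | inl i => rw [← sp, shiftHom_sp]; exact kerPt_mem_psSub hS _
    | inr i => rw [← sc, shiftHom_sc]; exact C_mem_psSub (hS _)

/-- The Vandermonde product of the positions of the first particles. -/
abbrev vdmX (n : ℕ) : PolyRing (Option (Fin n)) := vdm fun i => X (Sum.inl (some i))

/-- The Vandermonde product of the first spectral variables. -/
abbrev vdmL (n : ℕ) : PolyRing (Option (Fin n)) := vdm fun i => X (Sum.inr (some i))

/-- The product of the differences of the positions of the first particles and the last one. -/
abbrev crossX (n : ℕ) : PolyRing (Option (Fin n)) :=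
  cross (fun i => X (Sum.inl (some i))) (X (Sum.inl none))

/-- The product of the differences of the first spectral variables and the last one. -/
abbrev crossL (n : ℕ) : PolyRing (Option (Fin n)) :=
  cross (fun i => X (Sum.inr (some i))) (X (Sum.inr none))

theorem sub_dvd_vdm {R : Type*} [CommRing R] (x : Fin n → R) {i j : Fin n} (h : i ≠ j) :
    x i - x j ∣ vdm x := by
  have key : ∀ i j : Fin n, i < j → x i - x j ∣ vdm x := fun i j hij =>
    (Finset.dvd_prod_of_mem (fun j => x i - x j) (Finset.mem_Ioi.mpr hij)).trans
      (Finset.dvd_prod_of_mem (fun i => ∏ j ∈ Finset.Ioi i, (x i - x j)) (Finset.mem_univ i))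
  rcases lt_or_gt_of_ne h with h | h
  · exact key i j h
  · rw [← neg_sub, neg_dvd]
    exact key j i h

theorem sub_dvd_cross {R : Type*} [CommRing R] (x : Fin n → R) (y : R) (i : Fin n) :
    x i - y ∣ cross x y :=
  Finset.dvd_prod_of_mem (fun i => x i - y) (Finset.mem_univ i)

theorem map_vdm {R R' : Type*} [CommRing R] [CommRing R'] (f : R →+* R') (x : Fin n → R) :
    f (vdm x) = vdm fun i => f (x i) := by
  simp only [vdm, map_prod, map_sub]

theorem map_cross {R R' : Type*} [CommRing R] [CommRing R'] (f : R →+* R') (x : Fin n → R)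
    (y : R) : f (cross x y) = cross (fun i => f (x i)) (f y) := by
  simp only [cross, map_prod, map_sub]

theorem pair_inverse_mem {d : PolyRing (Option (Fin n))} (hd : vdmX n ∣ d) (i j : Fin n) :
    Ring.inverse (sp (some i) - sp (some j)) ∈ locSub d :=
  inverse_sub_mem_locSub fun h =>
    (sub_dvd_vdm (fun i => X (Sum.inl (some i))) (by simpa using h)).trans hd

/-- The part of the kernel function without the last particle. -/
def kerPairs (n : ℕ) (m : ℤ) : (KerRing n)ˣ :=
  (∏ i, ∏ j ∈ Finset.Ioi i, unitDiff (ptx i) (ptx j) * unitDiff (ptX i) (ptX j) *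
      (unitDiff (ptX i) (ptx j))⁻¹ * (unitDiff (ptx i) (ptX j))⁻¹) ^ (-m)

theorem kerPairs_mem {d : PolyRing (Option (Fin n))} (hd : vdmX n ∣ d) (m : ℤ) :
    kerPairs n m ∈ (psSub (locSub d)).toSubmonoid.units := by
  have h : ∀ a b : Option (Fin n) ⊕ Fin n, ∀ i j, kerBase a = some i → kerBase b = some j →
      unitDiff a b ∈ (psSub (locSub d)).toSubmonoid.units := fun a b i j ha hb =>
    unitDiff_mem toRat_mem_locSub (by rw [ha, hb]; exact pair_inverse_mem hd i j)
  refine zpow_mem (prod_mem fun i _ => prod_mem fun j _ => ?_) _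
  exact mul_mem (mul_mem (mul_mem (h _ _ i j rfl rfl) (h _ _ i j rfl rfl))
    (inv_mem (h _ _ i j rfl rfl))) (inv_mem (h _ _ i j rfl rfl))

theorem kerUnit_mem {d : PolyRing (Option (Fin n))} (hd : vdmX n ∣ d) (hd' : crossX n ∣ d)
    (m c : ℤ) : (kerUnit n m c : KerRing n) ∈ psSub (locSub d) := by
  have h : ∀ a : Option (Fin n) ⊕ Fin n, ∀ i, kerBase a = some i →
      unitDiff a pty ∈ (psSub (locSub d)).toSubmonoid.units := fun a i ha =>
    unitDiff_mem toRat_mem_locSub (by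
      rw [ha]
      exact inverse_sub_mem_locSub fun _ =>
        (sub_dvd_cross (fun i => X (Sum.inl (some i))) _ i).trans hd')
  have : kerUnit n m c ∈ (psSub (locSub d)).toSubmonoid.units :=
    mul_mem (kerPairs_mem hd m) (zpow_mem (prod_mem fun i _ =>
      mul_mem (h _ i rfl) (inv_mem (h _ i rfl))) c)
  exact ((Submonoid.mem_units_iff _ _).mp this).1

/-- For `c = 1` the poles at `x_i = y` come only from the unshifted product in the denominator, and
they are simple. The shifted product stands in the numerator. -/
theorem C_crossX_mul_kerUnit (m : ℤ) :
    MvPowerSeries.C (toRat (crossX n)) * (kerUnit n m 1 : KerRing n) =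
      (kerPairs n m : KerRing n) * ∏ i : Fin n, (kerPt (ptX i) - kerPt pty) := by
  have h1 : MvPowerSeries.C (toRat (crossX n)) =
      ((∏ i, unitDiff (ptx i) pty : (KerRing n)ˣ) : KerRing n) := by
    rw [map_cross, map_cross, Units.coe_prod, cross]
    refine Finset.prod_congr rfl fun i _ => ?_
    rw [val_unitDiff (by simp [kerBase])]
    rfl
  have h2 : (∏ i : Fin n, (kerPt (ptX i) - kerPt pty) : KerRing n) =
      ((∏ i, unitDiff (ptX i) pty : (KerRing n)ˣ) : KerRing n) := by
    rw [Units.coe_prod]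
    refine Finset.prod_congr rfl fun i _ => ?_
    rw [val_unitDiff (by simp [kerBase])]
  rw [h1, h2, ← Units.val_mul, ← Units.val_mul, kerUnit, ← kerPairs, zpow_one,
    Finset.prod_mul_distrib, Finset.prod_inv_distrib]
  congr 1
  rw [mul_left_comm, mul_left_comm (∏ i, unitDiff (ptx i) pty), mul_inv_cancel, mul_one]

theorem C_crossX_mul_kerUnit_mem {d : PolyRing (Option (Fin n))} (hd : vdmX n ∣ d) (m : ℤ) :
    MvPowerSeries.C (toRat (crossX n)) * (kerUnit n m 1 : KerRing n) ∈ psSub (locSub d) := by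
  rw [C_crossX_mul_kerUnit]
  exact (psSub (locSub d)).mul_mem ((Submonoid.mem_units_iff _ _).mp (kerPairs_mem hd m)).1
    (Subring.prod_mem _ fun i _ => sub_mem (kerPt_mem_psSub toRat_mem_locSub _)
      (kerPt_mem_psSub toRat_mem_locSub _))

/-- The shifted Vandermonde product is invertible over the localization at the unshifted one, and
the spectral Vandermonde product is a constant that can be cleared. -/
theorem shiftHom_quotient_mem {d : PolyRing (Option (Fin n))} (hd : vdmX n ∣ d) {k : ℕ}
    {f : RatRing (Fin n)} {P : PolyRing (Fin n)}
    (h : toRat (vdm (fun i => X (Sum.inl i)) ^ k * vdm (fun i => X (Sum.inr i)) ^ k) * f =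
      toRat P) :
    MvPowerSeries.C (toRat (vdmL n ^ k)) * shiftHom n f ∈ psSub (locSub d) := by
  set u : (KerRing n)ˣ := ∏ i, ∏ j ∈ Finset.Ioi i, unitDiff (ptX i) (ptX j) with hu
  have hmem : u ∈ (psSub (locSub d)).toSubmonoid.units :=
    prod_mem fun i _ => prod_mem fun j _ =>
      unitDiff_mem toRat_mem_locSub (pair_inverse_mem hd i j)
  have h1 := congrArg (shiftHom n) h
  have h2 : shiftHom n (toRat (vdm (fun i => X (Sum.inl i)))) = (u : KerRing n) := by
    rw [map_vdm, map_vdm, hu, Units.coe_prod, vdm]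
    refine Finset.prod_congr rfl fun i _ => ?_
    rw [Units.coe_prod]
    refine Finset.prod_congr rfl fun j hj => ?_
    rw [val_unitDiff (by simpa [kerBase] using (Finset.mem_Ioi.mp hj).ne), ← shiftHom_sp,
      ← shiftHom_sp, sp, sp]
  have h3 : shiftHom n (toRat (vdm (fun i => X (Sum.inr i)))) =
      MvPowerSeries.C (toRat (vdmL n)) := by
    rw [map_vdm, map_vdm, map_vdm, map_vdm]
    congr 1
    ext i : 1
    exact shiftHom_sc i
  rw [map_mul, map_mul, map_mul, map_pow, map_pow, map_pow, map_pow, h2, h3] at h1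
  have h4 : MvPowerSeries.C (toRat (vdmL n ^ k)) * shiftHom n f =
      (((u ^ k)⁻¹ : (KerRing n)ˣ) : KerRing n) * shiftHom n (toRat P) := by
    rw [← h1, map_pow, map_pow, mul_assoc, ← Units.val_pow_eq_pow_val, Units.inv_mul_cancel_left]
  rw [h4]
  exact mul_mem ((Submonoid.mem_units_iff _ _).mp (inv_mem (pow_mem hmem k))).1
    (shiftHom_toRat_mem toRat_mem_locSub _)

/-- The moment has a pole of order `α i` at `λ_i = μ` and no others. -/
theorem crossL_pow_mul_moment (hS : ∀ P, toRat P ∈ S) (p : ℂ) {r : ℕ} {α : Fin n →₀ ℕ}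
    (h : ∀ i, α i ≤ r) : toRat (crossL n ^ r) * moment p (specDiff n) α ∈ S := by
  rw [moment, mul_smul_comm, Algebra.smul_def, algebraMap_rat]
  refine mul_mem (hS _) ?_
  have h0 : toRat (crossL n ^ r) = ∏ i, toRat (X (Sum.inr (some i)) - X (Sum.inr none)) ^ r := by
    simp only [crossL, cross, map_pow, map_prod, Finset.prod_pow]
  rw [h0, ← Finset.prod_mul_distrib]
  refine prod_mem fun i _ => ?_
  have h1 : toRat (X (Sum.inr (some i)) - X (Sum.inr none)) = -specDiff n i := by
    rw [specDiff, map_sub, sc, sc]; ring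
  obtain ⟨s, hs⟩ := Nat.exists_eq_add_of_le (h i)
  have h2 : (-specDiff n i) ^ r * Ring.inverse (specDiff n i) ^ α i =
      (-1) ^ α i * (-specDiff n i) ^ s := by
    have h3 : specDiff n i ^ α i * Ring.inverse (specDiff n i) ^ α i = 1 := by
      rw [← mul_pow, Ring.mul_inverse_cancel _ (isUnit_specDiff i), one_pow]
    rw [hs, pow_add, neg_pow (specDiff n i) (α i)]
    linear_combination (-1) ^ α i * (-specDiff n i) ^ s * h3
  rw [h1, h2, ← h1]
  exact mul_mem (pow_mem (neg_mem (one_mem _)) _) (pow_mem (hS _) _)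

/-- Denominators of a series obtained by integration against the kernel function. -/
theorem kernelSeries_mem {d D₀ : PolyRing (Option (Fin n))} {m c : ℤ} {φ : ℕ → RatRing (Fin n)}
    (h : ∀ l, MvPowerSeries.C (toRat D₀) * ((kerUnit n m c : KerRing n) * shiftHom n (φ l)) ∈
      psSub (locSub d)) {r j : ℕ}
    (hr : ∀ α : Fin n →₀ ℕ, ∑ i, α i ≤ j → (∀ i, α i ≤ r) ∨ moment ((m : ℂ) + 1) (specDiff n) α = 0) :
    ∃ M, IsPolyMul (d ^ M * (D₀ * crossL n ^ r)) (kernelSeries m c φ j) := by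
  have key : toRat (D₀ * crossL n ^ r) * kernelSeries m c φ j ∈ locSub d := by
    rw [kernelSeries, Finset.mul_sum]
    refine sum_mem fun l hl => ?_
    rw [bracket_apply, Finset.mul_sum]
    refine sum_mem fun α hα => ?_
    simp only [Finset.mem_finsuppAntidiag, Finset.subset_univ, and_true] at hα
    have h1 := mem_psSub.mp (h l) α
    rw [MvPowerSeries.coeff_C_mul] at h1
    have hα' : ∑ i, α i = j - l := hα
    -- Either the exponents bound the pole by `r`, or the Pochhammer symbol makes the whole term
    -- vanish.
    rcases hr α (hα'.le.trans (Nat.sub_le _ _)) with h2 | h2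
    · have := mul_mem (crossL_pow_mul_moment (S := locSub d) toRat_mem_locSub ((m : ℂ) + 1) h2) h1
      convert this using 1
      rw [map_mul]
      ring
    · rw [h2]; simp
  obtain ⟨M, N, hN⟩ := key
  exact ⟨M, N, by rw [map_mul, map_pow, mul_assoc]; exact hN⟩

end Denominators

/-! ### Reduction of the denominators -/

section Reduction

variable {ι : Type*} [Fintype ι] [DecidableEq ι] {f : RatRing ι}

/-- Polynomials in the spectral variables. -/
def spectralSub (ι : Type*) [Fintype ι] [DecidableEq ι] : Subring (PolyRing ι) where
  carrier := {P | ∀ o, pderiv (Sum.inl o) P = 0}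
  mul_mem' := by
    intro a b ha hb o
    simp [Derivation.leibniz, ha o, hb o]
  one_mem' := by intro o; simp
  add_mem' := by
    intro a b ha hb o
    simp [ha o, hb o]
  zero_mem' := by intro o; simp
  neg_mem' := by
    intro a ha o
    simp [ha o]

theorem X_inr_mem_spectralSub (o : ι) : (X (Sum.inr o) : PolyRing ι) ∈ spectralSub ι := by
  intro o'
  rw [pderiv_X_of_ne (by simp)]

theorem dx_spectral {P : PolyRing ι} (h : P ∈ spectralSub ι) (o : ι) : dx o (toRat P) = 0 := by
  rw [dv_toRat, h o, map_zero]

theorem gradRat_spectral {P : PolyRing ι} (h : P ∈ spectralSub ι) : gradRat (toRat P) = 0 := by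
  simp [gradRat_apply, dx_spectral h]

theorem eulerX_spectral {P : PolyRing ι} (h : P ∈ spectralSub ι) : eulerX (toRat P) = 0 := by
  simp [eulerX_apply, dx_spectral h]

theorem lapRat_spectral_mul (q : ι → ℂ) {P : PolyRing ι} (h : P ∈ spectralSub ι) :
    lapRat q (toRat P * f) = toRat P * lapRat q f := by
  simp only [lapRat_apply, Derivation.leibniz, dx_spectral h, smul_eq_mul, mul_zero, add_zero,
    Finset.mul_sum, mul_smul_comm]

theorem dv_mem_locSub {d : PolyRing ι} (v : ι ⊕ ι) (h : f ∈ locSub d) : dv v f ∈ locSub d := by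
  obtain ⟨M, N, h⟩ := h
  have h1 := congrArg (dv v) h
  rw [Derivation.leibniz, Derivation.leibniz_pow, dv_toRat, dv_toRat, smul_eq_mul, smul_eq_mul,
    nsmul_eq_mul, smul_eq_mul] at h1
  refine ⟨M + 1, d * pderiv v N - M * pderiv v d * N, ?_⟩
  rw [map_sub, map_mul, map_mul, map_mul, ← h1, ← h, map_natCast]
  cases M with
  | zero => simp
  | succ M => rw [Nat.add_sub_cancel]; ring

theorem smul_mem_locSub {d : PolyRing ι} (c : ℂ) (h : f ∈ locSub d) : c • f ∈ locSub d := by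
  rw [Algebra.smul_def, algebraMap_rat]
  exact mul_mem (toRat_mem_locSub _) h

theorem lapRat_mem_locSub {d : PolyRing ι} (q : ι → ℂ) (h : f ∈ locSub d) :
    lapRat q f ∈ locSub d := by
  rw [lapRat_apply]
  exact sum_mem fun o _ => smul_mem_locSub _ (dv_mem_locSub _ (dv_mem_locSub _ h))

theorem potRat_mem_locSub {d : PolyRing ι} (m : ℂ) (q : ι → ℂ)
    (h : ∀ a b : ι, a ≠ b → (X (Sum.inl a) - X (Sum.inl b) : PolyRing ι) ∣ d) :
    potRat m q ∈ locSub d :=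
  sum_mem fun a _ => sum_mem fun b _ => smul_mem_locSub _
    (pow_mem (inverse_sub_mem_locSub (h a b)) _)

theorem IsPolyMul.mem_locSub {d T S : PolyRing ι} {M : ℕ} (h : IsPolyMul (T * S) f)
    (hd : T ∣ d ^ M) : toRat S * f ∈ locSub d := by
  obtain ⟨N, hN⟩ := h.of_dvd (mul_dvd_mul_right hd S)
  exact ⟨M, N, by rw [← hN, map_mul, map_pow, mul_assoc]⟩

theorem IsPolyMul.sum {β : Type*} {s : Finset β} {F : β → RatRing ι} {T : PolyRing ι}
    (h : ∀ i ∈ s, IsPolyMul T (F i)) : IsPolyMul T (∑ i ∈ s, F i) := by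
  classical
  choose! N hN using h
  exact ⟨∑ i ∈ s, N i, by rw [Finset.mul_sum, map_sum]; exact Finset.sum_congr rfl hN⟩

/-- Removal of a pole where two spectral variables coincide. -/
theorem IsSeries.isPolyMul_of_pole {m : ℂ} {q : ι → ℂ} {φ : ℕ → RatRing ι} (hφ : IsSeries m q φ)
    {j : ℕ} {a b : ι} (hab : a ≠ b) {H K Lam : PolyRing ι} {d : ℕ}
    (hH : IsWeightedHomogeneous wX H d) (hH0 : ∀ lam : ι → ℂ,
      (∀ c e, c ≠ e → (c, e) ≠ (a, b) → (c, e) ≠ (b, a) → lam c ≠ lam e) →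
      eval (Sum.elim lam lam) H ≠ 0)
    (hK : ∀ x lam : ι → ℂ, Function.Injective x → eval (Sum.elim x lam) K ≠ 0)
    (hLam : Lam ∈ spectralSub ι)
    (hprev : IsPolyMul (K * Lam) (lapRat q (φ (j + 1)) - potRat m q * φ (j + 1)))
    (h : IsPolyMul ((X (Sum.inr a) - X (Sum.inr b)) *
      (H * (X (Sum.inl a) - X (Sum.inl b)) * Lam)) (φ (j + 2))) :
    IsPolyMul (H * (X (Sum.inl a) - X (Sum.inl b)) * Lam) (φ (j + 2)) := by
  obtain ⟨u, hu⟩ : ∃ u : PolyRing ι, u = X (Sum.inr a) - X (Sum.inr b) := ⟨_, rfl⟩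
  obtain ⟨H₁, hH₁⟩ : ∃ H₁ : PolyRing ι, H₁ = H * (X (Sum.inl a) - X (Sum.inl b)) := ⟨_, rfl⟩
  rw [← hu, ← hH₁] at h
  rw [← hH₁]
  obtain ⟨N, hN⟩ := h
  obtain ⟨R, hR⟩ := hprev
  have huL : u * Lam ∈ spectralSub ι :=
    mul_mem (hu ▸ sub_mem (X_inr_mem_spectralSub _) (X_inr_mem_spectralSub _)) hLam
  have hN' : toRat (u * Lam) * (toRat H₁ * φ (j + 2)) = toRat N := by
    rw [← hN, map_mul, map_mul, map_mul]; ring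
  have hH₁d : IsWeightedHomogeneous wX H₁ (d + 1) :=
    hH₁ ▸ hH.mul (Submodule.sub_mem (weightedHomogeneousSubmodule ℂ wX 1)
      (isWeightedHomogeneous_X _ _ _) (isWeightedHomogeneous_X _ _ _))
  -- The recursion cleared of denominators: the Wronskian of `H₁` and `N` along `λ` is, up to `K`, a
  -- multiple of `u = λ_a - λ_b`. On the wall `u = 0` it vanishes, so `N / H₁` is constant along `λ`
  -- there.
  have hW : K * (H₁ * gradPoly N - N * gradPoly H₁) * 2 = -(u * H₁ ^ 2 * R) := by
    apply toRat_injective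
    have h1 := congrArg gradRat hN'
    rw [Derivation.leibniz, gradRat_spectral huL, smul_zero, add_zero, Derivation.leibniz,
      gradRat_toRat, gradRat_toRat, smul_eq_mul, smul_eq_mul, smul_eq_mul] at h1
    simp only [map_mul, map_sub, map_neg, map_ofNat, map_pow] at h1 hN' hR ⊢
    rw [← h1, ← hN', ← hR]
    linear_combination (toRat K * toRat u * toRat Lam * toRat H₁ ^ 2) * hφ.recursion (j + 1)
  have hE : CalogeroBA.eulerX (toRat N) = (((d + 1 : ℕ) : ℂ) - ((j + 2 : ℕ) : ℂ)) • toRat N := by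
    rw [← hN', Derivation.leibniz, eulerX_spectral huL, smul_zero, add_zero, Derivation.leibniz,
      hφ.eulerX, eulerX_toRat hH₁d, smul_eq_mul, smul_eq_mul, smul_eq_mul, sub_smul]
    simp only [mul_smul_comm, neg_smul, mul_neg, mul_add]
    rw [mul_comm (φ _)]
    abel
  -- It suffices that the numerator vanishes on the wall `λ_a = λ_b`.
  have hid : identify (Sum.inr a) (Sum.inr b) N = 0 := by
    by_cases hj : j + 2 ≤ d + 1
    · rw [← Nat.cast_sub hj] at hE
      have hNh := isWeightedHomogeneous_of_euler (fun _ _ => eulerX_toRat) hE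
      refine poly_eq_zero_of_eval (disc_ne_zero ι) fun z hz => ?_
      obtain ⟨h1, h2⟩ := injective_of_eval_disc hz
      rw [eval_identify]
      set x := z ∘ Sum.inl
      set lam := Function.update (z ∘ Sum.inr) a (z (Sum.inr b)) with hlam
      have hz' : Function.update z (Sum.inr a) (z (Sum.inr b)) = Sum.elim x lam := by
        ext (o | o)
        · simp [x]
        · by_cases ho : o = a
          · subst ho; simp [hlam]
          · simp [hlam, ho]
      have hab' : lam a = lam b := by simp [hlam, hab.symm]
      have hgen : ∀ c e, c ≠ e → (c, e) ≠ (a, b) → (c, e) ≠ (b, a) → lam c ≠ lam e := by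
        intro c e hce h3 h4
        simp only [hlam, Function.update_apply, Function.comp_apply]
        have h5 : ∀ {o o' : ι}, o ≠ o' → z (Sum.inr o) ≠ z (Sum.inr o') := fun h => h2.ne h
        split_ifs with h6 h7 h7
        · exact absurd (h6.trans h7.symm) hce
        · subst h6; exact h5 fun e' => h3 (by rw [e'])
        · subst h7; exact h5 fun e' => h4 (by rw [e'])
        · exact h5 hce
      rw [hz']
      refine eval_eq_zero_of_wronskian (H := H₁) (K := K) hNh ?_ ?_ ?_
      · intro x'
        have h3 := congrArg (eval (Sum.elim x' lam)) hW
        have h4 : eval (Sum.elim x' lam) u = 0 := by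
          rw [hu, map_sub, eval_X, eval_X, Sum.elim_inr, Sum.elim_inr, hab', sub_self]
        rw [map_mul, map_neg, mul_assoc u, map_mul (eval _) u, h4, zero_mul, neg_zero] at h3
        exact (mul_eq_zero.mp h3).resolve_right (by simp)
      · intro h3
        apply hK x lam h1
        rw [← eval_line_zero, h3, Polynomial.eval_zero]
      · obtain ⟨-, h4⟩ := line_homogeneous x lam hH
        -- On the wall, `λ` is tangent to `x_a = x_b`, so this factor is constant along the line and
        -- `H₁` may have degree only `d` there. The numerator has degree `d + 1 - (j + 2) < d`. For
        -- the first coefficient of the series this inequality fails, which is why a simple pole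
        -- survives.
        have h5 : line x lam (X (Sum.inl a) - X (Sum.inl b)) = Polynomial.C (x a - x b) := by
          simp [line, hab']
        have h6 : d ≤ (line x lam H₁).natDegree := by
          rw [hH₁, map_mul, h5, Polynomial.natDegree_mul_C (sub_ne_zero.mpr (h1.ne hab))]
          exact Polynomial.le_natDegree_of_ne_zero (by rw [h4]; exact hH0 lam hgen)
        omega
    -- Here the degree of `N` would be negative.
    · rw [eq_zero_of_euler (w := wX) (fun _ _ => eulerX_toRat) (fun n hn => ?_) hE, map_zero]
      rw [eq_sub_iff_add_eq] at hn
      have : n + (j + 2) = d + 1 := by exact_mod_cast hn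
      omega
  obtain ⟨N', rfl⟩ := sub_dvd_of_identify_eq_zero hid
  refine ⟨N', ?_⟩
  rw [map_mul, ← hu, map_mul toRat u N', mul_assoc] at hN
  have hu0 : u ≠ 0 := hu ▸ X_sub_X_ne_zero fun e => hab (Sum.inr_injective e)
  exact mul_left_cancel₀ ((map_ne_zero_iff _ toRat_injective).mpr hu0) hN

theorem identify_sub_ne_zero {a b c e : ι} (hce : c ≠ e) (h1 : (c, e) ≠ (a, b))
    (h2 : (c, e) ≠ (b, a)) :
    identify (Sum.inl a) (Sum.inl b) (X (Sum.inl c) - X (Sum.inl e) : PolyRing ι) ≠ 0 := by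
  rw [map_sub, identify_X, identify_X]
  simp only [Sum.inl.injEq, ← apply_ite X, ← apply_ite Sum.inl]
  refine X_sub_X_ne_zero fun h => ?_
  have h' := Sum.inl_injective h
  split_ifs at h' with h3 h4 h4
  · exact hce (h3.trans h4.symm)
  · exact h1 (by rw [h3, h'])
  · exact h2 (by rw [h4, h'])
  · exact hce h'

theorem identify_sub_inr_ne_zero {a b c e : ι} (hce : c ≠ e) :
    identify (Sum.inl a) (Sum.inl b) (X (Sum.inr c) - X (Sum.inr e) : PolyRing ι) ≠ 0 := by
  rw [map_sub, identify_X, identify_X, if_neg (by simp), if_neg (by simp)]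
  exact X_sub_X_ne_zero (by simpa using hce)

/-- Removal of poles where two particles of the same charge collide. -/
theorem IsPolyMul.reduce {m : ℂ} {q : ι → ℂ} {k r : ℕ} (hm : m * (m + 1) = k * (k + 1))
    (hf : schrRat m q f = 0) {β : Type*} [DecidableEq β] {s : Finset β} {a b : β → ι}
    (hs : ∀ p ∈ s, a p ≠ b p ∧ q (a p) = 1 ∧ q (b p) = 1)
    (hs' : ∀ p ∈ s, ∀ p' ∈ s, p' ≠ p → (a p', b p') ≠ (a p, b p) ∧ (a p', b p') ≠ (b p, a p))
    {T : PolyRing ι} (hT : ∀ p ∈ s, identify (Sum.inl (a p)) (Sum.inl (b p)) T ≠ 0)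
    (h : IsPolyMul ((∏ p ∈ s, (X (Sum.inl (a p)) - X (Sum.inl (b p)))) ^ (k + r) * T) f) :
    IsPolyMul ((∏ p ∈ s, (X (Sum.inl (a p)) - X (Sum.inl (b p)))) ^ k * T) f := by
  set g : β → PolyRing ι := fun p => X (Sum.inl (a p)) - X (Sum.inl (b p)) with hg
  have hprod : ∏ p ∈ s ×ˢ (Finset.univ : Finset (Fin r)), g p.1 = (∏ p ∈ s, g p) ^ r := by
    rw [Finset.prod_product]
    simp [Finset.prod_pow]
  -- The excess multiplicity `r` of every wall is spread over the second index and removed factor by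
  -- factor.
  refine IsPolyMul.remove_factors (s := s ×ˢ (Finset.univ : Finset (Fin r)))
    (g := fun p => g p.1) ?_ ?_
  · rintro ⟨p, i⟩ hp t - ht
    have hps : p ∈ s := (Finset.mem_product.mp hp).1
    refine IsPolyMul.of_regularAt (by simpa using (hs p hps).1) ht ?_
    have h1 : ∏ p ∈ s, g p = g p * ∏ p ∈ s.erase p, g p := (Finset.mul_prod_erase s g hps).symm
    -- The factors of the other walls do not vanish identically on this wall, so they may be put
    -- into the denominator `G` of the regularity condition.
    have h2 : RegularAt (Sum.inl (a p)) (Sum.inl (b p))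
        ((sp (a p) - sp (b p)) ^ (k + r) * f) := by
      obtain ⟨N, hN⟩ := h
      refine ⟨(∏ p ∈ s.erase p, g p) ^ (k + r) * T, N, ?_, ?_⟩
      · rw [map_mul, map_pow, map_prod]
        refine mul_ne_zero (pow_ne_zero _ (Finset.prod_ne_zero_iff.mpr fun p' hp' => ?_)) (hT p hps)
        have hp's := Finset.mem_of_mem_erase hp'
        obtain ⟨h3, h4⟩ := hs' p hps p' hp's (Finset.ne_of_mem_erase hp')
        exact identify_sub_ne_zero (hs p' hp's).1 h3 h4
      · rw [← hN, h1, mul_pow, map_mul, map_mul, map_mul, map_pow (toRat) (g p), hg, map_sub]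
        simp only [sp]
        ring
    have h3 := regularAt_pow_mul_of_schrRat (hs p hps).1 (hs p hps).2.1 (hs p hps).2.2 hm hf r h2
    have h4 : toRat ((∏ i ∈ t, g i.1) * ((∏ p ∈ s, g p) ^ k * T)) * f =
        toRat ((∏ i ∈ t, g i.1) * ((∏ p ∈ s.erase p, g p) ^ k * T)) *
          ((sp (a p) - sp (b p)) ^ k * f) := by
      rw [h1, mul_pow]
      simp only [map_mul, map_pow, hg, map_sub, sp]
      ring
    rw [h4]
    exact (regularAt_toRat _).mul h3
  · rw [hprod, ← mul_assoc, ← pow_add, add_comm]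
    exact h

end Reduction

/-! ### Existence of wave functions -/

section Existence

/-- A series whose denominators are powers of differences comes from a wave function. -/
theorem IsSeries.exists_isGenBA {ι : Type*} [Fintype ι] [DecidableEq ι] {m : ℂ} {q : ι → ℂ}
    (hq : ∀ o, q o ≠ 0) {k : ℕ} (hm : m * (m + 1) = k * (k + 1)) {φ : ℕ → RatRing ι}
    (hφ : IsSeries m q φ) {β : Type*} [DecidableEq β] {s : Finset β} {a b : β → ι}
    (hs : ∀ p ∈ s, a p ≠ b p ∧ q (a p) = 1 ∧ q (b p) = 1)
    (hs' : ∀ p ∈ s, ∀ p' ∈ s, p' ≠ p → (a p', b p') ≠ (a p, b p) ∧ (a p', b p') ≠ (b p, a p))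
    {V S T : PolyRing ι} (hV : V = ∏ p ∈ s, (X (Sum.inl (a p)) - X (Sum.inl (b p))))
    (hS : ∀ p ∈ s, identify (Sum.inl (a p)) (Sum.inl (b p)) S ≠ 0) {d dL : ℕ}
    (hSL : IsWeightedHomogeneous wL S dL) (hT : V ^ k * S = T) (hTd : IsDenominator T d)
    (h : ∀ j, ∃ M, IsPolyMul (V ^ M * S) (φ j)) :
    ∃ L Q, (∀ l, L ≤ l → φ l = 0) ∧ toRat T * ∑ l ∈ Finset.range L, φ l = toRat Q ∧
      IsGenBA m q T Q ∧ IsBalanced Q := by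
  have hV0 : V ≠ 0 := by
    rw [hV, Finset.prod_ne_zero_iff]
    exact fun p hp => X_sub_X_ne_zero fun e => (hs p hp).1 (Sum.inl_injective e)
  have hS0 : S ≠ 0 := by
    rintro rfl
    exact hTd.ne_zero (by rw [← hT, mul_zero])
  have hVL : IsWeightedHomogeneous wL V 0 := by
    have : IsWeightedHomogeneous wL (∏ p ∈ s, (X (Sum.inl (a p)) - X (Sum.inl (b p)) : PolyRing ι))
        (∑ p ∈ s, 0) := IsWeightedHomogeneous.prod _ _ _ fun p _ =>
      Submodule.sub_mem (weightedHomogeneousSubmodule ℂ wL 0)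
        (isWeightedHomogeneous_X _ _ _) (isWeightedHomogeneous_X _ _ _)
    rw [← hV, Finset.sum_const_zero] at this
    exact this
  -- The spectral degree of the denominator is `dL`, whatever `M` is, so the numerator of `φ l` has
  -- spectral degree `dL - l`, which is negative for `l > dL`.
  have hvan : ∀ l, dL + 1 ≤ l → φ l = 0 := by
    intro l hl
    obtain ⟨M, N, hN⟩ := h l
    have hVM : IsWeightedHomogeneous wL (V ^ M * S) dL := by
      have := (hVL.pow M).mul hSL
      simpa using this
    have hE : CalogeroBA.eulerL (toRat N) = ((dL : ℂ) - l) • toRat N := by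
      rw [← hN, Derivation.leibniz, hφ.eulerL, eulerL_toRat hVM, smul_eq_mul, smul_eq_mul,
        mul_smul_comm, mul_smul_comm, mul_comm (φ l)]
      module
    have hN0 : N = 0 := by
      refine eq_zero_of_euler (w := wL) (fun _ _ => eulerL_toRat) (fun n hn => ?_) hE
      rw [eq_sub_iff_add_eq] at hn
      have : n + l = dL := by exact_mod_cast hn
      omega
    rw [hN0, map_zero] at hN
    exact (mul_eq_zero.mp hN).resolve_left
      ((map_ne_zero_iff _ toRat_injective).mpr (mul_ne_zero (pow_ne_zero _ hV0) hS0))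
  choose M hM using h
  -- Since the sum is finite, one exponent `k + r` serves all its terms. The sum solves the full
  -- equation, which reduces the exponent to `k`.
  set f := ∑ l ∈ Finset.range (dL + 1), φ l with hf
  set r := (Finset.range (dL + 1)).sup M
  have h1 : IsPolyMul (V ^ (k + r) * S) f := IsPolyMul.sum fun l hl =>
    (hM l).of_dvd (mul_dvd_mul_right (pow_dvd_pow _ ((Finset.le_sup (f := M) hl).trans
      (Nat.le_add_left _ _))) _)
  have hschr : schrRat m q f = 0 := by
    rw [hf, schrRat_sum, Finset.sum_range_succ' (fun l => 2 * gradRat (φ l)), hφ.zero,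
      Finset.sum_range_succ, Derivation.map_one_eq_zero, mul_zero, add_zero]
    have h1 := hφ.recursion dL
    rw [hvan (dL + 1) le_rfl, map_zero, mul_zero, zero_add] at h1
    rw [h1, add_zero, ← Finset.sum_add_distrib]
    exact Finset.sum_eq_zero fun l _ => by rw [add_comm]; exact hφ.recursion l
  rw [hV] at h1
  have h2 := IsPolyMul.reduce hm hschr hs hs' hS h1
  rw [← hV, hT] at h2
  obtain ⟨Q, hQ⟩ := h2
  exact ⟨dL + 1, Q, hvan, hQ, hφ.isGenBA hq hTd hvan hQ⟩

theorem vdm_ne_zero {R : Type*} [CommRing R] [IsDomain R] {n : ℕ} {x : Fin n → R}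
    (h : ∀ i j, i ≠ j → x i ≠ x j) : vdm x ≠ 0 :=
  Finset.prod_ne_zero_iff.mpr fun i _ => Finset.prod_ne_zero_iff.mpr fun j hj =>
    sub_ne_zero.mpr (h i j (Finset.mem_Ioi.mp hj).ne)

theorem cross_ne_zero {R : Type*} [CommRing R] [IsDomain R] {n : ℕ} {x : Fin n → R} {y : R}
    (h : ∀ i, x i ≠ y) : cross x y ≠ 0 :=
  Finset.prod_ne_zero_iff.mpr fun i _ => sub_ne_zero.mpr (h i)

/-- The number of pairs of `n` particles. -/
def pairCount (n : ℕ) : ℕ := ∑ i : Fin n, ∑ _j ∈ Finset.Ioi i, 1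

section Homogeneous

variable {σ : Type*} {w : σ → ℕ} {n : ℕ}

theorem isWeightedHomogeneous_X_sub_X {u v : σ} {c : ℕ} (hu : w u = c) (hv : w v = c) :
    IsWeightedHomogeneous w (X u - X v : MvPolynomial σ ℂ) c :=
  Submodule.sub_mem (weightedHomogeneousSubmodule ℂ w c)
    (hu ▸ isWeightedHomogeneous_X _ _ _) (hv ▸ isWeightedHomogeneous_X _ _ _)

theorem isWeightedHomogeneous_vdm {u : Fin n → σ} {c : ℕ} (hu : ∀ i, w (u i) = c) :
    IsWeightedHomogeneous w (vdm fun i => (X (u i) : MvPolynomial σ ℂ)) (pairCount n * c) := by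
  have : pairCount n * c = ∑ i : Fin n, ∑ _j ∈ Finset.Ioi i, c := by
    simp only [pairCount, Finset.sum_mul, one_mul]
  rw [this]
  exact IsWeightedHomogeneous.prod _ _ _ fun i _ => IsWeightedHomogeneous.prod _ _ _ fun j _ =>
    isWeightedHomogeneous_X_sub_X (hu i) (hu j)

theorem isWeightedHomogeneous_cross {u : Fin n → σ} {v : σ} {c : ℕ} (hu : ∀ i, w (u i) = c)
    (hv : w v = c) :
    IsWeightedHomogeneous w (cross (fun i => (X (u i) : MvPolynomial σ ℂ)) (X v)) (n * c) := by
  have : n * c = ∑ _i : Fin n, c := by simp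
  rw [this]
  exact IsWeightedHomogeneous.prod _ _ _ fun i _ => isWeightedHomogeneous_X_sub_X (hu i) hv

end Homogeneous

variable {n : ℕ}

theorem isUnit_vdm {R : Type*} [CommRing R] {x : Fin n → R}
    (h : ∀ i j, i ≠ j → IsUnit (x i - x j)) : IsUnit (vdm x) :=
  IsUnit.prod_iff.mpr fun i _ => IsUnit.prod_iff.mpr fun j hj => h i j (Finset.mem_Ioi.mp hj).ne

theorem isUnit_cross {R : Type*} [CommRing R] {x : Fin n → R} {y : R}
    (h : ∀ i, IsUnit (x i - y)) : IsUnit (cross x y) :=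
  IsUnit.prod_iff.mpr fun i _ => h i

/-- The denominator of the wave functions of `n` equal particles. -/
abbrev baDen (n k : ℕ) : PolyRing (Fin n) :=
  vdm (fun i => X (Sum.inl i)) ^ k * vdm (fun i => X (Sum.inr i)) ^ k

/-- The denominator of the deformed wave functions. -/
abbrev deformedDen (n k : ℕ) : PolyRing (Option (Fin n)) :=
  vdmX n ^ k * crossX n * vdmL n ^ k * crossL n

/-- The denominator of the wave functions of equal particles, one of them marked. -/
abbrev markedDen (n k : ℕ) : PolyRing (Option (Fin n)) :=
  (vdmX n * crossX n) ^ k * (vdmL n * crossL n) ^ k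

theorem isUnit_toRat_vdmX : IsUnit (toRat (vdmX n)) := by
  rw [map_vdm]
  exact isUnit_vdm fun i j h => isUnit_sp_sub (by simpa using h)

theorem isUnit_toRat_vdmL : IsUnit (toRat (vdmL n)) := by
  rw [map_vdm]
  exact isUnit_vdm fun i j h => isUnit_sc_sub (by simpa using h)

theorem isUnit_toRat_crossX : IsUnit (toRat (crossX n)) := by
  rw [map_cross]
  exact isUnit_cross fun i => isUnit_sp_sub (by simp)

theorem isUnit_toRat_crossL : IsUnit (toRat (crossL n)) := by
  rw [map_cross]
  exact isUnit_cross fun i => isUnit_sc_sub (by simp)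

theorem isDenominator_baDen (n k : ℕ) : IsDenominator (baDen n k) (k * pairCount n) where
  isUnit := by
    rw [map_mul, map_pow, map_pow, map_vdm, map_vdm]
    exact ((isUnit_vdm fun i j h => isUnit_sp_sub h).pow k).mul
      ((isUnit_vdm fun i j h => isUnit_sc_sub h).pow k)
  homX := by
    have := ((isWeightedHomogeneous_vdm (w := wX) (u := fun i : Fin n => Sum.inl i) (c := 1)
      fun _ => rfl).pow k).mul ((isWeightedHomogeneous_vdm (w := wX)
      (u := fun i : Fin n => Sum.inr i) (c := 0) fun _ => rfl).pow k)
    simpa using this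
  homL := by
    have := ((isWeightedHomogeneous_vdm (w := wL) (u := fun i : Fin n => Sum.inl i) (c := 0)
      fun _ => rfl).pow k).mul ((isWeightedHomogeneous_vdm (w := wL)
      (u := fun i : Fin n => Sum.inr i) (c := 1) fun _ => rfl).pow k)
    simpa using this

theorem vdmX_homX : IsWeightedHomogeneous wX (vdmX n) (pairCount n) := by
  simpa using isWeightedHomogeneous_vdm (w := wX) (u := fun i : Fin n => Sum.inl (some i))
    (c := 1) fun _ => rfl

theorem vdmX_homL : IsWeightedHomogeneous wL (vdmX n) 0 := by
  simpa using isWeightedHomogeneous_vdm (w := wL) (u := fun i : Fin n => Sum.inl (some i))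
    (c := 0) fun _ => rfl

theorem vdmL_homX : IsWeightedHomogeneous wX (vdmL n) 0 := by
  simpa using isWeightedHomogeneous_vdm (w := wX) (u := fun i : Fin n => Sum.inr (some i))
    (c := 0) fun _ => rfl

theorem vdmL_homL : IsWeightedHomogeneous wL (vdmL n) (pairCount n) := by
  simpa using isWeightedHomogeneous_vdm (w := wL) (u := fun i : Fin n => Sum.inr (some i))
    (c := 1) fun _ => rfl

theorem crossX_homX : IsWeightedHomogeneous wX (crossX n) n := by
  simpa using isWeightedHomogeneous_cross (w := wX) (u := fun i : Fin n => Sum.inl (some i))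
    (v := Sum.inl none) (c := 1) (fun _ => rfl) rfl

theorem crossX_homL : IsWeightedHomogeneous wL (crossX n) 0 := by
  simpa using isWeightedHomogeneous_cross (w := wL) (u := fun i : Fin n => Sum.inl (some i))
    (v := Sum.inl none) (c := 0) (fun _ => rfl) rfl

theorem crossL_homX : IsWeightedHomogeneous wX (crossL n) 0 := by
  simpa using isWeightedHomogeneous_cross (w := wX) (u := fun i : Fin n => Sum.inr (some i))
    (v := Sum.inr none) (c := 0) (fun _ => rfl) rfl

theorem crossL_homL : IsWeightedHomogeneous wL (crossL n) n := by
  simpa using isWeightedHomogeneous_cross (w := wL) (u := fun i : Fin n => Sum.inr (some i))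
    (v := Sum.inr none) (c := 1) (fun _ => rfl) rfl

theorem isDenominator_deformedDen (n k : ℕ) :
    IsDenominator (deformedDen n k) (k * pairCount n + n) where
  isUnit := by
    rw [map_mul, map_mul, map_mul, map_pow, map_pow]
    exact (((isUnit_toRat_vdmX.pow k).mul isUnit_toRat_crossX).mul
      (isUnit_toRat_vdmL.pow k)).mul isUnit_toRat_crossL
  homX := by
    have := (((vdmX_homX (n := n).pow k).mul crossX_homX).mul (vdmL_homX.pow k)).mul crossL_homX
    simpa using this
  homL := by
    have := (((vdmX_homL (n := n).pow k).mul crossX_homL).mul (vdmL_homL.pow k)).mul crossL_homL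
    simpa using this

theorem isDenominator_markedDen (n k : ℕ) :
    IsDenominator (markedDen n k) (k * (pairCount n + n)) where
  isUnit := by
    rw [map_mul, map_pow, map_pow, map_mul, map_mul]
    exact ((isUnit_toRat_vdmX.mul isUnit_toRat_crossX).pow k).mul
      ((isUnit_toRat_vdmL.mul isUnit_toRat_crossL).pow k)
  homX := by
    have := (((vdmX_homX (n := n)).mul crossX_homX).pow k).mul ((vdmL_homX.mul crossL_homX).pow k)
    simpa using this
  homL := by
    have := (((vdmX_homL (n := n)).mul crossX_homL).pow k).mul ((vdmL_homL.mul crossL_homL).pow k)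
    simpa using this

theorem vdmL_mem_spectralSub : vdmL n ∈ spectralSub (Option (Fin n)) :=
  prod_mem fun _ _ => prod_mem fun _ _ =>
    sub_mem (X_inr_mem_spectralSub _) (X_inr_mem_spectralSub _)

theorem crossL_mem_spectralSub : crossL n ∈ spectralSub (Option (Fin n)) :=
  prod_mem fun _ _ => sub_mem (X_inr_mem_spectralSub _) (X_inr_mem_spectralSub _)

theorem sub_dvd_vdmX_mul_crossX (a b : Option (Fin n)) (h : a ≠ b) :
    (X (Sum.inl a) - X (Sum.inl b) : PolyRing (Option (Fin n))) ∣ vdmX n * crossX n := by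
  have h1 : ∀ i : Fin n, (X (Sum.inl (some i)) - X (Sum.inl none) : PolyRing (Option (Fin n))) ∣
      vdmX n * crossX n := fun i =>
    (sub_dvd_cross (fun i => X (Sum.inl (some i))) _ i).mul_left _
  rcases a with _ | i <;> rcases b with _ | j
  · exact absurd rfl h
  · rw [← neg_sub, neg_dvd]; exact h1 j
  · exact h1 i
  · exact (sub_dvd_vdm (fun i => X (Sum.inl (some i))) (by simpa using h)).mul_right _

theorem eval_vdmX (z : Option (Fin n) ⊕ Option (Fin n) → ℂ) :
    eval z (vdmX n) = vdm fun i => z (Sum.inl (some i)) := by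
  rw [map_vdm]; simp

theorem eval_crossX (z : Option (Fin n) ⊕ Option (Fin n) → ℂ) :
    eval z (crossX n) = cross (fun i => z (Sum.inl (some i))) (z (Sum.inl none)) := by
  rw [map_cross]; simp

end Existence

/-! ### Existence of the deformed wave function and addition of an equal particle. -/

section ExistenceDeformed

variable {n k : ℕ} {m : ℤ} {φ : ℕ → RatRing (Fin n)}

/-- The charges of the deformed system. -/
def deformedCharge (n : ℕ) (m : ℤ) (o : Option (Fin n)) : ℂ := o.elim ((m : ℂ)⁻¹) fun _ => 1

theorem IsSeries.kernelSeries_one (hm0 : m ≠ 0) (hφ : IsSeries m (fun _ => 1) φ) :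
    IsSeries m (deformedCharge n m) (CalogeroBA.kernelSeries m 1 φ) := by
  have h0 : (m : ℂ) ≠ 0 := by exact_mod_cast hm0
  exact hφ.kernelSeries (fun i => rfl) (by simp [deformedCharge, h0]) (by simp [deformedCharge])
    (by simp)

theorem IsSeries.kernelSeries_self (hφ : IsSeries m (fun _ => 1) φ) :
    IsSeries m (fun _ => 1) (CalogeroBA.kernelSeries m m φ) :=
  hφ.kernelSeries (fun i => rfl) (by simp) (by simp) (by simp)

/-- A crude bound: only moments with `|α| ≤ j` occur in the `j`-th coefficient, so its pole at `λ_i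
= μ` has order at most `j`. -/
theorem exists_isPolyMul_kernelSeries_one (hP : ∀ l, IsPolyMul (baDen n k) (φ l)) {j r : ℕ}
    (hr : j ≤ r) : ∃ M, IsPolyMul (vdmX n ^ M * (crossX n * vdmL n ^ k * crossL n ^ r))
      (kernelSeries m 1 φ j) := by
  refine kernelSeries_mem (fun l => ?_) fun α hα => Or.inl fun i =>
    (Finset.single_le_sum (f := α) (fun _ _ => Nat.zero_le _) (Finset.mem_univ i)).trans
      (hα.trans hr)
  obtain ⟨P, hP⟩ := hP l
  have h1 := mul_mem (C_crossX_mul_kerUnit_mem (n := n) dvd_rfl m)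
    (shiftHom_quotient_mem dvd_rfl hP)
  convert h1 using 1
  rw [map_mul, map_mul]
  ring

/-- The crude bound already suffices for `j ≤ 1`. From `j = 2` on, the recursion expresses the
gradient through the previous coefficient, which by induction has only simple spectral poles, and
the excess poles are removed one at a time. -/
theorem IsSeries.isPolyMul_kernelSeries_one (hm0 : m ≠ 0) (hφ : IsSeries m (fun _ => 1) φ)
    (hP : ∀ l, IsPolyMul (baDen n k) (φ l)) (j : ℕ) :
    ∃ M, IsPolyMul (vdmX n ^ M * (crossX n * (vdmL n ^ k * crossL n)))
      (CalogeroBA.kernelSeries m 1 φ j) := by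
  have hser := hφ.kernelSeries_one hm0
  have hden := fun {j r : ℕ} => exists_isPolyMul_kernelSeries_one (m := m) (j := j) (r := r) hP
  induction j with
  | zero =>
    obtain ⟨M, hM⟩ := hden (Nat.zero_le 1)
    exact ⟨M, by rwa [pow_one, mul_assoc] at hM⟩
  | succ j ih =>
    rcases Nat.eq_zero_or_pos j with rfl | hj
    · obtain ⟨M, hM⟩ := hden (r := 1) le_rfl
      exact ⟨M, by rwa [pow_one, mul_assoc] at hM⟩
    obtain ⟨j, rfl⟩ : ∃ j', j = j' + 1 := ⟨j - 1, by omega⟩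
    obtain ⟨M₀, hM₀⟩ := ih
    obtain ⟨M, hM⟩ := hden (j := j + 1 + 1) le_rfl
    refine ⟨M, ?_⟩
    set Lam : PolyRing (Option (Fin n)) := vdmL n ^ k * crossL n with hLam
    have hLs : Lam ∈ spectralSub (Option (Fin n)) :=
      mul_mem (pow_mem vdmL_mem_spectralSub _) crossL_mem_spectralSub
    have hprev : ∃ s, IsPolyMul ((vdmX n * crossX n) ^ s * Lam)
        (lapRat (deformedCharge n m) (CalogeroBA.kernelSeries m 1 φ (j + 1)) -
          potRat m (deformedCharge n m) * CalogeroBA.kernelSeries m 1 φ (j + 1)) := by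
      have h1 : toRat Lam * CalogeroBA.kernelSeries m 1 φ (j + 1) ∈
          locSub (vdmX n * crossX n) := by
        refine IsPolyMul.mem_locSub (T := vdmX n ^ M₀ * crossX n) (M := M₀ + 1) ?_ ?_
        · rw [mul_assoc]; exact hM₀
        · rw [mul_pow]
          exact mul_dvd_mul (pow_dvd_pow _ (Nat.le_succ _)) (dvd_pow_self _ (by omega))
      have h2 := sub_mem (lapRat_mem_locSub (deformedCharge n m) h1)
        (mul_mem (potRat_mem_locSub m (deformedCharge n m) sub_dvd_vdmX_mul_crossX) h1)
      rw [lapRat_spectral_mul _ hLs] at h2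
      obtain ⟨s, N, hN⟩ := h2
      refine ⟨s, N, ?_⟩
      rw [← hN, map_mul, map_pow]
      ring
    obtain ⟨s, hs⟩ := hprev
    -- The exponent of `crossL` falls from `j + 2` to 1, so each of the `n` spectral walls loses `j
    -- + 1` factors.
    refine IsPolyMul.remove_factors (s := (Finset.univ : Finset (Fin n × Fin (j + 1))))
      (g := fun p => X (Sum.inr (some p.1)) - X (Sum.inr none)) ?_ ?_
    · rintro ⟨i, i'⟩ - t - ht
      set G : PolyRing (Option (Fin n)) :=
        ∏ p ∈ t, (X (Sum.inr (some p.1)) - X (Sum.inr none)) with hG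
      -- The factor `x_i - y` is split off `crossX`: it is the one that becomes constant along `λ`
      -- when `λ_i = μ`.
      set C₀ : PolyRing (Option (Fin n)) := ∏ i' ∈ Finset.univ.erase i,
        (X (Sum.inl (some i')) - X (Sum.inl none)) with hC₀
      have hC : C₀ * (X (Sum.inl (some i)) - X (Sum.inl none)) = crossX n :=
        Finset.prod_erase_mul _ _ (Finset.mem_univ i)
      have e : G * (vdmX n ^ M * (crossX n * Lam)) =
          (vdmX n ^ M * C₀) * (X (Sum.inl (some i)) - X (Sum.inl none)) * (G * Lam) := by
        rw [← hC]; ring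
      have hGs : G ∈ spectralSub (Option (Fin n)) := prod_mem fun p _ =>
        sub_mem (X_inr_mem_spectralSub _) (X_inr_mem_spectralSub _)
      have hC₀h : IsWeightedHomogeneous wX C₀ (∑ _i' ∈ Finset.univ.erase i, 1) :=
        IsWeightedHomogeneous.prod _ _ _ fun i' _ => isWeightedHomogeneous_X_sub_X rfl rfl
      rw [e] at ht ⊢
      refine hser.isPolyMul_of_pole (a := some i) (b := none)
        (K := (vdmX n * crossX n) ^ s) (by simp) ((vdmX_homX.pow M).mul hC₀h) ?_ ?_
        (mul_mem hGs hLs) (hs.of_dvd ⟨G, by ring⟩) ht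
      · intro lam hlam
        rw [map_mul, map_pow, eval_vdmX, hC₀, map_prod]
        refine mul_ne_zero (pow_ne_zero _ (vdm_ne_zero fun a b hab => ?_))
          (Finset.prod_ne_zero_iff.mpr fun i' hi' => ?_)
        · exact hlam _ _ (by simpa using hab) (by simp) (by simp)
        · rw [map_sub, eval_X, eval_X]
          exact sub_ne_zero.mpr (hlam _ _ (by simp)
            (by simpa using Finset.ne_of_mem_erase hi') (by simp))
      · intro x lam hx
        rw [map_pow, map_mul, eval_vdmX, eval_crossX]
        exact pow_ne_zero _ (mul_ne_zero (vdm_ne_zero fun a b hab => hx.ne (by simpa using hab))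
          (cross_ne_zero fun i => hx.ne (by simp)))
    · have e : ∏ p : Fin n × Fin (j + 1),
          (X (Sum.inr (some p.1)) - X (Sum.inr none) : PolyRing (Option (Fin n))) =
          crossL n ^ (j + 1) := by
        rw [Fintype.prod_prod_type]
        simp [crossL, cross, Finset.prod_pow]
      rw [e, hLam]
      refine hM.of_dvd (dvd_of_eq ?_)
      ring

theorem vdmX_eq_prod : vdmX n = ∏ p ∈ Finset.univ.sigma (fun i : Fin n => Finset.Ioi i),
    (X (Sum.inl (some p.1)) - X (Sum.inl (some p.2)) : PolyRing (Option (Fin n))) := by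
  rw [Finset.prod_sigma]; rfl

/-- Existence of the deformed wave function. -/
theorem IsSeries.exists_deformed (hm0 : m ≠ 0) (hm : m * (m + 1) = k * (k + 1))
    (hφ : IsSeries m (fun _ => 1) φ) (hP : ∀ l, IsPolyMul (baDen n k) (φ l)) :
    ∃ L Q, (∀ l, L ≤ l → CalogeroBA.kernelSeries m 1 φ l = 0) ∧
      toRat (deformedDen n k) * ∑ l ∈ Finset.range L, CalogeroBA.kernelSeries m 1 φ l = toRat Q ∧
      IsGenBA m (deformedCharge n m) (deformedDen n k) Q ∧ IsBalanced Q := by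
  have hm0' : (m : ℂ) ≠ 0 := by exact_mod_cast hm0
  have hm' : (m : ℂ) * (m + 1) = k * (k + 1) := by exact_mod_cast hm
  refine (hφ.kernelSeries_one hm0).exists_isGenBA (s := Finset.univ.sigma fun i => Finset.Ioi i)
    (a := fun p => some p.1) (b := fun p => some p.2) (V := vdmX n)
    (S := crossX n * (vdmL n ^ k * crossL n)) (d := k * pairCount n + n)
    (dL := k * pairCount n + n) ?_ hm' ?_ ?_ ?_ ?_ ?_ ?_ ?_ ?_
  · rintro (_ | i) <;> simp [deformedCharge, hm0']
  · rintro ⟨i, j⟩ hp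
    simp only [Finset.mem_sigma, Finset.mem_Ioi, Finset.mem_univ, true_and] at hp
    exact ⟨by simpa using hp.ne, rfl, rfl⟩
  · rintro ⟨i, j⟩ hp ⟨i', j'⟩ hp' hne
    simp only [Finset.mem_sigma, Finset.mem_Ioi, Finset.mem_univ, true_and] at hp hp'
    simp only [ne_eq, Sigma.mk.injEq, heq_eq_eq, Prod.mk.injEq, Option.some.injEq] at hne ⊢
    exact ⟨hne, by rintro ⟨rfl, rfl⟩; exact absurd hp hp'.asymm⟩
  · exact vdmX_eq_prod
  · rintro ⟨i, j⟩ -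
    rw [map_mul, map_mul, map_pow]
    refine mul_ne_zero ?_ (mul_ne_zero (pow_ne_zero _ ?_) ?_)
    · rw [crossX, cross, map_prod]
      exact Finset.prod_ne_zero_iff.mpr fun _ _ =>
        identify_sub_ne_zero (by simp) (by simp) (by simp)
    · simp only [vdmL, vdm, map_prod]
      exact Finset.prod_ne_zero_iff.mpr fun _ _ => Finset.prod_ne_zero_iff.mpr fun _ h =>
        identify_sub_inr_ne_zero (by simpa using (Finset.mem_Ioi.mp h).ne)
    · rw [crossL, cross, map_prod]
      exact Finset.prod_ne_zero_iff.mpr fun _ _ => identify_sub_inr_ne_zero (by simp)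
  · have := (crossX_homL (n := n)).mul ((vdmL_homL.pow k).mul crossL_homL)
    simpa using this
  · rw [deformedDen]; ring
  · exact isDenominator_deformedDen n k
  · exact hφ.isPolyMul_kernelSeries_one hm0 hP

/-- Addition of a particle. -/
theorem IsSeries.exists_marked (hφ : IsSeries ((-(k : ℤ) - 1 : ℤ)) (fun _ => 1) φ)
    (hP : ∀ l, IsPolyMul (baDen n k) (φ l)) :
    ∃ Q, IsGenBA ((-(k : ℤ) - 1 : ℤ)) (fun _ => 1) (markedDen n k) Q ∧ IsBalanced Q := by
  -- The value `-k-1` has the same `m(m+1)` as `k`, but now `m + 1 = -k`. The symbols `(-k)_α`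
  -- vanish for `α > k`, so the spectral poles have order at most `k` without further argument.
  set m : ℤ := -(k : ℤ) - 1 with hmdef
  have hm' : (m : ℂ) * (m + 1) = k * (k + 1) := by rw [hmdef]; push_cast; ring
  have hser := hφ.kernelSeries_self
  suffices h : ∃ L Q, (∀ l, L ≤ l → CalogeroBA.kernelSeries m m φ l = 0) ∧
      toRat (markedDen n k) * ∑ l ∈ Finset.range L, CalogeroBA.kernelSeries m m φ l = toRat Q ∧
      IsGenBA m (fun _ => 1) (markedDen n k) Q ∧ IsBalanced Q by
    obtain ⟨-, Q, -, -, h⟩ := h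
    exact ⟨Q, h⟩
  refine hser.exists_isGenBA
    (s := (Finset.univ.sigma fun i => Finset.Ioi i).disjSum Finset.univ)
    (a := Sum.elim (fun p => some p.1) fun i => some i)
    (b := Sum.elim (fun p => some p.2) fun i => none) (V := vdmX n * crossX n)
    (S := (vdmL n * crossL n) ^ k) (d := k * (pairCount n + n))
    (dL := k * (pairCount n + n)) ?_ hm' ?_ ?_ ?_ ?_ ?_ rfl (isDenominator_markedDen n k) ?_
  · simp
  · rintro (⟨i, j⟩ | i) hp
    · simp only [Finset.inl_mem_disjSum, Finset.mem_sigma, Finset.mem_Ioi, Finset.mem_univ,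
        true_and] at hp
      exact ⟨by simpa using hp.ne, rfl, rfl⟩
    · simp
  · rintro (⟨i, j⟩ | i) hp (⟨i', j'⟩ | i') hp' hne
    · simp only [Finset.inl_mem_disjSum, Finset.mem_sigma, Finset.mem_Ioi, Finset.mem_univ,
        true_and] at hp hp'
      simp only [ne_eq, Sum.inl.injEq, Sigma.mk.injEq, heq_eq_eq, Prod.mk.injEq, Option.some.injEq,
        Sum.elim_inl] at hne ⊢
      exact ⟨hne, by rintro ⟨rfl, rfl⟩; exact absurd hp hp'.asymm⟩
    · simp
    · simp
    · simpa using hne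
  · rw [Finset.prod_disjSum, vdmX_eq_prod]; rfl
  · intro p _
    rw [map_pow, map_mul]
    refine pow_ne_zero _ (mul_ne_zero ?_ ?_)
    · simp only [vdmL, vdm, map_prod]
      exact Finset.prod_ne_zero_iff.mpr fun _ _ => Finset.prod_ne_zero_iff.mpr fun _ h =>
        identify_sub_inr_ne_zero (by simpa using (Finset.mem_Ioi.mp h).ne)
    · rw [crossL, cross, map_prod]
      exact Finset.prod_ne_zero_iff.mpr fun _ _ => identify_sub_inr_ne_zero (by simp)
  · have := ((vdmL_homL (n := n)).mul crossL_homL).pow k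
    simpa using this
  · intro j
    obtain ⟨M, hM⟩ := kernelSeries_mem (d := vdmX n * crossX n) (D₀ := vdmL n ^ k) (m := m)
      (c := m) (φ := φ) (r := k) (j := j) (fun l => by
        obtain ⟨P, hP⟩ := hP l
        have h1 := mul_mem (kerUnit_mem (n := n) (Dvd.intro _ rfl) (Dvd.intro_left _ rfl) m m)
          (shiftHom_quotient_mem (Dvd.intro _ rfl) hP)
        rw [mul_left_comm]
        exact h1) (fun α _ => by
        by_cases h : ∀ i, α i ≤ k
        · exact Or.inl h
        · right
          push Not at h
          obtain ⟨i, hi⟩ := h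
          rw [moment, Finset.prod_eq_zero (Finset.mem_univ i), zero_smul]
          have : (m : ℂ) + 1 = -(k : ℂ) := by rw [hmdef]; push_cast; ring
          rw [this]
          exact ascPochhammer_eval_neg_coe_nat_of_lt hi)
    exact ⟨M, by rwa [← mul_pow] at hM⟩

end ExistenceDeformed

/-! ### Relabelling of the particles -/

section Relabelling

variable {ι ι' : Type*} [Fintype ι] [DecidableEq ι] [Fintype ι'] [DecidableEq ι']

theorem isWeightedHomogeneous_rename {σ τ : Type*} (f : σ → τ) {w : σ → ℕ} {w' : τ → ℕ}
    (hw : ∀ s, w' (f s) = w s) {P : MvPolynomial σ ℂ} {d : ℕ} (h : IsWeightedHomogeneous w P d) :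
    IsWeightedHomogeneous w' (rename f P) d := by
  intro s hs
  obtain ⟨u, rfl, hu⟩ := coeff_rename_ne_zero _ _ _ hs
  rw [← h hu, Finsupp.weight_apply, Finsupp.weight_apply,
    Finsupp.sum_mapDomain_index (by simp) (by simp [add_mul])]
  simp only [hw]

theorem component_rename {σ τ : Type*} (f : σ → τ) {w : σ → ℕ} {w' : τ → ℕ}
    (hw : ∀ s, w' (f s) = w s) (P : MvPolynomial σ ℂ) (d : ℕ) :
    weightedHomogeneousComponent w' d (rename f P) =
      rename f (weightedHomogeneousComponent w d P) := by
  set L := max (weightedTotalDegree w P) d + 1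
  have hP : P = ∑ e ∈ Finset.range L, weightedHomogeneousComponent w e P :=
    (sum_component_of_lt fun e he => component_eq_zero_of_weightedTotalDegree_lt (by omega)).symm
  conv_lhs => rw [hP, map_sum]
  rw [component_sum_of_homogeneous (fun l _ => isWeightedHomogeneous_rename f hw
    (weightedHomogeneousComponent_isWeightedHomogeneous _ _)), if_pos (by omega)]

theorem leadingForm_rename {σ τ : Type*} {f : σ → τ} (hf : Function.Injective f) {w : σ → ℕ}
    {w' : τ → ℕ} (hw : ∀ s, w' (f s) = w s) {P T : MvPolynomial σ ℂ} {d : ℕ} (hT : T ≠ 0)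
    (hTd : IsWeightedHomogeneous w T d) (h : leadingForm w P = T) :
    leadingForm w' (rename f P) = rename f T := by
  obtain ⟨h1, h2⟩ := (leadingForm_eq_iff hT hTd).mp h
  rw [leadingForm_eq_iff ((map_ne_zero_iff _ (rename_injective f hf)).mpr hT)
    (isWeightedHomogeneous_rename f hw hTd)]
  exact ⟨fun e he => by rw [component_rename f hw, h1 e he, map_zero],
    by rw [component_rename f hw, h2]⟩

variable (e : ι ≃ ι')

theorem IsBalanced.rename {Q : PolyRing ι} (h : IsBalanced Q) :
    IsBalanced (MvPolynomial.rename (Sum.map e e) Q) := by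
  intro d
  rw [component_rename (w := wX) (Sum.map e e) (by rintro (o | o) <;> rfl)]
  exact isWeightedHomogeneous_rename _ (by rintro (o | o) <;> rfl) (h d)

theorem IsGenBA.rename {m : ℂ} {T Q : PolyRing ι} {d : ℕ} (hT : IsDenominator T d)
    (h : IsGenBA m (fun _ => 1) T Q) :
    IsGenBA m (fun _ : ι' => 1) (MvPolynomial.rename (Sum.map e e) T)
      (MvPolynomial.rename (Sum.map e e) Q) := by
  have hinj : Function.Injective (Sum.map e e) := Sum.map_injective.mpr ⟨e.injective, e.injective⟩
  refine ⟨⟨leadingForm_rename hinj (by rintro (o | o) <;> rfl) hT.ne_zero hT.homX h.leading.1,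
    leadingForm_rename hinj (by rintro (o | o) <;> rfl) hT.ne_zero hT.homL h.leading.2⟩, ?_⟩
  intro x lam hx hl
  have hg : ∀ y : ι' → ℂ, genFun (fun _ => 1) (MvPolynomial.rename (Sum.map e e) T)
      (MvPolynomial.rename (Sum.map e e) Q) y lam =
      genFun (fun _ => 1) T Q (y ∘ e) (lam ∘ e) := by
    intro y
    rw [genFun, genFun, eval_rename, eval_rename, Sum.elim_comp_map,
      ← e.sum_comp (fun o => 1 * lam o * y o)]
    rfl
  have hs := h.schr (x ∘ e) (lam ∘ e) (hx.comp e.injective) (hl.comp e.injective)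
  simp only [hg]
  rw [← e.sum_comp, ← e.sum_comp (fun o => 1 * lam o ^ 2)]
  have hp : potNum m (fun _ => 1) x = potNum m (fun _ => 1) (x ∘ e) := by
    rw [potNum, potNum, ← e.sum_comp]
    exact Finset.sum_congr rfl fun a _ => (e.sum_comp _).symm
  have hu : ∀ o (t : ℂ), Function.update x (e o) t ∘ e = Function.update (x ∘ e) o t := by
    intro o t
    ext o'
    simp [Function.update_apply]
  simp only [hu, hp]
  exact hs

end Relabelling

/-! ### Existence of the wave function of equal particles -/

section Equal

theorem vdm_succ {R : Type*} [CommRing R] {n : ℕ} (x : Fin (n + 1) → R) :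
    vdm x = vdm (fun i : Fin n => x i.castSucc) *
      cross (fun i : Fin n => x i.castSucc) (x (Fin.last n)) := by
  have h : ∀ (m : ℕ) (y : Fin m → R),
      vdm y = ∏ i, ∏ j, if i < j then y i - y j else 1 := by
    intro m y
    refine Finset.prod_congr rfl fun i _ => ?_
    rw [← Finset.prod_filter]
    congr 1
    ext; simp
  rw [h, h, Fin.prod_univ_castSucc, cross, ← Finset.prod_mul_distrib]
  rw [Finset.prod_eq_one (fun j _ => if_neg (not_lt_of_ge (Fin.le_last j))), mul_one]
  refine Finset.prod_congr rfl fun i _ => ?_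
  rw [Fin.prod_univ_castSucc, if_pos (Fin.castSucc_lt_last i)]
  simp

/-- Induction on the number of particles. Without particles the series is the constant 1; the
transform with `c = m = -k-1` supplies the next particle, which relabelling turns into the last one.
-/
theorem exists_isGenBA (n k : ℕ) :
    ∃ P, IsGenBA ((-(k : ℤ) - 1 : ℤ)) (fun _ => 1) (baDen n k) P ∧ IsBalanced P := by
  induction n with
  | zero =>
    set φ : ℕ → RatRing (Fin 0) := fun l => if l = 0 then 1 else 0
    have hφ : IsSeries ((-(k : ℤ) - 1 : ℤ)) (fun _ => 1) φ := by
      refine ⟨rfl, fun l => ?_, fun l => ?_, fun l => ?_⟩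
      · by_cases h : l = 0 <;> simp [φ, h]
      · by_cases h : l = 0 <;> simp [φ, h]
      · simp [gradRat_apply, lapRat_apply, potRat]
    obtain ⟨Q, hQ⟩ : ∃ Q, toRat (baDen 0 k) * ∑ l ∈ Finset.range 1, φ l = toRat Q :=
      ⟨baDen 0 k, by simp [φ]⟩
    exact ⟨Q, hφ.isGenBA (by simp) (isDenominator_baDen 0 k) (L := 1)
      (fun l hl => if_neg (by omega)) hQ⟩
  | succ n ih =>
    obtain ⟨P, hP, hb⟩ := ih
    obtain ⟨φ, hφ, h1, h2⟩ := hP.exists_series (by simp) (isDenominator_baDen n k) hb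
    obtain ⟨Q, hQ, hQb⟩ := hφ.exists_marked (k := k) (fun l => by
      by_cases hl : l ≤ k * pairCount n
      · exact ⟨_, h1 l hl⟩
      · exact ⟨0, by rw [h2 l (by omega)]; simp⟩)
    have e : MvPolynomial.rename (Sum.map finSuccEquivLast.symm finSuccEquivLast.symm)
        (markedDen n k) = baDen (n + 1) k := by
      have hc : ∀ f : PolyRing (Option (Fin n)) →ₐ[ℂ] PolyRing (Fin (n + 1)), ∀ P, f P =
        (f : PolyRing (Option (Fin n)) →+* PolyRing (Fin (n + 1))) P := fun _ _ => rfl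
      rw [baDen, vdm_succ, vdm_succ, markedDen, map_mul, map_pow, map_pow, map_mul, map_mul,
        hc, hc, hc, hc, map_vdm, map_vdm, map_cross, map_cross]
      simp
    have hr := hQ.rename finSuccEquivLast.symm (isDenominator_markedDen n k)
    rw [e] at hr
    exact ⟨_, hr, hQb.rename finSuccEquivLast.symm⟩

end Equal

/-! ### Comparison of the Schrödinger equations -/

section Transfer

variable {n k : ℕ}

theorem sum_sum_eq_sum_Ioi {F : Fin n → Fin n → ℂ} (h0 : ∀ i, F i i = 0)
    (hs : ∀ i j, F i j = F j i) : ∑ i, ∑ j, F i j = ∑ i, ∑ j ∈ Finset.Ioi i, 2 * F i j := by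
  have h1 : ∀ i, ∑ j, F i j = ∑ j ∈ Finset.Ioi i, F i j + ∑ j ∈ Finset.Iio i, F i j := by
    intro i
    rw [← Finset.sum_union (Finset.disjoint_left.mpr fun j h h' =>
      (Finset.mem_Ioi.mp h).asymm (Finset.mem_Iio.mp h'))]
    refine (Finset.sum_subset (Finset.subset_univ _) fun j _ hj => ?_).symm
    have : i = j := by
      by_contra hne
      rcases lt_or_gt_of_ne hne with h | h <;> simp [h] at hj
    rw [← this, h0]
  have h2 : ∑ i, ∑ j ∈ Finset.Iio i, F i j = ∑ i, ∑ j ∈ Finset.Ioi i, F i j := by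
    rw [Finset.sum_comm' (t' := Finset.univ) (s' := fun j => Finset.Ioi j) (by simp)]
    exact Finset.sum_congr rfl fun i _ => Finset.sum_congr rfl fun j _ => hs _ _
  simp only [h1, Finset.sum_add_distrib, h2, ← Finset.mul_sum]
  ring

theorem baFun_eq_genFun (P : PolyRing (Fin n)) (x lam : Fin n → ℂ) :
    baFun k P x lam = genFun (fun _ => 1) (baDen n k) P x lam := by
  have h : eval (Sum.elim x lam) (baDen n k) = vdm x ^ k * vdm lam ^ k := by
    rw [map_mul, map_pow, map_pow, map_vdm, map_vdm]; simp
  rw [baFun, genFun, h]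
  simp

/-- For charges 1 the potential depends on `m` only through `m(m+1)`, so the same function serves `m
= k` and `m = -k-1`. -/
theorem isBA_iff {m : ℤ} (hm : m * (m + 1) = k * (k + 1)) {P : PolyRing (Fin n)} :
    IsBA n k P ↔ IsGenBA m (fun _ => 1) (baDen n k) P := by
  have hm' : (m : ℂ) * (m + 1) = k * (k + 1) := by exact_mod_cast hm
  have hpot : ∀ x : Fin n → ℂ, potNum m (fun _ => 1) x =
      ∑ i, ∑ j ∈ Finset.Ioi i, 2 * (k : ℂ) * ((k : ℂ) + 1) / (x i - x j) ^ 2 := by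
    intro x
    rw [potNum, sum_sum_eq_sum_Ioi (by simp)
      (fun i j => by rw [coup, coup, ← neg_sub, inv_neg, neg_sq])]
    refine Finset.sum_congr rfl fun i _ => Finset.sum_congr rfl fun j _ => ?_
    rw [coup, div_eq_mul_inv, inv_pow]
    linear_combination 2 * ((x i - x j) ^ 2)⁻¹ * hm'
  have key : ∀ x lam : Fin n → ℂ,
      (calogeroMoser k (fun x' => baFun k P x' lam) x = -(∑ i, lam i ^ 2) * baFun k P x lam) ↔
      (-(∑ o, ((1 : ℂ))⁻¹ * iteratedDeriv 2 (fun t => genFun (fun _ => 1) (baDen n k) P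
        (Function.update x o t) lam) (x o)) +
      potNum m (fun _ => 1) x * genFun (fun _ => 1) (baDen n k) P x lam =
        -(∑ o, 1 * lam o ^ 2) * genFun (fun _ => 1) (baDen n k) P x lam) := by
    intro x lam
    simp only [calogeroMoser, partial2, baFun_eq_genFun, hpot, inv_one, one_mul]
  constructor
  · intro h
    exact ⟨h.leading, fun x lam hx hl => (key x lam).mp (h.schrodinger x lam hx hl)⟩
  · intro h
    exact ⟨h.leading, fun x lam hx hl => (key x lam).mpr (h.schr x lam hx hl)⟩

theorem deformedFun_eq_genFun {m : ℤ} (Q : PolyRing (Option (Fin n)))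
    (x lam : Option (Fin n) → ℂ) :
    deformedFun m Q (fun i => x (some i)) (x none) (fun i => lam (some i)) (lam none) =
      genFun (deformedCharge n m) (deformedDen n (mStar m)) Q x lam := by
  have e : ∀ z : Option (Fin n) → ℂ, (fun o => Option.elim o (z none) fun i => z (some i)) = z :=
    fun z => funext fun o => by cases o <;> rfl
  have h : eval (Sum.elim x lam) (deformedDen n (mStar m)) =
      vdm (fun i => x (some i)) ^ mStar m * cross (fun i => x (some i)) (x none) *
        vdm (fun i => lam (some i)) ^ mStar m * cross (fun i => lam (some i)) (lam none) := by
    rw [map_mul, map_mul, map_mul, map_pow, map_pow, map_vdm, map_vdm, map_cross, map_cross]; simp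
  rw [deformedFun, genFun, h, e, e, Fintype.sum_option]
  simp only [deformedCharge, Option.elim]
  congr 2
  simp only [one_mul, div_eq_mul_inv]
  ring

theorem injective_option {x : Option (Fin n) → ℂ} : Function.Injective x ↔
    Function.Injective (fun i => x (some i)) ∧ ∀ i, x (some i) ≠ x none := by
  constructor
  · intro h
    exact ⟨h.comp (Option.some_injective _), fun i => h.ne (by simp)⟩
  · rintro ⟨h1, h2⟩ (_ | i) (_ | j) h
    · rfl
    · exact absurd h.symm (h2 j)
    · exact absurd h (h2 i)
    · rw [h1 h]

/-- The charge `1/m` of the last particle yields the coefficient `m` of `∂_y²`, the exponent `μy/m`,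
the energy `μ²/m` and the coupling `2(m+1)`. -/
theorem isDeformedBA_iff {m : ℤ} (hm0 : m ≠ 0) {Q : PolyRing (Option (Fin n))} :
    IsDeformedBA n m Q ↔
      IsGenBA m (deformedCharge n m) (deformedDen n (mStar m)) Q := by
  have hm0' : (m : ℂ) ≠ 0 := by exact_mod_cast hm0
  have hpot : ∀ x : Option (Fin n) → ℂ, potNum m (deformedCharge n m) x =
      (∑ i, ∑ j ∈ Finset.Ioi i, 2 * (m : ℂ) * ((m : ℂ) + 1) / (x (some i) - x (some j)) ^ 2) +
        ∑ i, 2 * ((m : ℂ) + 1) / (x (some i) - x none) ^ 2 := by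
    intro x
    simp only [potNum, Fintype.sum_option]
    rw [Finset.sum_add_distrib, sum_sum_eq_sum_Ioi (by simp)
      (fun i j => by
        rw [coup, coup, ← neg_sub, inv_neg, neg_sq]; simp only [deformedCharge, Option.elim])]
    rw [sub_self, inv_zero, zero_pow two_ne_zero, mul_zero, zero_add, ← add_assoc,
      ← Finset.sum_add_distrib, add_comm]
    congr 1
    · refine Finset.sum_congr rfl fun i _ => Finset.sum_congr rfl fun j _ => ?_
      simp only [coup, deformedCharge, Option.elim, div_eq_mul_inv, inv_pow]
      ring
    · refine Finset.sum_congr rfl fun i _ => ?_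
      rw [← neg_sub (x (some i)), inv_neg, neg_sq]
      simp only [coup, deformedCharge, Option.elim, div_eq_mul_inv, inv_pow]
      field_simp
      ring
  have key : ∀ x lam : Option (Fin n) → ℂ,
      (deformedCM m (fun x' y' => deformedFun m Q x' y' (fun i => lam (some i)) (lam none))
          (fun i => x (some i)) (x none) =
        -((∑ i, lam (some i) ^ 2) + lam none ^ 2 / (m : ℂ)) *
          deformedFun m Q (fun i => x (some i)) (x none) (fun i => lam (some i)) (lam none)) ↔
      (-(∑ o, (deformedCharge n m o)⁻¹ * iteratedDeriv 2 (fun t => genFun (deformedCharge n m)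
          (deformedDen n (mStar m)) Q (Function.update x o t) lam) (x o)) +
        potNum m (deformedCharge n m) x *
          genFun (deformedCharge n m) (deformedDen n (mStar m)) Q x lam =
        -(∑ o, deformedCharge n m o * lam o ^ 2) *
          genFun (deformedCharge n m) (deformedDen n (mStar m)) Q x lam) := by
    intro x lam
    have h1 : ∀ (i : Fin n) (t : ℂ), deformedFun m Q
        (Function.update (fun i => x (some i)) i t) (x none) (fun i => lam (some i)) (lam none) =
        genFun (deformedCharge n m) (deformedDen n (mStar m)) Q
          (Function.update x (some i) t) lam := by
      intro i t
      rw [← deformedFun_eq_genFun]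
      congr 1
      ext j
      simp [Function.update_apply]
    have h2 : ∀ t : ℂ, deformedFun m Q
        (fun i => x (some i)) t (fun i => lam (some i)) (lam none) =
        genFun (deformedCharge n m) (deformedDen n (mStar m)) Q
          (Function.update x none t) lam := by
      intro t
      rw [← deformedFun_eq_genFun]
      simp
    rw [deformedCM, hpot]
    simp only [partial2, h1, h2, Fintype.sum_option]
    simp only [deformedCharge, Option.elim, inv_inv, inv_one, one_mul, Function.update_eq_self]
    constructor <;> intro h <;> linear_combination h
  have e : ∀ (y : ℂ) (z : Fin n → ℂ), ∃ x : Option (Fin n) → ℂ,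
      (fun i => x (some i)) = z ∧ x none = y := fun y z => ⟨fun o => o.elim y z, rfl, rfl⟩
  constructor
  · intro h
    refine ⟨h.leading, fun x lam hx hl => (key x lam).mp ?_⟩
    obtain ⟨h1, h2⟩ := injective_option.mp hx
    obtain ⟨h3, h4⟩ := injective_option.mp hl
    exact h.schrodinger _ _ _ _ h1 h2 h3 h4
  · intro h
    refine ⟨h.leading, fun x y lam mu hx hy hl hmu => ?_⟩
    obtain ⟨x, rfl, rfl⟩ := e y x
    obtain ⟨lam, rfl, rfl⟩ := e mu lam
    exact (key x lam).mpr (h.schr _ _ (injective_option.mpr ⟨hx, hy⟩)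
      (injective_option.mpr ⟨hl, hmu⟩))

theorem mStar_natCast (k : ℕ) : mStar k = k := by simp only [mStar]; omega

theorem mStar_neg (k : ℕ) : mStar (-(k : ℤ) - 1) = k := by simp only [mStar]; omega

theorem existsUnique_isBA (n k : ℕ) : ∃! P, IsBA n k P := by
  obtain ⟨P, hP, -⟩ := exists_isGenBA n k
  have h := fun {P} => isBA_iff (n := n) (k := k) (m := -(k : ℤ) - 1) (P := P) (by ring)
  exact ⟨P, h.mpr hP, fun P' hP' =>
    (h.mp hP').unique (by simp) (isDenominator_baDen n k) hP⟩

/-- The deformed wave function as a finite sum of brackets. -/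
theorem IsBA.exists_deformed {P : PolyRing (Fin n)} (hP : IsBA n k P) {m : ℤ} (hm0 : m ≠ 0)
    (hm : m * (m + 1) = k * (k + 1)) (hmk : mStar m = k) :
    ∃ (φ : ℕ → RatRing (Fin n)) (L : ℕ) (Q : PolyRing (Option (Fin n))),
      (∀ l, l ≤ k * pairCount n → toRat (baDen n k) * φ l =
        toRat (weightedHomogeneousComponent wX (k * pairCount n - l) P)) ∧
      (∀ l, k * pairCount n < l → φ l = 0) ∧
      (∀ e, IsWeightedHomogeneous wL (weightedHomogeneousComponent wX e P) e) ∧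
      (∀ l, L ≤ l → kernelSeries m 1 φ l = 0) ∧
      toRat (deformedDen n k) * ∑ l ∈ Finset.range L, kernelSeries m 1 φ l = toRat Q ∧
      IsDeformedBA n m Q := by
  obtain ⟨P', hP', hb⟩ := exists_isGenBA n k
  have h0 := fun {P} => isBA_iff (n := n) (k := k) (m := -(k : ℤ) - 1) (P := P) (by ring)
  -- The constructed numerator is balanced, and uniqueness transfers this to the given one.
  obtain rfl : P = P' := (h0.mp hP).unique (by simp) (isDenominator_baDen n k) hP'
  obtain ⟨φ, hφ, h1, h2⟩ := ((isBA_iff hm).mp hP).exists_series (by simp)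
    (isDenominator_baDen n k) hb
  obtain ⟨L, Q, h3, h4, h5, -⟩ := hφ.exists_deformed (k := k) hm0 hm (fun l => by
      by_cases hl : l ≤ k * pairCount n
      · exact ⟨_, h1 l hl⟩
      · exact ⟨0, by rw [h2 l (by omega)]; simp⟩)
  refine ⟨φ, L, Q, h1, h2, hb, h3, h4, ?_⟩
  rw [isDeformedBA_iff hm0, hmk]
  exact h5

theorem IsDeformedBA.unique {m : ℤ} (hm0 : m ≠ 0) {Q Q' : PolyRing (Option (Fin n))}
    (h : IsDeformedBA n m Q) (h' : IsDeformedBA n m Q') : Q = Q' := by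
  have hm0' : (m : ℂ) ≠ 0 := by exact_mod_cast hm0
  exact ((isDeformedBA_iff hm0).mp h).unique
    (by rintro (_ | i) <;> simp [deformedCharge, hm0']) (isDenominator_deformedDen n _)
    ((isDeformedBA_iff hm0).mp h')

theorem existsUnique_isDeformedBA {m : ℤ} (hm0 : m ≠ 0) (hm : m * (m + 1) = k * (k + 1))
    (hmk : mStar m = k) : ∃! Q, IsDeformedBA n m Q := by
  obtain ⟨P, hP, -⟩ := existsUnique_isBA n k
  obtain ⟨-, -, Q, -, -, -, -, -, h⟩ := hP.exists_deformed hm0 hm hmk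
  exact ⟨Q, h, fun Q' hQ' => hQ'.unique hm0 h⟩

end Transfer

/-! ### Integrals depending analytically on a parameter -/

section Analysis

/-- On a slightly larger disc the integrand is bounded by compactness. Cauchy's estimate then bounds
its derivative uniformly, which allows differentiation under the integral. -/
theorem differentiableOn_integral_of_compact {Y : Type*} [TopologicalSpace Y] [MeasurableSpace Y]
    [OpensMeasurableSpace Y] [SecondCountableTopology Y] {μ : Measure Y}
    [IsFiniteMeasureOnCompacts μ] {K s : Set Y} (hK : IsCompact K) (hs : MeasurableSet s)
    (hsK : s ⊆ K) {U : Set ℂ} (hU : IsOpen U) {f : ℂ → Y → ℂ}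
    (hf : ContinuousOn (Function.uncurry f) (U ×ˢ K))
    (hd : ∀ y ∈ K, DifferentiableOn ℂ (fun z => f z y) U) :
    DifferentiableOn ℂ (fun z => ∫ y in s, f z y ∂μ) U := by
  intro z₀ hz₀
  obtain ⟨r, hr, hrU⟩ := Metric.isOpen_iff.mp hU z₀ hz₀
  set ρ := r / 3 with hρ
  have hρ0 : 0 < ρ := by positivity
  have hball : Metric.closedBall z₀ (2 * ρ) ⊆ U := fun z hz =>
    hrU (Metric.mem_ball.mpr ((Metric.mem_closedBall.mp hz).trans_lt (by linarith)))
  obtain ⟨M, hM⟩ := ((isCompact_closedBall z₀ (2 * ρ)).prod hK).exists_bound_of_continuousOn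
    (hf.mono (Set.prod_mono hball subset_rfl))
  have hfin : IsFiniteMeasure (μ.restrict s) :=
    ⟨by rw [Measure.restrict_apply_univ]; exact (measure_mono hsK).trans_lt hK.measure_lt_top⟩
  have hmeas : ∀ z ∈ U, AEStronglyMeasurable (f z) (μ.restrict s) := by
    intro z hz
    have : ContinuousOn (f z) s := hf.comp (f := fun y => (z, y)) (by fun_prop)
      (fun y hy => ⟨hz, hsK hy⟩)
    exact this.aestronglyMeasurable hs
  have hder : ∀ y ∈ K, ∀ z ∈ Metric.ball z₀ ρ, HasDerivAt (fun z => f z y)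
      (deriv (fun z => f z y) z) z ∧ ‖deriv (fun z => f z y) z‖ ≤ M / ρ := by
    intro y hy z hz
    have hsub : Metric.closedBall z ρ ⊆ Metric.closedBall z₀ (2 * ρ) := fun w hw => by
      have h1 := Metric.mem_closedBall.mp hw
      have h2 := Metric.mem_ball.mp hz
      have h3 := dist_triangle w z z₀
      exact Metric.mem_closedBall.mpr (by linarith)
    have hzU : z ∈ U := hball (hsub (Metric.mem_closedBall_self hρ0.le))
    refine ⟨((hd y hy).differentiableAt (hU.mem_nhds hzU)).hasDerivAt, ?_⟩
    refine Complex.norm_deriv_le_of_forall_mem_sphere_norm_le hρ0 ?_ fun w hw =>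
      hM (w, y) ⟨hsub (Metric.sphere_subset_closedBall hw), hy⟩
    refine DifferentiableOn.diffContOnCl ?_
    rw [closure_ball _ hρ0.ne']
    exact (hd y hy).mono (hsub.trans hball)
  refine (HasDerivAt.differentiableAt (hasDerivAt_integral_of_dominated_loc_of_deriv_le
    (bound := fun _ => M / ρ) (F' := fun z y => deriv (fun z => f z y) z)
    (Metric.ball_mem_nhds z₀ hρ0) ?_ ?_ ?_ ?_ (integrable_const _) ?_).2).differentiableWithinAt
  · filter_upwards [hU.mem_nhds hz₀] with z hz using hmeas z hz
  · refine Integrable.mono' (integrable_const M) (hmeas z₀ hz₀) ?_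
    refine (ae_restrict_iff' hs).mpr (Filter.Eventually.of_forall fun y hy => ?_)
    exact hM (z₀, y) ⟨Metric.mem_closedBall_self (by positivity), hsK hy⟩
  -- The derivative is measurable in `y` as a pointwise limit of difference quotients along a
  -- sequence.
  · have hlim : Filter.Tendsto (fun n : ℕ => z₀ + ((ρ / (n + 2) : ℝ) : ℂ)) Filter.atTop
        (nhdsWithin z₀ {z₀}ᶜ) := by
      refine tendsto_nhdsWithin_iff.mpr ⟨?_, Filter.Eventually.of_forall fun n => ?_⟩
      · have h1 : Filter.Tendsto (fun n : ℕ => ρ / ((n : ℝ) + 2)) Filter.atTop (nhds 0) :=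
          tendsto_const_nhds.div_atTop
            (Filter.tendsto_atTop_add_const_right _ _ tendsto_natCast_atTop_atTop)
        have h2 := (Complex.continuous_ofReal.tendsto 0).comp h1
        have h3 := h2.const_add z₀
        simpa using h3
      · have : (0 : ℝ) < ρ / ((n : ℝ) + 2) := by positivity
        rw [Set.mem_compl_singleton_iff, ne_eq, add_eq_left, Complex.ofReal_eq_zero]
        exact this.ne'
    refine aestronglyMeasurable_of_tendsto_ae (μ := μ.restrict s) Filter.atTop
      (f := fun (n : ℕ) y => slope (fun z => f z y) z₀ (z₀ + ((ρ / (n + 2) : ℝ) : ℂ))) ?_ ?_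
    · intro n
      simp only [slope_def_module]
      refine AEStronglyMeasurable.fun_const_smul ((hmeas _ (hball ?_)).sub (hmeas _ hz₀)) _
      rw [Metric.mem_closedBall, dist_self_add_left, Complex.norm_real, Real.norm_eq_abs,
        abs_of_pos (by positivity)]
      calc ρ / ((n : ℝ) + 2) ≤ ρ / 1 := by
            apply div_le_div_of_nonneg_left hρ0.le one_pos
            linarith [(Nat.cast_nonneg n : (0 : ℝ) ≤ n)]
        _ ≤ 2 * ρ := by linarith
    · refine (ae_restrict_iff' hs).mpr (Filter.Eventually.of_forall fun y hy => ?_)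
      exact (hasDerivAt_iff_tendsto_slope.mp
        (hder y (hsK hy) z₀ (Metric.mem_ball_self hρ0)).1).comp hlim
  · exact (ae_restrict_iff' hs).mpr (Filter.Eventually.of_forall fun y hy z hz =>
      (hder y (hsK hy) z hz).2)
  · exact (ae_restrict_iff' hs).mpr (Filter.Eventually.of_forall fun y hy z hz =>
      (hder y (hsK hy) z hz).1)

/-! ### Gamma integrals -/

theorem integrableOn_pow_mul_exp (p : ℕ) {a : ℂ} (ha : 0 < a.re) :
    IntegrableOn (fun t : ℝ => (t : ℂ) ^ p * Complex.exp (-(a * t))) (Set.Ioi 0) := by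
  have h := integrableOn_rpow_mul_exp_neg_mul_rpow (p := 1) (s := p) (b := a.re)
    (by have : (0 : ℝ) ≤ p := Nat.cast_nonneg p
        linarith) one_pos ha
  refine (integrable_norm_iff ?_).mp ?_
  · exact (by fun_prop : Continuous fun t : ℝ =>
      (t : ℂ) ^ p * Complex.exp (-(a * t))).aestronglyMeasurable
  · refine IntegrableOn.congr_fun h (fun t ht => ?_) measurableSet_Ioi
    simp only [Real.rpow_natCast, Real.rpow_one, norm_mul, norm_pow, Complex.norm_real,
      Complex.norm_exp, Real.norm_eq_abs, abs_of_pos (Set.mem_Ioi.mp ht)]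
    simp

theorem integral_pow_mul_exp (p : ℕ) {a : ℂ} (ha : 0 < a.re) :
    ∫ t in Set.Ioi (0 : ℝ), (t : ℂ) ^ p * Complex.exp (-(a * t)) =
      p.factorial / a ^ (p + 1) := by
  have ha0 : a ≠ 0 := by rintro rfl; simp at ha
  induction p with
  | zero =>
    have := integral_exp_mul_complex_Ioi (a := -a) (by simpa using ha) 0
    simp only [neg_mul] at this
    simp only [pow_zero, one_mul, this]
    simp
  | succ p ih =>
    have hd : ∀ t ∈ Set.Ioi (0 : ℝ), HasDerivAt
        (fun t : ℝ => (t : ℂ) ^ (p + 1) * Complex.exp (-(a * t)))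
        ((p + 1) * ((t : ℂ) ^ p * Complex.exp (-(a * t))) -
          a * ((t : ℂ) ^ (p + 1) * Complex.exp (-(a * t)))) t := by
      intro t _
      have h0 : HasDerivAt (fun z : ℂ => z ^ (p + 1) * Complex.exp (-(a * z)))
          ((p + 1) * ((t : ℂ) ^ p * Complex.exp (-(a * t))) -
          a * ((t : ℂ) ^ (p + 1) * Complex.exp (-(a * t)))) (t : ℂ) := by
        have h1 := (hasDerivAt_pow (p + 1) (t : ℂ)).mul
          (((hasDerivAt_id (t : ℂ)).const_mul a).neg.cexp)
        refine h1.congr_deriv ?_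
        simp only [id_eq, Nat.cast_add, Nat.cast_one, Nat.add_sub_cancel, Pi.neg_apply]
        ring
      exact h0.comp_ofReal
    have hi := (integrableOn_pow_mul_exp p ha).const_mul ((p : ℂ) + 1)
    have hi' := (integrableOn_pow_mul_exp (p + 1) ha).const_mul a
    have hlim : Filter.Tendsto (fun t : ℝ => (t : ℂ) ^ (p + 1) * Complex.exp (-(a * t)))
        Filter.atTop (nhds 0) := by
      rw [tendsto_zero_iff_norm_tendsto_zero]
      refine (tendsto_rpow_mul_exp_neg_mul_atTop_nhds_zero (p + 1 : ℕ) a.re ha).congr' ?_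
      filter_upwards [Filter.eventually_gt_atTop 0] with t ht
      simp only [Real.rpow_natCast, norm_mul, norm_pow, Complex.norm_real,
        Complex.norm_exp, Real.norm_eq_abs, abs_of_pos ht]
      simp
    have h := integral_Ioi_of_hasDerivAt_of_tendsto (a := 0) (m := 0)
      (by fun_prop) hd (hi.sub hi') hlim
    rw [integral_sub hi hi', integral_const_mul, integral_const_mul, ih] at h
    simp only [Complex.ofReal_zero, ne_eq, Nat.add_eq_zero_iff, one_ne_zero, and_false,
      not_false_eq_true, zero_pow, zero_mul, sub_zero] at h
    have h2 : ∫ t in Set.Ioi (0 : ℝ), (t : ℂ) ^ (p + 1) * Complex.exp (-(a * t)) =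
        (p + 1) * (p.factorial / a ^ (p + 1)) / a := by
      rw [eq_div_iff ha0]
      linear_combination -h
    rw [h2, Nat.factorial_succ]
    push_cast
    field_simp
    ring

end Analysis

/-! ### A converse of Watson's lemma, and Laplace transforms over simplices. -/

section Watson

/-- An analytic function is zero near the origin when its Laplace transform decays faster than
every power. -/
theorem eventually_eq_zero_of_laplace {f : ℂ → ℂ} {K : ℝ} (hf : AnalyticAt ℂ f 0)
    (hb : ∀ u : ℝ, 0 < u → ‖f u‖ ≤ K) (hc : ContinuousOn (fun u : ℝ => f u) (Set.Ioi 0))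
    (hL : ∀ N : ℕ, ∃ M : ℝ, ∀ ν : ℝ, 1 ≤ ν →
      ‖∫ u in Set.Ioi (0 : ℝ), f u * Complex.exp (-(ν * u))‖ ≤ M / ν ^ N) :
    ∀ᶠ z in nhds 0, f z = 0 := by
  by_contra hne
  -- If `f` is not zero near the origin, then `f = z^p g` with `g 0 ≠ 0`, and its Laplace transform
  -- behaves like `g(0) p! / ν^{p+1}`.
  obtain ⟨p, g, hg, hg0, hfg⟩ := hf.exists_eventuallyEq_pow_smul_nonzero_iff.mpr hne
  -- Near the origin this is Taylor's formula; for `u ≥ δ` boundedness is enough, because `u^{p+1}`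
  -- is at least `δ^{p+1}`.
  obtain ⟨A, hA⟩ : ∃ A : ℝ, ∀ u : ℝ, 0 < u → ‖f u - g 0 * u ^ p‖ ≤ A * u ^ (p + 1) := by
    obtain ⟨c, hc⟩ := hg.differentiableAt.hasDerivAt.isBigO_sub.bound
    obtain ⟨δ, hδ, h⟩ := Metric.eventually_nhds_iff.mp (hc.and hfg)
    have hK : 0 ≤ K := (norm_nonneg _).trans (hb 1 one_pos)
    refine ⟨max c (K / δ ^ (p + 1) + ‖g 0‖ / δ), fun u hu => ?_⟩
    by_cases hud : u < δ
    · obtain ⟨h1, h2⟩ := h (y := (u : ℂ)) (by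
        rw [dist_zero_right, Complex.norm_real, Real.norm_eq_abs, abs_of_pos hu]; exact hud)
      rw [h2, sub_zero, smul_eq_mul, mul_comm (g 0), ← mul_sub, norm_mul, norm_pow,
        Complex.norm_real, Real.norm_eq_abs, abs_of_pos hu]
      rw [sub_zero, Complex.norm_real, Real.norm_eq_abs, abs_of_pos hu] at h1
      calc u ^ p * ‖g u - g 0‖ ≤ u ^ p * (c * u) := by gcongr
        _ = c * u ^ (p + 1) := by ring
        _ ≤ _ := by gcongr; exact le_max_left _ _
    · push Not at hud
      have h1 : K ≤ K / δ ^ (p + 1) * u ^ (p + 1) := by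
        rw [div_mul_eq_mul_div, le_div_iff₀ (by positivity)]
        gcongr
      have h2 : ‖g 0‖ * u ^ p ≤ ‖g 0‖ / δ * u ^ (p + 1) := by
        rw [div_mul_eq_mul_div, le_div_iff₀ hδ, pow_succ, mul_assoc]
        gcongr
      calc ‖f u - g 0 * u ^ p‖ ≤ ‖f u‖ + ‖g 0 * u ^ p‖ := norm_sub_le _ _
        _ ≤ K + ‖g 0‖ * u ^ p := by
          rw [norm_mul, norm_pow, Complex.norm_real, Real.norm_eq_abs, abs_of_pos hu]
          gcongr
          exact hb u hu
        _ ≤ (K / δ ^ (p + 1) + ‖g 0‖ / δ) * u ^ (p + 1) := by rw [add_mul]; gcongr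
        _ ≤ _ := by gcongr; exact le_max_right _ _
  -- Decay of order `p + 2` makes `ν` times a positive constant bounded, a contradiction.
  obtain ⟨M, hM⟩ := hL (p + 2)
  have key : ∀ ν : ℝ, 1 ≤ ν → ‖g 0‖ * p.factorial * ν ≤ A * (p + 1).factorial + M := by
    intro ν hν
    have hν0 : 0 < ν := by linarith
    have hν' : 0 < (ν : ℂ).re := by simpa using hν0
    have hi := (integrableOn_pow_mul_exp p hν').const_mul (g 0)
    have hexp : ∀ u : ℝ, ‖Complex.exp (-(ν * u))‖ = Real.exp (-(ν * u)) := fun u => by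
      rw [Complex.norm_exp]; simp
    have hif : IntegrableOn (fun u : ℝ => f u * Complex.exp (-(ν * u))) (Set.Ioi 0) := by
      have h0 := (integrableOn_pow_mul_exp 0 hν').norm.const_mul K
      refine Integrable.mono' h0 ((hc.mul (by fun_prop)).aestronglyMeasurable measurableSet_Ioi) ?_
      refine (ae_restrict_iff' measurableSet_Ioi).mpr (Filter.Eventually.of_forall fun u hu => ?_)
      rw [norm_mul, pow_zero, one_mul]
      gcongr
      exact hb u hu
    have hr : ∫ u in Set.Ioi (0 : ℝ), u ^ (p + 1) * Real.exp (-(ν * u)) =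
        (p + 1).factorial / ν ^ (p + 2) := by
      have := integral_pow_mul_exp (p + 1) hν'
      have h2 : ∀ u : ℝ, (u : ℂ) ^ (p + 1) * Complex.exp (-(ν * u)) =
          ((u ^ (p + 1) * Real.exp (-(ν * u)) : ℝ) : ℂ) := fun u => by push_cast; ring
      simp only [h2] at this
      rw [integral_complex_ofReal] at this
      exact_mod_cast this
    have h1 : ‖(∫ u in Set.Ioi (0 : ℝ), f u * Complex.exp (-(ν * u))) -
        g 0 * (p.factorial / (ν : ℂ) ^ (p + 1))‖ ≤ A * ((p + 1).factorial / ν ^ (p + 2)) := by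
      rw [← integral_pow_mul_exp p hν', ← integral_const_mul, ← integral_sub hif hi, ← hr,
        ← integral_const_mul]
      have hi2 := ((integrableOn_pow_mul_exp (p + 1) hν').norm.const_mul A)
      refine norm_integral_le_of_norm_le (Integrable.congr hi2 ?_) ?_
      · refine (ae_restrict_iff' measurableSet_Ioi).mpr (Filter.Eventually.of_forall fun u hu => ?_)
        simp only [norm_mul, norm_pow, hexp, Complex.norm_real, Real.norm_eq_abs,
          abs_of_pos (Set.mem_Ioi.mp hu)]
      · refine (ae_restrict_iff' measurableSet_Ioi).mpr (Filter.Eventually.of_forall fun u hu => ?_)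
        rw [← mul_assoc, ← sub_mul, norm_mul, hexp, ← mul_assoc]
        gcongr
        exact hA u hu
    have h2 : ‖g 0 * (p.factorial / (ν : ℂ) ^ (p + 1))‖ ≤
        A * ((p + 1).factorial / ν ^ (p + 2)) + M / ν ^ (p + 2) := by
      have h3 := hM ν hν
      have h4 := norm_sub_norm_le (g 0 * (p.factorial / (ν : ℂ) ^ (p + 1)))
        (∫ u in Set.Ioi (0 : ℝ), f u * Complex.exp (-(ν * u)))
      rw [norm_sub_rev] at h4
      linarith
    rw [norm_mul, norm_div, norm_pow, Complex.norm_natCast, Complex.norm_real, Real.norm_eq_abs,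
      abs_of_pos hν0] at h2
    have h3 : ‖g 0‖ * (p.factorial / ν ^ (p + 1)) * ν ^ (p + 2) = ‖g 0‖ * p.factorial * ν := by
      field_simp
      ring
    have h4 : (A * ((p + 1).factorial / ν ^ (p + 2)) + M / ν ^ (p + 2)) * ν ^ (p + 2) =
        A * (p + 1).factorial + M := by
      field_simp
    rw [← h3, ← h4]
    gcongr
  have hpos : 0 < ‖g 0‖ * p.factorial := by
    have := norm_pos_iff.mpr hg0
    positivity
  set B := A * (p + 1).factorial + M with hB
  have h1 := key (max 1 (B / (‖g 0‖ * p.factorial) + 1)) (le_max_left _ _)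
  have h2 : ‖g 0‖ * p.factorial * (B / (‖g 0‖ * p.factorial) + 1) ≤ B :=
    (mul_le_mul_of_nonneg_left (le_max_right _ _) hpos.le).trans h1
  rw [mul_add, mul_div_cancel₀ _ hpos.ne'] at h2
  linarith

/-- The Laplace transform of an integrable function on the orthant in terms of its integrals over
simplices. -/
theorem integral_orthant_eq {n : ℕ} {k : (Fin n → ℝ) → ℂ} {Q : Set (Fin n → ℝ)}
    (hQ : MeasurableSet Q) (hQ0 : ∀ τ ∈ Q, ∀ i, 0 ≤ τ i) (hk : IntegrableOn k Q) {ν : ℝ}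
    (hν : 0 < ν) :
    ∫ τ in Q, k τ * Complex.exp (-(ν * ∑ i, (τ i : ℂ))) =
      ν * ∫ u in Set.Ioi (0 : ℝ), (∫ τ in Q ∩ {τ | ∑ i, τ i ≤ u}, k τ) *
        Complex.exp (-(ν * u)) := by
  have hν' : 0 < (ν : ℂ).re := by simpa using hν
  have hνc : (ν : ℂ) ≠ 0 := by exact_mod_cast hν.ne'
  set S : Set (ℝ × (Fin n → ℝ)) := {p | ∑ i, p.2 i ≤ p.1} with hS
  have hSm : MeasurableSet S := (isClosed_le (by fun_prop) (by fun_prop)).measurableSet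
  -- Fubini's theorem for `exp (-νs) = ν ∫_s^∞ exp (-νu) du` with `s = ∑ τ_i`.
  set F : ℝ → (Fin n → ℝ) → ℂ := fun u τ =>
    S.indicator (fun p => Complex.exp (-(ν * p.1)) * k p.2) (u, τ) with hF
  have hint : Integrable (Function.uncurry F)
      ((volume.restrict (Set.Ioi (0 : ℝ))).prod (volume.restrict Q)) := by
    have h0 := integrableOn_pow_mul_exp 0 hν'
    simp only [pow_zero, one_mul] at h0
    exact (Integrable.mul_prod h0 hk).indicator hSm
  have hswap := integral_integral_swap hint
  have h1 : ∀ u : ℝ, ∫ τ in Q, F u τ =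
      (∫ τ in Q ∩ {τ | ∑ i, τ i ≤ u}, k τ) * Complex.exp (-(ν * u)) := by
    intro u
    have hm : MeasurableSet {τ : Fin n → ℝ | ∑ i, τ i ≤ u} :=
      (isClosed_le (by fun_prop) (by fun_prop)).measurableSet
    have : ∀ τ, F u τ = {τ : Fin n → ℝ | ∑ i, τ i ≤ u}.indicator
        (fun τ => Complex.exp (-(ν * u)) * k τ) τ := fun τ => by
      simp only [hF, hS, Set.indicator, Set.mem_ofPred_eq]
    simp only [this]
    rw [setIntegral_indicator hm, integral_const_mul, mul_comm]
  have h2 : ∀ τ ∈ Q, ∫ u in Set.Ioi (0 : ℝ), F u τ =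
      k τ * Complex.exp (-(ν * ∑ i, (τ i : ℂ))) / ν := by
    intro τ hτ
    have hs : 0 ≤ ∑ i, τ i := Finset.sum_nonneg fun i _ => hQ0 τ hτ i
    have : ∀ u, F u τ = (Set.Ici (∑ i, τ i)).indicator
        (fun u : ℝ => Complex.exp (-(ν * u)) * k τ) u := fun u => by
      simp only [hF, hS, Set.indicator, Set.mem_ofPred_eq, Set.mem_Ici]
    simp only [this]
    rw [← integral_Ici_eq_integral_Ioi, setIntegral_indicator measurableSet_Ici,
      Set.inter_eq_self_of_subset_right (Set.Ici_subset_Ici.mpr hs), integral_Ici_eq_integral_Ioi,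
      integral_mul_const]
    have h3 := integral_exp_mul_complex_Ioi (a := -(ν : ℂ)) (by simpa using hν) (∑ i, τ i)
    simp only [neg_mul] at h3
    rw [h3]
    push_cast
    field_simp
  simp only [h1] at hswap
  rw [hswap, setIntegral_congr_fun hQ h2, integral_div]
  field_simp

end Watson

/-! ### Gamma type integrals over the orthant. -/

section Orthant

variable {n : ℕ}

/-- The open positive orthant. -/
abbrev orthant (n : ℕ) : Set (Fin n → ℝ) := Set.univ.pi fun _ => Set.Ioi 0

theorem measurableSet_orthant : MeasurableSet (orthant n) :=
  MeasurableSet.univ_pi fun _ => measurableSet_Ioi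

/-- The weight of a Gamma type integral. -/
def gammaWeight (k : ℕ) (b : Fin n → ℂ) (w : Fin n → ℂ) : ℂ :=
  ∏ i, (w i ^ k * Complex.exp (-(b i * w i)))

/-- The Gamma type integral of a polynomial, computed term by term. -/
def gammaSum (k : ℕ) (b : Fin n → ℂ) (g : MvPolynomial (Fin n) ℂ) : ℂ :=
  ∑ β ∈ g.support, coeff β g * ∏ i, ((β i + k).factorial / b i ^ (β i + k + 1))

/-- Real points among complex ones. -/
def realPt (τ : Fin n → ℝ) : Fin n → ℂ := fun i => (τ i : ℂ)

theorem continuous_realPt : Continuous (realPt : (Fin n → ℝ) → Fin n → ℂ) := by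
  unfold realPt; fun_prop

theorem continuous_gammaWeight (k : ℕ) (b : Fin n → ℂ) : Continuous (gammaWeight k b) := by
  unfold gammaWeight; fun_prop

theorem integral_orthant_prod {f : Fin n → ℝ → ℂ} :
    ∫ τ in orthant n, ∏ i, f i (τ i) = ∏ i, ∫ t in Set.Ioi (0 : ℝ), f i t := by
  rw [volume_pi, Measure.restrict_pi_pi, integral_fintype_prod_eq_prod]

theorem integrableOn_orthant_prod {f : Fin n → ℝ → ℂ}
    (h : ∀ i, IntegrableOn (f i) (Set.Ioi (0 : ℝ))) :
    IntegrableOn (fun τ => ∏ i, f i (τ i)) (orthant n) := by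
  rw [IntegrableOn, volume_pi, Measure.restrict_pi_pi]
  exact Integrable.fintype_prod_dep h

theorem gammaWeight_mul_eval (k : ℕ) (b : Fin n → ℂ) (g : MvPolynomial (Fin n) ℂ)
    (w : Fin n → ℂ) : gammaWeight k b w * eval w g = ∑ β ∈ g.support,
      coeff β g * ∏ i, (w i ^ (β i + k) * Complex.exp (-(b i * w i))) := by
  rw [eval_eq', Finset.mul_sum]
  refine Finset.sum_congr rfl fun β _ => ?_
  rw [gammaWeight, mul_left_comm, ← Finset.prod_mul_distrib]
  refine congrArg _ (Finset.prod_congr rfl fun i _ => ?_)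
  ring

variable {b : Fin n → ℂ}

theorem integrableOn_gammaWeight_mul_eval (k : ℕ) (hb : ∀ i, 0 < (b i).re)
    (g : MvPolynomial (Fin n) ℂ) :
    IntegrableOn (fun τ => gammaWeight k b (realPt τ) * eval (realPt τ) g) (orthant n) := by
  simp only [gammaWeight_mul_eval]
  exact integrable_finsetSum _ fun β _ => (integrableOn_orthant_prod fun i =>
    integrableOn_pow_mul_exp (β i + k) (hb i)).const_mul _

theorem integral_gammaWeight_mul_eval (k : ℕ) (hb : ∀ i, 0 < (b i).re)
    (g : MvPolynomial (Fin n) ℂ) :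
    ∫ τ in orthant n, gammaWeight k b (realPt τ) * eval (realPt τ) g = gammaSum k b g := by
  simp only [gammaWeight_mul_eval, realPt]
  have hint : ∀ β : Fin n →₀ ℕ, IntegrableOn (fun τ : Fin n → ℝ =>
      ∏ i, ((τ i : ℂ) ^ (β i + k) * Complex.exp (-(b i * τ i)))) (orthant n) := fun β =>
    integrableOn_orthant_prod (f := fun i t => (t : ℂ) ^ (β i + k) * Complex.exp (-(b i * t)))
      fun i => integrableOn_pow_mul_exp (β i + k) (hb i)
  rw [integral_finsetSum _ fun β _ => (hint β).const_mul _, gammaSum]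
  refine Finset.sum_congr rfl fun β _ => ?_
  rw [integral_const_mul, integral_orthant_prod (f := fun i t => (t : ℂ) ^ (β i + k) *
    Complex.exp (-(b i * t)))]
  exact congrArg _ (Finset.prod_congr rfl fun i _ => integral_pow_mul_exp _ (hb i))

theorem continuous_eval_realPt (g : MvPolynomial (Fin n) ℂ) :
    Continuous fun τ : Fin n → ℝ => eval (realPt τ) g :=
  (MvPolynomial.continuous_eval g).comp continuous_realPt

theorem integrableOn_gammaWeight_mul_div (k : ℕ) (hb : ∀ i, 0 < (b i).re)
    {g D : MvPolynomial (Fin n) ℂ} {c : ℝ} (hc : 0 < c)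
    (hD : ∀ τ ∈ orthant n, c ≤ ‖eval (realPt τ) D‖) :
    IntegrableOn (fun τ => gammaWeight k b (realPt τ) * (eval (realPt τ) g / eval (realPt τ) D))
      (orthant n) := by
  refine Integrable.mono' ((integrableOn_gammaWeight_mul_eval k hb g).norm.const_mul c⁻¹) ?_ ?_
  · refine ContinuousOn.aestronglyMeasurable ?_ measurableSet_orthant
    refine ((continuous_gammaWeight k b).comp continuous_realPt).continuousOn.mul
      ((continuous_eval_realPt g).continuousOn.div (continuous_eval_realPt D).continuousOn ?_)
    intro τ hτ h0
    have := hD τ hτ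
    rw [h0, norm_zero] at this
    linarith
  · refine (ae_restrict_iff' measurableSet_orthant).mpr (Filter.Eventually.of_forall fun τ hτ => ?_)
    have h1 := hD τ hτ
    rw [← mul_div_assoc, norm_div, div_eq_inv_mul]
    gcongr

/-- A common shift of the parameters multiplies the weight by a function of `∑ τ_i` alone. Thus the
dependence on `μ` is that of a Laplace transform in one variable. -/
theorem gammaWeight_add (k : ℕ) (b : Fin n → ℂ) (ν : ℂ) (w : Fin n → ℂ) :
    gammaWeight k (fun i => b i + ν) w = gammaWeight k b w * Complex.exp (-(ν * ∑ i, w i)) := by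
  rw [gammaWeight, gammaWeight, Finset.mul_sum, ← Finset.sum_neg_distrib, Complex.exp_sum,
    ← Finset.prod_mul_distrib]
  refine Finset.prod_congr rfl fun i _ => ?_
  rw [mul_assoc, ← Complex.exp_add]
  congr 2
  ring

/-- Decay of the Gamma type integral of a rational function that vanishes at the origin. -/
theorem norm_integral_gammaWeight_le (k : ℕ) (hb : ∀ i, 0 < (b i).re)
    {g D : MvPolynomial (Fin n) ℂ} {c : ℝ} (hc : 0 < c)
    (hD : ∀ τ ∈ orthant n, c ≤ ‖eval (realPt τ) D‖) {N : ℕ}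
    (hg : ∀ β, ∑ i, β i < N → coeff β g = 0) :
    ∃ M : ℝ, ∀ ν : ℝ, 1 ≤ ν → ‖∫ τ in orthant n, gammaWeight k (fun i => b i + ν) (realPt τ) *
      (eval (realPt τ) g / eval (realPt τ) D)‖ ≤ M / ν ^ N := by
  -- Each monomial is estimated separately: the factors `exp (-b_i τ_i)` are at most 1 in norm, and
  -- since `ν ≥ 1` a monomial of degree at least `N` contributes at most a constant times `ν^{-N}`.
  refine ⟨c⁻¹ * ∑ β ∈ g.support, ‖coeff β g‖ * ∏ i, ((β i + k).factorial : ℝ), fun ν hν => ?_⟩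
  have hν0 : 0 < ν := by linarith
  have hν' : 0 < (ν : ℂ).re := by simpa using hν0
  have hint : ∀ β : Fin n →₀ ℕ, IntegrableOn (fun τ : Fin n → ℝ =>
      ∏ i, ((τ i : ℂ) ^ (β i + k) * Complex.exp (-(ν * τ i)))) (orthant n) := fun β =>
    integrableOn_orthant_prod (f := fun i t => (t : ℂ) ^ (β i + k) * Complex.exp (-(ν * t)))
      fun i => integrableOn_pow_mul_exp (β i + k) hν'
  have hval : ∀ β : Fin n →₀ ℕ, ∫ τ in orthant n,
      ‖∏ i, ((τ i : ℂ) ^ (β i + k) * Complex.exp (-(ν * τ i)))‖ =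
      ∏ i, ((β i + k).factorial / ν ^ (β i + k + 1) : ℝ) := by
    intro β
    have h1 : ∀ τ ∈ orthant n, ((‖∏ i, ((τ i : ℂ) ^ (β i + k) * Complex.exp (-(ν * τ i)))‖ : ℝ) : ℂ)
        = ∏ i, ((τ i : ℂ) ^ (β i + k) * Complex.exp (-(ν * τ i))) := by
      intro τ hτ
      rw [norm_prod]
      push_cast
      refine Finset.prod_congr rfl fun i _ => ?_
      have h0 : 0 < τ i := hτ i (Set.mem_univ i)
      rw [norm_mul, norm_pow, Complex.norm_exp, Complex.norm_real, Real.norm_eq_abs, abs_of_pos h0]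
      push_cast
      simp
    have h2 := integral_orthant_prod (f := fun (i : Fin n) t => (t : ℂ) ^ (β i + k) *
      Complex.exp (-(ν * t)))
    simp only [integral_pow_mul_exp _ hν'] at h2
    rw [← setIntegral_congr_fun measurableSet_orthant h1, integral_complex_ofReal] at h2
    apply Complex.ofReal_injective
    rw [h2]
    push_cast
    rfl
  have hbound : ∀ τ ∈ orthant n, ‖gammaWeight k (fun i => b i + ν) (realPt τ) *
      (eval (realPt τ) g / eval (realPt τ) D)‖ ≤ c⁻¹ * ∑ β ∈ g.support, ‖coeff β g‖ *
        ‖∏ i, ((τ i : ℂ) ^ (β i + k) * Complex.exp (-(ν * τ i)))‖ := by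
    intro τ hτ
    have h1 := hD τ hτ
    rw [← mul_div_assoc, norm_div, div_eq_inv_mul, gammaWeight_mul_eval]
    have h2 : ‖∑ β ∈ g.support, coeff β g * ∏ i, (realPt τ i ^ (β i + k) *
        Complex.exp (-((b i + ν) * realPt τ i)))‖ ≤ ∑ β ∈ g.support, ‖coeff β g‖ *
        ‖∏ i, ((τ i : ℂ) ^ (β i + k) * Complex.exp (-(ν * τ i)))‖ := by
      refine norm_sum_le_of_le _ fun β _ => ?_
      rw [norm_mul, norm_prod, norm_prod]
      refine mul_le_mul_of_nonneg_left (Finset.prod_le_prod (fun _ _ => norm_nonneg _)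
        fun i _ => ?_) (norm_nonneg _)
      have h0 : 0 < τ i := hτ i (Set.mem_univ i)
      rw [norm_mul, norm_mul, realPt, Complex.norm_exp, Complex.norm_exp]
      refine mul_le_mul_of_nonneg_left (Real.exp_le_exp.mpr ?_) (norm_nonneg _)
      simp only [Complex.neg_re, Complex.mul_re, Complex.add_re, Complex.ofReal_re,
        Complex.ofReal_im, mul_zero, sub_zero]
      nlinarith [mul_pos (hb i) h0]
    gcongr
  have hI : IntegrableOn (fun τ : Fin n → ℝ => c⁻¹ * ∑ β ∈ g.support, ‖coeff β g‖ *
        ‖∏ i, ((τ i : ℂ) ^ (β i + k) * Complex.exp (-(ν * τ i)))‖) (orthant n) :=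
    (integrable_finsetSum _ fun β _ => (hint β).norm.const_mul _).const_mul _
  refine (norm_integral_le_of_norm_le hI ((ae_restrict_iff' measurableSet_orthant).mpr
    (Filter.Eventually.of_forall hbound))).trans ?_
  rw [integral_const_mul, integral_finsetSum _ fun β _ => (hint β).norm.const_mul _, mul_div_assoc,
    Finset.sum_div]
  refine mul_le_mul_of_nonneg_left (Finset.sum_le_sum fun β hβ => ?_) (by positivity)
  rw [integral_const_mul, hval, mul_div_assoc, Finset.prod_div_distrib]
  refine mul_le_mul_of_nonneg_left ?_ (norm_nonneg _)
  have hβN : N ≤ ∑ i, (β i + k + 1) := by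
    have h1 : N ≤ ∑ i, β i := by
      by_contra h
      exact mem_support_iff.mp hβ (hg β (not_le.mp h))
    exact h1.trans (Finset.sum_le_sum fun i _ => by omega)
  rw [Finset.prod_pow_eq_pow_sum]
  gcongr

end Orthant

/-! ### Integrals whose formal expansion terminates. -/

section BorelSum

open scoped Pointwise

variable {n : ℕ}

theorem smul_orthant_simplex {u : ℝ} (hu : 0 < u) :
    u • (orthant n ∩ {τ | ∑ i, τ i ≤ 1}) = orthant n ∩ {τ | ∑ i, τ i ≤ u} := by
  ext τ
  rw [Set.mem_smul_set_iff_inv_smul_mem₀ hu.ne']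
  simp only [Set.mem_inter_iff, Set.mem_pi, Set.mem_univ, Set.mem_Ioi, true_implies,
    Pi.smul_apply, smul_eq_mul, Set.mem_ofPred_eq, ← Finset.mul_sum]
  refine and_congr (forall_congr' fun i => ?_) ?_
  · rw [mul_pos_iff_of_pos_left (inv_pos.mpr hu)]
  · rw [inv_mul_le_iff₀ hu, mul_one]

theorem orthant_simplex_subset : orthant n ∩ {τ | ∑ i, τ i ≤ 1} ⊆ Set.Icc 0 1 := by
  rintro τ ⟨h1, h2⟩
  have h0 : ∀ i, 0 ≤ τ i := fun i => (h1 i (Set.mem_univ i)).le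
  exact ⟨h0, fun i => (Finset.single_le_sum (fun j _ => h0 j) (Finset.mem_univ i)).trans h2⟩

/-- An integral over the orthant equals its formal expansion when the expansion terminates. -/
theorem integral_gammaWeight_div_eq {k : ℕ} {D N : MvPolynomial (Fin n) ℂ} {c δ : ℝ} (hc : 0 < c)
    (hD : ∀ τ ∈ orthant n, c ≤ ‖eval (realPt τ) D‖) (hδ : 0 < δ)
    (hstrip : ∀ z : ℂ, |z.im| < δ → ∀ τ ∈ Set.Icc (0 : Fin n → ℝ) 1,
      eval (fun i => z * τ i) D ≠ 0)
    {lam : Fin n → ℂ} {L d : ℕ} {G R : ℕ → MvPolynomial (Fin n) ℂ} {V : ℂ → ℂ}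
    (hN : ∀ J, L ≤ J → N = D * G J + R J)
    (hR : ∀ J, L ≤ J → ∀ β : Fin n →₀ ℕ, ∑ i, β i + d < J → coeff β (R J) = 0)
    (hV : ∀ J, L ≤ J → ∀ mu : ℂ, (∀ i, 0 < (mu - lam i).re) →
      gammaSum k (fun i => mu - lam i) (G J) = V mu)
    {mu : ℂ} (hmu : ∀ i, 0 < (mu - lam i).re) :
    ∫ τ in orthant n, gammaWeight k (fun i => mu - lam i) (realPt τ) *
      (eval (realPt τ) N / eval (realPt τ) D) = V mu := by
  -- The base point is moved from `μ` to `μ - θ` inside the domain of convergence; the value at `μ`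
  -- is then that of a Laplace transform at `ν = θ > 0`.
  obtain ⟨θ, hθ, hθmu⟩ : ∃ θ : ℝ, 0 < θ ∧ ∀ i, 0 < (mu - θ - lam i).re := by
    have h : ∀ᶠ θ in nhdsWithin (0 : ℝ) (Set.Ioi 0), ∀ i, θ < (mu - lam i).re :=
      Filter.eventually_all.mpr fun i =>
        Filter.Eventually.filter_mono nhdsWithin_le_nhds (gt_mem_nhds (hmu i))
    obtain ⟨θ, h1, h2⟩ := (h.and self_mem_nhdsWithin).exists
    refine ⟨θ, h2, fun i => ?_⟩
    have := h1 i
    simp only [Complex.sub_re, Complex.ofReal_re] at this ⊢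
    linarith
  set b : Fin n → ℂ := fun i => mu - θ - lam i with hb
  -- The integral of the remainder is the integral minus `V`. Since `V` is the same for all `J ≥ L`,
  -- so is this difference, which may hence be estimated with any `J`.
  have hsplit : ∀ J, L ≤ J → ∀ ν : ℝ, 0 ≤ ν →
      ∫ τ in orthant n, gammaWeight k (fun i => b i + ν) (realPt τ) *
        (eval (realPt τ) (R J) / eval (realPt τ) D) =
      (∫ τ in orthant n, gammaWeight k (fun i => b i + ν) (realPt τ) *
        (eval (realPt τ) N / eval (realPt τ) D)) - V (mu - θ + ν) := by
    intro J hJ ν hν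
    have hbν : ∀ i, 0 < (b i + ν).re := fun i => by
      have := hθmu i
      simp only [hb, Complex.add_re, Complex.ofReal_re]
      linarith
    have e : (fun i => b i + (ν : ℂ)) = fun i => (mu - θ + ν) - lam i := by
      ext i; simp only [hb]; ring
    have h1 := hV J hJ (mu - θ + ν) (fun i => by
      have h2 := hbν i
      simp only [hb] at h2
      convert h2 using 2
      ring)
    rw [← e] at h1
    rw [← h1, ← integral_gammaWeight_mul_eval k hbν,
      ← integral_sub (integrableOn_gammaWeight_mul_div k hbν hc hD)
      (integrableOn_gammaWeight_mul_eval k hbν _)]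
    refine setIntegral_congr_fun measurableSet_orthant fun τ hτ => ?_
    have hD0 : eval (realPt τ) D ≠ 0 := by
      intro h0
      have := hD τ hτ
      rw [h0, norm_zero] at this
      linarith
    have h2 := congrArg (eval (realPt τ)) (hN J hJ)
    rw [map_add, map_mul] at h2
    rw [h2]
    field_simp
    ring
  set κ : (Fin n → ℂ) → ℂ := fun w => gammaWeight k b w * (eval w (R L) / eval w D) with hκ
  have hκint : IntegrableOn (fun τ => κ (realPt τ)) (orthant n) :=
    integrableOn_gammaWeight_mul_div k hθmu hc hD
  set T : ℝ → ℂ := fun ν => ∫ τ in orthant n, κ (realPt τ) *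
    Complex.exp (-(ν * ∑ i, (τ i : ℂ))) with hT
  have hTR : ∀ J, L ≤ J → ∀ ν : ℝ, 0 ≤ ν → T ν =
      ∫ τ in orthant n, gammaWeight k (fun i => b i + ν) (realPt τ) *
        (eval (realPt τ) (R J) / eval (realPt τ) D) := by
    intro J hJ ν hν
    rw [hsplit J hJ ν hν, ← hsplit L le_rfl ν hν, hT]
    refine setIntegral_congr_fun measurableSet_orthant fun τ _ => ?_
    simp only [hκ, gammaWeight_add, realPt]
    ring
  set U : Set ℂ := {z | |z.im| < δ} with hU
  have hUo : IsOpen U := isOpen_lt (by fun_prop) (by fun_prop)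
  have hUc : IsPreconnected U := by
    have : U = Complex.imCLM ⁻¹' Set.Ioo (-δ) δ := by
      ext z; simp [hU, abs_lt]
    rw [this]
    exact ((convex_Ioo _ _).linear_preimage Complex.imCLM.toLinearMap).isPreconnected
  have hreal : ∀ u : ℝ, (u : ℂ) ∈ U := fun u => by simp [hU, hδ]
  set s : Set (Fin n → ℝ) := orthant n ∩ {τ | ∑ i, τ i ≤ 1} with hs
  have hsm : ∀ u : ℝ, MeasurableSet (orthant n ∩ {τ | ∑ i, τ i ≤ u}) := fun u =>
    measurableSet_orthant.inter (isClosed_le (by fun_prop) (by fun_prop)).measurableSet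
  -- For real `u > 0` this is the integral over the simplex `∑ τ_i ≤ u`, rescaled to the unit
  -- simplex with Jacobian `u^n`. In this form it extends analytically to the strip.
  set C : ℂ → ℂ := fun z => z ^ n * ∫ τ in s, κ (fun i => z * τ i) with hC
  have hCd : DifferentiableOn ℂ C U := by
    refine (differentiableOn_id.pow n).mul (differentiableOn_integral_of_compact
      (K := Set.Icc 0 1) (f := fun z (τ : Fin n → ℝ) => κ (fun i => z * τ i))
      isCompact_Icc (hsm 1) orthant_simplex_subset hUo ?_ ?_)
    · have hcont : Continuous fun p : ℂ × (Fin n → ℝ) => fun i => p.1 * (p.2 i : ℂ) := by fun_prop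
      refine ((continuous_gammaWeight k b).comp hcont).continuousOn.mul
        ((((MvPolynomial.continuous_eval (R L)).comp hcont).continuousOn).div
        ((MvPolynomial.continuous_eval D).comp hcont).continuousOn ?_)
      rintro ⟨z, τ⟩ ⟨hz, hτ⟩
      exact hstrip z hz τ hτ
    · intro τ hτ
      have he : ∀ g : MvPolynomial (Fin n) ℂ,
          Differentiable ℂ fun z : ℂ => eval (fun i => z * (τ i : ℂ)) g := by
        intro g
        simp only [eval_eq']
        fun_prop
      refine DifferentiableOn.mul ?_ ((he _).differentiableOn.div (he _).differentiableOn
        fun z hz => hstrip z hz τ hτ)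
      unfold gammaWeight
      fun_prop
  have hCB : ∀ u : ℝ, 0 < u → C u = ∫ τ in orthant n ∩ {τ | ∑ i, τ i ≤ u}, κ (realPt τ) := by
    intro u hu
    have h1 := Measure.setIntegral_comp_smul_of_pos (volume : Measure (Fin n → ℝ))
      (fun τ => κ (realPt τ)) s hu
    rw [hs, smul_orthant_simplex hu, Module.finrank_fin_fun] at h1
    have h2 : ∀ τ : Fin n → ℝ, realPt (u • τ) = fun i => (u : ℂ) * τ i := fun τ => by
      ext i; simp [realPt]
    simp only [h2] at h1
    have h3 : ((u ^ n : ℝ) : ℂ) ≠ 0 := by exact_mod_cast (pow_pos hu n).ne'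
    simp only [hC]
    rw [hs, h1, Complex.real_smul]
    push_cast at h3 ⊢
    rw [mul_inv_cancel_left₀ h3]
  have h0U : (0 : ℂ) ∈ U := by simpa using hreal 0
  have hCan := hCd.analyticOnNhd hUo
  have hev : ∀ᶠ z in nhds 0, C z = 0 := by
    refine eventually_eq_zero_of_laplace (K := ∫ τ in orthant n, ‖κ (realPt τ)‖) (hCan 0 h0U) ?_ ?_
      fun N => ?_
    · intro u hu
      rw [hCB u hu]
      exact (norm_integral_le_integral_norm _).trans (setIntegral_mono_set hκint.norm
        (Filter.Eventually.of_forall fun _ => norm_nonneg _)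
        (Filter.Eventually.of_forall Set.inter_subset_left))
    · exact hCd.continuousOn.comp Complex.continuous_ofReal.continuousOn fun u _ => hreal u
    -- For `J ≥ d + N + 1` the remainder has no terms of degree below `N`.
    · obtain ⟨M, hM⟩ := norm_integral_gammaWeight_le k (b := b) (g := R (max L (d + N + 1)))
        hθmu hc hD (N := N) (fun β hβ => hR _ (le_max_left _ _) β
          (lt_of_lt_of_le (by omega) (le_max_right _ _)))
      refine ⟨M, fun ν hν => ?_⟩
      have hν0 : 0 < ν := by linarith
      have h1 := hM ν hν
      rw [← hTR _ (le_max_left _ _) ν hν0.le, hT] at h1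
      simp only at h1
      rw [integral_orthant_eq measurableSet_orthant (fun τ hτ i => (hτ i (Set.mem_univ i)).le)
        hκint hν0, norm_mul, Complex.norm_real, Real.norm_eq_abs, abs_of_pos hν0] at h1
      have h2 : ∫ u in Set.Ioi (0 : ℝ), C u * Complex.exp (-(ν * u)) =
          ∫ u in Set.Ioi (0 : ℝ), (∫ τ in orthant n ∩ {τ | ∑ i, τ i ≤ u}, κ (realPt τ)) *
            Complex.exp (-(ν * u)) :=
        setIntegral_congr_fun measurableSet_Ioi fun u hu => by
          rw [hCB u hu]
      rw [h2]
      refine le_trans ?_ h1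
      exact le_mul_of_one_le_left (norm_nonneg _) hν
  -- By the identity theorem `C` vanishes on the strip, in particular for all real `u > 0`, so its
  -- Laplace transform is zero.
  have hzero := hCan.eqOn_zero_of_preconnected_of_eventuallyEq_zero hUc h0U hev
  have hTθ : T θ = 0 := by
    rw [hT]
    simp only
    rw [integral_orthant_eq measurableSet_orthant (fun τ hτ i => (hτ i (Set.mem_univ i)).le)
      hκint hθ, setIntegral_congr_fun (g := fun _ => 0) measurableSet_Ioi fun u hu => by
        simp only
        rw [← hCB u hu, hzero (hreal u), Pi.zero_apply, zero_mul]]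
    simp
  rw [hTR L le_rfl θ hθ.le, hsplit L le_rfl θ hθ.le, sub_eq_zero, sub_add_cancel] at hTθ
  rw [← hTθ]
  have e : (fun i => b i + (θ : ℂ)) = fun i => mu - lam i := by
    ext i; simp only [hb]; ring
  rw [e]

end BorelSum

/-! ### Iterated residues as torus integrals. -/

section TorusResidue

open Complex

variable {n : ℕ}

theorem torusIntegral_prod {f : Fin n → ℂ → ℂ} (c : Fin n → ℂ) (R : Fin n → ℝ) :
    torusIntegral (fun w => ∏ i, f i (w i)) c R = ∏ i, circleIntegral (f i) (c i) (R i) := by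
  rw [torusIntegral, ← Set.pi_univ_Icc, volume_pi, Measure.restrict_pi_pi]
  simp only [smul_eq_mul, ← Finset.prod_mul_distrib, torusMap]
  rw [integral_fintype_prod_eq_prod
    (f := fun i (t : ℝ) => (R i : ℂ) * exp (t * I) * I * f i (c i + R i * exp (t * I)))]
  refine Finset.prod_congr rfl fun i _ => ?_
  rw [circleIntegral_def_Icc]
  simp only [deriv_circleMap, circleMap, smul_eq_mul, zero_add, Pi.zero_apply]

/-- A torus integral as an iterated integral with the `i`-th circle innermost. -/
theorem torusIntegral_insertNth {f : (Fin (n + 1) → ℂ) → ℂ} {c : Fin (n + 1) → ℂ}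
    {R : Fin (n + 1) → ℝ} (hf : TorusIntegrable f c R) (i : Fin (n + 1)) :
    torusIntegral f c R = torusIntegral (fun y => ∮ x in C(c i, R i), f (i.insertNth x y))
      (c ∘ i.succAbove) (R ∘ i.succAbove) := by
  set e : ℝ × (Fin n → ℝ) ≃ᵐ (Fin (n + 1) → ℝ) :=
    (MeasurableEquiv.piFinSuccAbove (fun _ => ℝ) i).symm
  have hem : MeasurePreserving e :=
    (volume_preserving_piFinSuccAbove (fun _ : Fin (n + 1) => ℝ) i).symm _
  have heπ : (e ⁻¹' Set.Icc 0 fun _ => 2 * Real.pi) =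
      Set.Icc 0 (2 * Real.pi) ×ˢ Set.Icc (0 : Fin n → ℝ) fun _ => 2 * Real.pi :=
    ((Fin.insertNthOrderIso (fun _ => ℝ) i).preimage_Icc _ _).trans (Set.Icc_prod_eq _ _)
  have hint := hf.function_integrable
  rw [← hem.integrableOn_comp_preimage e.measurableEmbedding, heπ] at hint
  rw [torusIntegral, ← hem.map_eq, setIntegral_map_equiv, heπ, Measure.volume_eq_prod,
    ← Measure.prod_restrict, integral_prod_symm, torusIntegral]
  · refine setIntegral_congr_fun measurableSet_Icc fun Θ _ => ?_
    simp +unfoldPartialApp only [circleIntegral_def_Icc, ← integral_smul]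
    refine setIntegral_congr_fun measurableSet_Icc fun θ _ => ?_
    simp +unfoldPartialApp only [e, smul_smul, deriv_circleMap, i.prod_univ_succAbove _, torusMap,
      circleMap_zero]
    simp only [MeasurableEquiv.piFinSuccAbove_symm_apply, i.insertNth_apply_same,
      i.insertNth_apply_succAbove, (· ∘ ·), Fin.insertNthEquiv, Equiv.coe_fn_mk]
    refine congrArg₂ _ ?_ (congrArg f ?_)
    · ring
    · simp only [_root_.funext_iff, i.forall_iff_succAbove, circleMap, Fin.insertNth_apply_same,
        Fin.insertNth_apply_succAbove, imp_true_iff, and_self_iff]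
  · rwa [IntegrableOn, Measure.volume_eq_prod, ← Measure.prod_restrict] at hint

theorem torusMap_mem_sphere {c : Fin n → ℂ} {R : Fin n → ℝ} (hR : ∀ i, 0 ≤ R i) (θ : Fin n → ℝ)
    (i : Fin n) : ‖torusMap c R θ i - c i‖ = R i := by
  simp [torusMap, Complex.norm_exp_ofReal_mul_I, abs_of_nonneg (hR i)]

theorem continuous_torusMap (c : Fin n → ℂ) (R : Fin n → ℝ) : Continuous (torusMap c R) := by
  unfold torusMap; fun_prop

theorem torusIntegrable_of_continuousOn {f : (Fin n → ℂ) → ℂ} {c : Fin n → ℂ} {R : Fin n → ℝ}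
    (hR : ∀ i, 0 ≤ R i) (hf : ContinuousOn f {w | ∀ i, ‖w i - c i‖ = R i}) :
    TorusIntegrable f c R := by
  refine ContinuousOn.integrableOn_compact isCompact_Icc ?_
  exact hf.comp (continuous_torusMap c R).continuousOn fun θ _ => torusMap_mem_sphere hR θ

theorem torusIntegral_congr {f g : (Fin n → ℂ) → ℂ} {c : Fin n → ℂ} {R : Fin n → ℝ}
    (hR : ∀ i, 0 ≤ R i) (h : ∀ w, (∀ i, ‖w i - c i‖ = R i) → f w = g w) :
    torusIntegral f c R = torusIntegral g c R := by
  simp only [torusIntegral, h _ (torusMap_mem_sphere hR _)]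

/-- A torus integral vanishes if the integrand extends holomorphically in one of the variables. -/
theorem torusIntegral_eq_zero_of_holomorphic {f : (Fin n → ℂ) → ℂ} {c : Fin n → ℂ}
    {R : Fin n → ℝ} (hR : ∀ i, 0 ≤ R i) (hf : TorusIntegrable f c R) (i : Fin n)
    (h : ∀ w, (∀ j, j ≠ i → ‖w j - c j‖ = R j) → ∃ g : ℂ → ℂ,
      (∀ t, ‖t - c i‖ ≤ R i → DifferentiableAt ℂ g t) ∧
      ∀ t, ‖t - c i‖ = R i → f (Function.update w i t) = g t) :
    torusIntegral f c R = 0 := by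
  obtain ⟨n, rfl⟩ : ∃ n', n = n' + 1 := ⟨n - 1, by have := i.2; omega⟩
  rw [torusIntegral_insertNth hf i, torusIntegral_congr (g := fun _ => 0) (fun j => by exact hR _)]
  · simp [torusIntegral]
  intro y hy
  obtain ⟨g, hg, hfg⟩ := h (i.insertNth 0 y) fun j hj => by
    obtain ⟨j', rfl⟩ := Fin.exists_succAbove_eq hj
    simpa using hy j'
  rw [circleIntegral.integral_congr (hR i) (g := g) fun t ht => by
    rw [← hfg t (by simpa using ht), Fin.update_insertNth]]
  refine circleIntegral_eq_zero_of_differentiable_on_off_countable (hR i) Set.countable_empty ?_ ?_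
  · exact fun t ht => (hg t (by simpa [dist_eq_norm] using ht)).continuousAt.continuousWithinAt
  · exact fun t ht => hg t (by simpa [dist_eq_norm] using (Metric.mem_ball.mp ht.1).le)

/-- The integral of the derivative of `exp (-bw) / w^{p+1}` over the circle is zero, which gives a
recursion in `p`. -/
theorem circleIntegral_exp_div_pow (b : ℂ) {ε : ℝ} (hε : 0 < ε) (p : ℕ) :
    (∮ w in C(0, ε), exp (-(b * w)) / w ^ (p + 1)) =
      2 * Real.pi * I * ((-b) ^ p / p.factorial) := by
  induction p with
  | zero =>
    have := circleIntegral_sub_center_inv_smul_of_differentiable_on_off_countable hε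
      (f := fun w => exp (-(b * w))) (c := 0) Set.countable_empty (by fun_prop)
      (fun z _ => by fun_prop)
    simpa [div_eq_inv_mul] using this
  | succ p ih =>
    have hne : ∀ w ∈ Metric.sphere (0 : ℂ) ε, w ≠ 0 := fun w hw h => by
      simp [h] at hw; exact hε.ne hw
    have hci : ∀ q : ℕ, CircleIntegrable (fun w => exp (-(b * w)) / w ^ q) 0 ε := fun q =>
      ContinuousOn.circleIntegrable hε.le (ContinuousOn.div (by fun_prop) (by fun_prop)
        fun w hw => pow_ne_zero _ (hne w hw))
    have h0 := circleIntegral.integral_eq_zero_of_hasDerivWithinAt hε.le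
      (f := fun w => exp (-(b * w)) / w ^ (p + 1))
      (f' := fun w => -b * (exp (-(b * w)) / w ^ (p + 1)) -
        (p + 1) * (exp (-(b * w)) / w ^ (p + 1 + 1))) (c := 0) fun w hw => by
        have hw0 := hne w hw
        have h1 : HasDerivAt (fun w => exp (-(b * w))) (exp (-(b * w)) * -(b * 1)) w :=
          (((hasDerivAt_id w).const_mul b).neg).cexp
        have h2 := h1.div (hasDerivAt_pow (p + 1) w) (pow_ne_zero _ hw0)
        refine (h2.congr_deriv ?_).hasDerivWithinAt
        push_cast
        field_simp
        ring
    rw [circleIntegral.integral_sub, circleIntegral.integral_const_mul,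
      circleIntegral.integral_const_mul, ih] at h0
    · have hp : (p : ℂ) + 1 ≠ 0 := by exact_mod_cast p.succ_ne_zero
      have : (p.factorial : ℂ) ≠ 0 := by exact_mod_cast p.factorial_ne_zero
      apply mul_left_cancel₀ hp
      rw [← sub_eq_zero.mp h0, Nat.factorial_succ]
      push_cast
      field_simp
      ring
    · exact (hci _).const_fun_smul (a := -b)
    · exact (hci _).const_fun_smul (a := (p + 1 : ℂ))

/-- The residue at `0` of `t ^ α exp (-b t) / t ^ (k + 1)`. -/
def residueCoeff (k : ℕ) (b : ℂ) (α : ℕ) : ℂ :=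
  if α ≤ k then (-b) ^ (k - α) / (k - α).factorial else 0

theorem circleIntegral_residue (k : ℕ) (b : ℂ) {ε : ℝ} (hε : 0 < ε) (α : ℕ) :
    (∮ w in C(0, ε), exp (-(b * w)) / w ^ (k + 1) * w ^ α) =
      2 * Real.pi * I * residueCoeff k b α := by
  have hne : ∀ w ∈ Metric.sphere (0 : ℂ) ε, w ≠ 0 := fun w hw h => by
    simp [h] at hw; exact hε.ne hw
  rw [residueCoeff]
  split_ifs with h
  · rw [← circleIntegral_exp_div_pow b hε, circleIntegral.integral_congr hε.le fun w hw => ?_]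
    have := hne w hw
    obtain ⟨q, rfl⟩ := Nat.exists_eq_add_of_le h
    simp only [Nat.add_sub_cancel_left]
    field_simp
    ring
  · rw [mul_zero, circleIntegral.integral_congr (g := fun w => exp (-(b * w)) * w ^ (α - (k + 1)))
      hε.le fun w hw => ?_]
    · exact circleIntegral_eq_zero_of_differentiable_on_off_countable hε.le Set.countable_empty
        (by fun_prop) (fun z _ => by fun_prop)
    have := hne w hw
    obtain ⟨q, rfl⟩ := Nat.exists_eq_add_of_lt (not_le.mp h)
    have : k + q + 1 - (k + 1) = q := by omega
    simp only [this]
    field_simp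
    ring

/-- The kernel `∏ exp (-b_i w_i) / w_i ^ (k + 1)`. -/
def poleWeight (k : ℕ) (b w : Fin n → ℂ) : ℂ := ∏ i, exp (-(b i * w i)) / w i ^ (k + 1)

/-- The total residue of `poleWeight k b` times a polynomial. -/
def residueSum (k : ℕ) (b : Fin n → ℂ) (g : MvPolynomial (Fin n) ℂ) : ℂ :=
  ∑ β ∈ g.support, coeff β g * ∏ i, residueCoeff k (b i) (β i)

theorem poleWeight_mul_eval (k : ℕ) (b : Fin n → ℂ) (g : MvPolynomial (Fin n) ℂ)
    (w : Fin n → ℂ) : poleWeight k b w * eval w g = ∑ β ∈ g.support,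
      coeff β g * ∏ i, (exp (-(b i * w i)) / w i ^ (k + 1) * w i ^ β i) := by
  rw [eval_eq', Finset.mul_sum]
  refine Finset.sum_congr rfl fun β _ => ?_
  rw [poleWeight, mul_left_comm, ← Finset.prod_mul_distrib]

theorem torusIntegral_finsetSum {ι : Type*} {s : Finset ι} {f : ι → (Fin n → ℂ) → ℂ}
    {c : Fin n → ℂ} {R : Fin n → ℝ} (h : ∀ j ∈ s, TorusIntegrable (f j) c R) :
    torusIntegral (fun w => ∑ j ∈ s, f j w) c R = ∑ j ∈ s, torusIntegral (f j) c R := by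
  simp only [torusIntegral, Finset.smul_sum]
  exact integral_finsetSum _ fun j hj => (h j hj).function_integrable

theorem continuousOn_poleWeight (k : ℕ) (b : Fin n → ℂ) {ε : ℝ} (hε : 0 < ε) :
    ContinuousOn (poleWeight k b) {w | ∀ i, ‖w i - (0 : Fin n → ℂ) i‖ = ε} := by
  refine continuousOn_finsetProd _ fun i _ => ContinuousOn.div (by fun_prop) (by fun_prop) ?_
  intro w hw h
  have h1 := hw i
  rw [eq_zero_of_pow_eq_zero h] at h1
  simp at h1
  exact hε.ne h1

theorem torusIntegrable_poleWeight_mul_div (k : ℕ) (b : Fin n → ℂ) {ε : ℝ} (hε : 0 < ε)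
    {D : MvPolynomial (Fin n) ℂ} (hD : ∀ w : Fin n → ℂ, (∀ i, ‖w i‖ ≤ ε) → eval w D ≠ 0)
    (N : MvPolynomial (Fin n) ℂ) :
    TorusIntegrable (fun w => poleWeight k b w * (eval w N / eval w D)) 0 (fun _ => ε) := by
  refine torusIntegrable_of_continuousOn (fun _ => hε.le) ?_
  refine (continuousOn_poleWeight k b hε).mul (ContinuousOn.div
    (MvPolynomial.continuous_eval N).continuousOn (MvPolynomial.continuous_eval D).continuousOn
    fun w hw => hD w fun i => ?_)
  simpa using (hw i).le

theorem torusIntegral_poleWeight_mul_eval (k : ℕ) (b : Fin n → ℂ) {ε : ℝ} (hε : 0 < ε)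
    (g : MvPolynomial (Fin n) ℂ) :
    torusIntegral (fun w => poleWeight k b w * eval w g) 0 (fun _ => ε) =
      (2 * Real.pi * I) ^ n * residueSum k b g := by
  simp only [poleWeight_mul_eval]
  rw [torusIntegral_finsetSum, residueSum, Finset.mul_sum]
  · refine Finset.sum_congr rfl fun β _ => ?_
    rw [torusIntegral_const_mul, torusIntegral_prod
      (f := fun i w => exp (-(b i * w)) / w ^ (k + 1) * w ^ β i)]
    simp only [Pi.zero_apply, circleIntegral_residue k _ hε, Finset.prod_mul_distrib,
      Finset.prod_const, Finset.card_univ, Fintype.card_fin]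
    ring
  · intro β _
    refine (torusIntegrable_of_continuousOn (fun _ => hε.le) ?_)
    refine ((continuousOn_poleWeight k b hε).mul (MvPolynomial.continuous_eval
      (monomial β (coeff β g))).continuousOn).congr fun w _ => ?_
    change _ = poleWeight k b w * eval w (monomial β (coeff β g))
    rw [poleWeight, eval_monomial, Finsupp.prod_fintype _ _ (by simp), mul_left_comm,
      ← Finset.prod_mul_distrib]

/-- A monomial of degree greater than `k` in one of the variables has residue zero. -/
theorem torusIntegral_poleWeight_monomial_div (k : ℕ) (b : Fin n → ℂ) {ε : ℝ} (hε : 0 < ε)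
    {D : MvPolynomial (Fin n) ℂ} (hD : ∀ w : Fin n → ℂ, (∀ i, ‖w i‖ ≤ ε) → eval w D ≠ 0)
    {β : Fin n →₀ ℕ} (i : Fin n) (hi : k < β i) (c : ℂ) :
    torusIntegral (fun w => poleWeight k b w * (eval w (monomial β c) / eval w D)) 0
      (fun _ => ε) = 0 := by
  refine torusIntegral_eq_zero_of_holomorphic (fun _ => hε.le)
    (torusIntegrable_poleWeight_mul_div k b hε hD _) i fun w hw => ?_
  have hupd : ∀ t : ℂ, ‖t‖ ≤ ε → ∀ j, ‖Function.update w i t j‖ ≤ ε := fun t ht j => by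
    rcases eq_or_ne j i with rfl | h
    · simp [ht]
    · simpa [h] using (hw j h).le
  refine ⟨fun t => exp (-(b i * t)) * t ^ (β i - (k + 1)) *
    (c * ∏ j ∈ Finset.univ.erase i, (exp (-(b j * w j)) / w j ^ (k + 1) * w j ^ β j)) /
      eval (Function.update w i t) D, fun t ht => ?_, fun t ht => ?_⟩
  · refine DifferentiableAt.div (by fun_prop) ?_ (hD _ (hupd t (by simpa using ht)))
    have hu : Differentiable ℂ (fun t : ℂ => Function.update w i t) := by
      refine differentiable_pi.mpr fun j => ?_
      rcases eq_or_ne j i with rfl | h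
      · simp
      · simp [h]
    simp only [eval_eq']
    have hu' := fun j => (differentiable_pi.mp hu j)
    fun_prop
  · have ht0 : t ≠ 0 := fun h => by simp [h] at ht; exact hε.ne ht
    obtain ⟨q, hq⟩ := Nat.exists_eq_add_of_lt hi
    have hq' : β i - (k + 1) = q := by omega
    rw [poleWeight, eval_monomial, Finsupp.prod_fintype _ _ (by simp), hq', mul_div_assoc',
      mul_left_comm, ← Finset.prod_mul_distrib, ← Finset.mul_prod_erase _ _ (Finset.mem_univ i),
      Finset.prod_congr rfl fun j hj => by
        rw [Function.update_of_ne (Finset.ne_of_mem_erase hj)],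
      Function.update_self, hq]
    congr 1
    field_simp
    ring

/-- The total residue of a polynomial fraction is computed by any expansion of high order. -/
theorem torusIntegral_poleWeight_div_eq (k : ℕ) (b : Fin n → ℂ) {ε : ℝ} (hε : 0 < ε)
    {D N G R : MvPolynomial (Fin n) ℂ} (hD : ∀ w : Fin n → ℂ, (∀ i, ‖w i‖ ≤ ε) → eval w D ≠ 0)
    (hN : N = D * G + R) (hR : ∀ β : Fin n →₀ ℕ, ∑ i, β i ≤ n * k → coeff β R = 0) :
    torusIntegral (fun w => poleWeight k b w * (eval w N / eval w D)) 0 (fun _ => ε) =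
      (2 * Real.pi * I) ^ n * residueSum k b G := by
  rw [← torusIntegral_poleWeight_mul_eval k b hε, ← sub_eq_zero]
  have h1 := torusIntegrable_poleWeight_mul_div k b hε hD N
  have h2 : TorusIntegrable (fun w => poleWeight k b w * eval w G) 0 (fun _ => ε) := by
    simpa using torusIntegrable_poleWeight_mul_div k b hε (D := 1) (by simp) G
  rw [← torusIntegral_sub h1 h2, torusIntegral_congr (g := fun w => ∑ β ∈ R.support,
    poleWeight k b w * (eval w (monomial β (coeff β R)) / eval w D)) (fun _ => hε.le),
    torusIntegral_finsetSum]
  · refine Finset.sum_eq_zero fun β hβ => ?_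
    -- A monomial of degree greater than `nk` has some exponent greater than `k`, which cancels the
    -- pole in that variable.
    obtain ⟨i, -, hi⟩ : ∃ i ∈ Finset.univ, k < β i := by
      refine Finset.exists_lt_of_sum_lt (f := fun _ => k) (s := Finset.univ) ?_
      by_contra h
      exact mem_support_iff.mp hβ (hR β (by simpa using h))
    exact torusIntegral_poleWeight_monomial_div k b hε hD i hi _
  · exact fun β _ => torusIntegrable_poleWeight_mul_div k b hε hD _
  · intro w hw
    have hDw := hD w fun i => by simpa using (hw i).le
    rw [← Finset.mul_sum, ← Finset.sum_div, ← map_sum, support_sum_monomial_coeff, hN]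
    simp only [map_add, map_mul]
    field_simp
    ring

end TorusResidue

/-! ### Partial sums of formal expansions and their integrals. -/

section FormalExpansion

variable {n : ℕ}

/-- The linear functional on polynomials with given values on the monomials. -/
def weightHom (v : (Fin n →₀ ℕ) → ℂ) : MvPolynomial (Fin n) ℂ →+ ℂ where
  toFun g := ∑ β ∈ g.support, coeff β g * v β
  map_zero' := by simp
  map_add' g h := by
    classical
    have key : ∀ f : MvPolynomial (Fin n) ℂ, f.support ⊆ g.support ∪ h.support →
        ∑ β ∈ f.support, coeff β f * v β = ∑ β ∈ g.support ∪ h.support, coeff β f * v β := by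
      intro f hf
      refine Finset.sum_subset hf fun β _ hβ => ?_
      rw [notMem_support_iff.mp hβ, zero_mul]
    rw [key _ support_add, key g Finset.subset_union_left, key h Finset.subset_union_right,
      ← Finset.sum_add_distrib]
    exact Finset.sum_congr rfl fun β _ => by rw [coeff_add, add_mul]

theorem weightHom_monomial (v : (Fin n →₀ ℕ) → ℂ) (α : Fin n →₀ ℕ) (c : ℂ) :
    weightHom v (monomial α c) = c * v α := by
  classical
  change ∑ β ∈ (monomial α c).support, coeff β (monomial α c) * v β = _
  rcases eq_or_ne c 0 with rfl | hc
  · simp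
  · rw [support_monomial, if_neg hc, Finset.sum_singleton, coeff_monomial, if_pos rfl]

/-- The homogeneous part of degree `N` of a power series. -/
def homPart (N : ℕ) (g : MvPowerSeries (Fin n) ℂ) : MvPolynomial (Fin n) ℂ :=
  ∑ α ∈ Finset.finsuppAntidiag (Finset.univ : Finset (Fin n)) N,
    monomial α (MvPowerSeries.coeff α g)

theorem coeff_homPart (N : ℕ) (g : MvPowerSeries (Fin n) ℂ) (β : Fin n →₀ ℕ) :
    coeff β (homPart N g) = if ∑ i, β i = N then MvPowerSeries.coeff β g else 0 := by
  classical
  simp only [homPart, coeff_sum, coeff_monomial]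
  rw [Finset.sum_ite_eq' (Finset.finsuppAntidiag (Finset.univ : Finset (Fin n)) N) β
    (fun α => MvPowerSeries.coeff α g)]
  simp [Finset.mem_finsuppAntidiag]

theorem ascPochhammer_natCast_add_one (k α : ℕ) :
    (ascPochhammer ℂ α).eval ((k : ℂ) + 1) * k.factorial = (α + k).factorial := by
  induction α with
  | zero => simp
  | succ α ih =>
    rw [ascPochhammer_succ_eval, mul_right_comm, ih, show α + 1 + k = α + k + 1 by ring,
      Nat.factorial_succ]
    push_cast
    ring

/-- The symbol `(-k)_α` vanishes for `α > k`, as does the residue. So residues realize the same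
formal functional as Gamma integrals, with `m + 1 = -k` in place of `k + 1`. -/
theorem residueCoeff_eq (k : ℕ) {b : ℂ} (hb : b ≠ 0) (α : ℕ) :
    residueCoeff k b α =
      (-b) ^ k / k.factorial * ((ascPochhammer ℂ α).eval (-(k : ℂ)) * b⁻¹ ^ α) := by
  induction α with
  | zero => simp [residueCoeff]
  | succ α ih =>
    rw [ascPochhammer_succ_eval, pow_succ, show ∀ u v w z t : ℂ,
      u * (v * w * (z * t)) = u * (v * z) * (w * t) by intros; ring, ← ih, residueCoeff,
      residueCoeff]
    rcases lt_trichotomy α k with h | rfl | h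
    · rw [if_pos h.le, if_pos (Nat.succ_le_of_lt h)]
      obtain ⟨q, rfl⟩ := Nat.exists_eq_add_of_lt h
      have h1 : α + q + 1 - (α + 1) = q := by omega
      have h2 : α + q + 1 - α = q + 1 := by omega
      rw [h1, h2, Nat.factorial_succ]
      have h3 : (q.factorial : ℂ) ≠ 0 := by exact_mod_cast q.factorial_ne_zero
      have h4 : (q : ℂ) + 1 ≠ 0 := by exact_mod_cast q.succ_ne_zero
      push_cast
      field_simp
      ring
    · simp
    · rw [if_neg (by omega), if_neg (by omega), zero_mul]

theorem gammaSum_eq_weightHom (k : ℕ) (b : Fin n → ℂ) (g : MvPolynomial (Fin n) ℂ) :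
    gammaSum k b g =
      weightHom (fun β => ∏ i, ((β i + k).factorial / b i ^ (β i + k + 1))) g := rfl

theorem residueSum_eq_weightHom (k : ℕ) (b : Fin n → ℂ) (g : MvPolynomial (Fin n) ℂ) :
    residueSum k b g = weightHom (fun β => ∏ i, residueCoeff k (b i) (β i)) g := rfl

theorem moment_complex (p : ℂ) (a : Fin n → ℂ) (α : Fin n →₀ ℕ) :
    moment p a α = ∏ i, ((ascPochhammer ℂ (α i)).eval p * (a i)⁻¹ ^ α i) := by
  simp only [moment, smul_eq_mul, Finset.prod_mul_distrib, Ring.inverse_eq_inv']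

theorem weightHom_homPart {v : (Fin n →₀ ℕ) → ℂ} {c p : ℂ} {a : Fin n → ℂ}
    (hv : ∀ α, v α = c * moment p a α) (N : ℕ) (g : MvPowerSeries (Fin n) ℂ) :
    weightHom v (homPart N g) = c * bracket p a N g := by
  rw [homPart, map_sum, bracket_apply, Finset.mul_sum]
  refine Finset.sum_congr rfl fun α _ => ?_
  rw [weightHom_monomial, hv]
  ring

/-- With `b_i = μ - λ_i` the normalizing factor is the reciprocal of `C₅`. -/
theorem gammaSum_homPart (k : ℕ) {b : Fin n → ℂ} (hb : ∀ i, b i ≠ 0) (N : ℕ)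
    (g : MvPowerSeries (Fin n) ℂ) :
    weightHom (fun β => ∏ i, ((β i + k).factorial / b i ^ (β i + k + 1))) (homPart N g) =
      ((k.factorial : ℂ) ^ n / ∏ i, b i ^ (k + 1)) * bracket ((k : ℂ) + 1) b N g := by
  refine weightHom_homPart (fun α => ?_) N g
  rw [moment_complex, ← Fin.prod_const n (k.factorial : ℂ), ← Finset.prod_div_distrib,
    ← Finset.prod_mul_distrib]
  refine Finset.prod_congr rfl fun i _ => ?_
  have := hb i
  rw [← ascPochhammer_natCast_add_one, inv_pow]
  field_simp
  ring

/-- With `b_i = μ - λ_i` the normalizing factor, times `(2πi)^n`, is the reciprocal of `C₆`. -/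
theorem residueSum_homPart (k : ℕ) {b : Fin n → ℂ} (hb : ∀ i, b i ≠ 0) (N : ℕ)
    (g : MvPowerSeries (Fin n) ℂ) :
    weightHom (fun β => ∏ i, residueCoeff k (b i) (β i)) (homPart N g) =
      ((∏ i, (-b i) ^ k) / (k.factorial : ℂ) ^ n) * bracket (-(k : ℂ)) b N g := by
  refine weightHom_homPart (fun α => ?_) N g
  rw [moment_complex, ← Fin.prod_const n (k.factorial : ℂ), ← Finset.prod_div_distrib,
    ← Finset.prod_mul_distrib]
  exact Finset.prod_congr rfl fun i _ => residueCoeff_eq k (hb i) _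

/-- The partial sums, by total degree, of a sequence of power series in which the `l`-th one is
counted with an additional degree `l`. -/
def partialSum (H : ℕ → MvPowerSeries (Fin n) ℂ) (J : ℕ) : MvPolynomial (Fin n) ℂ :=
  ∑ j ∈ Finset.range J, ∑ l ∈ Finset.range (j + 1), homPart (j - l) (H l)

/-- Each `H l` contributes its coefficient at `β` exactly once, for `j = |β| + l`, and all these
indices lie below `J`. -/
theorem coeff_partialSum {H : ℕ → MvPowerSeries (Fin n) ℂ} {d J : ℕ} (hH : ∀ l, d < l → H l = 0)
    {β : Fin n →₀ ℕ} (hβ : ∑ i, β i + d < J) :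
    coeff β (partialSum H J) =
      MvPowerSeries.coeff β (∑ l ∈ Finset.range (d + 1), H l) := by
  simp only [partialSum, coeff_sum, map_sum, coeff_homPart]
  set s := ∑ i, β i
  have h1 : ∀ j ∈ Finset.range J, (∑ l ∈ Finset.range (j + 1),
      if s = j - l then MvPowerSeries.coeff β (H l) else 0) =
      ∑ l ∈ Finset.range (d + 1), if j = s + l then MvPowerSeries.coeff β (H l) else 0 := by
    intro j _
    rw [← Finset.sum_filter, ← Finset.sum_filter]
    refine (Finset.sum_subset_zero_on_sdiff (fun l => ?_) (fun l => ?_) fun _ _ => rfl).symm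
    · simp only [Finset.mem_filter, Finset.mem_range]
      omega
    · simp only [Finset.mem_sdiff, Finset.mem_filter, Finset.mem_range]
      intro h
      rw [hH l (by omega), map_zero]
  rw [Finset.sum_congr rfl h1, Finset.sum_comm]
  refine Finset.sum_congr rfl fun l hl => ?_
  rw [Finset.sum_ite_eq', if_pos]
  simp at hl ⊢
  omega

theorem coeff_sub_mul_partialSum {H : ℕ → MvPowerSeries (Fin n) ℂ} {d J : ℕ}
    {D : MvPolynomial (Fin n) ℂ} {N : ℕ → MvPolynomial (Fin n) ℂ}
    (hN : ∀ l ≤ d, (D : MvPowerSeries (Fin n) ℂ) * H l = N l) (hH : ∀ l, d < l → H l = 0)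
    {β : Fin n →₀ ℕ} (hβ : ∑ i, β i + d < J) :
    coeff β ((∑ l ∈ Finset.range (d + 1), N l) - D * partialSum H J) = 0 := by
  classical
  have h1 : ((∑ l ∈ Finset.range (d + 1), N l : MvPolynomial (Fin n) ℂ) :
      MvPowerSeries (Fin n) ℂ) = D * ∑ l ∈ Finset.range (d + 1), H l := by
    rw [Finset.mul_sum, ← coeToMvPowerSeries.ringHom_apply, map_sum]
    exact Finset.sum_congr rfl fun l hl => (hN l (by simpa [Nat.lt_succ_iff] using hl)).symm
  rw [coeff_sub, sub_eq_zero, ← MvPolynomial.coeff_coe, ← MvPolynomial.coeff_coe, h1,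
    MvPolynomial.coe_mul, MvPowerSeries.coeff_mul, MvPowerSeries.coeff_mul]
  refine Finset.sum_congr rfl fun p hp => ?_
  rw [MvPolynomial.coeff_coe (partialSum H J), coeff_partialSum hH]
  have h2 : ∑ i, p.2 i ≤ ∑ i, β i := Finset.sum_le_sum fun i _ => by
    rw [← Finset.HasAntidiagonal.mem_antidiagonal.mp hp]; simp
  omega

end FormalExpansion

/-! ### The kernel at numerical positions. -/

section Specialization

variable {n : ℕ}

/-- The product of the differences of two families of positions, over pairs of different
particles. -/
def pairCross {R : Type*} [CommRing R] (u v : Fin n → R) : R :=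
  ∏ i, ∏ j ∈ Finset.Ioi i, ((u i - v j) * (v i - u j))

theorem map_pairCross {R S : Type*} [CommRing R] [CommRing S] (f : R →+* S) (u v : Fin n → R) :
    f (pairCross u v) = pairCross (fun i => f (u i)) (fun i => f (v i)) := by
  simp [pairCross]

/-- The diagonal factors `z_i - x_i` produce the weight `∏ τ_i^k` or the poles of the residue; the
other factors are those of the kernel function. -/
theorem starProd_eq (z x : Fin n → ℂ) :
    starProd z x = (∏ i, (z i - x i)) * pairCross z x := by
  have h : ∀ i j : Fin n, (if i ≤ j then z i - x j else x j - z i) =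
      (if i = j then z i - x i else 1) * ((if i < j then z i - x j else 1) *
        (if j < i then x j - z i else 1)) := by
    intro i j
    rcases lt_trichotomy i j with h | rfl | h
    · simp [h, h.le, h.ne, h.not_gt]
    · simp
    · simp [h, h.not_ge, h.ne', h.not_gt]
  rw [starProd]
  simp only [h, Finset.prod_mul_distrib, Finset.prod_ite_eq, Finset.mem_univ, if_true]
  rw [pairCross]
  simp only [Finset.prod_mul_distrib]
  rw [Finset.prod_comm (f := fun i j => if j < i then x j - z i else 1)]
  simp only [← Finset.prod_filter]
  have hf : ∀ i : Fin n, Finset.univ.filter (i < ·) = Finset.Ioi i := fun i => by ext; simp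
  simp only [hf]

theorem kerUnit_eq (m : ℤ) : ∃ U V A B : (KerRing n)ˣ, kerUnit n m 1 = (U * V⁻¹) ^ (-m) * (A * B⁻¹) ∧
    (U : KerRing n) = vdm (fun i => kerPt (ptx i)) * vdm (fun i => kerPt (ptX i)) ∧
    (V : KerRing n) = pairCross (fun i => kerPt (ptX i)) (fun i => kerPt (ptx i)) ∧
    (A : KerRing n) = cross (fun i => kerPt (ptX i)) (kerPt pty) ∧
    (B : KerRing n) = cross (fun i => kerPt (ptx i)) (kerPt pty) := by
  have hne : ∀ i : Fin n, ∀ j ∈ Finset.Ioi i, some i ≠ some j := fun i j hj h =>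
    (Finset.mem_Ioi.mp hj).ne (Option.some_injective _ h)
  refine ⟨∏ i, ∏ j ∈ Finset.Ioi i, unitDiff (ptx i) (ptx j) * unitDiff (ptX i) (ptX j),
    ∏ i, ∏ j ∈ Finset.Ioi i, unitDiff (ptX i) (ptx j) * unitDiff (ptx i) (ptX j),
    ∏ i, unitDiff (ptX i) pty, ∏ i, unitDiff (ptx i) pty, ?_, ?_, ?_, ?_, ?_⟩
  · rw [kerUnit, zpow_one]
    simp only [← Finset.prod_inv_distrib, ← Finset.prod_mul_distrib, mul_inv, mul_assoc]
  · simp only [vdm, Units.coe_prod, ← Finset.prod_mul_distrib, Units.val_mul]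
    refine Finset.prod_congr rfl fun i _ => Finset.prod_congr rfl fun j hj => ?_
    rw [val_unitDiff (a := ptx i) (b := ptx j) (hne i j hj),
      val_unitDiff (a := ptX i) (b := ptX j) (hne i j hj)]
  · simp only [pairCross, Units.coe_prod, Units.val_mul]
    refine Finset.prod_congr rfl fun i _ => Finset.prod_congr rfl fun j hj => ?_
    rw [val_unitDiff (a := ptX i) (b := ptx j) (hne i j hj),
      val_unitDiff (a := ptx i) (b := ptX j) (hne i j hj)]
  · simp only [cross, Units.coe_prod]
    exact Finset.prod_congr rfl fun i _ => val_unitDiff (by simp [kerBase])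
  · simp only [cross, Units.coe_prod]
    exact Finset.prod_congr rfl fun i _ => val_unitDiff (by simp [kerBase])

theorem kerUnit_natCast (k : ℕ) :
    (kerUnit n k 1 : KerRing n) * ((vdm (fun i => kerPt (ptx i)) *
        vdm (fun i => kerPt (ptX i))) ^ k * cross (fun i => kerPt (ptx i)) (kerPt pty)) =
      pairCross (fun i => kerPt (ptX i)) (fun i => kerPt (ptx i)) ^ k *
        cross (fun i => kerPt (ptX i)) (kerPt pty) := by
  obtain ⟨U, V, A, B, h, hU, hV, hA, hB⟩ := kerUnit_eq (n := n) k
  rw [← hU, ← hV, ← hA, ← hB, h]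
  refine congrArg Units.val (?_ : (U * V⁻¹) ^ (-(k : ℤ)) * (A * B⁻¹) * (U ^ k * B) = V ^ k * A)
  rw [zpow_neg, zpow_natCast, mul_pow, inv_pow, mul_inv, inv_inv, show (U ^ k)⁻¹ * V ^ k *
    (A * B⁻¹) * (U ^ k * B) = (U ^ k)⁻¹ * U ^ k * (B⁻¹ * B) * (V ^ k * A) by ac_rfl,
    inv_mul_cancel, inv_mul_cancel, one_mul, one_mul]

theorem kerUnit_neg (k : ℕ) :
    (kerUnit n (-(k : ℤ) - 1) 1 : KerRing n) *
        (pairCross (fun i => kerPt (ptX i)) (fun i => kerPt (ptx i)) ^ (k + 1) *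
          cross (fun i => kerPt (ptx i)) (kerPt pty)) =
      (vdm (fun i => kerPt (ptx i)) * vdm (fun i => kerPt (ptX i))) ^ (k + 1) *
        cross (fun i => kerPt (ptX i)) (kerPt pty) := by
  obtain ⟨U, V, A, B, h, hU, hV, hA, hB⟩ := kerUnit_eq (n := n) (-(k : ℤ) - 1)
  have hk : -(-(k : ℤ) - 1) = ((k + 1 : ℕ) : ℤ) := by push_cast; ring
  rw [← hU, ← hV, ← hA, ← hB, h, hk]
  refine congrArg Units.val (?_ : (U * V⁻¹) ^ ((k + 1 : ℕ) : ℤ) * (A * B⁻¹) * (V ^ (k + 1) * B) =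
    U ^ (k + 1) * A)
  rw [zpow_natCast, mul_pow, inv_pow, show U ^ (k + 1) * (V ^ (k + 1))⁻¹ * (A * B⁻¹) *
    (V ^ (k + 1) * B) = (V ^ (k + 1))⁻¹ * V ^ (k + 1) * (B⁻¹ * B) * (U ^ (k + 1) * A) by ac_rfl,
    inv_mul_cancel, inv_mul_cancel, one_mul, one_mul]

/-- The shifted positions as polynomials in the shifts. -/
def shiftedPt (x : Fin n → ℂ) (i : Fin n) : MvPolynomial (Fin n) ℂ := C (x i) + X i

/-- The substitution of numerical positions with polynomial shifts. -/
def shiftEval (x lam : Fin n → ℂ) : PolyRing (Fin n) →+* MvPolynomial (Fin n) ℂ :=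
  eval₂Hom C (Sum.elim (shiftedPt x) fun i => C (lam i))

theorem eval_shiftEval (x lam w : Fin n → ℂ) (P : PolyRing (Fin n)) :
    eval w (shiftEval x lam P) = eval (Sum.elim (fun i => x i + w i) lam) P := by
  refine congrArg (fun g : PolyRing (Fin n) →+* ℂ => g P)
    (?_ : (eval w).comp (shiftEval x lam) = eval (Sum.elim (fun i => x i + w i) lam))
  refine MvPolynomial.ringHom_ext (fun a => ?_) (fun v => ?_)
  · simp [shiftEval]
  · cases v <;> simp [shiftEval, shiftedPt]

/-- The evaluation of the coefficients of a kernel power series. -/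
abbrev kerEval (x lam : Option (Fin n) → ℂ) (hx : Function.Injective x)
    (hl : Function.Injective lam) : KerRing n →+* MvPowerSeries (Fin n) ℂ :=
  MvPowerSeries.map (evalRat x lam hx hl)

section

variable {x lam : Option (Fin n) → ℂ} (hx : Function.Injective x) (hl : Function.Injective lam)

theorem kerEval_ptx (i : Fin n) : kerEval x lam hx hl (kerPt (ptx i)) =
    coeToMvPowerSeries.ringHom (C (x (some i)) : MvPolynomial (Fin n) ℂ) := by
  simp [kerPt]

theorem kerEval_pty : kerEval x lam hx hl (kerPt pty) =
    coeToMvPowerSeries.ringHom (C (x none) : MvPolynomial (Fin n) ℂ) := by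
  simp [kerPt]

theorem kerEval_ptX (i : Fin n) : kerEval x lam hx hl (kerPt (ptX i)) =
    coeToMvPowerSeries.ringHom (shiftedPt (fun i => x (some i)) i) := by
  simp [kerPt, shiftedPt]

theorem kerEval_shiftHom (P : PolyRing (Fin n)) :
    kerEval x lam hx hl (shiftHom n (toRat P)) = coeToMvPowerSeries.ringHom
      (shiftEval (fun i => x (some i)) (fun i => lam (some i)) P) := by
  rw [shiftHom_toRat]
  refine congrArg (fun g : PolyRing (Fin n) →+* MvPowerSeries (Fin n) ℂ => g P)
    (?_ : (kerEval x lam hx hl).comp (shiftPoly n) = coeToMvPowerSeries.ringHom.comp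
      (shiftEval (fun i => x (some i)) (fun i => lam (some i))))
  refine MvPolynomial.ringHom_ext (fun a => ?_) (fun v => ?_)
  · simp only [RingHom.comp_apply, shiftPoly, shiftEval, coe_eval₂Hom, eval₂_C]
    rw [algebraMap_powerSeries, MvPowerSeries.map_C, algebraMap_rat, evalRat_toRat, eval_C]
    simp
  · simp only [RingHom.comp_apply, shiftPoly, shiftEval, coe_eval₂Hom, eval₂_X]
    cases v with
    | inl i => exact kerEval_ptX hx hl i
    | inr i => simp

theorem map_bracket (p : ℂ) (N : ℕ) (g : KerRing n) :
    evalRat x lam hx hl (bracket p (specDiff n) N g) =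
      bracket p (fun i => lam none - lam (some i)) N (kerEval x lam hx hl g) := by
  rw [bracket_apply, bracket_apply, map_sum]
  refine Finset.sum_congr rfl fun α _ => ?_
  rw [map_mul, MvPowerSeries.coeff_map, moment, moment, evalRat_smul, map_prod, smul_eq_mul]
  congr 2
  refine Finset.prod_congr rfl fun i _ => ?_
  rw [map_pow, map_ringInverse _ (isUnit_specDiff i), Ring.inverse_eq_inv']
  simp [specDiff]

end

end Specialization

/-! ### The deformed wave function as a terminating expansion. -/

section Expansion

variable {n k : ℕ} {P : PolyRing (Fin n)}

theorem IsBA.component_eq_zero (hP : IsBA n k P) {e : ℕ} (he : k * pairCount n < e) :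
    weightedHomogeneousComponent wX e P = 0 :=
  ((leadingForm_eq_iff (isDenominator_baDen n k).ne_zero
    (isDenominator_baDen n k).homX).mp hP.leading.1).1 e he

theorem IsBA.sum_component (hP : IsBA n k P) :
    ∑ l ∈ Finset.range (k * pairCount n + 1),
      weightedHomogeneousComponent wX (k * pairCount n - l) P = P :=
  (Finset.sum_range_reflect (fun e => weightedHomogeneousComponent wX e P)
    (k * pairCount n + 1)).trans (sum_component_of_lt fun _ he => hP.component_eq_zero he)

/-- The kernel power series belonging to numerical positions and spectral parameters. -/
def kernelPart (m : ℤ) (f : RatRing (Fin n)) {x lam : Option (Fin n) → ℂ}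
    (hx : Function.Injective x) (hl : Function.Injective lam) : MvPowerSeries (Fin n) ℂ :=
  kerEval x lam hx hl (kerUnit n m 1 * shiftHom n f)

/-- The denominator `D` and the factor `E` of the numerator describe the kernel power series. -/
def IsKernelFraction (k : ℕ) (m : ℤ) (x : Option (Fin n) → ℂ) (lam : Fin n → ℂ)
    (D E : MvPolynomial (Fin n) ℂ) : Prop :=
  ∀ (lam' : Option (Fin n) → ℂ) (hx : Function.Injective x) (hl : Function.Injective lam')
    (f : RatRing (Fin n)) (F : PolyRing (Fin n)), (∀ i, lam' (some i) = lam i) →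
    toRat (baDen n k) * f = toRat F → (D : MvPowerSeries (Fin n) ℂ) * kernelPart m f hx hl =
      (E * shiftEval (fun i => x (some i)) lam F : MvPolynomial (Fin n) ℂ)

/-- The deformed wave function as a terminating expansion of a fraction. -/
theorem IsBA.exists_expansion (hP : IsBA n k P) {m : ℤ} (hm0 : m ≠ 0)
    (hm : m * (m + 1) = k * (k + 1)) (hmk : mStar m = k) {Q : PolyRing (Option (Fin n))}
    (hQ : IsDeformedBA n m Q) {x : Fin n → ℂ} {y : ℂ} {lam : Fin n → ℂ}
    (hx : Function.Injective x) (hy : ∀ i, x i ≠ y) (hl : Function.Injective lam)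
    {D E : MvPolynomial (Fin n) ℂ} (hD : D ≠ 0)
    (hDE : IsKernelFraction k m (fun o => o.elim y x) lam D E) :
    ∃ (H : ℕ → MvPowerSeries (Fin n) ℂ) (L : ℕ),
      (∀ (J : ℕ) (β : Fin n →₀ ℕ), ∑ i, β i + k * pairCount n < J →
        coeff β (E * shiftEval x lam P - D * partialSum H J) = 0) ∧
      ∀ mu : ℂ, (∀ i, lam i ≠ mu) → ∀ J, L ≤ J → deformedFun m Q x y lam mu =
        (∑ j ∈ Finset.range J, ∑ l ∈ Finset.range (j + 1),
          bracket ((m : ℂ) + 1) (fun i => mu - lam i) (j - l) (H l)) *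
        Complex.exp ((∑ i, lam i * x i) + mu * y / m) := by
  obtain ⟨φ, L, Q', h1, h2, -, h3, h4, hQ'⟩ := hP.exists_deformed hm0 hm hmk
  obtain rfl := hQ.unique hm0 hQ'
  set X : Option (Fin n) → ℂ := fun o => o.elim y x with hX
  have hxX : Function.Injective X := injective_option.mpr ⟨hx, hy⟩
  have hll : ∀ {mu : ℂ}, (∀ i, lam i ≠ mu) →
      Function.Injective (fun o : Option (Fin n) => o.elim mu lam) := fun h =>
    injective_option.mpr ⟨hl, h⟩
  obtain ⟨mu₀, hmu₀⟩ : ∃ mu : ℂ, ∀ i, lam i ≠ mu := by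
    obtain ⟨mu, hmu⟩ := (Set.finite_range lam).exists_notMem
    exact ⟨mu, fun i h => hmu ⟨i, h⟩⟩
  have hDc : (D : MvPowerSeries (Fin n) ℂ) ≠ 0 := fun h =>
    hD (coe_injective (Fin n) ℂ (by simpa using h))
  have hF : ∀ l, ∃ F, toRat (baDen n k) * φ l = toRat F := fun l => by
    by_cases hl : l ≤ k * pairCount n
    · exact ⟨_, h1 l hl⟩
    · exact ⟨0, by rw [h2 l (by omega)]; simp⟩
  -- Neither `D` nor `E` involves `μ`, and `D` can be cancelled in the domain of power series. Hence
  -- one sequence `H` serves all `μ`.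
  have hindep : ∀ {mu : ℂ} (hmu : ∀ i, lam i ≠ mu) (l : ℕ),
      kernelPart m (φ l) hxX (hll hmu) = kernelPart m (φ l) hxX (hll hmu₀) := by
    intro mu hmu l
    obtain ⟨F, hF⟩ := hF l
    refine mul_left_cancel₀ hDc ?_
    rw [hDE _ hxX (hll hmu) _ F (fun _ => rfl) hF, hDE _ hxX (hll hmu₀) _ F (fun _ => rfl) hF]
  refine ⟨fun l => kernelPart m (φ l) hxX (hll hmu₀), L, fun J β hβ => ?_, fun mu hmu J hJ => ?_⟩
  · have := coeff_sub_mul_partialSum (H := fun l => kernelPart m (φ l) hxX (hll hmu₀))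
      (d := k * pairCount n) (D := D) (N := fun l => E * shiftEval x lam
        (weightedHomogeneousComponent wX (k * pairCount n - l) P))
      (fun l hl => hDE _ hxX (hll hmu₀) _ _ (fun _ => rfl) (h1 l hl))
      (fun l hl => by simp [kernelPart, h2 l hl]) hβ
    rwa [← Finset.mul_sum, ← map_sum, hP.sum_component] at this
  · have hT := (isDenominator_deformedDen n k).isUnit
    have hs : ∑ j ∈ Finset.range J, kernelSeries m 1 φ j =
        ∑ j ∈ Finset.range L, kernelSeries m 1 φ j := by
      refine (Finset.sum_subset (Finset.range_subset_range.mpr hJ) fun l _ hl => ?_).symm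
      exact h3 l (by simpa using hl)
    have h5 := deformedFun_eq_genFun (m := m) Q X (fun o => o.elim mu lam)
    rw [hmk, genFun_eq_expFun hT (hs ▸ h4) hxX (hll hmu), expFun, ratFun_eq _ hxX (hll hmu),
      map_sum] at h5
    refine h5.trans (congrArg₂ _ (Finset.sum_congr rfl fun j _ => ?_) ?_)
    · rw [kernelSeries, map_sum]
      refine Finset.sum_congr rfl fun l _ => ?_
      rw [map_bracket]
      exact congrArg _ (hindep hmu l)
    · rw [Fintype.sum_option, add_comm]
      simp only [deformedCharge, Option.elim, one_mul, hX]
      congr 2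
      ring


theorem kerEval_vdm_ptx {x lam : Option (Fin n) → ℂ} (hx : Function.Injective x)
    (hl : Function.Injective lam) : kerEval x lam hx hl (vdm fun i => kerPt (ptx i)) =
      coeToMvPowerSeries.ringHom (C (vdm fun i => x (some i))) := by
  simp only [map_vdm, kerEval_ptx]

theorem kerEval_vdm_ptX {x lam : Option (Fin n) → ℂ} (hx : Function.Injective x)
    (hl : Function.Injective lam) : kerEval x lam hx hl (vdm fun i => kerPt (ptX i)) =
      coeToMvPowerSeries.ringHom (vdm (shiftedPt fun i => x (some i))) := by
  simp only [map_vdm, kerEval_ptX]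

theorem kerEval_cross_ptx {x lam : Option (Fin n) → ℂ} (hx : Function.Injective x)
    (hl : Function.Injective lam) :
    kerEval x lam hx hl (cross (fun i => kerPt (ptx i)) (kerPt pty)) =
      coeToMvPowerSeries.ringHom (C (cross (fun i => x (some i)) (x none))) := by
  simp only [map_cross, kerEval_ptx, kerEval_pty]

theorem kerEval_cross_ptX {x lam : Option (Fin n) → ℂ} (hx : Function.Injective x)
    (hl : Function.Injective lam) :
    kerEval x lam hx hl (cross (fun i => kerPt (ptX i)) (kerPt pty)) =
      coeToMvPowerSeries.ringHom (cross (shiftedPt fun i => x (some i)) (C (x none))) := by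
  simp only [map_cross, kerEval_ptX, kerEval_pty]

theorem kerEval_pairCross {x lam : Option (Fin n) → ℂ} (hx : Function.Injective x)
    (hl : Function.Injective lam) :
    kerEval x lam hx hl (pairCross (fun i => kerPt (ptX i)) (fun i => kerPt (ptx i))) =
      coeToMvPowerSeries.ringHom
        (pairCross (shiftedPt fun i => x (some i)) fun i => C (x (some i))) := by
  simp only [map_pairCross, kerEval_ptX, kerEval_ptx]

theorem kerEval_baDen {x lam : Option (Fin n) → ℂ} (hx : Function.Injective x)
    (hl : Function.Injective lam) {f : RatRing (Fin n)} {F : PolyRing (Fin n)}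
    (hf : toRat (baDen n k) * f = toRat F) :
    coeToMvPowerSeries.ringHom (vdm (shiftedPt fun i => x (some i)) ^ k *
        C ((vdm fun i => lam (some i)) ^ k)) * kerEval x lam hx hl (shiftHom n f) =
      coeToMvPowerSeries.ringHom
        (shiftEval (fun i => x (some i)) (fun i => lam (some i)) F) := by
  have h : kerEval x lam hx hl (shiftHom n (toRat (baDen n k) * f)) =
      kerEval x lam hx hl (shiftHom n (toRat F)) := by rw [hf]
  rw [map_mul, map_mul, kerEval_shiftHom, kerEval_shiftHom] at h
  rw [← h]
  congr 2
  rw [map_mul, map_pow, map_pow, map_vdm, map_vdm, map_pow, map_vdm]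
  simp [shiftEval]

/-- Of the `2k` powers of the shifted Vandermonde product, `k` come from the kernel and `k` from the
denominator of the wave function. -/
theorem isKernelFraction_natCast (k : ℕ) (x : Option (Fin n) → ℂ) (lam : Fin n → ℂ) :
    IsKernelFraction k k x lam
      (C ((vdm fun i => x (some i)) ^ k * cross (fun i => x (some i)) (x none) * vdm lam ^ k) *
        vdm (shiftedPt fun i => x (some i)) ^ (2 * k))
      (pairCross (shiftedPt fun i => x (some i)) (fun i => C (x (some i))) ^ k *
        cross (shiftedPt fun i => x (some i)) (C (x none))) := by
  intro lam' hx hl f F hlam hf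
  obtain rfl : (fun i => lam' (some i)) = lam := _root_.funext hlam
  have h1 := congrArg (kerEval x lam' hx hl) (kerUnit_natCast (n := n) k)
  have h2 := kerEval_baDen hx hl hf
  simp only [map_mul, map_pow, kerEval_vdm_ptx, kerEval_vdm_ptX, kerEval_cross_ptx,
    kerEval_cross_ptX, kerEval_pairCross] at h1 h2
  simp only [← coeToMvPowerSeries.ringHom_apply, kernelPart, map_mul, map_pow]
  rw [← h2, ← h1]
  ring

/-- Here the kernel has `k + 1` powers of the shifted Vandermonde product in the numerator. They
absorb the denominator of the wave function and leave one factor, so there is no pole where shifted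
positions coincide. -/
theorem isKernelFraction_neg (k : ℕ) (x : Option (Fin n) → ℂ) (lam : Fin n → ℂ) :
    IsKernelFraction k (-(k : ℤ) - 1) x lam
      (C (cross (fun i => x (some i)) (x none) * vdm lam ^ k) *
        pairCross (shiftedPt fun i => x (some i)) (fun i => C (x (some i))) ^ (k + 1))
      (C ((vdm fun i => x (some i)) ^ (k + 1)) * vdm (shiftedPt fun i => x (some i)) *
        cross (shiftedPt fun i => x (some i)) (C (x none))) := by
  intro lam' hx hl f F hlam hf
  obtain rfl : (fun i => lam' (some i)) = lam := _root_.funext hlam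
  have h1 := congrArg (kerEval x lam' hx hl) (kerUnit_neg (n := n) k)
  have h2 := kerEval_baDen hx hl hf
  simp only [map_mul, map_pow, kerEval_vdm_ptx, kerEval_vdm_ptX, kerEval_cross_ptx,
    kerEval_cross_ptX, kerEval_pairCross] at h1 h2
  simp only [← coeToMvPowerSeries.ringHom_apply, kernelPart, map_mul, map_pow]
  rw [← h2]
  linear_combination (coeToMvPowerSeries.ringHom (C (vdm fun i => lam' (some i))) ^ k *
    kerEval x lam' hx hl (shiftHom n f)) * h1

end Expansion

/-! ### The two integral formulas. -/

section IntegralFormulas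

variable {n k : ℕ} {P : PolyRing (Fin n)} {x lam : Fin n → ℂ} {y mu : ℂ}

theorem eval_vdm_shiftedPt (x w : Fin n → ℂ) :
    eval w (vdm (shiftedPt x)) = vdm fun i => x i + w i := by
  rw [map_vdm]; simp [shiftedPt]

theorem eval_cross_shiftedPt (x : Fin n → ℂ) (y : ℂ) (w : Fin n → ℂ) :
    eval w (cross (shiftedPt x) (C y)) = cross (fun i => x i + w i) y := by
  rw [map_cross]; simp [shiftedPt]

theorem eval_pairCross_shiftedPt (x w : Fin n → ℂ) :
    eval w (pairCross (shiftedPt x) fun i => C (x i)) = pairCross (fun i => x i + w i) x := by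
  rw [map_pairCross]; simp [shiftedPt]

theorem exp_shift (x lam w : Fin n → ℂ) (mu c : ℂ) :
    Complex.exp (mu * ((∑ i, x i) - (∑ i, (x i + w i)) + c)) *
        Complex.exp (∑ i, lam i * (x i + w i)) =
      Complex.exp ((∑ i, lam i * x i) + mu * c) * ∏ i, Complex.exp (-((mu - lam i) * w i)) := by
  rw [← Complex.exp_sum, ← Complex.exp_add, ← Complex.exp_add]
  congr 1
  simp only [mul_add, Finset.sum_add_distrib, Finset.sum_neg_distrib, sub_mul,
    Finset.sum_sub_distrib]
  rw [← Finset.mul_sum]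
  ring

theorem torusIntegral_translate (f : (Fin n → ℂ) → ℂ) (c : Fin n → ℂ) (R : Fin n → ℝ) :
    torusIntegral f c R = torusIntegral (fun w => f fun i => c i + w i) 0 R := by
  simp +unfoldPartialApp only [torusIntegral, torusMap, Pi.zero_apply, zero_add]

theorem torusIntegrable_translate {f : (Fin n → ℂ) → ℂ} {c : Fin n → ℂ} {R : Fin n → ℝ} :
    TorusIntegrable f c R ↔ TorusIntegrable (fun w => f fun i => c i + w i) 0 R := by
  simp +unfoldPartialApp only [TorusIntegrable, torusMap, Pi.zero_apply, zero_add]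

/-- The denominator of the residue integrand. -/
def residueDen (k : ℕ) (x : Fin n → ℂ) (y : ℂ) (lam : Fin n → ℂ) : MvPolynomial (Fin n) ℂ :=
  C (cross x y * vdm lam ^ k) * pairCross (shiftedPt x) (fun i => C (x i)) ^ (k + 1)

/-- The factor of the numerator of the residue integrand that does not depend on `P`. -/
def residueNum (k : ℕ) (x : Fin n → ℂ) (y : ℂ) : MvPolynomial (Fin n) ℂ :=
  C (vdm x ^ (k + 1)) * vdm (shiftedPt x) * cross (shiftedPt x) (C y)

/-- A shift of size at most `ε < |x_i - x_j|` cannot move `x_i` to `x_j`. -/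
theorem eval_residueDen_ne_zero (hxy : ∀ i, x i ≠ y) (hl : Function.Injective lam) {ε : ℝ}
    (hsep : ∀ i j, i ≠ j → ε < ‖x i - x j‖) {w : Fin n → ℂ} (hw : ∀ i, ‖w i‖ ≤ ε) :
    eval w (residueDen k x y lam) ≠ 0 := by
  rw [residueDen, map_mul, map_pow, eval_C, eval_pairCross_shiftedPt]
  refine mul_ne_zero (mul_ne_zero (cross_ne_zero hxy)
    (pow_ne_zero _ (vdm_ne_zero fun i j h => hl.ne h))) (pow_ne_zero _ ?_)
  have key : ∀ i j, i ≠ j → x i + w i - x j ≠ 0 := fun i j h h0 => by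
    have : x i - x j = -w i := by linear_combination h0
    have h1 := hsep i j h
    rw [this, norm_neg] at h1
    exact (hw i).not_gt h1
  refine Finset.prod_ne_zero_iff.mpr fun i _ => Finset.prod_ne_zero_iff.mpr fun j hj => ?_
  have hij := (Finset.mem_Ioi.mp hj).ne
  refine mul_ne_zero (key i j hij) fun h0 => key j i hij.symm ?_
  linear_combination -h0

theorem residueIntegrand_eq (hx : Function.Injective x) (hxy : ∀ i, x i ≠ y)
    (hl : Function.Injective lam) {w : Fin n → ℂ} (hw : ∀ i, w i ≠ 0) 
    (hD : eval w (residueDen k x y lam) ≠ 0) :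
    residueIntegrand k P x y lam mu (fun i => x i + w i) =
      Complex.exp ((∑ i, lam i * x i) + mu * y / ((-(k : ℤ) - 1 : ℤ) : ℂ)) *
        (cross x y / vdm x ^ (k + 1)) * (poleWeight k (fun i => mu - lam i) w *
        (eval w (residueNum k x y * shiftEval x lam P) / eval w (residueDen k x y lam))) := by
  have h1 : cross x y ≠ 0 := cross_ne_zero hxy
  have h2 : vdm x ≠ 0 := vdm_ne_zero fun i j h => hx.ne h
  have h3 : vdm lam ≠ 0 := vdm_ne_zero fun i j h => hl.ne h
  have h4 : ∏ i, w i ≠ 0 := Finset.prod_ne_zero_iff.mpr fun i _ => hw i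
  have hs : starProd (fun i => x i + w i) x = (∏ i, w i) * pairCross (fun i => x i + w i) x := by
    rw [starProd_eq]; simp
  have he := exp_shift x lam w mu (y / (-(k : ℂ) - 1))
  simp only [residueDen, residueNum, map_mul, map_pow, eval_C, eval_pairCross_shiftedPt,
    eval_vdm_shiftedPt, eval_cross_shiftedPt, eval_shiftEval] at hD ⊢
  have h5 : pairCross (fun i => x i + w i) x ≠ 0 := fun h => by simp [h] at hD
  rw [residueIntegrand, baFun, hs, poleWeight, Finset.prod_div_distrib, Finset.prod_pow]
  push_cast
  rw [mul_div_assoc]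
  set A := Complex.exp (mu * ((∑ i, x i) - (∑ i, (x i + w i)) + y / (-(k : ℂ) - 1)))
  set B := Complex.exp (∑ i, lam i * (x i + w i))
  -- Points of the torus may have coinciding coordinates. There both sides are zero: the positive
  -- power of the Vandermonde product kills the integrand despite the division by zero, and one
  -- factor remains in `residueNum`.
  rcases eq_or_ne (vdm fun i => x i + w i) 0 with h0 | h0
  · simp [h0]
  · rw [show ∀ a b c : ℂ, a * A * (b / c * B) = a * (b / c) * (A * B) by intros; ring, he]
    field_simp
    ring

theorem residue_formula (hP : IsBA n k P) {Q : PolyRing (Option (Fin n))}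
    (hQ : IsDeformedBA n (-(k : ℤ) - 1) Q) (hx : Function.Injective x) (hxy : ∀ i, x i ≠ y)
    (hl : Function.Injective lam) (hmu : ∀ i, lam i ≠ mu) {ε : ℝ} (hε : 0 < ε)
    (hsep : ∀ i j, i ≠ j → ε < ‖x i - x j‖) :
    TorusIntegrable (residueIntegrand k P x y lam mu) x (fun _ => ε) ∧
      deformedFun (-(k : ℤ) - 1) Q x y lam mu =
        residueConst k lam mu * (vdm x ^ (k + 1) / cross x y) *
          torusIntegral (residueIntegrand k P x y lam mu) x (fun _ => ε) := by
  have hD : ∀ w : Fin n → ℂ, (∀ i, ‖w i‖ ≤ ε) → eval w (residueDen k x y lam) ≠ 0 :=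
    fun w hw => eval_residueDen_ne_zero hxy hl hsep hw
  have hD0 : residueDen k x y lam ≠ 0 := fun h => hD 0 (by simp [hε.le]) (by simp [h])
  have heq : ∀ w : Fin n → ℂ, (∀ i, ‖w i - (0 : Fin n → ℂ) i‖ = ε) →
      residueIntegrand k P x y lam mu (fun i => x i + w i) = _ := fun w hw =>
    residueIntegrand_eq hx hxy hl (fun i h => by
        have := hw i
        simp [h] at this
        exact hε.ne this)
      (hD w fun i => by simpa using (hw i).le)
  obtain ⟨H, L, hR, hV⟩ := hP.exists_expansion (E := residueNum k x y) (by omega) (by ring) (mStar_neg k) hQ hx hxy hl hD0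
    (isKernelFraction_neg k (fun o => o.elim y x) lam)
  constructor
  · rw [torusIntegrable_translate]
    have h := (torusIntegrable_poleWeight_mul_div k (fun i => mu - lam i) hε hD
      (residueNum k x y * shiftEval x lam P))
    have h' := Integrable.const_mul h
      (Complex.exp ((∑ i, lam i * x i) + mu * y / ((-(k : ℤ) - 1 : ℤ) : ℂ)) *
        (cross x y / vdm x ^ (k + 1)))
    refine h'.congr (Filter.Eventually.of_forall fun θ => ?_)
    exact (heq _ (torusMap_mem_sphere (fun _ => hε.le) θ)).symm
  -- The summand `L` ensures that the expansion has reached its final value; the others make the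
  -- remainder vanish to degree `nk`.
  · rw [torusIntegral_translate, torusIntegral_congr (fun _ => hε.le) heq, torusIntegral_const_mul,
      torusIntegral_poleWeight_div_eq k _ hε hD (add_sub_cancel (residueDen k x y lam *
        partialSum H (L + (n * k + k * pairCount n + 1))) _).symm (fun β hβ => hR _ β (by omega)),
      hV mu hmu _ (Nat.le_add_right L (n * k + k * pairCount n + 1)), residueSum_eq_weightHom,
      partialSum, map_sum]
    have h1 : cross x y ≠ 0 := cross_ne_zero hxy
    have h2 : vdm x ≠ 0 := vdm_ne_zero fun i j h => hx.ne h
    have hb : ∀ i, mu - lam i ≠ 0 := fun i => sub_ne_zero.mpr (hmu i).symm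
    have h3 : ∏ i, (lam i - mu) ^ k ≠ 0 := Finset.prod_ne_zero_iff.mpr fun i _ =>
      pow_ne_zero _ (sub_ne_zero.mpr (hmu i))
    have h4 : (k.factorial : ℂ) ≠ 0 := by exact_mod_cast k.factorial_ne_zero
    have h5 : (2 * Real.pi * Complex.I : ℂ) ≠ 0 := Complex.two_pi_I_ne_zero
    simp only [map_sum, residueSum_homPart k hb, neg_sub, ← Finset.mul_sum]
    rw [residueConst, Finset.prod_inv_distrib, div_pow]
    push_cast
    rw [sub_add_cancel]
    field_simp

/-- The denominator of the Selberg type integrand. -/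
def selbergDen (k : ℕ) (x : Fin n → ℂ) (y : ℂ) (lam : Fin n → ℂ) : MvPolynomial (Fin n) ℂ :=
  C (vdm x ^ k * cross x y * vdm lam ^ k) * vdm (shiftedPt x) ^ (2 * k)

/-- The factor of the numerator of the Selberg type integrand that does not depend on `P`. -/
def selbergNum (k : ℕ) (x : Fin n → ℂ) (y : ℂ) : MvPolynomial (Fin n) ℂ :=
  pairCross (shiftedPt x) (fun i => C (x i)) ^ k * cross (shiftedPt x) (C y)

theorem selbergIntegrand_eq (hx : Function.Injective x) (hxy : ∀ i, x i ≠ y)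
    (hl : Function.Injective lam) {w : Fin n → ℂ} (hw : (vdm fun i => x i + w i) ≠ 0) :
    selbergIntegrand k P x y lam mu (fun i => x i + w i) =
      Complex.exp ((∑ i, lam i * x i) + mu * y / ((k : ℤ) : ℂ)) *
        (vdm x ^ k * cross x y) * (gammaWeight k (fun i => mu - lam i) w *
        (eval w (selbergNum k x y * shiftEval x lam P) / eval w (selbergDen k x y lam))) := by
  have h1 : cross x y ≠ 0 := cross_ne_zero hxy
  have h2 : vdm x ≠ 0 := vdm_ne_zero fun i j h => hx.ne h
  have h3 : vdm lam ≠ 0 := vdm_ne_zero fun i j h => hl.ne h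
  have hs : starProd (fun i => x i + w i) x = (∏ i, w i) * pairCross (fun i => x i + w i) x := by
    rw [starProd_eq]; simp
  have he := exp_shift x lam w mu (y / (k : ℂ))
  simp only [selbergDen, selbergNum, map_mul, map_pow, eval_C, eval_pairCross_shiftedPt,
    eval_vdm_shiftedPt, eval_cross_shiftedPt, eval_shiftEval]
  rw [selbergIntegrand, baFun, hs, gammaWeight, Finset.prod_mul_distrib, Finset.prod_pow,
    Int.cast_natCast, mul_div_assoc mu]
  set A := Complex.exp (mu * ((∑ i, x i) - (∑ i, (x i + w i)) + y / (k : ℂ)))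
  set B := Complex.exp (∑ i, lam i * (x i + w i))
  rw [show ∀ a b c : ℂ, a * A * (b / c * B) = a * (b / c) * (A * B) by intros; ring, he]
  field_simp
  ring

/-- Imaginary parts are unchanged when the positions are shifted by real numbers, so this bounds the
denominator below uniformly on the contour. -/
theorem norm_vdm_ge (z : Fin n → ℂ) :
    ∏ i, ∏ j ∈ Finset.Ioi i, |(z i - z j).im| ≤ ‖vdm z‖ := by
  rw [vdm, norm_prod]
  refine Finset.prod_le_prod (fun i _ => Finset.prod_nonneg fun j _ => abs_nonneg _) fun i _ => ?_
  rw [norm_prod]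
  exact Finset.prod_le_prod (fun j _ => abs_nonneg _) fun j _ => Complex.abs_im_le_norm _

theorem exists_pos_forall_lt_abs_im (him : ∀ i j, i ≠ j → (x i).im ≠ (x j).im) :
    ∃ δ : ℝ, 0 < δ ∧ ∀ i j, i ≠ j → δ < |(x i - x j).im| := by
  have h : ∀ᶠ δ in nhdsWithin (0 : ℝ) (Set.Ioi 0), ∀ i j, i ≠ j → δ < |(x i - x j).im| := by
    refine Filter.eventually_all.mpr fun i => Filter.eventually_all.mpr fun j => ?_
    by_cases hij : i = j
    · exact Filter.Eventually.of_forall fun _ h => (h hij).elim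
    · filter_upwards [mem_nhdsWithin_of_mem_nhds (Iio_mem_nhds (abs_pos.mpr
        (sub_ne_zero.mpr (him i j hij))))] with δ hδ _
      simpa using hδ
  exact (Filter.Eventually.and (self_mem_nhdsWithin (s := Set.Ioi (0 : ℝ))) h).exists

theorem selberg_formula (hP : IsBA n k P) (hk : 1 ≤ k) {Q : PolyRing (Option (Fin n))}
    (hQ : IsDeformedBA n (k : ℤ) Q) (him : ∀ i j, i ≠ j → (x i).im ≠ (x j).im)
    (hxy : ∀ i, x i ≠ y) (hl : Function.Injective lam) (hmu : ∀ i, (lam i - mu).re < 0) :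
    IntegrableOn (fun τ : Fin n → ℝ => selbergIntegrand k P x y lam mu fun i => x i + (τ i : ℂ))
        (orthant n) ∧
      deformedFun (k : ℤ) Q x y lam mu = selbergConst k lam mu / (vdm x ^ k * cross x y) *
        ∫ τ in orthant n, selbergIntegrand k P x y lam mu fun i => x i + (τ i : ℂ) := by
  have hx : Function.Injective x := fun i j h => by
    by_contra hij
    exact him i j hij (congrArg Complex.im h)
  have h1 : cross x y ≠ 0 := cross_ne_zero hxy
  have h2 : vdm x ≠ 0 := vdm_ne_zero fun i j h => hx.ne h
  have h3 : vdm lam ≠ 0 := vdm_ne_zero fun i j h => hl.ne h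
  have hC : vdm x ^ k * cross x y * vdm lam ^ k ≠ 0 :=
    mul_ne_zero (mul_ne_zero (pow_ne_zero _ h2) h1) (pow_ne_zero _ h3)
  have hbpos : ∀ i, 0 < (mu - lam i).re := fun i => by
    have := hmu i
    simp only [Complex.sub_re] at this ⊢
    linarith
  have heval : ∀ w : Fin n → ℂ, eval w (selbergDen k x y lam) =
      vdm x ^ k * cross x y * vdm lam ^ k * (vdm fun i => x i + w i) ^ (2 * k) := fun w => by
    simp only [selbergDen, map_mul, map_pow, eval_C, eval_vdm_shiftedPt]
  set v : ℝ := ∏ i, ∏ j ∈ Finset.Ioi i, |(x i - x j).im|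
  have hv : 0 < v := Finset.prod_pos fun i _ => Finset.prod_pos fun j hj =>
    abs_pos.mpr (sub_ne_zero.mpr (him i j (Finset.mem_Ioi.mp hj).ne))
  have hvle : ∀ τ : Fin n → ℝ, v ≤ ‖vdm fun i => x i + realPt τ i‖ := fun τ => by
    refine le_of_eq_of_le ?_ (norm_vdm_ge _)
    simp [v, realPt]
  have hcpos : 0 < ‖vdm x ^ k * cross x y * vdm lam ^ k‖ * v ^ (2 * k) :=
    mul_pos (norm_pos_iff.mpr hC) (pow_pos hv _)
  have hDc : ∀ τ ∈ orthant n, ‖vdm x ^ k * cross x y * vdm lam ^ k‖ * v ^ (2 * k) ≤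
      ‖eval (realPt τ) (selbergDen k x y lam)‖ := fun τ _ => by
    rw [heval, norm_mul (vdm x ^ k * cross x y * vdm lam ^ k), norm_pow]
    gcongr
    exact hvle τ
  have heq : ∀ τ : Fin n → ℝ,
      selbergIntegrand k P x y lam mu (fun i => x i + (τ i : ℂ)) = _ := fun τ =>
    selbergIntegrand_eq (w := realPt τ) hx hxy hl
      (norm_pos_iff (a := vdm fun i => x i + realPt τ i).mp (hv.trans_le (hvle τ)))
  simp only [heq]
  refine ⟨(integrableOn_gammaWeight_mul_div k hbpos hcpos hDc).const_mul _, ?_⟩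
  obtain ⟨δ, hδ, hδx⟩ := exists_pos_forall_lt_abs_im him
  have hD0 : selbergDen k x y lam ≠ 0 := fun h => by
    have := heval 0
    rw [h, map_zero] at this
    exact mul_ne_zero hC (pow_ne_zero _ (by simpa using h2)) this.symm
  obtain ⟨H, L, hR, hV⟩ := hP.exists_expansion (E := selbergNum k x y) (m := (k : ℤ)) (by omega)
    rfl (mStar_natCast k) hQ hx hxy hl hD0 (isKernelFraction_natCast k (fun o => o.elim y x) lam)
  have hne : ∀ {mu : ℂ}, (∀ i, 0 < (mu - lam i).re) → ∀ i, mu - lam i ≠ 0 := fun h i h0 => by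
    have := h i
    simp [h0] at this
  -- The formal Gamma sum is independent of `J ≥ L` because the transformed series has stopped; this
  -- is the value `V` of the terminating expansion.
  have hsum : ∀ J, L ≤ J → ∀ nu : ℂ, (∀ i, 0 < (nu - lam i).re) →
      gammaSum k (fun i => nu - lam i) (partialSum H J) =
        (k.factorial : ℂ) ^ n / (∏ i, (nu - lam i) ^ (k + 1)) *
          (deformedFun (k : ℤ) Q x y lam nu /
            Complex.exp ((∑ i, lam i * x i) + nu * y / ((k : ℤ) : ℂ))) := by
    intro J hJ nu hnu
    rw [hV nu (fun i h => hne hnu i (sub_eq_zero.mpr h.symm)) J hJ,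
      mul_div_cancel_right₀ _ (Complex.exp_ne_zero _), gammaSum_eq_weightHom, partialSum, map_sum]
    simp only [map_sum, gammaSum_homPart k (hne hnu), ← Finset.mul_sum, Int.cast_natCast]
  rw [integral_const_mul, integral_gammaWeight_div_eq hcpos hDc hδ (fun z hz τ hτ => ?_)
    (fun J _ => (add_sub_cancel (selbergDen k x y lam * partialSum H J) _).symm)
    (fun J _ β hβ => hR J β hβ) hsum hbpos, selbergConst]
  · have h4 : (k.factorial : ℂ) ≠ 0 := by exact_mod_cast k.factorial_ne_zero
    have h5 : ∏ i, (mu - lam i) ^ (k + 1) ≠ 0 := Finset.prod_ne_zero_iff.mpr fun i _ =>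
      pow_ne_zero _ (hne hbpos i)
    have h6 := Complex.exp_ne_zero ((∑ i, lam i * x i) + mu * y / ((k : ℤ) : ℂ))
    field_simp
  -- On the strip `|Im z| < δ` with `τ` in the unit cube, the shift changes `Im (x_i - x_j)` by at
  -- most `|Im z| < δ`, which cannot make it zero.
  · rw [heval]
    refine mul_ne_zero hC (pow_ne_zero _ (vdm_ne_zero fun i j hij h0 => ?_))
    have h4 : (x i - x j).im = z.im * (τ j - τ i) := by
      have := congrArg Complex.im h0
      simp only [Complex.add_im, Complex.mul_im, Complex.ofReal_im, Complex.ofReal_re,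
        mul_zero, zero_add] at this
      rw [Complex.sub_im]
      linear_combination this
    have h5 := hδx i j hij
    rw [h4, abs_mul] at h5
    have h6 : |τ j - τ i| ≤ 1 := by
      have a1 := hτ.1 i; have a2 := hτ.2 i; have a3 := hτ.1 j; have a4 := hτ.2 j
      simp only [Pi.zero_apply, Pi.one_apply] at a1 a2 a3 a4
      rw [abs_le]; constructor <;> linarith
    have h7 := mul_le_mul_of_nonneg_left h6 (abs_nonneg z.im)
    linarith

end IntegralFormulas

end CalogeroBA

end

/-! ### The main theorem. -/

theorem mainTheorem9 (n k : ℕ) :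
    (∃! P : MvPolynomial (Fin n ⊕ Fin n) ℂ, CalogeroBA.IsBA n k P) ∧
    (1 ≤ k →
      (∃! Q : MvPolynomial (Option (Fin n) ⊕ Option (Fin n)) ℂ,
        CalogeroBA.IsDeformedBA n (k : ℤ) Q) ∧
      ∀ P Q, CalogeroBA.IsBA n k P → CalogeroBA.IsDeformedBA n (k : ℤ) Q →
        ∀ (x : Fin n → ℂ) (y : ℂ) (lam : Fin n → ℂ) (mu : ℂ),
          (∀ i j, i ≠ j → (x i).im ≠ (x j).im) → (∀ i, x i ≠ y) →
          Function.Injective lam → (∀ i, (lam i - mu).re < 0) →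
          IntegrableOn
            (fun τ : Fin n → ℝ => CalogeroBA.selbergIntegrand k P x y lam mu
              (fun i => x i + (τ i : ℂ)))
            (Set.univ.pi fun _ => Set.Ioi (0 : ℝ)) ∧
          CalogeroBA.deformedFun (k : ℤ) Q x y lam mu =
            CalogeroBA.selbergConst k lam mu /
                (CalogeroBA.vdm x ^ k * CalogeroBA.cross x y) *
              ∫ τ in (Set.univ.pi fun _ : Fin n => Set.Ioi (0 : ℝ)),
                CalogeroBA.selbergIntegrand k P x y lam mu (fun i => x i + (τ i : ℂ))) ∧
    ((∃! Q : MvPolynomial (Option (Fin n) ⊕ Option (Fin n)) ℂ,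
        CalogeroBA.IsDeformedBA n (-(k : ℤ) - 1) Q) ∧
      ∀ P Q, CalogeroBA.IsBA n k P → CalogeroBA.IsDeformedBA n (-(k : ℤ) - 1) Q →
        ∀ (x : Fin n → ℂ) (y : ℂ) (lam : Fin n → ℂ) (mu : ℂ),
          Function.Injective x → (∀ i, x i ≠ y) →
          Function.Injective lam → (∀ i, lam i ≠ mu) →
          ∀ ε : ℝ, 0 < ε → (∀ i j, i ≠ j → ε < ‖x i - x j‖) →
            TorusIntegrable (CalogeroBA.residueIntegrand k P x y lam mu) x (fun _ => ε) ∧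
            CalogeroBA.deformedFun (-(k : ℤ) - 1) Q x y lam mu =
              CalogeroBA.residueConst k lam mu *
                (CalogeroBA.vdm x ^ (k + 1) / CalogeroBA.cross x y) *
                torusIntegral (CalogeroBA.residueIntegrand k P x y lam mu) x (fun _ => ε)) := by
  refine ⟨CalogeroBA.existsUnique_isBA n k, fun hk => ⟨?_, ?_⟩, ?_, ?_⟩
  · exact CalogeroBA.existsUnique_isDeformedBA (k := k) (by omega) rfl
      (CalogeroBA.mStar_natCast k)
  · intro P Q hP hQ x y lam mu him hxy hl hmu
    exact CalogeroBA.selberg_formula hP hk hQ him hxy hl hmu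
  · exact CalogeroBA.existsUnique_isDeformedBA (k := k) (by omega) (by ring)
      (CalogeroBA.mStar_neg k)
  · intro P Q hP hQ x y lam mu hx hxy hl hmu ε hε hsep
    exact CalogeroBA.residue_formula hP hQ hx hxy hl hmu hε hsep
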